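/- Let $k$ be a field, let $X$ and $Y$ be separated $k$-schemes locally of finite type, and let $\varphi:X\to Y$ be a $k$-morphism. Assume that $Y$ is smooth over $k$, that $X$ is a locally complete intersection, and that the open locus $U\subset X$ where $\varphi$ is etale is dense in $X$. Let $\Delta_X\subset X$ be the different of $\varphi$, i.e. the effective Cartier divisor associated with $\Omega^1_{X/Y}$ (locally defined by $\det A$ for a resolution $0\to\mathcal O_X^l\xrightarrow{A}\mathcal O_X^l\to\Omega^1_{X/Y}\to 0$); thus $X\setminus\Delta_X=U$. Write $X\times X$ for $X\times_k X$, let $j:U\times U\hookrightarrow X\times X$ be the open immersion, let $I_1\supset I_2$ be the ideal sheaves in $\mathcal O_{X\times X}$ of the diagonal and of $X\times_YX$, and put $D=\Delta_X\times X$, $\tilde D=X\times\Delta_X$. For an integer $r\ge 2$ let $\mathcal A_r\subset j_*\mathcal O_{U\times U}$ be the $\mathcal O_{X\times X}$-subalgebra generated by $I_1((r-1)D)$, $I_2(rD)$, $I_1((r-1)\tilde D)$, $I_2(r\tilde D)$, let $\Gamma_r=\operatorname{Spec}\mathcal A_r$ be its relative spectrum over $X\times X$, and let $p_1,p_2:\Gamma_r\to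 X$ be the two projections. Then there is a unique structure of groupoid on $X$ on $\Gamma_r\to X\times X$ (the $r$-th Newton groupoid of $\varphi$), and the following holds. (i) The groupoid $\Gamma_r$ is smooth, i.e. $p_1:\Gamma_r\to X$ is smooth. (ii) Let $z\in\Delta_X$, with residue field $\kappa(z)$. Then $p_1$ and $p_2$ agree on the fiber $(\Gamma_r)_z:=\Gamma_r\times_{p_1,X}\operatorname{Spec}\kappa(z)$, so that the groupoid composition makes it a group scheme over $\kappa(z)$. Let $n=\dim_zX$, and let $m\in\mathbb N\cup\{\infty\}$ be the multiplicity of $z$ in $X\times_Yz$, i.e. the length of the local ring of the fiber $X\times_Y\operatorname{Spec}\kappa(z)$ at the $\kappa(z)$-point defined by $z$. Then $m\ge 2$, and, as group schemes over $\kappa(z)$: (a) if $r\ge 3$ or $m\ge 3$, then $(\Gamma_r)_z\simeq\mathbb G_a^n$; (b) if $m=r=2$, $X$ is smooth over $k$ at $z$, and $\operatorname{char}k\ne 2$, then $(\Gamma_r)_z\simeq\mathbb G_m\ltimes\mathbb G_a^{n-1}$, where $\lambda\in\mathbb G_m$ acts on $\mathbb G_a^{n-1}$ as multiplication by $\lambda^2$;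 (c) if $m=r=2$, $X$ is smooth over $k$ at $z$, and $\operatorname{char}k=2$, then $(\Gamma_r)_z\simeq\mathbb G_a^n$; (d) if $m=r=2$ and $X$ is not smooth over $k$ at $z$, then $(\Gamma_r)_z\simeq(\mathbb Z/2\mathbb Z)\times\mathbb G_a^n$. -/

import Mathlib

open CategoryTheory Limits AlgebraicGeometry Opposite

universe u

noncomputable section

namespace Newton

section LocalAlgebra

variable {R B : Type*} [CommRing R] [CommRing B]

/-- For a ring homomorphism `ρ : R → B` and ideals `I`, `K` of `R`, the elements `s` of `B` with
`K s ⊆ I` (in `B`). If `K = (d)` and `d` is invertible in `B`, these are the fractions `a / d`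
with `a ∈ I`. -/
def fractions (ρ : R →+* B) (I K : Ideal R) : Set B :=
  {s | ∀ d ∈ K, ∃ a ∈ I, ρ d * s = ρ a}

/-- The subring of `B` generated by the image of `R` and by all `fractions ρ (I i) (K i)`. -/
def fractionSubring {ι : Type} (ρ : R →+* B) (I K : ι → Ideal R) : Subring B :=
  Subring.closure (Set.range ρ ∪ ⋃ i, fractions ρ (I i) (K i))

lemma mem_fractionSubring {ι : Type} (ρ : R →+* B) (I K : ι → Ideal R) (a : R) :
    ρ a ∈ fractionSubring ρ I K :=
  Subring.subset_closure (Or.inl ⟨a, rfl⟩)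

variable {R' B' : Type*} [CommRing R'] [CommRing B'] {ρ : R →+* B} {ρ' : R' →+* B'}
  {α : R →+* R'} {β : B →+* B'}

lemma map_fractions (h : ∀ a, β (ρ a) = ρ' (α a)) (I K : Ideal R) {s : B}
    (hs : s ∈ fractions ρ I K) : β s ∈ fractions ρ' (I.map α) (K.map α) := by
  intro d hd
  induction hd using Submodule.span_induction with
  | mem x hx =>
    obtain ⟨d, hd, rfl⟩ := hx
    obtain ⟨a, ha, e⟩ := hs d hd
    exact ⟨α a, Ideal.mem_map_of_mem _ ha, by rw [← h, ← h, ← map_mul, e]⟩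
  | zero => exact ⟨0, zero_mem _, by simp⟩
  | add x y _ _ hx hy =>
    obtain ⟨a, ha, e⟩ := hx
    obtain ⟨b, hb, e'⟩ := hy
    exact ⟨a + b, add_mem ha hb, by rw [map_add, map_add, add_mul, e, e']⟩
  | smul c x _ hx =>
    obtain ⟨a, ha, e⟩ := hx
    exact ⟨c * a, Ideal.mul_mem_left _ _ ha, by
      rw [smul_eq_mul, map_mul, map_mul, mul_assoc, e]⟩

lemma map_fractionSubring {ι : Type} (h : ∀ a, β (ρ a) = ρ' (α a)) (I K : ι → Ideal R) {s : B}
    (hs : s ∈ fractionSubring ρ I K) :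
    β s ∈ fractionSubring ρ' (fun i ↦ (I i).map α) (fun i ↦ (K i).map α) := by
  suffices fractionSubring ρ I K ≤
    (fractionSubring ρ' (fun i ↦ (I i).map α) (fun i ↦ (K i).map α)).comap β from this hs
  refine Subring.closure_le.mpr ?_
  rintro s (⟨a, rfl⟩ | hs)
  · rw [SetLike.mem_coe, Subring.mem_comap, h]
    exact mem_fractionSubring _ _ _ _
  · obtain ⟨i, hi⟩ := Set.mem_iUnion.mp hs
    exact Subring.subset_closure (Or.inr (Set.mem_iUnion.mpr ⟨i, map_fractions h _ _ hi⟩))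

/-- `α : R → R'` inverts `g`, in elementary terms. -/
def Inverts (α : R →+* R') (g : R) : Prop :=
  (∀ t : R', ∃ (n : ℕ) (b : R), α b = α g ^ n * t) ∧
  (∀ b : R, α b = 0 → ∃ n : ℕ, g ^ n * b = 0) ∧ IsUnit (α g)

lemma Inverts.exists_mem_map {α : R →+* R'} {g : R} (hα : Inverts α g) (I : Ideal R) {t : R'}
    (ht : t ∈ I.map α) : ∃ (n : ℕ), ∃ b ∈ I, α b = α g ^ n * t := by
  induction ht using Submodule.span_induction with
  | mem x hx =>
    obtain ⟨d, hd, rfl⟩ := hx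
    exact ⟨0, d, hd, by simp⟩
  | zero => exact ⟨0, 0, zero_mem _, by simp⟩
  | add x y _ _ hx hy =>
    obtain ⟨n, s, hs, h⟩ := hx
    obtain ⟨n', s', hs', h'⟩ := hy
    refine ⟨n + n', g ^ n' * s + g ^ n * s',
      add_mem (Ideal.mul_mem_left _ _ hs) (Ideal.mul_mem_left _ _ hs'), ?_⟩
    simp only [map_add, map_mul, map_pow, h, h']; ring
  | smul c x _ hx =>
    obtain ⟨n, s, hs, h⟩ := hx
    obtain ⟨m, b, hb⟩ := hα.1 c
    refine ⟨m + n, b * s, Ideal.mul_mem_left _ _ hs, ?_⟩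
    simp only [map_mul, h, hb, smul_eq_mul]; ring

lemma exists_mem_fractions [IsNoetherianRing R] {g : R} (h : ∀ a, β (ρ a) = ρ' (α a))
    (hα : Inverts α g) (hβ : Inverts β (ρ g)) (I K : Ideal R) {t : B'}
    (ht : t ∈ fractions ρ' (I.map α) (K.map α)) :
    ∃ (n : ℕ), ∃ s ∈ fractions ρ I K, β s = β (ρ g) ^ n * t := by
  obtain ⟨n, b, hb⟩ := hβ.1 t
  have step : ∀ d ∈ K, ∃ m : ℕ, ∃ a ∈ I, ρ g ^ m * (ρ d * b) = ρ a := by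
    intro d hd
    obtain ⟨a, ha, e⟩ := ht (α d) (Ideal.mem_map_of_mem _ hd)
    obtain ⟨k, a', ha', e'⟩ := hα.exists_mem_map I ha
    have h0 : β (ρ g ^ k * (ρ d * b) - ρ (g ^ n * a')) = 0 := by
      simp only [map_sub, map_mul, map_pow, hb, h, e', ← e]
      ring
    obtain ⟨m, hm⟩ := hβ.2.1 _ h0
    refine ⟨m + k, g ^ m * (g ^ n * a'), Ideal.mul_mem_left _ _ (Ideal.mul_mem_left _ _ ha'), ?_⟩
    rw [mul_sub, sub_eq_zero] at hm
    rw [pow_add, mul_assoc, hm, map_mul ρ (g ^ m), map_pow]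
  have unif : ∀ L : Ideal R, L.FG → L ≤ K → ∃ m : ℕ, ∀ d ∈ L, ∃ a ∈ I,
      ρ g ^ m * (ρ d * b) = ρ a := by
    intro L hL
    induction L, hL using Submodule.fg_induction with
    | singleton x =>
      intro hle
      obtain ⟨m, a, ha, e⟩ := step x (hle (Submodule.mem_span_singleton_self x))
      refine ⟨m, fun d hd ↦ ?_⟩
      obtain ⟨c, rfl⟩ := Submodule.mem_span_singleton.mp hd
      refine ⟨c * a, Ideal.mul_mem_left _ _ ha, ?_⟩
      rw [smul_eq_mul, map_mul, map_mul, ← e]; ring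
    | sup M₁ M₂ _ _ h₁ h₂ =>
      intro hle
      obtain ⟨m₁, h₁⟩ := h₁ (le_sup_left.trans hle)
      obtain ⟨m₂, h₂⟩ := h₂ (le_sup_right.trans hle)
      refine ⟨m₁ + m₂, fun d hd ↦ ?_⟩
      obtain ⟨x, hx, y, hy, rfl⟩ := Submodule.mem_sup.mp hd
      obtain ⟨a₁, ha₁, e₁⟩ := h₁ x hx
      obtain ⟨a₂, ha₂, e₂⟩ := h₂ y hy
      refine ⟨g ^ m₂ * a₁ + g ^ m₁ * a₂,
        add_mem (Ideal.mul_mem_left _ _ ha₁) (Ideal.mul_mem_left _ _ ha₂), ?_⟩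
      simp only [map_add, map_mul, map_pow, ← e₁, ← e₂]; ring
  obtain ⟨m, hm⟩ := unif K (IsNoetherian.noetherian _) le_rfl
  refine ⟨m + n, ρ g ^ m * b, fun d hd ↦ ?_, ?_⟩
  · obtain ⟨a, ha, e⟩ := hm d hd
    exact ⟨a, ha, by rw [← e]; ring⟩
  · rw [map_mul, hb, map_pow, pow_add]; ring

lemma exists_mem_fractionSubring [IsNoetherianRing R] {ι : Type} {g : R}
    (h : ∀ a, β (ρ a) = ρ' (α a)) (hα : Inverts α g) (hβ : Inverts β (ρ g))
    (I K : ι → Ideal R) {t : B'}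
    (ht : t ∈ fractionSubring ρ' (fun i ↦ (I i).map α) (fun i ↦ (K i).map α)) :
    ∃ (n : ℕ), ∃ s ∈ fractionSubring ρ I K, β s = β (ρ g) ^ n * t := by
  have hg := mem_fractionSubring ρ I K g
  induction ht using Subring.closure_induction with
  | mem x hx =>
    rcases hx with ⟨a, rfl⟩ | hx
    · obtain ⟨n, b, e⟩ := hα.1 a
      exact ⟨n, _, mem_fractionSubring ρ I K b, by rw [h, e, h, map_mul, map_pow]⟩
    · obtain ⟨i, hi⟩ := Set.mem_iUnion.mp hx
      obtain ⟨n, s, hs, e⟩ := exists_mem_fractions h hα hβ _ _ hi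
      exact ⟨n, s, Subring.subset_closure (Or.inr (Set.mem_iUnion.mpr ⟨i, hs⟩)), e⟩
  | zero => exact ⟨0, 0, zero_mem _, by simp⟩
  | one => exact ⟨0, 1, one_mem _, by simp⟩
  | add x y _ _ hx hy =>
    obtain ⟨n, s, hs, h⟩ := hx
    obtain ⟨n', s', hs', h'⟩ := hy
    refine ⟨n + n', ρ g ^ n' * s + ρ g ^ n * s',
      add_mem (mul_mem (pow_mem hg _) hs) (mul_mem (pow_mem hg _) hs'), ?_⟩
    simp only [map_add, map_mul, map_pow, h, h']; ring
  | neg x _ hx =>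
    obtain ⟨n, s, hs, h⟩ := hx
    exact ⟨n, -s, neg_mem hs, by simp only [map_neg, h]; ring⟩
  | mul x y _ _ hx hy =>
    obtain ⟨n, s, hs, h⟩ := hx
    obtain ⟨n', s', hs', h'⟩ := hy
    exact ⟨n + n', s * s', mul_mem hs hs', by rw [map_mul, h, h']; ring⟩

lemma Inverts.isLocalization {α : R →+* R'} {g : R} (hα : Inverts α g) :
    letI := α.toAlgebra
    IsLocalization.Away g R' := by
  let := α.toAlgebra
  refine ⟨?_, ?_, ?_⟩
  · rintro ⟨_, n, rfl⟩
    have := hα.2.2.pow n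
    rw [← map_pow] at this
    exact this
  · intro t
    obtain ⟨n, b, e⟩ := hα.1 t
    refine ⟨⟨b, ⟨_, n, rfl⟩⟩, ?_⟩
    rw [map_pow, mul_comm]
    exact e.symm
  · intro x y e
    obtain ⟨n, hn⟩ := hα.2.1 (x - y) (by rw [map_sub, sub_eq_zero]; exact e)
    refine ⟨⟨_, n, rfl⟩, ?_⟩
    rw [mul_sub, sub_eq_zero] at hn
    exact hn

lemma inverts_fractionSubring [IsNoetherianRing R] {ι : Type} {g : R}
    (h : ∀ a, β (ρ a) = ρ' (α a)) (hα : Inverts α g) (hβ : Inverts β (ρ g))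
    (I K : ι → Ideal R) (I' K' : ι → Ideal R') (hI : ∀ i, (I i).map α = I' i)
    (hK : ∀ i, (K i).map α = K' i) (f : fractionSubring ρ I K →+* fractionSubring ρ' I' K')
    (hf : ∀ x, (f x : B') = β x) : Inverts f ⟨ρ g, mem_fractionSubring ρ I K g⟩ := by
  obtain rfl : (fun i ↦ (I i).map α) = I' := funext hI
  obtain rfl : (fun i ↦ (K i).map α) = K' := funext hK
  refine ⟨?_, ?_, ?_⟩
  · rintro ⟨t, ht⟩
    obtain ⟨n, s, hs, e⟩ := exists_mem_fractionSubring h hα hβ I K ht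
    exact ⟨n, ⟨s, hs⟩, Subtype.ext (by simpa [hf] using e)⟩
  · rintro ⟨b, hb⟩ e
    obtain ⟨n, hn⟩ := hβ.2.1 b (by rw [← hf ⟨b, hb⟩, e]; rfl)
    exact ⟨n, Subtype.ext (by simpa using hn)⟩
  · obtain ⟨v, hv⟩ := hα.2.2.exists_right_inv
    refine IsUnit.of_mul_eq_one ⟨ρ' v, mem_fractionSubring _ _ _ _⟩ (Subtype.ext ?_)
    rw [Subring.coe_mul, hf, h, ← map_mul, hv, map_one]
    rfl

end LocalAlgebra

section RelativeSpec

variable {P : Scheme.{u}} (W : P.Opens)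

lemma inverts_of_eq_basicOpen {O O' : P.Opens} (hc : IsCompact (O : Set P))
    (hq : IsQuasiSeparated (O : Set P)) (f : Γ(P, O)) (hO : O' ≤ O) (h : O' = P.basicOpen f) :
    Inverts (P.presheaf.map (homOfLE hO).op).hom f := by
  subst h
  let : Algebra Γ(P, O) Γ(P, P.basicOpen f) :=
    (P.presheaf.map (homOfLE (P.basicOpen_le _)).op).hom.toAlgebra
  have loc := isLocalization_basicOpen_of_qcqs hc hq f
  refine ⟨fun t ↦ ?_, fun b hb ↦ ?_, ?_⟩
  · obtain ⟨⟨b, ⟨_, n, rfl⟩⟩, h⟩ := IsLocalization.surj (.powers f) t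
    refine ⟨n, b, ?_⟩
    rw [mul_comm, ← map_pow]
    exact h.symm
  · obtain ⟨⟨_, n, rfl⟩, h⟩ := (IsLocalization.map_eq_zero_iff
      (.powers f) Γ(P, P.basicOpen f) b).mp hb
    exact ⟨n, h⟩
  · exact IsLocalization.map_units Γ(P, P.basicOpen f)
      (⟨_, Submonoid.mem_powers _⟩ : Submonoid.powers f)

/-- Restriction of functions from `V` to `V ∩ W`. -/
def restrictTo (V : P.Opens) : Γ(P, V) →+* Γ(P, V ⊓ W) :=
  (P.presheaf.map (homOfLE inf_le_left).op).hom

variable {ι : Type} (I K : ι → P.IdealSheafData)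

/-- Let `j : W → P` be the inclusion. The sections over an affine open `V` of the `𝒪_P`-subalgebra
of `j_* 𝒪_W` generated by the subsheaves of local sections `s` of `j_* 𝒪_W` with `K i * s ⊆ I i`. -/
def fractionSections (V : P.AffineZariskiSite) : Subring Γ(P, V.toOpens ⊓ W) :=
  fractionSubring (restrictTo W V.toOpens)
    (fun i ↦ (I i).ideal ⟨V.1, V.2⟩) (fun i ↦ (K i).ideal ⟨V.1, V.2⟩)

lemma restrict_mem_fractionSections {V V' : P.AffineZariskiSite} (h : V' ≤ V)
    {s : Γ(P, V.toOpens ⊓ W)} (hs : s ∈ fractionSections W I K V) :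
    (P.presheaf.map (homOfLE (inf_le_inf_right W
      (Scheme.AffineZariskiSite.toOpens_mono h))).op).hom s ∈ fractionSections W I K V' := by
  obtain ⟨V, hV⟩ := V
  obtain ⟨V', hV'⟩ := V'
  obtain ⟨g, hg⟩ := h
  change P.basicOpen g = V' at hg
  subst hg
  have := map_fractionSubring (ρ := restrictTo W V) (ρ' := restrictTo W (P.basicOpen g))
    (α := (P.presheaf.map (homOfLE (P.basicOpen_le g)).op).hom)
    (β := (P.presheaf.map (homOfLE (inf_le_inf_right W (P.basicOpen_le g))).op).hom) (fun a ↦ by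
      simp only [restrictTo, ← CommRingCat.comp_apply, ← Functor.map_comp]; rfl) _ _ hs
  have e (J : P.IdealSheafData) := J.map_ideal_basicOpen ⟨V, hV⟩ g
  simp only [e] at this
  exact this

/-- The presheaf `V ↦ 𝒜(V)` on affine opens, where `𝒜(V)` is `fractionSections W I K V`. -/
def fractionFunctor : P.AffineZariskiSiteᵒᵖ ⥤ CommRingCat.{u} where
  obj V := .of (fractionSections W I K V.unop)
  map {V V'} i := CommRingCat.ofHom
    (RingHom.restrict (P.presheaf.map (homOfLE (inf_le_inf_right W
      (Scheme.AffineZariskiSite.toOpens_mono i.unop.le))).op).hom _ _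
      fun _ hs ↦ restrict_mem_fractionSections W I K i.unop.le hs)
  map_id V := by
    ext x
    exact congr($(P.presheaf.map_id _).hom x.1)
  map_comp i j := by
    ext x
    exact congr($(P.presheaf.map_comp (homOfLE (inf_le_inf_right W
      (Scheme.AffineZariskiSite.toOpens_mono i.unop.le))).op (homOfLE (inf_le_inf_right W
      (Scheme.AffineZariskiSite.toOpens_mono j.unop.le))).op).hom x.1)

/-- The structure map `𝒪_P → 𝒜`. -/
def fractionFunctorMap :
    (Scheme.AffineZariskiSite.toOpensFunctor P).op ⋙ P.presheaf ⟶ fractionFunctor W I K where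
  app V := CommRingCat.ofHom ((restrictTo W V.unop.toOpens).codRestrict _
    fun a ↦ mem_fractionSubring _ _ _ a)
  naturality V V' i := by
    ext x
    refine Subtype.ext ?_
    have hi := Scheme.AffineZariskiSite.toOpens_mono i.unop.le
    exact congr($((P.presheaf.map_comp (homOfLE hi).op
      (homOfLE (inf_le_left (b := W))).op).symm.trans (P.presheaf.map_comp
      (homOfLE (inf_le_left (b := W))).op (homOfLE (inf_le_inf_right W hi)).op)).hom x)

/-- The `𝒪_P`-algebra `𝒜` is quasi-coherent. -/
lemma coequifibered_fractionFunctorMap [IsLocallyNoetherian P] :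
    (fractionFunctorMap W I K).Coequifibered := by
  refine Scheme.AffineZariskiSite.coequifibered_iff_forall_isLocalizationAway.mpr fun V g ↦ ?_
  obtain ⟨V, hV⟩ := V
  have : IsNoetherianRing Γ(P, V) := IsLocallyNoetherian.component_noetherian ⟨V, hV⟩
  have hc : IsCompact ((V ⊓ W : P.Opens) : Set P) := by
    have := noetherianSpace_of_isAffineOpen V hV
    exact (TopologicalSpace.noetherianSpace_set_iff _).mp this _ Set.inter_subset_left
  have hq : IsQuasiSeparated ((V ⊓ W : P.Opens) : Set P) := .of_quasiSeparatedSpace _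
  let α := (P.presheaf.map (homOfLE (P.basicOpen_le g)).op).hom
  let β := (P.presheaf.map (homOfLE (inf_le_inf_right W (P.basicOpen_le g))).op).hom
  have hα : Inverts α g :=
    inverts_of_eq_basicOpen hV.isCompact hV.isQuasiSeparated g _ rfl
  have hβ : Inverts β (restrictTo W V g) := by
    refine inverts_of_eq_basicOpen hc hq _ _ ?_
    rw [restrictTo, Scheme.basicOpen_res]
    ext x
    have := P.basicOpen_le g (x := x)
    constructor
    · rintro ⟨h1, h2⟩; exact ⟨⟨this h1, h2⟩, h1⟩
    · rintro ⟨⟨h1, h2⟩, h3⟩; exact ⟨h3, h2⟩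
  have hcomm : ∀ a, β (restrictTo W V a) = restrictTo W (P.basicOpen g) (α a) := fun a ↦ by
    simp only [α, β, restrictTo, ← CommRingCat.comp_apply, ← Functor.map_comp]; rfl
  exact (inverts_fractionSubring hcomm hα hβ _ _ _ _
    (fun i ↦ (I i).map_ideal_basicOpen ⟨V, hV⟩ g) (fun i ↦ (K i).map_ideal_basicOpen ⟨V, hV⟩ g)
    ((fractionFunctor W I K).map (homOfLE
      (Scheme.AffineZariskiSite.basicOpen_le ⟨V, hV⟩ g)).op).hom fun _ ↦ rfl).isLocalization

/-- `Spec_P 𝒜`, the relative spectrum of the quasi-coherent algebra `𝒜 = fractionSections W I K`,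
glued from the `Spec 𝒜(V)` for the affine opens `V` of `P`. -/
def fractionSpec [IsLocallyNoetherian P] : Scheme.{u} :=
  (Scheme.AffineZariskiSite.relativeGluingData
    (coequifibered_fractionFunctorMap W I K)).glued

/-- The structure morphism `Spec_P 𝒜 → P`. -/
def fractionSpecMap [IsLocallyNoetherian P] : fractionSpec W I K ⟶ P :=
  (Scheme.AffineZariskiSite.relativeGluingData
    (coequifibered_fractionFunctorMap W I K)).toBase

end RelativeSpec


section Groupoids

/-- A groupoid in the category of schemes with scheme of objects `X`, scheme of morphisms `Γ`,
source `p₁` and target `p₂`. The composite of `(γ₁, γ₂)` with `p₂ γ₁ = p₁ γ₂` is `comp (γ₁, γ₂)`;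
the identities are required on `T`-points. -/
@[ext]
structure GroupoidOn {X Γ : Scheme.{u}} (p₁ p₂ : Γ ⟶ X) where
  comp : pullback p₂ p₁ ⟶ Γ
  unit : X ⟶ Γ
  inv : Γ ⟶ Γ
  comp_p₁ : comp ≫ p₁ = pullback.fst p₂ p₁ ≫ p₁
  comp_p₂ : comp ≫ p₂ = pullback.snd p₂ p₁ ≫ p₂
  unit_p₁ : unit ≫ p₁ = 𝟙 X
  unit_p₂ : unit ≫ p₂ = 𝟙 X
  inv_p₁ : inv ≫ p₁ = p₂
  inv_p₂ : inv ≫ p₂ = p₁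
  assoc : ∀ {T : Scheme.{u}} (a b c : T ⟶ Γ) (hab : a ≫ p₂ = b ≫ p₁) (hbc : b ≫ p₂ = c ≫ p₁),
    pullback.lift (pullback.lift a b hab ≫ comp) c
        (by rw [Category.assoc, comp_p₂, pullback.lift_snd_assoc, hbc]) ≫ comp =
      pullback.lift a (pullback.lift b c hbc ≫ comp)
        (by rw [Category.assoc, comp_p₁, pullback.lift_fst_assoc, hab]) ≫ comp
  unit_comp : ∀ {T : Scheme.{u}} (a : T ⟶ Γ),
    pullback.lift (a ≫ p₁ ≫ unit) a
      (by rw [Category.assoc, Category.assoc, unit_p₂, Category.comp_id]) ≫ comp = a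
  comp_unit : ∀ {T : Scheme.{u}} (a : T ⟶ Γ),
    pullback.lift a (a ≫ p₂ ≫ unit)
      (by rw [Category.assoc, Category.assoc, unit_p₁, Category.comp_id]) ≫ comp = a
  inv_comp : ∀ {T : Scheme.{u}} (a : T ⟶ Γ),
    pullback.lift (a ≫ inv) a (by rw [Category.assoc, inv_p₂]) ≫ comp = a ≫ p₂ ≫ unit
  comp_inv : ∀ {T : Scheme.{u}} (a : T ⟶ Γ),
    pullback.lift a (a ≫ inv) (by rw [Category.assoc, inv_p₁]) ≫ comp = a ≫ p₁ ≫ unit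

namespace GroupoidOn

variable {X Γ : Scheme.{u}} {p₁ p₂ : Γ ⟶ X} (G : GroupoidOn p₁ p₂)

/-- A groupoid is smooth if its source morphism is smooth. -/
def IsSmooth (_ : GroupoidOn p₁ p₂) : Prop := Smooth p₁

variable {Z : Scheme.{u}} (z : Z ⟶ X)

/-- The `T`-points of `Γ` that are automorphisms of the object `T → Z → X`. -/
def Loops (_ : GroupoidOn p₁ p₂) (T : Over Z) : Type u :=
  {g : T.left ⟶ Γ // g ≫ p₁ = T.hom ≫ z ∧ g ≫ p₂ = T.hom ≫ z}

/-- Automorphisms form a group under the composition of the groupoid. -/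
instance (T : Over Z) : Group (G.Loops z T) where
  mul a b := ⟨pullback.lift a.1 b.1 (a.2.2.trans b.2.1.symm) ≫ G.comp, by
    rw [Category.assoc, G.comp_p₁, pullback.lift_fst_assoc, a.2.1], by
    rw [Category.assoc, G.comp_p₂, pullback.lift_snd_assoc, b.2.2]⟩
  one := ⟨T.hom ≫ z ≫ G.unit, by
    rw [Category.assoc, Category.assoc, G.unit_p₁, Category.comp_id], by
    rw [Category.assoc, Category.assoc, G.unit_p₂, Category.comp_id]⟩
  inv a := ⟨a.1 ≫ G.inv, by rw [Category.assoc, G.inv_p₁, a.2.2], by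
    rw [Category.assoc, G.inv_p₂, a.2.1]⟩
  mul_assoc a b c := Subtype.ext
    (G.assoc a.1 b.1 c.1 (a.2.2.trans b.2.1.symm) (b.2.2.trans c.2.1.symm))
  one_mul a := Subtype.ext ((by
    change pullback.lift (T.hom ≫ z ≫ G.unit) a.1 _ ≫ G.comp = a.1
    have h := G.unit_comp a.1
    simp only [reassoc_of% a.2.1] at h
    exact h))
  mul_one a := Subtype.ext ((by
    change pullback.lift a.1 (T.hom ≫ z ≫ G.unit) _ ≫ G.comp = a.1
    have h := G.comp_unit a.1
    simp only [reassoc_of% a.2.2] at h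
    exact h))
  inv_mul_cancel a := Subtype.ext ((G.inv_comp a.1).trans (by
    rw [reassoc_of% a.2.2]; rfl))

/-- The functor sending `T` over `Z` to its group of automorphisms. -/
def loopsFunctor : (Over Z)ᵒᵖ ⥤ GrpCat.{u} where
  obj T := GrpCat.of (G.Loops z T.unop)
  map {T T'} f := GrpCat.ofHom (MonoidHom.mk'
    (fun a : G.Loops z T.unop ↦ (⟨f.unop.left ≫ a.1, by
      rw [Category.assoc, a.2.1, Over.w_assoc], by
      rw [Category.assoc, a.2.2, Over.w_assoc]⟩ : G.Loops z T'.unop))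
    fun a b ↦ Subtype.ext (by
      change f.unop.left ≫ pullback.lift a.1 b.1 _ ≫ G.comp =
        pullback.lift (f.unop.left ≫ a.1) (f.unop.left ≫ b.1) _ ≫ G.comp
      rw [← Category.assoc]
      congr 1
      refine pullback.hom_ext ?_ ?_
      · rw [Category.assoc]
        exact (congrArg (f.unop.left ≫ ·) (pullback.lift_fst _ _ _)).trans
          (pullback.lift_fst _ _ _).symm
      · rw [Category.assoc]
        exact (congrArg (f.unop.left ≫ ·) (pullback.lift_snd _ _ _)).trans
          (pullback.lift_snd _ _ _).symm))
  map_id T := by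
    ext a
    exact Subtype.ext (Category.id_comp a.1)
  map_comp f g := by
    ext a
    exact Subtype.ext (Category.assoc g.unop.left f.unop.left a.1)

/-- The fibre `Γ ×_X Z` of `p₁ : Γ → X` over `z : Z → X`, as a scheme over `Z`. -/
def fiber (_ : GroupoidOn p₁ p₂) : Over Z := Over.mk (pullback.snd p₁ z)

lemma fiber_condition {T : Over Z} (f : T ⟶ G.fiber z) :
    (f.left ≫ pullback.fst p₁ z) ≫ p₁ = T.hom ≫ z :=
  (Category.assoc f.left (pullback.fst p₁ z) p₁).trans <|
    (congrArg (f.left ≫ ·) pullback.condition).trans <|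
      (Category.assoc f.left (pullback.snd p₁ z) z).symm.trans (congrArg (· ≫ z) (Over.w f))

/-- If `p₁` and `p₂` agree on the fibre over `z`, then the fibre represents the automorphisms. -/
def fiberRepresentableBy (h : pullback.fst p₁ z ≫ p₂ = pullback.fst p₁ z ≫ p₁) :
    (G.loopsFunctor z ⋙ forget GrpCat).RepresentableBy (G.fiber z) where
  homEquiv {T} :=
    { toFun f := (⟨f.left ≫ pullback.fst p₁ z, G.fiber_condition z f,
        (Category.assoc f.left (pullback.fst p₁ z) p₂).trans <|
          (congrArg (f.left ≫ ·) h).trans <|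
            (Category.assoc f.left (pullback.fst p₁ z) p₁).symm.trans
              (G.fiber_condition z f)⟩ : G.Loops z T)
      invFun a := Over.homMk (pullback.lift (Subtype.val (p := fun g : T.left ⟶ Γ ↦
        g ≫ p₁ = T.hom ≫ z ∧ g ≫ p₂ = T.hom ≫ z) a) T.hom a.2.1) (pullback.lift_snd _ _ _)
      left_inv f := by
        ext
        refine pullback.hom_ext ?_ ?_
        · exact pullback.lift_fst _ _ _
        · exact (pullback.lift_snd _ _ _).trans (Over.w f).symm
      right_inv a := Subtype.ext (pullback.lift_fst _ _ _) }
  homEquiv_comp f g := Subtype.ext (Category.assoc f.left g.left _)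

/-- The group scheme `Γ ×_X Z` over `Z`, if `p₁` and `p₂` agree on it; its group law is the
composition of the groupoid. -/
def fiberGroup (h : pullback.fst p₁ z ≫ p₂ = pullback.fst p₁ z ≫ p₁) : Grp (Over Z) :=
  letI : GrpObj (G.fiber z) := .ofRepresentableBy _ _ (G.fiberRepresentableBy z h)
  ⟨G.fiber z⟩

end GroupoidOn

end Groupoids

section GroupSchemes

/-- The functor `R ↦ R ^ n` to (additive) groups. -/
def gaPow (n : ℕ) : CommRingCat.{u} ⥤ GrpCat.{u} where
  obj R := GrpCat.of (Multiplicative (Fin n → R))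
  map f := GrpCat.ofHom (AddMonoidHom.toMultiplicative (f.hom.toAddMonoidHom.compLeft (Fin n)))

/-- The action of `Rˣ` on `R ^ n` in which `c` acts as multiplication by `c ^ 2`. -/
def squareAction (n : ℕ) (R : Type u) [CommRing R] :
    Rˣ →* MulAut (Multiplicative (Fin n → R)) where
  toFun c := AddEquiv.toMultiplicative (DistribMulAction.toAddEquiv (Fin n → R) (c ^ 2))
  map_one' := MulEquiv.ext fun a ↦ by
    refine Multiplicative.toAdd.injective ?_
    simp
  map_mul' c d := MulEquiv.ext fun a ↦ by
    refine Multiplicative.toAdd.injective ?_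
    simp [mul_pow, mul_smul]

/-- The functor `R ↦ R ^ n ⋊ Rˣ`, where `c` in `Rˣ` acts on `R ^ n` as multiplication by `c ^ 2`. -/
def gmGaPow (n : ℕ) : CommRingCat.{u} ⥤ GrpCat.{u} where
  obj R := GrpCat.of (Multiplicative (Fin n → R) ⋊[squareAction n R] Rˣ)
  map f := GrpCat.ofHom (SemidirectProduct.map
    (AddMonoidHom.toMultiplicative (f.hom.toAddMonoidHom.compLeft (Fin n)))
    (Units.map f.hom.toMonoidHom)
    (fun c ↦ MonoidHom.ext fun a ↦ by
      refine Multiplicative.toAdd.injective (funext fun i ↦ ?_)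
      simp [squareAction, Units.smul_def]))

/-- The functor sending `T` to the group of locally constant functions on `T` with values in `A`:
the functor of points of the constant group scheme `A`. -/
def constantGroup (S : Scheme.{u}) (A : Type) [AddGroup A] : (Over S)ᵒᵖ ⥤ GrpCat.{u} where
  obj T := GrpCat.of (Multiplicative (LocallyConstant T.unop.left A))
  map f := GrpCat.ofHom (AddMonoidHom.toMultiplicative
    (LocallyConstant.comapAddMonoidHom (Z := A) ⟨f.unop.left, f.unop.left.continuous⟩))

variable (S : Scheme.{u})

/-- The functor `T ↦ Γ(T, 𝒪_T)` on schemes over `S`. -/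
def globalFunctions : (Over S)ᵒᵖ ⥤ CommRingCat.{u} := (Over.forget S).op ⋙ Scheme.Γ

/-- The functor of points of the group scheme `𝔾_a ^ n` over `S`. -/
def GaPow (n : ℕ) : (Over S)ᵒᵖ ⥤ GrpCat.{u} := globalFunctions S ⋙ gaPow n

/-- The functor of points of the group scheme `𝔾_m ⋉ 𝔾_a ^ n` over `S`, where `c` in `𝔾_m` acts on
`𝔾_a ^ n` as multiplication by `c ^ 2`. -/
def GmGaPow (n : ℕ) : (Over S)ᵒᵖ ⥤ GrpCat.{u} := globalFunctions S ⋙ gmGaPow n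

/-- The functor of points of the group scheme `(ℤ/2ℤ) × 𝔾_a ^ n` over `S`. -/
def ZModTwoGaPow (n : ℕ) : (Over S)ᵒᵖ ⥤ GrpCat.{u} where
  obj T := GrpCat.of ((constantGroup S (ZMod 2)).obj T × (GaPow S n).obj T)
  map f := GrpCat.ofHom (MonoidHom.prodMap
    ((constantGroup S (ZMod 2)).map f).hom ((GaPow S n).map f).hom)

variable {S} in
/-- The group scheme `H` over `S` has the group functor `F`. -/
def HasGroupFunctor (H : Grp (Over S)) (F : (Over S)ᵒᵖ ⥤ GrpCat.{u}) : Prop :=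
  Nonempty (yonedaGrp.obj H ≅ F)

end GroupSchemes

section Geometry

variable {X Y : Scheme.{u}} (φ : X ⟶ Y)

/-- The largest open subscheme of `X` on which `φ` is etale. -/
def etaleLocus : X.Opens := sSup {W | Etale (W.ι ≫ φ)}

/-- `f` is smooth in a neighbourhood of `z`. -/
def SmoothAt (f : X ⟶ Y) (z : X) : Prop := ∃ W : X.Opens, z ∈ W ∧ Smooth (W.ι ≫ f)

/-- `X` is a locally complete intersection over the field `k`: each point has an open neighbourhood
isomorphic over `k` to `Spec k[x₁, …, x_N] / (f₁, …, f_c)` for a regular sequence `f₁, …, f_c`. -/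
def IsLocallyCompleteIntersection {k : Type u} [Field k] (f : X ⟶ Spec (.of k)) : Prop :=
  ∀ x : X, ∃ W : X.Opens, x ∈ W ∧ ∃ (N : ℕ) (F : List (MvPolynomial (Fin N) k)),
    RingTheory.Sequence.IsRegular (MvPolynomial (Fin N) k) F ∧
    ∃ e : (W : Scheme.{u}) ≅ Spec (.of (MvPolynomial (Fin N) k ⧸ Ideal.ofList F)),
      e.hom ≫ Spec.map (CommRingCat.ofHom
        (algebraMap k (MvPolynomial (Fin N) k ⧸ Ideal.ofList F))) = W.ι ≫ f

/-- The ideal generated by `det A` for all resolutions `0 → Rⁿ → Rⁿ → M → 0` with matrix `A`.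
All such `A` have the same determinant up to units. -/
def resolutionIdeal (R M : Type u) [CommRing R] [AddCommGroup M] [Module R M] : Ideal R :=
  Ideal.span {d | ∃ (n : ℕ) (A : Matrix (Fin n) (Fin n) R),
    Function.Injective A.mulVecLin ∧
    Nonempty (((Fin n → R) ⧸ LinearMap.range A.mulVecLin) ≃ₗ[R] M) ∧ A.det = d}

/-- The stalk at `x` of the ideal of the different: the ideal of the divisor of the stalk of
`Ω¹_{X/Y}`, that is, of the module of differentials of `𝒪_{X,x}` over `𝒪_{Y,φ(x)}`. -/
def differentStalk (x : X) : Ideal (X.presheaf.stalk x) :=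
  letI := (φ.stalkMap x).hom.toAlgebra
  resolutionIdeal (X.presheaf.stalk x)
    (KaehlerDifferential (Y.presheaf.stalk (φ x)) (X.presheaf.stalk x))

/-- The ideal sheaf of the different `Δ_X` of `φ`. -/
def different : X.IdealSheafData :=
  Scheme.IdealSheafData.ofIdeals fun W ↦
    ⨅ x : W.1, (differentStalk φ x.1).comap (X.presheaf.germ W.1 x.1 x.2).hom

/-- The dimension of `X` at `z`: the least dimension of an open neighbourhood of `z`. -/
def dimAt (X : Scheme.{u}) (z : X) : WithBot ℕ∞ :=
  ⨅ W : {W : X.Opens // z ∈ W}, topologicalKrullDim W.1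

/-- The multiplicity of `z` in the fibre `X ×_Y z`: the length of the local ring of this fibre at
its point given by `z`. -/
def fiberMultiplicity (z : X) : ℕ∞ :=
  let F := pullback φ (X.fromSpecResidueField z ≫ φ)
  let σ : Spec (X.residueField z) ⟶ F :=
    pullback.lift (X.fromSpecResidueField z) (𝟙 _) (Category.id_comp _).symm
  let x : F := σ (IsLocalRing.closedPoint (X.residueField z))
  Module.length (F.presheaf.stalk x) (F.presheaf.stalk x)

end Geometry

section NewtonGroupoid

variable {k : Type u} [Field k] {X Y : Scheme.{u}} (φ : X ⟶ Y) (s : Y ⟶ Spec (.of k))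

/-- `X ×_k X`. -/
abbrev square : Scheme.{u} := pullback (φ ≫ s) (φ ≫ s)

instance [LocallyOfFiniteType (φ ≫ s)] : IsLocallyNoetherian (square φ s) :=
  LocallyOfFiniteType.isLocallyNoetherian (pullback.fst (φ ≫ s) (φ ≫ s) ≫ φ ≫ s)

/-- The ideal sheaf of the diagonal `X → X ×_k X`. -/
def idealDiagonal : (square φ s).IdealSheafData := (pullback.diagonal (φ ≫ s)).ker

/-- The ideal sheaf of `X ×_Y X → X ×_k X`. -/
def idealFiberProduct : (square φ s).IdealSheafData :=
  (pullback.lift (f := φ ≫ s) (g := φ ≫ s) (pullback.fst φ φ) (pullback.snd φ φ)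
    (by rw [pullback.condition_assoc])).ker

/-- The ideal sheaf of the divisor `D = Δ_X × X`. -/
def idealD : (square φ s).IdealSheafData := (different φ).comap (pullback.fst (φ ≫ s) (φ ≫ s))

/-- The ideal sheaf of the divisor `D̃ = X × Δ_X`. -/
def idealDTilde : (square φ s).IdealSheafData := (different φ).comap (pullback.snd (φ ≫ s) (φ ≫ s))

/-- The open subscheme `U × U` of `X × X`, where `U` is the etale locus of `φ`. -/
def squareOpen : (square φ s).Opens :=
  pullback.fst (φ ≫ s) (φ ≫ s) ⁻¹ᵁ etaleLocus φ ⊓ pullback.snd (φ ≫ s) (φ ≫ s) ⁻¹ᵁ etaleLocus φ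

variable [LocallyOfFiniteType (φ ≫ s)] (r : ℕ)

/-- `Γ_r = Spec 𝒜_r`, where `𝒜_r ⊆ j_* 𝒪_{U × U}` is the `𝒪_{X × X}`-subalgebra generated by
`I₁((r-1)D)`, `I₂(rD)`, `I₁((r-1)D̃)` and `I₂(rD̃)`. -/
def newtonScheme : Scheme.{u} :=
  fractionSpec (squareOpen φ s)
    ![idealDiagonal φ s, idealFiberProduct φ s, idealDiagonal φ s, idealFiberProduct φ s]
    ![idealD φ s ^ (r - 1), idealD φ s ^ r, idealDTilde φ s ^ (r - 1), idealDTilde φ s ^ r]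

/-- The structure morphism `Γ_r → X × X`. -/
def newtonMap : newtonScheme φ s r ⟶ square φ s := fractionSpecMap _ _ _

/-- The source morphism `Γ_r → X`. -/
def newtonSource : newtonScheme φ s r ⟶ X := newtonMap φ s r ≫ pullback.fst (φ ≫ s) (φ ≫ s)

/-- The target morphism `Γ_r → X`. -/
def newtonTarget : newtonScheme φ s r ⟶ X := newtonMap φ s r ≫ pullback.snd (φ ≫ s) (φ ≫ s)

end NewtonGroupoid

end Newton

end

noncomputable section

namespace Newton

set_option linter.unusedSectionVars false

open Category
open Function (Surjective Bijective)
open Ideal.Quotient (eq_zero_iff_mem)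
open pullback (fst snd)
open CommRingCat (ofHom)
open IsLocalRing (maximalIdeal)
open Multiplicative (ofAdd toAdd)
open RingHom (comp_assoc)
open TrivSqZeroExt (inl inr fstHom inlHom)

section RegularSequences
open RingTheory.Sequence Pointwise

/-- A relation among the members of a regular sequence has its coefficients in the ideal generated
by the sequence. -/
lemma mem_span_of_sum_mul_eq_zero {P : Type*} [CommRing P] {c : ℕ} (F : Fin c → P)
    (hF : IsWeaklyRegular P (List.ofFn F)) (a : Fin c → P) (h : ∑ i, a i * F i = 0) (i : Fin c) :
    a i ∈ Ideal.span (Set.range F) := by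
  induction c with
  | zero => exact i.elim0
  | succ c ih =>
    rw [List.ofFn_succ', List.concat_eq_append, isWeaklyRegular_append_iff,
      isWeaklyRegular_singleton_iff] at hF
    obtain ⟨h1, h2⟩ := hF
    set I := Ideal.span (Set.range fun i : Fin c ↦ F i.castSucc) with hI
    have hI' : Ideal.ofList (List.ofFn fun i : Fin c ↦ F i.castSucc) = I := by
      rw [Ideal.ofList, hI]
      congr 1
      ext x
      simp [List.mem_ofFn]
    have hle : I ≤ Ideal.span (Set.range F) :=
      Ideal.span_mono (by rintro _ ⟨i, rfl⟩; exact ⟨_, rfl⟩)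
    have hmem : a (Fin.last c) ∈ I := by
      have h3 : F (Fin.last c) * a (Fin.last c) ∈ I := by
        rw [Fin.sum_univ_castSucc] at h
        rw [mul_comm, eq_neg_of_add_eq_zero_right h]
        exact neg_mem (sum_mem fun j _ ↦ Ideal.mul_mem_left _ _ (Ideal.subset_span ⟨j, rfl⟩))
      rw [hI', smul_eq_mul, Ideal.mul_top] at h2
      have := @h2 (Submodule.Quotient.mk (a (Fin.last c))) 0 (by
        change F (Fin.last c) • Submodule.Quotient.mk (a (Fin.last c)) =
          F (Fin.last c) • (0 : P ⧸ I)
        rw [smul_zero, ← Submodule.Quotient.mk_smul, Submodule.Quotient.mk_eq_zero]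
        exact h3)
      rwa [Submodule.Quotient.mk_eq_zero] at this
    obtain ⟨e, he⟩ := (Ideal.mem_span_range_iff_exists_fun).mp hmem
    have key := ih (fun i ↦ F i.castSucc) h1 (fun j ↦ a j.castSucc + e j * F (Fin.last c)) (by
      rw [Fin.sum_univ_castSucc, ← he, Finset.sum_mul] at h
      rw [← h, ← Finset.sum_add_distrib]
      exact Finset.sum_congr rfl fun j _ ↦ by ring)
    refine Fin.lastCases (hle hmem) (fun j ↦ ?_) i
    have h4 := sub_mem (hle (key j))
      (Ideal.mul_mem_left _ (e j) (Ideal.subset_span (Set.mem_range_self (f := F) (Fin.last c))))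
    simpa using h4

/-- A regular sequence is independent modulo the square of the ideal it generates. -/
lemma mem_span_of_sum_mul_mem_sq {P : Type*} [CommRing P] {c : ℕ} (F : Fin c → P)
    (hF : IsWeaklyRegular P (List.ofFn F)) (a : Fin c → P)
    (h : ∑ i, a i * F i ∈ Ideal.span (Set.range F) ^ 2) (i : Fin c) :
    a i ∈ Ideal.span (Set.range F) := by
  rw [pow_two, ← smul_eq_mul] at h
  obtain ⟨b, hb, e⟩ := (Submodule.mem_ideal_smul_span_iff_exists_sum _ F _).mp h
  have key := mem_span_of_sum_mul_eq_zero F hF (fun j ↦ a j - b j) (by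
    rw [Finsupp.sum_fintype _ _ (by simp)] at e
    simp only [sub_mul, Finset.sum_sub_distrib, ← e, smul_eq_mul, sub_self]) i
  simpa using add_mem key (hb i)

/-- Modulo a non-zero-divisor `x`, some associated prime contains a given associated prime
and `x`. -/
lemma exists_mem_associatedPrimes_quotSMulTop {A M : Type*} [CommRing A] [IsNoetherianRing A]
    [IsLocalRing A] [AddCommGroup M] [Module A M] [Module.Finite A M] {x : A}
    (hx : x ∈ maximalIdeal A) (hreg : IsSMulRegular M x) {p : Ideal A}
    (hp : p ∈ associatedPrimes A M) :
    ∃ q ∈ associatedPrimes A (QuotSMulTop x M), p ≤ q ∧ x ∈ q := by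
  obtain ⟨hpp, m₀, hm₀⟩ := isAssociatedPrime_iff.mp hp
  let K : Submodule A M :=
    { carrier := {m | ∀ a ∈ p, a • m = 0}
      add_mem' := fun h1 h2 a ha ↦ by rw [smul_add, h1 a ha, h2 a ha, add_zero]
      zero_mem' := fun a _ ↦ smul_zero a
      smul_mem' := fun c m h a ha ↦ by rw [smul_comm, h a ha, smul_zero] }
  have hm₀K : m₀ ∈ K := fun a ha ↦ by
    rw [hm₀] at ha
    simpa [Submodule.mem_colon_singleton] using ha
  have hne : ∃ m ∈ K, (Submodule.Quotient.mk m : QuotSMulTop x M) ≠ 0 := by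
    by_contra! hcon
    have hK : K = ⊥ := by
      refine Submodule.eq_bot_of_le_smul_of_le_jacobson_bot (Ideal.span {x}) K
        (IsNoetherian.noetherian K) ?_ ?_
      · intro m hm
        have := (Submodule.Quotient.mk_eq_zero _).mp (hcon m hm)
        obtain ⟨m', -, rfl⟩ := (Submodule.mem_smul_pointwise_iff_exists _ _ _).mp this
        refine Submodule.smul_mem_smul (Ideal.mem_span_singleton_self x) fun a ha ↦ hreg ?_
        have := hm a ha
        simp only [smul_zero]
        rwa [smul_comm]
      · rw [IsLocalRing.jacobson_eq_maximalIdeal _ bot_ne_top, Ideal.span_singleton_le_iff_mem]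
        exact hx
    have h0 : m₀ = 0 := by rw [hK] at hm₀K; simpa using hm₀K
    apply hpp.ne_top
    rw [hm₀, h0, eq_top_iff]
    intro a _
    simp [Submodule.mem_colon_singleton]
  obtain ⟨m, hm, hne⟩ := hne
  obtain ⟨q, hq, hle⟩ := exists_le_isAssociatedPrime_of_isNoetherianRing A _ hne
  refine ⟨q, hq, fun a ha ↦ hle ?_, hle ?_⟩
  · rw [Submodule.mem_colon_singleton, Submodule.mem_bot, ← Submodule.Quotient.mk_smul, hm a ha,
      Submodule.Quotient.mk_zero]
  · rw [Submodule.mem_colon_singleton, Submodule.mem_bot, ← Submodule.Quotient.mk_smul,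
      Submodule.Quotient.mk_eq_zero]
    exact Submodule.smul_mem_pointwise_smul _ _ _ Submodule.mem_top

lemma length_le_ringKrullDim_quotient_of_mem_associatedPrimes {A M : Type*} [CommRing A]
    [IsNoetherianRing A] [IsLocalRing A] [AddCommGroup M] [Module A M] [Module.Finite A M]
    (rs : List A) (hmem : ∀ r ∈ rs, r ∈ maximalIdeal A) (hrs : IsWeaklyRegular M rs)
    {p : Ideal A} (hp : p ∈ associatedPrimes A M) :
    (rs.length : WithBot ℕ∞) ≤ ringKrullDim (A ⧸ p) := by
  induction rs generalizing M p with
  | nil =>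
    have := Ideal.Quotient.nontrivial_iff.mpr hp.isPrime.ne_top
    simpa using ringKrullDim_nonneg_of_nontrivial (R := A ⧸ p)
  | cons x rs ih =>
    rw [isWeaklyRegular_cons_iff] at hrs
    obtain ⟨q, hq, hpq, hxq⟩ := exists_mem_associatedPrimes_quotSMulTop (hmem x (by simp)) hrs.1 hp
    have h1 := ih (fun r hr ↦ hmem r (by simp [hr])) hrs.2 hq
    have hxp : x ∉ p := fun hx ↦ by
      obtain ⟨hpp, m₀, hm₀⟩ := isAssociatedPrime_iff.mp hp
      rw [hm₀] at hx
      have h0 : m₀ = 0 := hrs.1 (by simpa [Submodule.mem_colon_singleton] using hx)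
      apply hpp.ne_top
      rw [hm₀, h0, eq_top_iff]
      intro a _
      simp [Submodule.mem_colon_singleton]
    have := hp.isPrime
    have h2 := ringKrullDim_quotient_succ_le_of_nonZeroDivisor
      (R := A ⧸ p) (r := Ideal.Quotient.mk p x)
      (mem_nonZeroDivisors_of_ne_zero (by rwa [ne_eq, eq_zero_iff_mem]))
    refine le_trans ?_ h2
    push_cast [List.length_cons]
    gcongr
    refine h1.trans (ringKrullDim_le_of_surjective (Ideal.Quotient.lift _ (Ideal.Quotient.factor hpq) ?_) ?_)
    · intro a ha
      obtain ⟨b, rfl⟩ := Ideal.mem_span_singleton'.mp ha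
      rw [map_mul, Ideal.Quotient.factor_mk, eq_zero_iff_mem.mpr hxq, mul_zero]
    · exact Ideal.Quotient.lift_surjective_of_surjective _ _ (Ideal.Quotient.factor_surjective hpq)


lemma Ext_quotient_subsingleton {A : Type u} [CommRing A] (N : ModuleCat.{u} A) (n : ℕ)
    (rs : List A) (M : ModuleCat.{u} A) (hrs : IsWeaklyRegular M rs)
    (h : ∀ i < n + rs.length, Subsingleton (Abelian.Ext N M i)) :
    ∀ i < n, Subsingleton (Abelian.Ext N
      (ModuleCat.of A (M ⧸ (Ideal.ofList rs • ⊤ : Submodule A M))) i) := by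
  induction rs generalizing M with
  | nil =>
    intro i hi
    have e : M ≃ₗ[A] (M ⧸ (Ideal.ofList ([] : List A) • ⊤ : Submodule A M)) :=
      (Submodule.quotEquivOfEqBot _ (by simp)).symm
    have := h i (by simpa using hi)
    exact @Equiv.subsingleton _ _ ((Abelian.extFunctorObj N i).mapIso
      e.toModuleIso).addCommGroupIsoToAddEquiv.symm.toEquiv this
  | cons x rs ih =>
    rw [isWeaklyRegular_cons_iff] at hrs
    intro i hi
    have key := ih (ModuleCat.of A (QuotSMulTop x M)) hrs.2 (fun j hj ↦ by
      have h1 := h j (by simp; omega)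
      have h2 := h (j + 1) (by simp; omega)
      have ex := (Abelian.Ext.covariant_sequence_exact₃' N hrs.1.smulShortComplex_shortExact j (j + 1) rfl)
      refine AddCommGrpCat.subsingleton_of_isZero (ex.isZero_of_both_zeros ?_ ?_)
      · exact (AddCommGrpCat.isZero_of_iff_subsingleton.mpr h1).eq_zero_of_src _
      · exact (AddCommGrpCat.isZero_of_iff_subsingleton.mpr h2).eq_zero_of_tgt _) i hi
    exact @Equiv.subsingleton _ _ ((Abelian.extFunctorObj N i).mapIso
      (Submodule.quotOfListConsSMulTopEquivQuotSMulTopInner M x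
        rs).toModuleIso).addCommGroupIsoToAddEquiv.toEquiv key

/-- Unmixedness: in a local ring of dimension `N` with a regular sequence of length `N`, the
associated primes of the quotient by a regular sequence are minimal. -/
lemma mem_minimalPrimes_of_mem_associatedPrimes {A : Type u} [CommRing A] [IsNoetherianRing A]
    [IsLocalRing A] (gs : List A) (hg : IsRegular A gs)
    (hgm : ∀ r ∈ gs, r ∈ maximalIdeal A) (hdim : ringKrullDim A ≤ gs.length)
    (rs : List A) (hrs : IsRegular A rs) {p : Ideal A}
    (hp : p ∈ associatedPrimes A (A ⧸ Ideal.ofList rs)) : p ∈ (Ideal.ofList rs).minimalPrimes := by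
  set I := Ideal.ofList rs
  set m := maximalIdeal A
  have hI : (I • ⊤ : Submodule A A) = I := by simp
  have hItop : I ≠ ⊤ := fun h ↦ hrs.top_ne_smul (by
    change (⊤ : Submodule A A) = I • ⊤
    rw [hI, h])
  have hlt : (m • ⊤ : Submodule A A) < ⊤ := by
    rw [smul_eq_mul, Ideal.mul_top]
    exact Ne.lt_top (Ideal.IsPrime.ne_top inferInstance)
  have := Ideal.Quotient.nontrivial_iff.mpr hItop
  have h1 : ∀ i < gs.length, Subsingleton (Abelian.Ext (ModuleCat.of A (Shrink.{u} (A ⧸ m)))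
      (ModuleCat.of A A) i) :=
    ((ModuleCat.exists_isRegular_tfae m gs.length (ModuleCat.of A A) hlt).out 1 3).mpr
      (show ∃ rs : List A, rs.length = gs.length ∧ (∀ r ∈ rs, r ∈ m) ∧
        IsRegular (ModuleCat.of A A) rs from ⟨gs, rfl, hgm, hg⟩)
  have hdim' := ringKrullDim_add_length_eq_ringKrullDim_of_isRegular rs hrs
  obtain ⟨d, hd⟩ : ∃ d : ℕ, ringKrullDim (A ⧸ I) = d := by
    have h0 := ringKrullDim_nonneg_of_nontrivial (R := A ⧸ I)
    have h1 : ringKrullDim (A ⧸ I) ≤ gs.length := (ringKrullDim_quotient_le I).trans hdim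
    generalize ringKrullDim (A ⧸ I) = t at h0 h1
    induction t with
    | bot => simp at h0
    | coe t =>
      have h2 : t ≤ gs.length := by exact_mod_cast h1
      obtain ⟨d, rfl⟩ := ENat.ne_top_iff_exists.mp (ne_top_of_le_ne_top (ENat.natCast_ne_top _) h2)
      exact ⟨d, rfl⟩
  have hle : d + rs.length ≤ gs.length := by
    change ringKrullDim (A ⧸ I) + _ = _ at hdim'
    rw [← hdim', hd] at hdim
    exact_mod_cast hdim
  have hlen : gs.length ≤ d + rs.length := by
    have h0 := length_le_ringKrullDim_quotient_of_mem_associatedPrimes gs hgm hg.toIsWeaklyRegular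
      (associatedPrimes.nonempty A A).some_mem
    have := h0.trans ((ringKrullDim_quotient_le _).trans hdim'.symm.le)
    change _ ≤ ringKrullDim (A ⧸ I) + _ at this
    rw [hd] at this
    exact_mod_cast this
  have h2 := Ext_quotient_subsingleton (ModuleCat.of A (Shrink.{u} (A ⧸ m))) d rs
    (ModuleCat.of A A) hrs.toIsWeaklyRegular fun i hi ↦ h1 i (hi.trans_le hle)
  have hlt' : (m • ⊤ : Submodule A (A ⧸ (Ideal.ofList rs • ⊤ : Submodule A A))) < ⊤ := by
    have : Nontrivial (A ⧸ (Ideal.ofList rs • ⊤ : Submodule A A)) := by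
      rw [Submodule.Quotient.nontrivial_iff]; exact hrs.top_ne_smul.symm
    refine Ne.lt_top fun h ↦ ?_
    have := Submodule.eq_bot_of_le_smul_of_le_jacobson_bot m
      (⊤ : Submodule A (A ⧸ (Ideal.ofList rs • ⊤ : Submodule A A)))
      (IsNoetherian.noetherian _) h.ge (by rw [IsLocalRing.jacobson_eq_maximalIdeal _ bot_ne_top])
    exact top_ne_bot this
  obtain ⟨hs, hlen', hsm, hsr⟩ := ((ModuleCat.exists_isRegular_tfae m d (ModuleCat.of A
    (A ⧸ (Ideal.ofList rs • ⊤ : Submodule A A))) hlt').out 1 3).mp h2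
  have e : (A ⧸ (Ideal.ofList rs • ⊤ : Submodule A A)) ≃ₗ[A] (A ⧸ I) :=
    Submodule.quotEquivOfEq _ _ hI
  have h3 := length_le_ringKrullDim_quotient_of_mem_associatedPrimes hs hsm
    ((e.isWeaklyRegular_congr hs).mp hsr.toIsWeaklyRegular) hp
  have hIp : I ≤ p := by
    obtain ⟨-, x, rfl⟩ := isAssociatedPrime_iff.mp hp
    intro a ha
    obtain ⟨x, rfl⟩ := Ideal.Quotient.mk_surjective x
    rw [Submodule.mem_colon_singleton, Submodule.mem_bot, ← Ideal.Quotient.mk_eq_mk,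
      ← Submodule.Quotient.mk_smul, Submodule.Quotient.mk_eq_zero]
    exact Ideal.mul_mem_right _ _ ha
  have hpp := hp.isPrime
  refine ⟨⟨hpp, hIp⟩, fun q ⟨hq, hIq⟩ hqp ↦ ?_⟩
  by_contra hpq
  obtain ⟨x, hxp, hxq⟩ := Set.not_subset.mp hpq
  have h4 := ringKrullDim_quotient_succ_le_of_nonZeroDivisor
      (R := A ⧸ q) (r := Ideal.Quotient.mk q x)
      (mem_nonZeroDivisors_of_ne_zero (by rwa [ne_eq, eq_zero_iff_mem]))
  have h5 : ringKrullDim (A ⧸ p) ≤ ringKrullDim ((A ⧸ q) ⧸ Ideal.span {Ideal.Quotient.mk q x}) := by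
    refine ringKrullDim_le_of_surjective
      (Ideal.Quotient.lift _ (Ideal.Quotient.factor hqp) ?_) ?_
    · intro a ha
      obtain ⟨b, rfl⟩ := Ideal.mem_span_singleton'.mp ha
      rw [map_mul, Ideal.Quotient.factor_mk, eq_zero_iff_mem.mpr hxp, mul_zero]
    · exact Ideal.Quotient.lift_surjective_of_surjective _ _ (Ideal.Quotient.factor_surjective hqp)
  have h6 : ringKrullDim (A ⧸ q) ≤ ringKrullDim (A ⧸ I) :=
    ringKrullDim_le_of_surjective _ (Ideal.Quotient.factor_surjective hIq)
  have h7 : (d : WithBot ℕ∞) + 1 ≤ d := by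
    rw [hlen'] at h3
    calc (d : WithBot ℕ∞) + 1 ≤ _ + 1 := by gcongr; exact h3.trans h5
      _ ≤ _ := h4.trans (h6.trans hd.le)
  have h8 : d + 1 ≤ d := by exact_mod_cast h7
  omega

/-- Every maximal ideal of `A` contains a regular sequence of length `N`. -/
def HasRegularSequences (A : Type*) [CommRing A] (N : ℕ) : Prop :=
  ∀ m : Ideal A, m.IsMaximal → ∃ rs : List A, rs.length = N ∧ (∀ r ∈ rs, r ∈ m) ∧
    IsWeaklyRegular A rs

lemma HasRegularSequences.of_ringEquiv {A B : Type*} [CommRing A] [CommRing B] {N : ℕ}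
    (e : A ≃+* B) (h : HasRegularSequences A N) : HasRegularSequences B N := by
  intro m hm
  obtain ⟨rs, h1, h2, h3⟩ := h (m.comap e) (Ideal.comap_isMaximal_of_equiv e)
  refine ⟨rs.map e, by simpa using h1, ?_, ?_⟩
  · intro r hr
    obtain ⟨a, ha, rfl⟩ := List.mem_map.mp hr
    exact h2 a ha
  · let := e.toRingHom.toAlgebra
    have : Module.Flat A B := .of_linearEquiv
      ({ e with map_smul' := fun a b ↦ map_mul e a b } : A ≃ₗ[A] B).symm
    exact h3.of_flat (S := B)

open Polynomial in
lemma HasRegularSequences.polynomial {A : Type*} [CommRing A] [IsJacobsonRing A] {N : ℕ}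
    (h : HasRegularSequences A N) : HasRegularSequences A[X] (N + 1) := by
  intro M hM
  have hm : (M.comap (C : A →+* A[X])).IsMaximal := isMaximal_comap_C_of_isJacobsonRing M
  set m := M.comap (C : A →+* A[X])
  obtain ⟨rs, h1, h2, h3⟩ := h m hm
  -- a monic polynomial in `M`
  obtain ⟨f, hf, hfM⟩ : ∃ f : A[X], f.Monic ∧ f ∈ M := by
    obtain ⟨f, hf, hf0⟩ := Polynomial.quotient_mk_comp_C_isIntegral_of_isJacobsonRing M
      (Ideal.Quotient.mk M X)
    rw [← hom_eval₂, eval₂_C_X, eq_zero_iff_mem] at hf0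
    exact ⟨f, hf, hf0⟩
  refine ⟨rs.map C ++ [f], by simp [h1], ?_, ?_⟩
  · intro r hr
    rcases List.mem_append.mp hr with hr | hr
    · obtain ⟨a, ha, rfl⟩ := List.mem_map.mp hr
      exact h2 a ha
    · rw [List.mem_singleton.mp hr]; exact hfM
  · rw [isWeaklyRegular_append_iff, isWeaklyRegular_singleton_iff]
    refine ⟨h3.of_flat (S := A[X]), ?_⟩
    rw [smul_eq_mul, Ideal.mul_top]
    refine isSMulRegular_iff_right_eq_zero_of_smul.mpr fun g ↦ ?_
    have hmap : Ideal.ofList (rs.map C) = (Ideal.ofList rs).map C := (Ideal.map_ofList _ _).symm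
    obtain ⟨g, rfl⟩ := Ideal.Quotient.mk_surjective g
    intro hg
    rw [← Ideal.Quotient.mk_eq_mk, ← Submodule.Quotient.mk_smul, Ideal.Quotient.mk_eq_mk,
      eq_zero_iff_mem, smul_eq_mul, hmap] at hg
    rw [eq_zero_iff_mem, hmap]
    rw [Ideal.mem_map_C_iff] at hg ⊢
    have h0 : (f * g).map (Ideal.Quotient.mk (Ideal.ofList rs)) = 0 := by
      ext i; rw [coeff_map, coeff_zero, eq_zero_iff_mem]; exact hg i
    rw [Polynomial.map_mul, (hf.map _).mul_right_eq_zero_iff] at h0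
    intro i
    have := congr(coeff $h0 i)
    rwa [coeff_map, coeff_zero, eq_zero_iff_mem] at this

lemma hasRegularSequences_mvPolynomial (k : Type*) [Field k] (N : ℕ) :
    HasRegularSequences (MvPolynomial (Fin N) k) N := by
  induction N with
  | zero => exact fun m _ ↦ ⟨[], rfl, by simp, .nil _ _⟩
  | succ N ih => exact ih.polynomial.of_ringEquiv (MvPolynomial.finSuccEquiv k N).toRingEquiv.symm


lemma ringKrullDim_localization_atPrime_le {P : Type*} [CommRing P] (m : Ideal P) [m.IsPrime] :
    ringKrullDim (Localization.AtPrime m) ≤ ringKrullDim P := by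
  rw [IsLocalization.AtPrime.ringKrullDim_eq_height m]
  exact Ideal.height_le_ringKrullDim_of_ne_top (Ideal.IsPrime.ne_top inferInstance)

lemma IsRegular.localization_atPrime {P : Type*} [CommRing P] (m : Ideal P) [m.IsPrime]
    {F : List P} (hF : IsWeaklyRegular P F) (hm : Ideal.ofList F ≤ m) :
    IsRegular (Localization.AtPrime m) (F.map (algebraMap P (Localization.AtPrime m))) ∧
      ∀ r ∈ F.map (algebraMap P (Localization.AtPrime m)),
        r ∈ maximalIdeal (Localization.AtPrime m) := by
  have h : ∀ r ∈ F.map (algebraMap P (Localization.AtPrime m)),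
      r ∈ maximalIdeal (Localization.AtPrime m) := by
    intro r hr
    obtain ⟨a, ha, rfl⟩ := List.mem_map.mp hr
    rw [IsLocalization.AtPrime.to_map_mem_maximal_iff _ m]
    exact hm (Ideal.subset_span ha)
  refine ⟨?_, h⟩
  rw [IsLocalRing.isRegular_iff_isWeaklyRegular_of_subset_maximalIdeal h]
  exact hF.of_isLocalization _ m.primeCompl

lemma exists_isRegular_localization_mvPolynomial {k : Type u} [Field k] {N : ℕ}
    (m : Ideal (MvPolynomial (Fin N) k)) [hm : m.IsMaximal] :
    ∃ gs : List (Localization.AtPrime m), IsRegular (Localization.AtPrime m) gs ∧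
      (∀ r ∈ gs, r ∈ maximalIdeal (Localization.AtPrime m)) ∧ gs.length = N ∧
      ringKrullDim (Localization.AtPrime m) ≤ N := by
  obtain ⟨gs, h1, h2, h3⟩ := hasRegularSequences_mvPolynomial k N m hm
  obtain ⟨h4, h5⟩ := IsRegular.localization_atPrime m h3 (Ideal.span_le.mpr h2)
  refine ⟨_, h4, h5, by simpa using h1, (ringKrullDim_localization_atPrime_le m).trans ?_⟩
  rw [MvPolynomial.ringKrullDim_of_isNoetherianRing]
  simp

/-- An element that lies in no minimal prime over the ideal generated by a regular sequence is a
non-zero-divisor modulo this ideal. -/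
lemma mem_ofList_of_mul_mem {k : Type u} [Field k] {N : ℕ} {F : List (MvPolynomial (Fin N) k)}
    (hF : IsWeaklyRegular (MvPolynomial (Fin N) k) F) {d : MvPolynomial (Fin N) k}
    (hd : ∀ p ∈ (Ideal.ofList F).minimalPrimes, d ∉ p) {a : MvPolynomial (Fin N) k}
    (ha : d * a ∈ Ideal.ofList F) : a ∈ Ideal.ofList F := by
  by_contra haI
  set I := Ideal.ofList F
  let K : Ideal (MvPolynomial (Fin N) k) := (I : Submodule _ _).colon {a}
  have hK : K ≠ ⊤ := fun h ↦ haI (by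
    have : (1 : MvPolynomial (Fin N) k) ∈ K := h ▸ Submodule.mem_top
    simpa [K, Submodule.mem_colon_singleton] using this)
  obtain ⟨m, hm, hKm⟩ := Ideal.exists_le_maximal K hK
  have hIm : I ≤ m := fun b hb ↦ hKm (by
    rw [Submodule.mem_colon_singleton]; exact Ideal.mul_mem_right _ _ hb)
  obtain ⟨gs, hg, hgm, hgl, hdim⟩ := exists_isRegular_localization_mvPolynomial m
  obtain ⟨hr, -⟩ := IsRegular.localization_atPrime m hF hIm
  let A := Localization.AtPrime m
  have hmap : Ideal.ofList (F.map (algebraMap _ A)) = I.map (algebraMap _ A) :=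
    (Ideal.map_ofList _ _).symm
  have hne : Ideal.Quotient.mk (Ideal.ofList (F.map (algebraMap _ A))) (algebraMap _ A a) ≠ 0 := by
    rw [ne_eq, eq_zero_iff_mem, hmap,
      IsLocalization.algebraMap_mem_map_algebraMap_iff m.primeCompl]
    rintro ⟨s, hs, hsa⟩
    exact hs (hKm (by rw [Submodule.mem_colon_singleton]; exact hsa))
  obtain ⟨q, hq, hle⟩ := exists_le_isAssociatedPrime_of_isNoetherianRing A _ hne
  have hdq : algebraMap _ A d ∈ q := hle (by
    rw [Submodule.mem_colon_singleton, Submodule.mem_bot, ← Ideal.Quotient.mk_eq_mk,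
      ← Submodule.Quotient.mk_smul, Submodule.Quotient.mk_eq_zero, hmap, smul_eq_mul, ← map_mul]
    exact Ideal.mem_map_of_mem _ ha)
  have hmin := mem_minimalPrimes_of_mem_associatedPrimes gs hg hgm (by rw [hgl]; exact hdim) _ hr hq
  have hqp := hmin.1.1
  have hqI := hmin.1.2
  refine hd (q.comap (algebraMap _ A)) ⟨⟨inferInstance, ?_⟩, fun p ⟨hp, hIp⟩ hpq ↦ ?_⟩ hdq
  · rw [← Ideal.map_le_iff_le_comap, ← hmap]; exact hqI
  · have hdisj : Disjoint (m.primeCompl : Set (MvPolynomial (Fin N) k)) p := by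
      rw [Set.disjoint_left]
      intro x hx hxp
      have := hpq hxp
      exact hqp.ne_top (Ideal.eq_top_of_isUnit_mem _ this (IsLocalization.map_units A ⟨x, hx⟩))
    have h1 := IsLocalization.isPrime_of_isPrime_disjoint m.primeCompl A p hp hdisj
    have h2 := hmin.2 ⟨h1, by rw [hmap]; exact Ideal.map_mono hIp⟩
      (Ideal.map_le_iff_le_comap.mpr hpq)
    refine (Ideal.comap_mono h2).trans ?_
    exact (IsLocalization.under_map_of_isPrime_disjoint m.primeCompl A hp hdisj).le

lemma supportDim_quotient_add_length_le {A M : Type*} [CommRing A] [IsNoetherianRing A]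
    [AddCommGroup M] [Module A M] [Module.Finite A M] (rs : List A) (hrs : IsWeaklyRegular M rs) :
    Module.supportDim A (M ⧸ (Ideal.ofList rs • ⊤ : Submodule A M)) + rs.length ≤
      Module.supportDim A M := by
  induction rs generalizing M with
  | nil =>
    rw [Ideal.ofList_nil, Submodule.bot_smul]
    simpa using (Module.supportDim_eq_of_equiv (Submodule.quotEquivOfEqBot (⊥ : Submodule A M) rfl)).le
  | cons x rs ih =>
    rw [isWeaklyRegular_cons_iff] at hrs
    have h1 := ih hrs.2
    have h2 : Module.supportDim A (QuotSMulTop x M) + 1 ≤ Module.supportDim A M :=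
      Module.supportDim_quotSMulTop_succ_le_of_notMem_minimalPrimes fun p hp hx ↦ by
        have hp' := Module.associatedPrimes.minimalPrimes_annihilator_subset_associatedPrimes A M hp
        obtain ⟨hpp, m₀, hm₀⟩ := isAssociatedPrime_iff.mp hp'
        rw [hm₀] at hx
        have h0 : m₀ = 0 := hrs.1 (by simpa [Submodule.mem_colon_singleton] using hx)
        apply hpp.ne_top
        rw [hm₀, h0, eq_top_iff]
        intro a _
        simp [Submodule.mem_colon_singleton]
    rw [Module.supportDim_eq_of_equiv (Submodule.quotOfListConsSMulTopEquivQuotSMulTopInner M x _)]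
    refine le_trans ?_ h2
    push_cast [List.length_cons]
    rw [← add_assoc]
    gcongr

lemma ringKrullDim_le_of_comap_injective {A A' : Type*} [CommRing A] [CommRing A'] (f : A →+* A')
    (h : Function.Injective (PrimeSpectrum.comap f)) : ringKrullDim A' ≤ ringKrullDim A :=
  Order.krullDim_le_of_strictMono (PrimeSpectrum.comap f) fun _ _ hpq ↦
    lt_of_le_of_ne (fun _ hx ↦ hpq.le hx) fun e ↦ hpq.ne (h e)

lemma ringKrullDim_quotient_map_le {P : Type*} [CommRing P] (M : Submonoid P) (A : Type*)
    [CommRing A] [Algebra P A] [IsLocalization M A] (I : Ideal P) :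
    ringKrullDim (A ⧸ I.map (algebraMap P A)) ≤ ringKrullDim (P ⧸ I) := by
  let f : (P ⧸ I) →+* (A ⧸ I.map (algebraMap P A)) :=
    Ideal.quotientMap _ (algebraMap P A) Ideal.le_comap_map
  refine ringKrullDim_le_of_comap_injective f ?_
  have h4 : Function.Injective (PrimeSpectrum.comap (f.comp (Ideal.Quotient.mk I))) := by
    have : f.comp (Ideal.Quotient.mk I) =
        (Ideal.Quotient.mk (I.map (algebraMap P A))).comp (algebraMap P A) := RingHom.ext fun _ ↦ rfl
    rw [this, PrimeSpectrum.comap_comp]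
    exact (PrimeSpectrum.localization_comap_injective A M).comp
      (PrimeSpectrum.comap_injective_of_surjective _ Ideal.Quotient.mk_surjective)
  rw [PrimeSpectrum.comap_comp] at h4
  exact h4.of_comp

lemma ringKrullDim_mvPolynomial_quotient {k : Type u} [Field k] {N : ℕ}
    {F : List (MvPolynomial (Fin N) k)} (hF : IsRegular (MvPolynomial (Fin N) k) F) :
    ringKrullDim (MvPolynomial (Fin N) k ⧸ Ideal.ofList F) + F.length = N := by
  refine le_antisymm ?_ ?_
  · have h := supportDim_quotient_add_length_le F hF.toIsWeaklyRegular
    rw [smul_eq_mul, Ideal.mul_top, Module.supportDim_self_eq_ringKrullDim,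
      Module.supportDim_quotient_eq_ringKrullDim,
      MvPolynomial.ringKrullDim_of_isNoetherianRing] at h
    simpa using h
  · have hI : Ideal.ofList F ≠ ⊤ := fun h ↦ hF.top_ne_smul (by rw [h]; simp)
    obtain ⟨m, hm, hIm⟩ := Ideal.exists_le_maximal _ hI
    obtain ⟨gs, hg, hgm, hgl, hdim⟩ := exists_isRegular_localization_mvPolynomial m
    obtain ⟨hr, -⟩ := IsRegular.localization_atPrime m hF.toIsWeaklyRegular hIm
    let A := Localization.AtPrime m
    have h1 := ringKrullDim_add_length_eq_ringKrullDim_of_isRegular _ hr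
    have h2 : (N : WithBot ℕ∞) ≤ ringKrullDim A := by
      have := length_le_ringKrullDim_quotient_of_mem_associatedPrimes gs hgm hg.toIsWeaklyRegular
        (associatedPrimes.nonempty A A).some_mem
      rw [hgl] at this
      exact this.trans (ringKrullDim_quotient_le _)
    have h3 : ringKrullDim (A ⧸ Ideal.ofList (F.map (algebraMap _ A))) ≤
        ringKrullDim (MvPolynomial (Fin N) k ⧸ Ideal.ofList F) := by
      rw [← Ideal.map_ofList]
      exact ringKrullDim_quotient_map_le m.primeCompl A _
    calc (N : WithBot ℕ∞) ≤ ringKrullDim A := h2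
      _ = _ := h1.symm
      _ ≤ _ := by rw [List.length_map]; gcongr

end RegularSequences

section Taylor

open MvPolynomial

variable {k σ : Type*} [CommRing k] [Fintype σ] {S S' : Type*} [CommRing S] [CommRing S']

/-- The chain rule for a derivation killing the constants. -/
lemma derivation_eval₂ {M : Type*} [AddCommGroup M] [Module S M] (D : Derivation ℤ S M)
    (c : k →+* S) (hc : ∀ t, D (c t) = 0) (b : σ → S) (p : MvPolynomial σ k) :
    D (eval₂ c b p) = ∑ j, eval₂ c b (pderiv j p) • D (b j) := by
  classical
  induction p using MvPolynomial.induction_on with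
  | C t => simp [hc]
  | add p q hp hq => simp only [eval₂_add, map_add, hp, hq, add_smul, Finset.sum_add_distrib]
  | mul_X p i hp =>
    have : ∀ j, eval₂ c b (pderiv j (p * X i)) • D (b j) = b i • eval₂ c b (pderiv j p) • D (b j) +
          if j = i then eval₂ c b p • D (b i) else 0 := by
      intro j
      rw [(pderiv j).leibniz, smul_eq_mul, smul_eq_mul, eval₂_add, eval₂_mul, eval₂_mul, eval₂_X,
        add_smul, add_comm, mul_smul, pderiv_X]
      congr 1
      by_cases h : j = i
      · subst h; simp
      · simp [h, Ne.symm h]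
    rw [eval₂_mul, eval₂_X, D.leibniz, hp, Finset.sum_congr rfl fun j _ ↦ this j,
      Finset.sum_add_distrib, Finset.sum_ite_eq' Finset.univ i, if_pos (Finset.mem_univ i),
      ← Finset.smul_sum, add_comm]

/-- The polynomial `p (a + X ξ)`. -/
def lineRestriction (c : k →+* S) (a ξ : σ → S) (p : MvPolynomial σ k) : Polynomial S :=
  eval₂ (Polynomial.C.comp c) (fun j ↦ Polynomial.C (a j) + Polynomial.X * Polynomial.C (ξ j)) p

/-- The remainder term in `p (a + s ξ) = p a + s ∑ ∂ⱼ p (a) ξⱼ + s² T`. -/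
def taylor (c : k →+* S) (a : σ → S) (s : S) (ξ : σ → S) (p : MvPolynomial σ k) : S :=
  (lineRestriction c a ξ p).divX.divX.eval s

lemma eval_lineRestriction (c : k →+* S) (a : σ → S) (s : S) (ξ : σ → S) (p : MvPolynomial σ k) :
    (lineRestriction c a ξ p).eval s = eval₂ c (a + s • ξ) p := by
  rw [lineRestriction, ← Polynomial.coe_evalRingHom, ← coe_eval₂Hom, ← RingHom.comp_apply,
    comp_eval₂Hom, coe_eval₂Hom]
  congr 1
  · ext t; simp
  · ext j; simp; ring

lemma coeff_zero_lineRestriction (c : k →+* S) (a ξ : σ → S) (p : MvPolynomial σ k) :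
    (lineRestriction c a ξ p).coeff 0 = eval₂ c a p := by
  rw [Polynomial.coeff_zero_eq_eval_zero, eval_lineRestriction, zero_smul, add_zero]

lemma coeff_one_lineRestriction (c : k →+* S) (a ξ : σ → S) (p : MvPolynomial σ k) :
    (lineRestriction c a ξ p).coeff 1 = ∑ j, eval₂ c a (pderiv j p) * ξ j := by
  have h := derivation_eval₂ ((Polynomial.derivative' (R := S)).restrictScalars ℤ)
    (Polynomial.C.comp c) (fun t ↦ Polynomial.derivative_C)
    (fun j ↦ Polynomial.C (a j) + Polynomial.X * Polynomial.C (ξ j)) p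
  have h' := congr(Polynomial.eval 0 $h)
  have h1 : Polynomial.eval 0 (Polynomial.derivative (lineRestriction c a ξ p)) =
      (lineRestriction c a ξ p).coeff 1 := by
    rw [← Polynomial.coeff_zero_eq_eval_zero, Polynomial.coeff_derivative]; simp
  rw [← h1]
  refine h'.trans ?_
  rw [Polynomial.eval_finsetSum]
  refine Finset.sum_congr rfl fun j _ ↦ ?_
  change Polynomial.eval 0 (lineRestriction c a ξ (pderiv j p) *
    Polynomial.derivative (Polynomial.C (a j) + Polynomial.X * Polynomial.C (ξ j))) = _
  rw [Polynomial.eval_mul, eval_lineRestriction]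
  simp

lemma taylor_spec (c : k →+* S) (a : σ → S) (s : S) (ξ : σ → S) (p : MvPolynomial σ k) :
    eval₂ c (a + s • ξ) p = eval₂ c a p + s * ∑ j, eval₂ c a (pderiv j p) * ξ j +
      s ^ 2 * taylor c a s ξ p := by
  rw [← eval_lineRestriction, ← coeff_zero_lineRestriction c a ξ, ← coeff_one_lineRestriction]
  conv_lhs => rw [← Polynomial.divX_mul_X_add (lineRestriction c a ξ p),
    ← Polynomial.divX_mul_X_add (lineRestriction c a ξ p).divX]
  simp only [Polynomial.eval_add, Polynomial.eval_mul, Polynomial.eval_X, Polynomial.eval_C,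
    Polynomial.coeff_divX, taylor]
  ring

lemma map_lineRestriction (χ : S →+* S') (c : k →+* S) (a ξ : σ → S) (p : MvPolynomial σ k) :
    (lineRestriction c a ξ p).map χ = lineRestriction (χ.comp c) (χ ∘ a) (χ ∘ ξ) p := by
  rw [lineRestriction, ← Polynomial.coe_mapRingHom, ← coe_eval₂Hom, ← RingHom.comp_apply,
    comp_eval₂Hom, coe_eval₂Hom, lineRestriction]
  congr 1
  · ext t; simp
  · ext j; simp

lemma divX_map (χ : S →+* S') (p : Polynomial S) : (p.map χ).divX = p.divX.map χ := by
  ext n; simp [Polynomial.coeff_divX]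

lemma map_taylor (χ : S →+* S') (c : k →+* S) (a : σ → S) (s : S) (ξ : σ → S)
    (p : MvPolynomial σ k) :
    χ (taylor c a s ξ p) = taylor (χ.comp c) (χ ∘ a) (χ s) (χ ∘ ξ) p := by
  rw [taylor, taylor, ← map_lineRestriction, divX_map, divX_map, Polynomial.eval_map_apply]

lemma map_eval₂ (χ : S →+* S') (c : k →+* S) (a : σ → S) (p : MvPolynomial σ k) :
    χ (eval₂ c a p) = eval₂ (χ.comp c) (χ ∘ a) p := by
  rw [← coe_eval₂Hom, ← RingHom.comp_apply, comp_eval₂Hom, coe_eval₂Hom]; rfl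

end Taylor

section NewtonEquations

open MvPolynomial Matrix

variable {k : Type*} [CommRing k] {ι κ : Type*} [Fintype ι] [Fintype κ] [DecidableEq ι]
  [DecidableEq κ]
  {S S' : Type*} [CommRing S] [CommRing S'] (G : ι ⊕ κ → MvPolynomial (ι ⊕ κ) k) (r : ℕ)

/-- The Jacobian determinant. -/
def jacobian : MvPolynomial (ι ⊕ κ) k := (Matrix.of fun i j ↦ pderiv j (G i)).det

/-- The Jacobian matrix at the point `a`. -/
def jacobianMatrix (c : k →+* S) (a : ι ⊕ κ → S) : Matrix (ι ⊕ κ) (ι ⊕ κ) S :=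
  Matrix.of fun i j ↦ eval₂ c a (pderiv j (G i))

lemma det_jacobianMatrix (c : k →+* S) (a : ι ⊕ κ → S) :
    (jacobianMatrix G c a).det = eval₂ c a (jacobian G) := by
  rw [jacobian, ← coe_eval₂Hom, RingHom.map_det]; rfl

lemma map_jacobianMatrix (χ : S →+* S') (c : k →+* S) (a : ι ⊕ κ → S) :
    (jacobianMatrix G c a).map χ = jacobianMatrix G (χ.comp c) (χ ∘ a) := by
  ext i j; exact map_eval₂ _ _ _ _

/-- The equations satisfied by the coordinates `ξ`, `η` of a point of the Newton groupoid. -/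
def newtonEq (c : k →+* S) (a ξ : ι ⊕ κ → S) (η : κ → S) : ι ⊕ κ → S :=
  ξ + (jacobianMatrix G c a).adjugate *ᵥ
    ((eval₂ c a (jacobian G) ^ (r - 2)) •
      (fun i ↦ taylor c a (eval₂ c a (jacobian G) ^ (r - 1)) ξ (G i)) - Sum.elim (fun _ ↦ 0) η)

/-- The ratio of the Jacobians at source and target. -/
def newtonUnit (c : k →+* S) (a ξ : ι ⊕ κ → S) : S :=
  1 + eval₂ c a (jacobian G) ^ (r - 2) * ∑ j, eval₂ c a (pderiv j (jacobian G)) * ξ j +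
    eval₂ c a (jacobian G) ^ (2 * r - 3) *
      taylor c a (eval₂ c a (jacobian G) ^ (r - 1)) ξ (jacobian G)

lemma map_newtonEq (χ : S →+* S') (c : k →+* S) (a ξ : ι ⊕ κ → S) (η : κ → S) (j : ι ⊕ κ) :
    χ (newtonEq G r c a ξ η j) = newtonEq G r (χ.comp c) (χ ∘ a) (χ ∘ ξ) (χ ∘ η) j := by
  simp only [newtonEq, Pi.add_apply, map_add, Function.comp_apply, mulVec, dotProduct, map_sum,
    map_mul, Pi.sub_apply, Pi.smul_apply, smul_eq_mul, map_sub, map_pow, map_taylor, map_eval₂]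
  congr 1
  refine Finset.sum_congr rfl fun i _ ↦ ?_
  rw [← map_jacobianMatrix, ← RingHom.mapMatrix_apply, ← RingHom.map_adjugate]
  congr 2
  cases i <;> simp

lemma map_newtonUnit (χ : S →+* S') (c : k →+* S) (a ξ : ι ⊕ κ → S) :
    χ (newtonUnit G r c a ξ) = newtonUnit G r (χ.comp c) (χ ∘ a) (χ ∘ ξ) := by
  simp only [newtonUnit, map_add, map_one, map_mul, map_pow, map_sum, map_taylor, map_eval₂,
    Function.comp_apply]

lemma pow_mul_jacobianMatrix_mulVec_newtonEq (hr : 2 ≤ r) (c : k →+* S) (a ξ : ι ⊕ κ → S)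
    (η : κ → S) (i : ι ⊕ κ) :
    eval₂ c a (jacobian G) ^ (r - 1) * (jacobianMatrix G c a *ᵥ newtonEq G r c a ξ η) i =
      eval₂ c (a + eval₂ c a (jacobian G) ^ (r - 1) • ξ) (G i) - eval₂ c a (G i) -
        eval₂ c a (jacobian G) ^ r * (Sum.elim (fun _ ↦ 0) η : ι ⊕ κ → S) i := by
  rw [taylor_spec, newtonEq, mulVec_add, mulVec_mulVec, mul_adjugate, det_jacobianMatrix,
    smul_mulVec, one_mulVec]
  obtain ⟨r, rfl⟩ := Nat.exists_eq_add_of_le' hr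
  simp only [Pi.add_apply, Pi.smul_apply, Pi.sub_apply, smul_eq_mul, Nat.add_sub_cancel,
    show r + 2 - 1 = r + 1 from rfl]
  have : (jacobianMatrix G c a *ᵥ ξ) i = ∑ j, eval₂ c a (pderiv j (G i)) * ξ j := rfl
  rw [this]
  ring

lemma eval₂_jacobian_add (hr : 2 ≤ r) (c : k →+* S) (a ξ : ι ⊕ κ → S) :
    eval₂ c (a + eval₂ c a (jacobian G) ^ (r - 1) • ξ) (jacobian G) =
      eval₂ c a (jacobian G) * newtonUnit G r c a ξ := by
  rw [taylor_spec, newtonUnit]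
  obtain ⟨r, rfl⟩ := Nat.exists_eq_add_of_le' hr
  simp only [Nat.add_sub_cancel, show r + 2 - 1 = r + 1 from rfl,
    show 2 * (r + 2) - 3 = 2 * r + 1 from by omega]
  ring

/-- The equations hold if and only if they hold after multiplication by the Jacobian. -/
lemma newtonEq_eq_zero (hr : 2 ≤ r) (c : k →+* S) (a ξ : ι ⊕ κ → S) (η : κ → S)
    (hd : eval₂ c a (jacobian G) ∈ nonZeroDivisors S)
    (h : ∀ i, eval₂ c (a + eval₂ c a (jacobian G) ^ (r - 1) • ξ) (G i) - eval₂ c a (G i) =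
        eval₂ c a (jacobian G) ^ r * (Sum.elim (fun _ ↦ 0) η : ι ⊕ κ → S) i) :
    newtonEq G r c a ξ η = 0 := by
  have h1 : jacobianMatrix G c a *ᵥ newtonEq G r c a ξ η = 0 := by
    ext i
    have := pow_mul_jacobianMatrix_mulVec_newtonEq G r hr c a ξ η i
    rw [h, sub_self] at this
    exact (mul_left_mem_nonZeroDivisors_eq_zero_iff (pow_mem hd _)).mp this
  have h2 := congr((jacobianMatrix G c a).adjugate *ᵥ $h1)
  rw [mulVec_mulVec, adjugate_mul, det_jacobianMatrix, smul_mulVec, one_mulVec, mulVec_zero] at h2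
  ext j
  exact (mul_left_mem_nonZeroDivisors_eq_zero_iff hd).mp congr($h2 j)

/-- The determinant of `∂E/∂ξ`. -/
lemma det_derivation_newtonEq (hr : 2 ≤ r) (c : k →+* S) (a ξ : ι ⊕ κ → S) (η : κ → S)
    (hd : eval₂ c a (jacobian G) ∈ nonZeroDivisors S)
    (D : ι ⊕ κ → Derivation ℤ S S) (hc : ∀ l t, D l (c t) = 0) (ha : ∀ l j, D l (a j) = 0)
    (hη : ∀ l i, D l (η i) = 0) (hξ : ∀ l j, D l (ξ j) = if j = l then 1 else 0) :
    (Matrix.of fun j l ↦ D l (newtonEq G r c a ξ η j)).det = newtonUnit G r c a ξ := by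
  set d := eval₂ c a (jacobian G)
  have hpoly : ∀ l p, D l (eval₂ c a p) = 0 := fun l p ↦ by
    rw [derivation_eval₂ (D l) c (hc l)]; simp [ha]
  have hdl : ∀ l m, D l (d ^ m) = 0 := fun l m ↦ by rw [(D l).leibniz_pow, hpoly]; simp
  have hb : ∀ l p, D l (eval₂ c (a + d ^ (r - 1) • ξ) p) =
      d ^ (r - 1) * eval₂ c (a + d ^ (r - 1) • ξ) (pderiv l p) := fun l p ↦ by
    rw [derivation_eval₂ (D l) c (hc l), Finset.sum_eq_single l]
    · simp [ha, hdl, hξ, mul_comm]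
    · intro j _ hj
      simp [ha, hdl, hξ, hj]
    · simp
  have h1 : jacobianMatrix G c a * (Matrix.of fun j l ↦ D l (newtonEq G r c a ξ η j)) =
      jacobianMatrix G c (a + d ^ (r - 1) • ξ) := by
    ext i l
    have h2 := congr(D l $(pow_mul_jacobianMatrix_mulVec_newtonEq G r hr c a ξ η i))
    have h3 : D l ((Sum.elim (fun _ ↦ 0) η : ι ⊕ κ → S) i) = 0 := by cases i <;> simp [hη]
    rw [map_sub, map_sub, hpoly, hb, (D l).leibniz, hdl, (D l).leibniz, hdl, h3] at h2
    simp only [mul_zero, add_zero, sub_zero, smul_eq_mul] at h2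
    have h4 : D l ((jacobianMatrix G c a *ᵥ newtonEq G r c a ξ η) i) =
        (jacobianMatrix G c a * (Matrix.of fun j l ↦ D l (newtonEq G r c a ξ η j))) i l := by
      rw [mulVec, dotProduct, map_sum, Matrix.mul_apply]
      refine Finset.sum_congr rfl fun j _ ↦ ?_
      rw [(D l).leibniz, show D l (jacobianMatrix G c a i j) = 0 from hpoly _ _]
      simp
    rw [h4] at h2
    exact (mul_cancel_left_mem_nonZeroDivisors (pow_mem hd _)).mp h2
  have h2 := congr(Matrix.det $h1)
  rw [det_mul, det_jacobianMatrix, det_jacobianMatrix, eval₂_jacobian_add G r hr] at h2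
  exact (mul_cancel_left_mem_nonZeroDivisors hd).mp h2

end NewtonEquations

section Presentations

open RingTheory.Sequence MvPolynomial

lemma isWeaklyRegular_map_ringEquiv {A B : Type*} [CommRing A] [CommRing B] (e : A ≃+* B)
    {rs : List A} (h : IsWeaklyRegular A rs) : IsWeaklyRegular B (rs.map e) := by
  let := e.toRingHom.toAlgebra
  have : Module.Flat A B := .of_linearEquiv
    ({ e with map_smul' := fun a b ↦ map_mul e a b } : A ≃ₗ[A] B).symm
  exact h.of_flat (S := B)

lemma isWeaklyRegular_polynomial {A : Type*} [CommRing A] {rs : List A}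
    (h : IsWeaklyRegular A rs) (g : A) :
    IsWeaklyRegular (Polynomial A)
      (rs.map Polynomial.C ++ [Polynomial.C g * Polynomial.X - 1]) := by
  rw [isWeaklyRegular_append_iff, isWeaklyRegular_singleton_iff]
  refine ⟨h.of_flat (S := Polynomial A), ?_⟩
  rw [smul_eq_mul, Ideal.mul_top]
  refine isSMulRegular_iff_right_eq_zero_of_smul.mpr fun q ↦ ?_
  have hmap : Ideal.ofList (rs.map Polynomial.C) = (Ideal.ofList rs).map Polynomial.C :=
    (Ideal.map_ofList _ _).symm
  obtain ⟨q, rfl⟩ := Ideal.Quotient.mk_surjective q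
  intro hq
  rw [← Ideal.Quotient.mk_eq_mk, ← Submodule.Quotient.mk_smul, Ideal.Quotient.mk_eq_mk,
    eq_zero_iff_mem, smul_eq_mul, hmap] at hq
  rw [eq_zero_iff_mem, hmap]
  rw [Ideal.mem_map_C_iff] at hq ⊢
  intro i
  induction i with
  | zero =>
    have := hq 0
    simpa [sub_mul, mul_assoc] using this
  | succ i ih =>
    have := hq (i + 1)
    rw [sub_mul, mul_assoc, one_mul, Polynomial.coeff_sub, Polynomial.coeff_C_mul,
      Polynomial.coeff_X_mul] at this
    exact (Submodule.sub_mem_iff_right _ (Ideal.mul_mem_left _ g ih)).mp this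

/-- `R` is the quotient of a polynomial ring in `N` variables by a regular sequence of
length `m`. -/
def HasLCIPresentation {k R : Type*} [Field k] [CommRing R] (c : k →+* R) (N m : ℕ) : Prop :=
  ∃ F : List (MvPolynomial (Fin N) k), F.length = m ∧ IsRegular (MvPolynomial (Fin N) k) F ∧
    ∃ π : MvPolynomial (Fin N) k →+* R, Surjective π ∧
      RingHom.ker π = Ideal.ofList F ∧ π.comp C = c

lemma HasLCIPresentation.ringKrullDim {k : Type u} {R : Type*} [Field k] [CommRing R] {c : k →+* R}
    {N m : ℕ} (h : HasLCIPresentation c N m) : ringKrullDim R + m = N := by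
  obtain ⟨F, rfl, hF, π, hπ, hker, -⟩ := h
  rw [← ringKrullDim_mvPolynomial_quotient hF, ← hker,
    ringKrullDim_eq_of_ringEquiv (RingHom.quotientKerEquivOfSurjective hπ)]

lemma HasLCIPresentation.localization {k R R' : Type*} [Field k] [CommRing R] [CommRing R']
    [Algebra R R'] {c : k →+* R} {N m : ℕ} (h : HasLCIPresentation c N m) (g : R)
    [IsLocalization.Away g R'] [Nontrivial R'] :
    HasLCIPresentation ((algebraMap R R').comp c) (N + 1) (m + 1) := by
  obtain ⟨F, rfl, hF, π, hπ, hker, hc⟩ := h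
  obtain ⟨g, rfl⟩ := hπ g
  let F' := F.map (rename Fin.succ : MvPolynomial (Fin N) k → MvPolynomial (Fin (N + 1)) k) ++
    [rename Fin.succ g * X 0 - 1]
  let v : R' := IsLocalization.Away.invSelf (S := R') (π g)
  let π' : MvPolynomial (Fin (N + 1)) k →+* R' :=
    eval₂Hom ((algebraMap R R').comp c) (Fin.cases v fun i ↦ algebraMap R R' (π (X i)))
  have hπ' : ∀ p, π' (rename Fin.succ p) = algebraMap R R' (π p) := by
    intro p
    have : π'.comp (rename Fin.succ : MvPolynomial (Fin N) k →ₐ[k] _).toRingHom =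
        (algebraMap R R').comp π := by
      refine MvPolynomial.ringHom_ext (fun t ↦ ?_) fun i ↦ ?_
      · simp [π', ← hc]
      · simp [π']
    exact congr($this p)
  have hv : algebraMap R R' (π g) * v = 1 := IsLocalization.Away.mul_invSelf _
  have hX : π' (X 0) = v := by simp [π']
  have hle : Ideal.ofList F' ≤ RingHom.ker π' := by
    refine Ideal.span_le.mpr fun x hx ↦ ?_
    rcases List.mem_append.mp hx with hx | hx
    · obtain ⟨p, hp, rfl⟩ := List.mem_map.mp hx
      have : π p = 0 := by rw [← RingHom.mem_ker, hker]; exact Ideal.subset_span hp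
      simp [hπ', this]
    · rw [List.mem_singleton.mp hx]
      simp [hπ', hX, hv]
  have hsurj : Surjective π' := by
    intro t
    obtain ⟨n, a, ha⟩ := IsLocalization.Away.surj (π g) t
    obtain ⟨p, rfl⟩ := hπ a
    refine ⟨rename Fin.succ p * X 0 ^ n, ?_⟩
    rw [map_mul, map_pow, hπ', hX, ← ha, mul_assoc, ← mul_pow, hv, one_pow, mul_one]
  have hker' : RingHom.ker π' = Ideal.ofList F' := by
    refine le_antisymm (fun p hp ↦ ?_) hle
    let ψ₀ : R →+* MvPolynomial (Fin (N + 1)) k ⧸ Ideal.ofList F' :=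
      RingHom.liftOfSurjective π hπ ⟨(Ideal.Quotient.mk _).comp
        (rename Fin.succ : MvPolynomial (Fin N) k →ₐ[k] _).toRingHom, fun x hx ↦ by
          rw [hker] at hx
          rw [RingHom.mem_ker, RingHom.comp_apply, eq_zero_iff_mem]
          have : Ideal.ofList F ≤ (Ideal.ofList F').comap
              (rename Fin.succ : MvPolynomial (Fin N) k →ₐ[k] _).toRingHom :=
            Ideal.span_le.mpr fun y hy ↦ Ideal.subset_span
              (List.mem_append_left _ (List.mem_map_of_mem hy))
          exact this hx⟩
    have hψ₀ : ∀ q, ψ₀ (π q) = Ideal.Quotient.mk _ (rename Fin.succ q) := fun q ↦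
      RingHom.liftOfRightInverse_comp_apply _ _ _ _ q
    have hu : ψ₀ (π g) * Ideal.Quotient.mk _ (X 0) = 1 := by
      rw [hψ₀, ← map_mul, ← map_one (Ideal.Quotient.mk _), Ideal.Quotient.mk_eq_mk_iff_sub_mem]
      exact Ideal.subset_span (List.mem_append_right _ (List.mem_singleton_self _))
    let ψ : R' →+* MvPolynomial (Fin (N + 1)) k ⧸ Ideal.ofList F' :=
      IsLocalization.Away.lift (π g) (IsUnit.of_mul_eq_one _ hu)
    have hψ : ∀ a, ψ (algebraMap R R' a) = ψ₀ a := IsLocalization.Away.lift_eq _ _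
    have h1 : ψ.comp π' = Ideal.Quotient.mk _ := by
      refine MvPolynomial.ringHom_ext (fun t ↦ ?_) fun i ↦ ?_
      · have : π' (C t) = algebraMap R R' (π (C t)) := by rw [← hπ', rename_C]
        rw [RingHom.comp_apply, this, hψ, hψ₀, rename_C]
      · refine Fin.cases ?_ (fun i ↦ ?_) i
        · rw [RingHom.comp_apply, hX]
          have h2 : ψ₀ (π g) * ψ v = 1 := by rw [← hψ, ← map_mul, hv, map_one]
          exact (IsUnit.of_mul_eq_one _ hu).mul_left_cancel (h2.trans hu.symm)
        · have : π' (X i.succ) = algebraMap R R' (π (X i)) := by rw [← hπ', rename_X]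
          rw [RingHom.comp_apply, this, hψ, hψ₀, rename_X]
    rw [← eq_zero_iff_mem, ← h1, RingHom.comp_apply, RingHom.mem_ker.mp hp, map_zero]
  refine ⟨F', by simp [F'], ⟨?_, fun h ↦ ?_⟩, π', hsurj, hker', ?_⟩
  · have h1 := isWeaklyRegular_map_ringEquiv (finSuccEquiv k N).toRingEquiv.symm
      (isWeaklyRegular_polynomial hF.toIsWeaklyRegular g)
    have h2 : ∀ p : MvPolynomial (Fin N) k, (finSuccEquiv k N).symm (Polynomial.C p) =
        rename Fin.succ p := fun p ↦ by
      rw [AlgEquiv.symm_apply_eq]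
      induction p using MvPolynomial.induction_on with
      | C t => rw [rename_C]; exact ((finSuccEquiv k N).commutes t).symm
      | add p q hp hq => simp only [map_add, hp, hq]
      | mul_X p i hp => simp only [map_mul, hp, rename_X, finSuccEquiv_X_succ]
    have h3 : (finSuccEquiv k N).symm Polynomial.X = X 0 := by
      rw [AlgEquiv.symm_apply_eq, finSuccEquiv_X_zero]
    have h4 : F' = (F.map Polynomial.C ++ [Polynomial.C g * Polynomial.X - 1]).map
        (finSuccEquiv k N).toRingEquiv.symm := ?_
    · exact h4 ▸ h1
    rw [List.map_append, List.map_map]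
    refine congr_arg₂ (· ++ ·) ?_ ?_
    · exact List.map_congr_left fun p _ ↦ (h2 p).symm
    · change _ = [(finSuccEquiv k N).symm (Polynomial.C g * Polynomial.X - 1)]
      rw [map_sub, map_mul, map_one, h2, h3]
  · rw [← hker', smul_eq_mul, Ideal.mul_top] at h
    exact one_ne_zero (α := R') (by
      rw [← map_one π', ← RingHom.mem_ker, ← h]; exact Submodule.mem_top)
  · ext t; simp [π']

end Presentations

section Jacobian

open MvPolynomial

lemma eval₂_sub_mem_sq {k S σ : Type*} [CommRing k] [CommRing S] [Fintype σ] (c : k →+* S)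
    (a w : σ → S) (I : Ideal S) (hw : ∀ j, w j ∈ I) (p : MvPolynomial σ k) :
    eval₂ c (a - w) p - (eval₂ c a p - ∑ j, eval₂ c a (pderiv j p) * w j) ∈ I ^ 2 := by
  classical
  induction p using MvPolynomial.induction_on with
  | C t => simp
  | add p q hp hq =>
    simp only [eval₂_add, map_add, add_mul, Finset.sum_add_distrib]
    convert add_mem hp hq using 1
    ring
  | mul_X p i hp =>
    have h1 : ∑ j, eval₂ c a (pderiv j (p * X i)) * w j =
        (∑ j, eval₂ c a (pderiv j p) * w j) * a i + eval₂ c a p * w i := by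
      have : ∀ j, eval₂ c a (pderiv j (p * X i)) * w j =
          eval₂ c a (pderiv j p) * w j * a i + if j = i then eval₂ c a p * w i else 0 := by
        intro j
        rw [(pderiv j).leibniz, smul_eq_mul, smul_eq_mul, eval₂_add, eval₂_mul, eval₂_mul,
          eval₂_X, pderiv_X]
        by_cases h : j = i
        · subst h; simp; ring
        · simp [h, Ne.symm h]; ring
      rw [Finset.sum_congr rfl fun j _ ↦ this j, Finset.sum_add_distrib,
        Finset.sum_ite_eq' Finset.univ i, if_pos (Finset.mem_univ i), Finset.sum_mul]
    rw [h1, eval₂_mul, eval₂_mul, eval₂_X, eval₂_X]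
    have h2 : (∑ j, eval₂ c a (pderiv j p) * w j) * w i ∈ I ^ 2 := by
      rw [pow_two]
      exact Ideal.mul_mem_mul (Ideal.sum_mem _ fun j _ ↦ Ideal.mul_mem_left _ _ (hw j)) (hw i)
    convert add_mem (Ideal.mul_mem_right (a i - w i) _ hp) h2 using 1
    simp only [Pi.sub_apply]
    ring

/-- The Jacobian matrix of the equations of a smooth algebra has a right inverse. -/
lemma exists_rightInverse_jacobian {k A ι σ : Type*} [CommRing k] [CommRing A] [Fintype σ]
    [Fintype ι] [DecidableEq ι] [Algebra k A] (F : ι → MvPolynomial σ k) (x : σ → A) (I : Ideal A)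
    (hI : I = Ideal.span (Set.range fun i ↦ eval₂ (algebraMap k A) x (F i)))
    (hreg : ∀ a : ι → A, ∑ i, a i * eval₂ (algebraMap k A) x (F i) ∈ I ^ 2 → ∀ i, a i ∈ I)
    [Algebra.FormallySmooth k (A ⧸ I)] :
    ∃ b : σ → ι → A, ∀ i l, ∑ j, eval₂ (algebraMap k A) x (pderiv j (F i)) * b j l -
      (if i = l then 1 else 0) ∈ I := by
  let q : A ⧸ I ^ 2 →ₐ[k] A ⧸ I := Ideal.Quotient.factorₐ k (Ideal.pow_le_self (I := I) two_ne_zero)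
  have hq : Surjective q := Ideal.Quotient.factor_surjective (Ideal.pow_le_self two_ne_zero)
  have hker : ∀ t, q t = 0 → ∃ w ∈ I, Ideal.Quotient.mk (I ^ 2) w = t := by
    intro t ht
    obtain ⟨w, rfl⟩ := Ideal.Quotient.mk_surjective t
    exact ⟨w, eq_zero_iff_mem.mp ht, rfl⟩
  have hnil : IsNilpotent (RingHom.ker (q : A ⧸ I ^ 2 →+* A ⧸ I)) := by
    refine ⟨2, ?_⟩
    rw [Ideal.zero_eq_bot, eq_bot_iff, pow_two (RingHom.ker _), Ideal.mul_le]
    intro s hs t ht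
    obtain ⟨s, hs', rfl⟩ := hker s hs
    obtain ⟨t, ht', rfl⟩ := hker t ht
    rw [Ideal.mem_bot, ← map_mul, eq_zero_iff_mem, pow_two]
    exact Ideal.mul_mem_mul hs' ht'
  let s := Algebra.FormallySmooth.liftOfSurjective (AlgHom.id k (A ⧸ I)) q hq hnil
  have hs : ∀ t, q (s t) = t := Algebra.FormallySmooth.liftOfSurjective_apply _ _ _ _
  have hw : ∀ j, ∃ w ∈ I, Ideal.Quotient.mk (I ^ 2) w =
      Ideal.Quotient.mk (I ^ 2) (x j) - s (Ideal.Quotient.mk I (x j)) := fun j ↦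
    hker _ (by rw [map_sub, hs]; exact sub_self _)
  choose w hwI hw using hw
  have hb : ∀ j, ∃ b : ι → A, w j = ∑ l, b l * eval₂ (algebraMap k A) x (F l) := fun j ↦ by
    have := hwI j
    rw [hI] at this
    obtain ⟨b, hb⟩ := (Ideal.mem_span_range_iff_exists_fun).mp this
    exact ⟨b, hb.symm⟩
  choose b hb using hb
  refine ⟨b, fun i ↦ ?_⟩
  have h1 : Ideal.Quotient.mk (I ^ 2) (eval₂ (algebraMap k A) (x - w) (F i)) = 0 := by
    have e1 : Ideal.Quotient.mk (I ^ 2) (eval₂ (algebraMap k A) (x - w) (F i)) =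
        s (Ideal.Quotient.mk I (eval₂ (algebraMap k A) x (F i))) := by
      rw [map_eval₂, map_eval₂, ← RingHom.coe_coe s, map_eval₂]
      have e2 : (Ideal.Quotient.mk (I ^ 2)).comp (algebraMap k A) =
        (s : (A ⧸ I) →+* A ⧸ I ^ 2).comp ((Ideal.Quotient.mk I).comp (algebraMap k A)) := by
        ext t; exact (s.commutes t).symm
      rw [e2]
      congr 1
      ext j
      simp [hw]
    rw [e1, eq_zero_iff_mem.mpr (by rw [hI]; exact Ideal.subset_span ⟨i, rfl⟩),
      map_zero]
  rw [eq_zero_iff_mem] at h1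
  have h2 := sub_mem h1 (eval₂_sub_mem_sq (algebraMap k A) x w I hwI (F i))
  rw [sub_sub_cancel] at h2
  refine fun l ↦ hreg (fun l ↦ ∑ j, eval₂ (algebraMap k A) x (pderiv j (F i)) * b j l -
      (if i = l then 1 else 0)) ?_ l
  convert neg_mem h2 using 1
  simp only [sub_mul, Finset.sum_sub_distrib, ite_mul, one_mul, zero_mul, Finset.sum_ite_eq,
    Finset.mem_univ, if_true, hb, Finset.sum_mul, Finset.mul_sum, neg_sub]
  rw [Finset.sum_comm]
  simp only [mul_assoc]

/-- Two square presentations of the same module: the determinants divide each other. -/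
lemma det_mem_span_of_equiv {R M ι ι' : Type*} [CommRing R] [AddCommGroup M] [Module R M]
    [Fintype ι] [Fintype ι'] [DecidableEq ι] [DecidableEq ι']
    (A : Matrix ι ι R) (A' : Matrix ι' ι' R) (f : (ι → R) →ₗ[R] M) (f' : (ι' → R) →ₗ[R] M)
    (hf : Surjective f) (hf' : Surjective f')
    (hA : LinearMap.ker f = LinearMap.range A.mulVecLin)
    (hA' : LinearMap.range A'.mulVecLin ≤ LinearMap.ker f') : A'.det ∈ Ideal.span {A.det} := by
  obtain ⟨c, hc⟩ : ∃ c : (ι' → R) →ₗ[R] (ι → R), f ∘ₗ c = f' := by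
    exact Module.projective_lifting_property f f' hf
  obtain ⟨c', hc'⟩ := Module.projective_lifting_property f' f hf'
  let C := LinearMap.toMatrix' c
  let C' := LinearMap.toMatrix' c'
  have hC : ∀ v, C.mulVec v = c v := fun v ↦ LinearMap.toMatrix'_mulVec _ _
  have hC' : ∀ v, C'.mulVec v = c' v := fun v ↦ LinearMap.toMatrix'_mulVec _ _
  have hmem : ∀ v, f v = 0 → ∃ w, A.mulVec w = v := fun v hv ↦ by
    have : v ∈ LinearMap.ker f := hv
    rwa [hA] at this
  let K₁ : Matrix (ι ⊕ ι') (ι ⊕ ι') R := Matrix.fromBlocks A (-C) 0 1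
  let K₂ : Matrix (ι ⊕ ι') (ι ⊕ ι') R := Matrix.fromBlocks 1 0 (-C') A'
  have key : ∀ w : ι ⊕ ι' → R, ∃ t, K₁.mulVec t = K₂.mulVec w := by
    intro w
    have h1 : f (w ∘ Sum.inl) + f' (-C'.mulVec (w ∘ Sum.inl) + A'.mulVec (w ∘ Sum.inr)) = 0 := by
      have h2 : f' (A'.mulVec (w ∘ Sum.inr)) = 0 := hA' ⟨_, rfl⟩
      rw [map_add, h2, map_neg, hC', ← LinearMap.comp_apply, hc']
      simp
    set t' := -C'.mulVec (w ∘ Sum.inl) + A'.mulVec (w ∘ Sum.inr)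
    obtain ⟨t, ht⟩ := hmem (w ∘ Sum.inl + C.mulVec t') (by
      rw [map_add, hC, ← LinearMap.comp_apply, hc, h1])
    refine ⟨Sum.elim t t', ?_⟩
    rw [Matrix.fromBlocks_mulVec, Matrix.fromBlocks_mulVec]
    simp only [Sum.elim_comp_inl, Sum.elim_comp_inr, Matrix.neg_mulVec, ht, Matrix.one_mulVec,
      Matrix.zero_mulVec, add_zero, zero_add, add_neg_cancel_right]
    rfl
  choose T hT using fun j ↦ key (Pi.single j 1)
  have hK : K₁ * (Matrix.of fun i j ↦ T j i) = K₂ := by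
    ext i j
    have := congr($(hT j) i)
    rw [Matrix.mulVec_single_one] at this
    exact this
  have h1 : K₁.det = A.det := by simp [K₁]
  have h2 : K₂.det = A'.det := by simp [K₂]
  rw [← h2, ← hK, Matrix.det_mul, h1]
  exact Ideal.mul_mem_right _ _ (Ideal.mem_span_singleton_self _)

lemma isUnit_of_mk_sq {S : Type*} [CommRing S] (I : Ideal S) (hI : I ^ 2 = ⊥) {t : S}
    (ht : IsUnit (Ideal.Quotient.mk I t)) : IsUnit t := by
  obtain ⟨s, hs⟩ := ht.exists_right_inv
  obtain ⟨s, rfl⟩ := Ideal.Quotient.mk_surjective s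
  rw [← map_mul, ← map_one (Ideal.Quotient.mk I), Ideal.Quotient.mk_eq_mk_iff_sub_mem] at hs
  have h : (t * s - 1) * (t * s - 1) ∈ I ^ 2 := by rw [pow_two]; exact Ideal.mul_mem_mul hs hs
  rw [hI, Ideal.mem_bot] at h
  exact IsUnit.of_mul_eq_one (s * (2 - t * s)) (by linear_combination -h)

/-- An algebra representing the points at which given equations hold, as many as there are
variables, and at which their Jacobian is invertible, is formally etale. -/
lemma formallyEtale_of_jacobian {A₀ R' : Type u} {σ : Type*} [CommRing A₀] [CommRing R']
    [Algebra A₀ R'] [Fintype σ] [DecidableEq σ] (G : σ → MvPolynomial σ A₀) (x : σ → R')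
    (hx : ∀ i, eval₂ (algebraMap A₀ R') x (G i) = 0)
    (hd : IsUnit (Matrix.of fun i j ↦ eval₂ (algebraMap A₀ R') x (pderiv j (G i))).det)
    (huniv : ∀ (S : Type u) [CommRing S] [Algebra A₀ S] (a : σ → S),
      (∀ i, eval₂ (algebraMap A₀ S) a (G i) = 0) →
      IsUnit (Matrix.of fun i j ↦ eval₂ (algebraMap A₀ S) a (pderiv j (G i))).det →
      ∃ f : R' →ₐ[A₀] S, ∀ j, f (x j) = a j)
    (hext : ∀ (S : Type u) [CommRing S] [Algebra A₀ S] (f g : R' →ₐ[A₀] S),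
      (∀ j, f (x j) = g (x j)) → f = g) :
    Algebra.FormallyEtale A₀ R' := by
  rw [Algebra.FormallyEtale.iff_comp_bijective]
  intro S _ _ I hI
  have hJ (S : Type u) [CommRing S] [Algebra A₀ S] (f : R' →ₐ[A₀] S) (p : MvPolynomial σ A₀) :
      f (eval₂ (algebraMap A₀ R') x p) = eval₂ (algebraMap A₀ S) (f ∘ x) p := by
    rw [← RingHom.coe_coe f, map_eval₂, f.comp_algebraMap]
  have hdet (S : Type u) [CommRing S] [Algebra A₀ S] (f : R' →ₐ[A₀] S) :
      IsUnit (Matrix.of fun i j ↦ eval₂ (algebraMap A₀ S) (f ∘ x) (pderiv j (G i))).det := by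
    have := hd.map f
    rw [AlgHom.map_det] at this
    convert this using 2
    ext i j
    exact (hJ S f _).symm
  have hnil : ∀ t, IsUnit (Ideal.Quotient.mk I t) → IsUnit t := fun t ht ↦ isUnit_of_mk_sq I hI ht
  constructor
  · intro f g hfg
    refine hext S f g fun j ↦ ?_
    have hw : ∀ j, f (x j) - g (x j) ∈ I := fun j ↦ by
      rw [← Ideal.Quotient.mk_eq_mk_iff_sub_mem]
      exact congr($hfg (x j))
    have h1 : Matrix.mulVec (Matrix.of fun i j ↦ eval₂ (algebraMap A₀ S) (f ∘ x) (pderiv j (G i)))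
        (f ∘ x - g ∘ x) = 0 := by
      ext i
      have := eval₂_sub_mem_sq (algebraMap A₀ S) (f ∘ x) (f ∘ x - g ∘ x) I hw (G i)
      rw [hI, Ideal.mem_bot, sub_sub_cancel, ← hJ, ← hJ, hx, map_zero, map_zero, zero_sub,
        zero_sub, neg_neg] at this
      exact this
    have h2 := Matrix.mulVec_injective_of_isUnit ((Matrix.isUnit_iff_isUnit_det _).mpr (hdet S f))
      (h1.trans (Matrix.mulVec_zero _).symm)
    exact sub_eq_zero.mp congr($h2 j)
  · intro g
    choose a ha using fun j ↦ Ideal.Quotient.mk_surjective (g (x j))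
    have hmk : ∀ p, Ideal.Quotient.mk I (eval₂ (algebraMap A₀ S) a p) =
        g (eval₂ (algebraMap A₀ R') x p) := by
      intro p
      rw [map_eval₂, hJ]
      congr 1
      ext j; exact ha j
    let J := Matrix.of fun i j ↦ eval₂ (algebraMap A₀ S) a (pderiv j (G i))
    have hmkJ (a' : σ → S) (ha' : ∀ j, Ideal.Quotient.mk I (a' j) = g (x j)) :
        IsUnit (Matrix.of fun i j ↦ eval₂ (algebraMap A₀ S) a' (pderiv j (G i))).det := by
      refine hnil _ ?_
      rw [RingHom.map_det]
      convert hdet _ g using 2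
      ext i j
      change Ideal.Quotient.mk I (eval₂ _ _ _) = _
      rw [map_eval₂]
      change _ = eval₂ (algebraMap A₀ (S ⧸ I)) (g ∘ x) _
      congr 1
      ext j; exact ha' j
    have hJu : IsUnit J.det := hmkJ a ha
    let w := J⁻¹.mulVec fun i ↦ eval₂ (algebraMap A₀ S) a (G i)
    have hGI : ∀ i, eval₂ (algebraMap A₀ S) a (G i) ∈ I := fun i ↦ by
      rw [← eq_zero_iff_mem, hmk, hx, map_zero]
    have hw : ∀ j, w j ∈ I := fun j ↦ Ideal.sum_mem _ fun i _ ↦ Ideal.mul_mem_left _ _ (hGI i)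
    have ha' : ∀ j, Ideal.Quotient.mk I ((a - w) j) = g (x j) := fun j ↦ by
      rw [Pi.sub_apply, map_sub, ha, eq_zero_iff_mem.mpr (hw j), sub_zero]
    obtain ⟨f, hf⟩ := huniv S (a - w) (fun i ↦ by
      have := eval₂_sub_mem_sq (algebraMap A₀ S) a w I hw (G i)
      have h1 : ∑ j, eval₂ (algebraMap A₀ S) a (pderiv j (G i)) * w j = (J.mulVec w) i := rfl
      rw [hI, Ideal.mem_bot, h1, Matrix.mulVec_mulVec, Matrix.mul_nonsing_inv _ hJu,
        Matrix.one_mulVec, sub_self, sub_zero] at this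
      exact this) (hmkJ _ ha')
    refine ⟨f, hext _ _ _ fun j ↦ ?_⟩
    rw [AlgHom.comp_apply, hf]
    exact ha' j

end Jacobian

section Coordinates

variable {k B : Type u} [CommRing k] [CommRing B]

/-- The differentials of the `y i` form a basis of the differentials of `B` over `k`. -/
structure IsCoordinates (c : k →+* B) {n : ℕ} (y : Fin n → B) : Prop where
  eq_zero : ∀ {S : Type u} [CommRing S] (α : B →+* S) (D : B →+ S), (∀ t, D (c t) = 0) →
    (∀ a b, D (a * b) = α a * D b + α b * D a) → (∀ i, D (y i) = 0) → ∀ b, D b = 0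
  exists_derivation : ∀ {S : Type u} [CommRing S] (α : B →+* S) (μ : Fin n → S), ∃ D : B →+ S,
    (∀ t, D (c t) = 0) ∧ (∀ a b, D (a * b) = α a * D b + α b * D a) ∧ ∀ i, D (y i) = μ i

lemma isCoordinates_of_basis [Algebra k B] {n : ℕ} (y : Fin n → B)
    (b : Module.Basis (Fin n) B (Ω[B⁄k])) (hb : ∀ i, b i = KaehlerDifferential.D k B (y i)) :
    IsCoordinates (algebraMap k B) y where
  eq_zero {S} _ α D hc hD hy := by
    let := Module.compHom S α
    let := Module.compHom S (algebraMap k B)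
    have : IsScalarTower k B S := ⟨fun t b s ↦ by
      change α (t • b) * s = α (algebraMap k B t) * (α b * s)
      rw [Algebra.smul_def, map_mul, mul_assoc]⟩
    let D₀ : B →ₗ[k] S :=
      { toFun := D
        map_add' := D.map_add
        map_smul' := fun t b ↦ by
          change D (t • b) = α (algebraMap k B t) * D b
          rw [Algebra.smul_def, hD, hc, mul_zero, add_zero] }
    let D' : Derivation k B S := Derivation.mk' D₀ fun a b ↦ hD a b
    have : D'.liftKaehlerDifferential = 0 := b.ext fun i ↦ by
      rw [hb, Derivation.liftKaehlerDifferential_comp_D]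
      exact hy i
    intro b
    have h := Derivation.liftKaehlerDifferential_comp_D D' b
    rw [this] at h
    exact h.symm
  exists_derivation {S} _ α μ := by
    let := Module.compHom S α
    let := Module.compHom S (algebraMap k B)
    have : IsScalarTower k B S := ⟨fun t b s ↦ by
      change α (t • b) * s = α (algebraMap k B t) * (α b * s)
      rw [Algebra.smul_def, map_mul, mul_assoc]⟩
    let D : Derivation k B S := (b.constr B μ).compDer (KaehlerDifferential.D k B)
    refine ⟨(D : B →ₗ[k] S).toAddMonoidHom, fun t ↦ D.map_algebraMap t,
      fun a b ↦ D.leibniz a b, fun i ↦ ?_⟩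
    change b.constr B μ (KaehlerDifferential.D k B (y i)) = μ i
    rw [← hb, Module.Basis.constr_basis]

variable {c : k →+* B} {n : ℕ} {y : Fin n → B} (hy : IsCoordinates c y)
include hy

/-- Near the diagonal, the ideal of the diagonal is generated by the coordinates. -/
lemma IsCoordinates.exists_mul_mem_span {S : Type u} [CommRing S] [IsNoetherianRing S]
    (α β : B →+* S) (h : α.comp c = β.comp c) :
    ∃ e : S, e - 1 ∈ Ideal.span (Set.range fun b ↦ β b - α b) ∧
      ∀ b, e * (β b - α b) ∈ Ideal.span (Set.range fun i ↦ β (y i) - α (y i)) := by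
  set I := Ideal.span (Set.range fun b ↦ β b - α b)
  set J := Ideal.span (Set.range fun i ↦ β (y i) - α (y i))
  have hJ : J ≤ I := Ideal.span_le.mpr (by
    rintro _ ⟨i, rfl⟩; exact Ideal.subset_span ⟨y i, rfl⟩)
  let q := Ideal.Quotient.mk (J ⊔ I * I)
  have h1 : ∀ b, q (β b - α b) = 0 := by
    refine hy.eq_zero (q.comp α) (q.toAddMonoidHom.comp (β.toAddMonoidHom - α.toAddMonoidHom))
      (fun t ↦ ?_) (fun a b ↦ ?_) fun i ↦ ?_
    · change q (β (c t) - α (c t)) = 0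
      rw [show β (c t) = α (c t) from congr($h.symm t), sub_self, map_zero]
    · change q (β (a * b) - α (a * b)) = q (α a) * q (β b - α b) + q (α b) * q (β a - α a)
      rw [← map_mul, ← map_mul, ← map_add, ← sub_eq_zero, ← map_sub, eq_zero_iff_mem]
      refine Ideal.mem_sup_right ?_
      convert Ideal.mul_mem_mul (Ideal.subset_span ⟨a, rfl⟩ : β a - α a ∈ I)
        (Ideal.subset_span ⟨b, rfl⟩ : β b - α b ∈ I) using 1
      simp only [map_mul]; ring
    · exact eq_zero_iff_mem.mpr (Ideal.mem_sup_left (Ideal.subset_span ⟨i, rfl⟩))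
  have h2 : I ≤ J ⊔ I * I := Ideal.span_le.mpr (by
    rintro _ ⟨b, rfl⟩; exact eq_zero_iff_mem.mp (h1 b))
  let I' := I.map (Ideal.Quotient.mk J)
  obtain ⟨r, hr, hr'⟩ := Submodule.exists_sub_one_mem_and_smul_eq_zero_of_fg_of_le_smul I' I'
    (IsNoetherian.noetherian _) (by
      have := Ideal.map_mono (f := Ideal.Quotient.mk J) h2
      rw [Ideal.map_sup, Ideal.map_quotient_self, bot_sup_eq, Ideal.map_mul] at this
      exact this)
  obtain ⟨e, rfl⟩ := Ideal.Quotient.mk_surjective r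
  refine ⟨e, ?_, fun b ↦ ?_⟩
  · rw [← map_one (Ideal.Quotient.mk J), ← map_sub, ← Ideal.mem_comap,
      Ideal.comap_map_of_surjective _ Ideal.Quotient.mk_surjective, ← RingHom.ker_eq_comap_bot,
      Ideal.mk_ker, sup_eq_left.mpr hJ] at hr
    exact hr
  · rw [← eq_zero_iff_mem, map_mul]
    exact hr' _ (Ideal.mem_map_of_mem _ (Ideal.subset_span ⟨b, rfl⟩))

/-- Ring homomorphisms that agree modulo a square zero ideal agree if they agree on coordinates. -/
lemma IsCoordinates.ringHom_ext {S : Type u} [CommRing S] (α β : B →+* S)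
    (h : α.comp c = β.comp c) (I : Ideal S) (hI : I * I = ⊥) (hαβ : ∀ b, β b - α b ∈ I)
    (hy' : ∀ i, α (y i) = β (y i)) : α = β := by
  refine RingHom.ext fun b ↦ (sub_eq_zero.mp ?_).symm
  refine hy.eq_zero α (β.toAddMonoidHom - α.toAddMonoidHom) (fun t ↦ ?_) (fun a b ↦ ?_)
    (fun i ↦ ?_) b
  · exact sub_eq_zero.mpr congr($h.symm t)
  · change β (a * b) - α (a * b) = α a * (β b - α b) + α b * (β a - α a)
    have := Ideal.mul_mem_mul (hαβ a) (hαβ b)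
    rw [hI, Ideal.mem_bot] at this
    rw [map_mul, map_mul]
    linear_combination this
  · exact sub_eq_zero.mpr (hy' i).symm

lemma IsCoordinates.formallyUnramified :
    (MvPolynomial.eval₂Hom c y).FormallyUnramified := by
  algebraize [MvPolynomial.eval₂Hom c y]
  refine Algebra.FormallyUnramified.iff_comp_injective.mpr fun S _ _ I hI f g hfg ↦ ?_
  have halg : ∀ p, f (MvPolynomial.eval₂Hom c y p) = g (MvPolynomial.eval₂Hom c y p) := fun p ↦
    (f.commutes p).trans (g.commutes p).symm
  have := hy.ringHom_ext (f : B →+* S) g (RingHom.ext fun t ↦ by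
      have := halg (MvPolynomial.C t); simpa using this) I (by rw [← pow_two, hI]) (fun b ↦ by
      rw [← Ideal.Quotient.mk_eq_mk_iff_sub_mem]
      exact congr($hfg.symm b)) (fun i ↦ by
      have := halg (MvPolynomial.X i); simpa using this)
  exact AlgHom.ext fun b ↦ congr($this b)

end Coordinates

section EtalePoints

open MvPolynomial

variable {k R R' : Type u} [CommRing k] [CommRing R] [CommRing R'] {m n : ℕ}

lemma eval₂_eq_map {σ S : Type*} [CommRing S] (f : MvPolynomial σ k →+* S) (p : MvPolynomial σ k) :
    eval₂ (f.comp C) (fun j ↦ f (X j)) p = f p := by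
  have : eval₂Hom (f.comp C) (fun j ↦ f (X j)) = f := MvPolynomial.ringHom_ext (by simp) (by simp)
  exact congr($this p)

/-- The ring of a complete intersection is etale over the polynomial ring in the remaining
coordinates where the Jacobian determinant is invertible. -/
lemma formallyEtale_eval₂Hom (G : Fin m ⊕ Fin n → MvPolynomial (Fin m ⊕ Fin n) k)
    (π : MvPolynomial (Fin m ⊕ Fin n) k →+* R) (hπ : Surjective π)
    (hker : RingHom.ker π = Ideal.span (Set.range (G ∘ Sum.inl))) [Algebra R R'] (g : R)
    [IsLocalization.Away g R'] (hδ : IsUnit (algebraMap R R' (π (jacobian G))))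
    (hg : ∃ N, g ∣ (π (jacobian G)) ^ N) :
    (eval₂Hom (((algebraMap R R').comp π).comp C)
      fun i ↦ algebraMap R R' (π (G (Sum.inr i)))).FormallyEtale := by
  let τ := (algebraMap R R').comp π
  have hτ : ∀ i, τ (G (Sum.inl i)) = 0 := fun i ↦ by
    have : π (G (Sum.inl i)) = 0 := by
      rw [← RingHom.mem_ker, hker]; exact Ideal.subset_span ⟨i, rfl⟩
    rw [RingHom.comp_apply, this, map_zero]
  let η : MvPolynomial (Fin n) k →+* R' := eval₂Hom (τ.comp C) fun i ↦ τ (G (Sum.inr i))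
  change η.FormallyEtale
  algebraize [η]
  have halg : algebraMap (MvPolynomial (Fin n) k) R' = η := rfl
  let Y : Fin m ⊕ Fin n → MvPolynomial (Fin m ⊕ Fin n) (MvPolynomial (Fin n) k) :=
    Sum.elim (fun _ ↦ 0) (fun i ↦ C (X i))
  let G' : Fin m ⊕ Fin n → MvPolynomial (Fin m ⊕ Fin n) (MvPolynomial (Fin n) k) :=
    fun i ↦ map C (G i) - Y i
  have hpd : ∀ i j, pderiv j (G' i) = map C (pderiv j (G i)) := fun i j ↦ by
    rw [map_sub, pderiv_map]
    rcases i with i | i <;> simp [Y]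
  have hev (S : Type u) [CommRing S] [Algebra (MvPolynomial (Fin n) k) S]
      (a : Fin m ⊕ Fin n → S) (p : MvPolynomial (Fin m ⊕ Fin n) k) :
      eval₂ (algebraMap (MvPolynomial (Fin n) k) S) a (map C p) =
        eval₂ ((algebraMap (MvPolynomial (Fin n) k) S).comp C) a p := eval₂_map _ _ _ _
  have hdet (S : Type u) [CommRing S] [Algebra (MvPolynomial (Fin n) k) S]
      (a : Fin m ⊕ Fin n → S) : (Matrix.of fun i j ↦ eval₂ (algebraMap _ S) a
        (pderiv j (G' i))).det = eval₂ ((algebraMap (MvPolynomial (Fin n) k) S).comp C) a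
          (jacobian G) := by
    rw [← det_jacobianMatrix]
    congr 1
    ext i j
    simp only [Matrix.of_apply, hpd, hev, jacobianMatrix]
  have hηC : η.comp C = τ.comp C := by ext t; simp [η]
  have hτX : ∀ p, eval₂ (η.comp C) (fun j ↦ τ (X j)) p = τ p := fun p ↦ by rw [hηC, eval₂_eq_map]
  refine formallyEtale_of_jacobian G' (fun j ↦ τ (X j)) ?_ ?_ ?_ ?_
  · intro i
    rw [show G' i = map C (G i) - Y i from rfl, eval₂_sub, hev, halg, hτX]
    rcases i with i | i
    · simp [Y, hτ]
    · simp [Y, η]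
  · rw [hdet, halg, hτX]; exact hδ
  · intro S _ _ a ha hu
    rw [hdet] at hu
    let θ : MvPolynomial (Fin m ⊕ Fin n) k →+* S :=
      eval₂Hom ((algebraMap (MvPolynomial (Fin n) k) S).comp C) a
    have hθ : ∀ i, θ (G i) = eval₂ (algebraMap _ S) a (Y i) := fun i ↦ by
      have := ha i
      rw [show G' i = map C (G i) - Y i from rfl, eval₂_sub, hev, sub_eq_zero] at this
      exact this
    let θ₁ : R →+* S := RingHom.liftOfSurjective π hπ ⟨θ, by
      rw [hker, Ideal.span_le]
      rintro _ ⟨i, rfl⟩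
      exact (hθ (Sum.inl i)).trans (by simp [Y])⟩
    have hθ₁ : ∀ q, θ₁ (π q) = θ q := fun q ↦ RingHom.liftOfRightInverse_comp_apply _ _ _ _ q
    have hgu : IsUnit (θ₁ g) := by
      obtain ⟨N, hN⟩ := hg
      refine isUnit_of_dvd_unit (map_dvd θ₁ hN) ?_
      rw [map_pow, hθ₁]
      exact hu.pow N
    let θ₂ : R' →+* S := IsLocalization.Away.lift g hgu
    have hθ₂ : ∀ q, θ₂ (τ q) = θ q := fun q ↦ (IsLocalization.Away.lift_eq g hgu _).trans (hθ₁ q)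
    refine ⟨{ θ₂ with commutes' := fun p ↦ ?_ }, fun j ↦ ?_⟩
    · have : θ₂.comp η = algebraMap (MvPolynomial (Fin n) k) S := by
        refine MvPolynomial.ringHom_ext (fun t ↦ ?_) fun i ↦ ?_
        · have : η (C t) = τ (C t) := congr($hηC t)
          rw [RingHom.comp_apply, this, hθ₂]
          simp [θ]
        · have : η (X i) = τ (G (Sum.inr i)) := by simp [η]
          rw [RingHom.comp_apply, this, hθ₂, hθ]
          simp [Y]
      exact congr($this p)
    · exact (hθ₂ _).trans (by simp [θ])
  · intro S _ _ f g' hfg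
    have h1 : (f : R' →+* S).comp τ = (g' : R' →+* S).comp τ := by
      refine MvPolynomial.ringHom_ext (fun t ↦ ?_) fun i ↦ hfg i
      have : τ (C t) = η (C t) := congr($hηC.symm t)
      change f (τ (C t)) = g' (τ (C t))
      rw [this]
      exact (f.commutes _).trans (g'.commutes _).symm
    have h2 : (f : R' →+* S) = g' := by
      refine IsLocalization.ringHom_ext (Submonoid.powers g) (RingHom.ext fun a ↦ ?_)
      obtain ⟨p, rfl⟩ := hπ a
      exact congr($h1 p)
    exact AlgHom.ext fun a ↦ congr($h2 a)

lemma formallyEtale_of_isCoordinates {B : Type u} [CommRing B] {c : k →+* B} {y : Fin n → B}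
    (hy : IsCoordinates c y) (f : B →+* R')
    (h : (eval₂Hom (f.comp c) fun i ↦ f (y i)).FormallyEtale) : f.FormallyEtale := by
  have h1 := hy.formallyUnramified
  have h2 : f.comp (eval₂Hom c y) = eval₂Hom (f.comp c) fun i ↦ f (y i) :=
    MvPolynomial.ringHom_ext (by simp) (by simp)
  rw [← h2] at h
  algebraize [eval₂Hom c y, f, f.comp (eval₂Hom c y)]
  have := Algebra.FormallyEtale.of_restrictScalars (R := MvPolynomial (Fin n) k) (A := B) (B := R')
  exact this

end EtalePoints

section EtalePoints

open MvPolynomial RingTheory.Sequence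

lemma ker_fst_mul_self {S M : Type*} [CommRing S] [AddCommGroup M] [Module S M]
    [Module Sᵐᵒᵖ M] [IsCentralScalar S M] :
    RingHom.ker (fstHom S S M) * RingHom.ker (fstHom S S M) = ⊥ := by
  rw [eq_bot_iff, Ideal.mul_le]
  intro s hs t ht
  have hs' : s.fst = 0 := hs
  have ht' : t.fst = 0 := ht
  rw [Ideal.mem_bot]
  ext <;> simp [hs', ht']

lemma isNilpotent_of_mul_self {S : Type*} [CommRing S] (I : Ideal S) (h : I * I = ⊥) :
    IsNilpotent I :=
  ⟨2, by rw [pow_two]; exact h⟩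

lemma isNilpotent_ker_fst {L : Type*} [CommRing L] :
    IsNilpotent (RingHom.ker (fstHom L L L)) :=
  isNilpotent_of_mul_self _ ker_fst_mul_self

lemma eval₂_inl_add_inr {k L σ : Type*} [CommRing k] [CommRing L] [Fintype σ] (c : k →+* L)
    (a v : σ → L) (p : MvPolynomial σ k) :
    eval₂ ((inlHom L L).comp c)
      (fun j ↦ (inl (a j) + inr (v j) : TrivSqZeroExt L L)) p =
    inl (eval₂ c a p) + inr (∑ j, eval₂ c a (pderiv j p) * v j) := by
  have h := eval₂_sub_mem_sq ((inlHom L L).comp c)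
    (fun j ↦ (inl (a j) : TrivSqZeroExt L L)) (fun j ↦ -inr (v j))
    (RingHom.ker (fstHom L L L)) (fun j ↦ by rw [RingHom.mem_ker, map_neg]; simp) p
  rw [pow_two, ker_fst_mul_self, Ideal.mem_bot, sub_eq_zero] at h
  have h1 : ∀ q : MvPolynomial σ k, eval₂ ((inlHom L L).comp c)
      (fun j ↦ (inl (a j) : TrivSqZeroExt L L)) q =
        inl (eval₂ c a q) := fun q ↦
    (map_eval₂ (inlHom L L) c a q).symm
  simp only [h1, mul_neg, Finset.sum_neg_distrib, sub_neg_eq_add] at h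
  convert h using 1
  · congr 1
    ext1 j
    simp
  · rw [TrivSqZeroExt.inr_sum]
    simp only [TrivSqZeroExt.inl_mul_inr, smul_eq_mul]

variable {k B R R' L : Type u} [Field k] [CommRing B] [CommRing R] [CommRing R'] [Field L]
  {σ : Type} [Fintype σ] {m n : ℕ}

lemma exists_rightInverse_jacobian_localization (F : Fin m → MvPolynomial σ k)
    (hF : IsWeaklyRegular (MvPolynomial σ k) (List.ofFn F))
    (π : MvPolynomial σ k →+* R) (hπ : Surjective π)
    (hker : RingHom.ker π = Ideal.span (Set.range F)) [Algebra R R'] (g : R)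
    [IsLocalization.Away g R']
    (hs : (((algebraMap R R').comp π).comp C).FormallySmooth) :
    ∃ b : σ → Fin m → R', ∀ i l, ∑ j, algebraMap R R' (π (pderiv j (F i))) * b j l =
      if i = l then 1 else 0 := by
  obtain ⟨g, rfl⟩ := hπ g
  let A := Localization.Away g
  let θ : A →+* R' := IsLocalization.Away.lift (g := (algebraMap R R').comp π) g
    (IsLocalization.Away.algebraMap_isUnit (S := R') (π g))
  have hθ : ∀ p, θ (algebraMap _ A p) = algebraMap R R' (π p) := fun p ↦
    IsLocalization.Away.lift_eq (g := (algebraMap R R').comp π) g _ p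
  have hsurj : Surjective θ := by
    intro t
    obtain ⟨N, a, ha⟩ := IsLocalization.Away.surj (π g) t
    obtain ⟨p, rfl⟩ := hπ a
    refine ⟨algebraMap _ A p * IsLocalization.Away.invSelf g ^ N, ?_⟩
    have h1 : algebraMap R R' (π g) * θ (IsLocalization.Away.invSelf g) = 1 := by
      rw [← hθ, ← map_mul, IsLocalization.Away.mul_invSelf, map_one]
    rw [map_mul, map_pow, hθ, ← ha, mul_assoc, ← mul_pow, h1, one_pow, mul_one]
  let I := Ideal.span (Set.range fun i ↦ algebraMap (MvPolynomial σ k) A (F i))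
  have hI : I = (Ideal.span (Set.range F)).map (algebraMap _ A) := by
    rw [Ideal.map_span, ← Set.range_comp]; rfl
  have hkerθ : RingHom.ker θ = I := by
    refine le_antisymm (fun t ht ↦ ?_) ?_
    · obtain ⟨N, p, hp⟩ := IsLocalization.Away.surj g t
      have h1 : algebraMap R R' (π p) = 0 := by
        rw [← hθ, ← hp, map_mul, RingHom.mem_ker.mp ht, zero_mul]
      obtain ⟨N', hN'⟩ := IsLocalization.Away.exists_of_eq (S := R') (π g)
        (h1.trans (map_zero _).symm)
      rw [mul_zero, ← map_pow, ← map_mul, ← RingHom.mem_ker, hker] at hN'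
      have h2 : algebraMap _ A (g ^ N' * p) ∈ I := by rw [hI]; exact Ideal.mem_map_of_mem _ hN'
      rw [map_mul, ← hp, map_pow] at h2
      have hu := IsLocalization.Away.algebraMap_isUnit (S := A) g
      rw [Ideal.unit_mul_mem_iff_mem _ (hu.pow _), Ideal.mul_unit_mem_iff_mem _ ?_] at h2
      · exact h2
      · exact hu.pow _
    · refine Ideal.span_le.mpr ?_
      rintro _ ⟨i, rfl⟩
      have : π (F i) = 0 := by rw [← RingHom.mem_ker, hker]; exact Ideal.subset_span ⟨i, rfl⟩
      rw [SetLike.mem_coe, RingHom.mem_ker, hθ, this, map_zero]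
  have hx : ∀ p, eval₂ (algebraMap k A) (fun j ↦ algebraMap (MvPolynomial σ k) A (X j)) p =
      algebraMap _ A p := fun p ↦ by
    rw [← eval₂_eq_map (algebraMap (MvPolynomial σ k) A) p]
    rfl
  have hreg : IsWeaklyRegular A (List.ofFn fun i ↦ algebraMap (MvPolynomial σ k) A (F i)) := by
    have := hF.of_isLocalization A (Submonoid.powers g)
    rwa [List.map_ofFn] at this
  have hsm : Algebra.FormallySmooth k (A ⧸ I) := by
    let : Algebra k R' := (((algebraMap R R').comp π).comp C).toAlgebra
    have : Algebra.FormallySmooth k R' := hs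
    let θ' : A →ₐ[k] R' := { θ with commutes' := fun t ↦ hθ (C t) }
    have h2 : I = RingHom.ker θ' := hkerθ.symm
    exact Algebra.FormallySmooth.of_equiv ((Ideal.quotientEquivAlgOfEq k h2).trans
      (Ideal.quotientKerAlgEquivOfSurjective (f := θ') hsurj)).symm
  obtain ⟨b, hb⟩ := exists_rightInverse_jacobian F
    (fun j ↦ algebraMap (MvPolynomial σ k) A (X j)) I (by simp only [hx]; rfl) (fun a ha i ↦ by
      simp only [hx] at ha
      exact mem_span_of_sum_mul_mem_sq _ hreg a ha i)
  refine ⟨fun j l ↦ θ (b j l), fun i l ↦ ?_⟩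
  have := hb i l
  rw [← hkerθ, RingHom.mem_ker, map_sub, map_sum, sub_eq_zero] at this
  simp only [hx, map_mul, hθ] at this
  rw [this]
  split_ifs <;> simp

/-- At an etale point, the Jacobian matrix of the equations together with that of the coordinates
is invertible. -/
lemma bijective_jacobian_of_formallyEtale {c : k →+* B} {y : Fin n → B}
    (hy : IsCoordinates c y) (F : Fin m → MvPolynomial σ k) (H : Fin n → MvPolynomial σ k)
    (π : MvPolynomial σ k →+* R) (hπ : Surjective π)
    (hker : RingHom.ker π = Ideal.span (Set.range F)) [Algebra R R'] (g : R)
    [IsLocalization.Away g R'] (f : B →+* R)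
    (hfc : f.comp c = π.comp C) (hH : ∀ i, π (H i) = f (y i))
    (hf : ((algebraMap R R').comp f).FormallyEtale)
    (hright : ∃ b : σ → Fin m → R', ∀ i l, ∑ j, algebraMap R R' (π (pderiv j (F i))) * b j l =
      if i = l then 1 else 0) (ρ : R' →+* L) :
    Bijective fun (v : σ → L) (i : Fin m ⊕ Fin n) ↦
      ∑ j, ρ (algebraMap R R' (π (pderiv j (Sum.elim F H i)))) * v j := by
  let f' := (algebraMap R R').comp f
  let τ := (algebraMap R R').comp π
  have hτF : ∀ i, τ (F i) = 0 := fun i ↦ by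
    have : π (F i) = 0 := by rw [← RingHom.mem_ker, hker]; exact Ideal.subset_span ⟨i, rfl⟩
    rw [RingHom.comp_apply, this, map_zero]
  have hτc : τ.comp C = f'.comp c := by rw [comp_assoc, ← hfc, comp_assoc]
  have hev : ∀ p, eval₂ ((ρ.comp τ).comp C) (fun j ↦ ρ (τ (X j))) p = ρ (τ p) := fun p ↦
    eval₂_eq_map (ρ.comp τ) p
  have hev' := fun (v : σ → L) p ↦ eval₂_inl_add_inr ((ρ.comp τ).comp C) (fun j ↦ ρ (τ (X j))) v p
  simp only [hev] at hev'
  constructor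
  · suffices ∀ v : σ → L, (∀ i, ∑ j, ρ (τ (pderiv j (Sum.elim F H i))) * v j = 0) → v = 0 by
      intro v v' h
      refine sub_eq_zero.mp (this (v - v') fun i ↦ ?_)
      have := congr($h i)
      change ∑ j, ρ (τ _) * (v j - v' j) = 0
      simp only [mul_sub, Finset.sum_sub_distrib]
      exact sub_eq_zero.mpr this
    intro v hv
    let χ₀ : MvPolynomial σ k →+* TrivSqZeroExt L L :=
      eval₂Hom ((inlHom L L).comp ((ρ.comp τ).comp C))
        (fun j ↦ (inl (ρ (τ (X j))) + inr (v j) : TrivSqZeroExt L L))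
    have hχ₀ : ∀ p, χ₀ p = inl (ρ (τ p)) +
      inr (∑ j, ρ (τ (pderiv j p)) * v j) := hev' v
    let χ₁ : R →+* TrivSqZeroExt L L := RingHom.liftOfSurjective π hπ ⟨χ₀, by
      rw [hker, Ideal.span_le]
      rintro _ ⟨i, rfl⟩
      have h1 := hv (Sum.inl i)
      rw [Sum.elim_inl] at h1
      rw [SetLike.mem_coe, RingHom.mem_ker, hχ₀, hτF, h1]
      simp⟩
    have hχ₁ : ∀ q, χ₁ (π q) = χ₀ q := fun q ↦ RingHom.liftOfRightInverse_comp_apply _ _ _ _ q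
    have hgu : IsUnit (χ₁ g) := by
      obtain ⟨g', rfl⟩ := hπ g
      rw [hχ₁, TrivSqZeroExt.isUnit_iff_isUnit_fst, hχ₀]
      simp only [TrivSqZeroExt.fst_add, TrivSqZeroExt.fst_inl, TrivSqZeroExt.fst_inr, add_zero]
      exact (IsLocalization.Away.algebraMap_isUnit (S := R') (π g')).map ρ
    let χ : R' →+* TrivSqZeroExt L L := IsLocalization.Away.lift g hgu
    have hχ : ∀ p, χ (τ p) = inl (ρ (τ p)) +
        inr (∑ j, ρ (τ (pderiv j p)) * v j) := fun p ↦
      (IsLocalization.Away.lift_eq g hgu _).trans ((hχ₁ p).trans (hχ₀ p))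
    let ω : R' →+* TrivSqZeroExt L L := (inlHom L L).comp ρ
    have hfst : (fstHom L L L : TrivSqZeroExt L L →+* L).comp χ = ρ := by
      refine IsLocalization.ringHom_ext (Submonoid.powers g) (RingHom.ext fun a ↦ ?_)
      obtain ⟨p, rfl⟩ := hπ a
      exact congr(TrivSqZeroExt.fst $(hχ p)).trans (by simp [τ])
    have hB : ω.comp f' = χ.comp f' := by
      refine hy.ringHom_ext _ _ (RingHom.ext fun t ↦ ?_) _ ker_fst_mul_self (fun b ↦ ?_) fun i ↦ ?_
      · have e : f' (c t) = τ (C t) := congr($hτc.symm t)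
        simp only [RingHom.comp_apply, e, ω, hχ]
        simp [τ]
      · rw [RingHom.mem_ker, map_sub, sub_eq_zero]
        exact congr($hfst (f' b))
      · have e : f' (y i) = τ (H i) := congr(algebraMap R R' $((hH i).symm))
        have h1 := hv (Sum.inr i)
        rw [Sum.elim_inr] at h1
        simp only [RingHom.comp_apply, e, ω, hχ, h1]
        simp
    let : Algebra B R' := f'.toAlgebra
    have : Algebra.FormallyEtale B R' := hf
    let : Algebra B (TrivSqZeroExt L L) := (ω.comp f').toAlgebra
    have h1 := Algebra.FormallyUnramified.ext (I := RingHom.ker (fstHom L L L))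
      isNilpotent_ker_fst
      (g₁ := ({ ω with commutes' := fun b ↦ rfl } : R' →ₐ[B] TrivSqZeroExt L L))
      (g₂ := ({ χ with commutes' := fun b ↦ congr($hB.symm b) } : R' →ₐ[B] TrivSqZeroExt L L))
      (fun x ↦ by
        rw [Ideal.Quotient.mk_eq_mk_iff_sub_mem, RingHom.mem_ker, map_sub, sub_eq_zero]
        exact congr($hfst.symm x))
    ext j
    have h2 : ω (τ (X j)) = χ (τ (X j)) := congr($h1 (τ (X j)))
    rw [hχ] at h2
    have h3 := congr(TrivSqZeroExt.snd $h2)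
    classical
    simpa [ω, pderiv_X, Pi.single_apply, apply_ite] using h3.symm
  · have h2 : ∀ μ : Fin n → L, ∃ v : σ → L, (∀ i, ∑ j, ρ (τ (pderiv j (F i))) * v j = 0) ∧
        ∀ i, ∑ j, ρ (τ (pderiv j (H i))) * v j = μ i := by
      intro μ
      obtain ⟨D, hDc, hD, hDy⟩ := hy.exists_derivation (ρ.comp f') μ
      have hD1 : D 1 = 0 := by rw [← map_one c, hDc]
      let γ : B →+* TrivSqZeroExt L L :=
        { toFun := fun b ↦ inl (ρ (f' b)) + inr (D b)
          map_one' := by simp [hD1]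
          map_zero' := by simp
          map_add' := fun a b ↦ by ext <;> simp
          map_mul' := fun a b ↦ by
            ext
            · simp
            · simp [hD, mul_comm] }
      let : Algebra B R' := f'.toAlgebra
      have : Algebra.FormallyEtale B R' := hf
      let : Algebra B L := (ρ.comp f').toAlgebra
      let : Algebra B (TrivSqZeroExt L L) := γ.toAlgebra
      let fst : TrivSqZeroExt L L →ₐ[B] L :=
        { (fstHom L L L : TrivSqZeroExt L L →+* L) with
          commutes' := fun b ↦ by
            change (inl (ρ (f' b)) + inr (D b) :
              TrivSqZeroExt L L).fst = ρ (f' b)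
            simp }
      let ρ' : R' →ₐ[B] L := { ρ with commutes' := fun _ ↦ rfl }
      have hnil : IsNilpotent (RingHom.ker (fst : TrivSqZeroExt L L →+* L)) := isNilpotent_ker_fst
      have hsf : Surjective fst := fun l ↦ ⟨inl l, rfl⟩
      let ψ := Algebra.FormallySmooth.liftOfSurjective ρ' fst hsf hnil
      have hψ : ∀ x, (ψ x).fst = ρ x := Algebra.FormallySmooth.liftOfSurjective_apply ρ' fst _ _
      have hψB : ∀ b, ψ (f' b) = γ b := ψ.commutes
      have hψτ : ∀ p, ψ (τ p) = inl (ρ (τ p)) +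
          inr (∑ j, ρ (τ (pderiv j p)) * (ψ (τ (X j))).snd) := by
        intro p
        refine ((eval₂_eq_map (ψ.toRingHom.comp τ) p).symm.trans ?_).trans (hev' _ p)
        congr 1
        · refine RingHom.ext fun t ↦ ?_
          have e : τ (C t) = f' (c t) := congr($hτc t)
          change ψ (τ (C t)) = inl (ρ (τ (C t)))
          rw [e, hψB]
          change inl (ρ (f' (c t))) + inr (D (c t)) = _
          rw [hDc]
          simp
        · ext1 j
          change ψ (τ (X j)) = _
          ext
          · simp [hψ]
          · simp
      refine ⟨fun j ↦ (ψ (τ (X j))).snd, fun i ↦ ?_, fun i ↦ ?_⟩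
      · have h1 := congr(TrivSqZeroExt.snd $(hψτ (F i)))
        rw [hτF, map_zero] at h1
        simpa using h1.symm
      · have e : τ (H i) = f' (y i) := congr(algebraMap R R' $(hH i))
        have h1 := congr(TrivSqZeroExt.snd $(hψτ (H i)))
        rw [e, hψB] at h1
        change (inl (ρ (f' (y i))) + inr (D (y i)) :
              TrivSqZeroExt L L).snd = _ at h1
        rw [hDy] at h1
        simpa using h1.symm
    intro ν
    obtain ⟨b, hb⟩ := hright
    let v₁ : σ → L := fun j ↦ ∑ l, ρ (b j l) * ν (Sum.inl l)
    have hv₁ : ∀ i, ∑ j, ρ (τ (pderiv j (F i))) * v₁ j = ν (Sum.inl i) := fun i ↦ by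
      have h1 : ∀ l, ∑ j, ρ (τ (pderiv j (F i))) * ρ (b j l) = if i = l then 1 else 0 := fun l ↦ by
        have := congr(ρ $(hb i l))
        rw [map_sum] at this
        simp only [map_mul] at this
        refine this.trans ?_
        split_ifs <;> simp
      simp only [v₁, Finset.mul_sum, ← mul_assoc]
      rw [Finset.sum_comm]
      simp only [← Finset.sum_mul, h1]
      simp
    obtain ⟨v₂, hv₂, hv₂'⟩ := h2 fun i ↦ ν (Sum.inr i) - ∑ j, ρ (τ (pderiv j (H i))) * v₁ j
    refine ⟨v₁ + v₂, funext fun i ↦ ?_⟩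
    rcases i with i | i
    · change ∑ j, ρ (τ (pderiv j (F i))) * (v₁ j + v₂ j) = _
      simp only [mul_add, Finset.sum_add_distrib, hv₁, hv₂, add_zero]
    · change ∑ j, ρ (τ (pderiv j (H i))) * (v₁ j + v₂ j) = _
      simp only [mul_add, Finset.sum_add_distrib, hv₂']
      ring

end EtalePoints

section Charts

open MvPolynomial RingTheory.Sequence

/-- Coordinates for a homomorphism `f : B → R` of `k`-algebras: coordinates `y` of `B`, a
presentation of `R` by a regular sequence `G ∘ inl`, and lifts `G ∘ inr` of the coordinates, such
that there are as many functions in `G` as variables. -/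
structure NewtonChart {k B R : Type u} [Field k] [CommRing B] [CommRing R] (c : k →+* B)
    (f : B →+* R) where
  /-- the number of equations -/
  m : ℕ
  /-- the relative dimension of `B` over `k` -/
  n : ℕ
  /-- the coordinates of `B` -/
  y : Fin n → B
  hy : IsCoordinates c y
  /-- the equations of `R` and the coordinates of `B` in terms of those of `R` -/
  G : Fin m ⊕ Fin n → MvPolynomial (Fin m ⊕ Fin n) k
  /-- the presentation -/
  π : MvPolynomial (Fin m ⊕ Fin n) k →+* R
  surj : Surjective π
  ker_π : RingHom.ker π = Ideal.span (Set.range (G ∘ Sum.inl))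
  π_C : π.comp C = f.comp c
  π_G : ∀ i, π (G (Sum.inr i)) = f (y i)
  reg : IsWeaklyRegular (MvPolynomial (Fin m ⊕ Fin n) k) (List.ofFn (G ∘ Sum.inl))

/-- The index set of the coordinates of a chart. -/
abbrev NewtonChart.Idx {k B R : Type u} [Field k] [CommRing B] [CommRing R] {c : k →+* B}
    {f : B →+* R} (ch : NewtonChart c f) : Type := Fin ch.m ⊕ Fin ch.n

lemma HasLCIPresentation.mem_nonZeroDivisors {k R : Type u} [Field k] [CommRing R] {c : k →+* R}
    {N m : ℕ} (h : HasLCIPresentation c N m) {d : R} (hd : ∀ p ∈ minimalPrimes R, d ∉ p) :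
    d ∈ nonZeroDivisors R := by
  obtain ⟨F, rfl, hF, π, hπ, hker, -⟩ := h
  rw [mem_nonZeroDivisors_iff_right]
  intro a ha
  obtain ⟨d, rfl⟩ := hπ d
  obtain ⟨a, rfl⟩ := hπ a
  rw [← map_mul, ← RingHom.mem_ker, hker, mul_comm] at ha
  rw [← RingHom.mem_ker, hker]
  refine mem_ofList_of_mul_mem hF.toIsWeaklyRegular (fun p hp hdp ↦ ?_) ha
  rw [← hker, RingHom.ker_eq_comap_bot, Ideal.comap_minimalPrimes_eq_of_surjective hπ] at hp
  obtain ⟨q, hq, rfl⟩ := hp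
  exact hd q hq hdp

lemma formallySmooth_of_formallyEtale {A A' : Type*} [CommRing A] [CommRing A'] {f : A →+* A'}
    (h : f.FormallyEtale) : f.FormallySmooth := by
  let := f.toAlgebra
  have : Algebra.FormallyEtale A A' := h
  exact (inferInstance : Algebra.FormallySmooth A A')

lemma det_ne_zero_of_bijective {L ι : Type*} [Field L] [Fintype ι] [DecidableEq ι]
    (A : Matrix ι ι L) (h : Function.Injective A.mulVec) : A.det ≠ 0 := by
  have := (Matrix.mulVec_injective_iff_isUnit (A := A)).mp h
  rwa [Matrix.isUnit_iff_isUnit_det, isUnit_iff_ne_zero] at this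

variable {k B R R' L : Type u} [Field k] [CommRing B] [CommRing R] [CommRing R'] [Field L]
  {c : k →+* B} {f : B →+* R}

lemma exists_newtonChart {N m n : ℕ} (h : HasLCIPresentation (f.comp c) N m)
    {y : Fin n → B} (hy : IsCoordinates c y) (hc : c.FormallySmooth) [Algebra R R'] (g : R)
    [IsLocalization.Away g R'] [Nontrivial R'] (hf : ((algebraMap R R').comp f).FormallyEtale) :
    N = m + n ∧ ∃ ch : NewtonChart c f, ch.n = n := by
  obtain ⟨F, rfl, hF, π, hπ, hker, hπc⟩ := h
  obtain ⟨M, hM⟩ := Ideal.exists_maximal R'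
  let := Ideal.Quotient.field M
  choose H hH using fun i ↦ hπ (f (y i))
  have hker' : RingHom.ker π = Ideal.span (Set.range F.get) := by
    rw [hker, Ideal.ofList]
    congr 1
    ext x
    simp [List.mem_iff_get]
  have hF' : IsWeaklyRegular (MvPolynomial (Fin N) k) (List.ofFn F.get) := by
    rw [List.ofFn_get]; exact hF.toIsWeaklyRegular
  have hsm : (((algebraMap R R').comp π).comp C).FormallySmooth := by
    rw [comp_assoc, hπc, ← comp_assoc]
    exact RingHom.FormallySmooth.comp hc (formallySmooth_of_formallyEtale hf)
  have hbij := bijective_jacobian_of_formallyEtale hy F.get H π hπ hker' g f hπc.symm hH hf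
    (exists_rightInverse_jacobian_localization F.get hF' π hπ hker' g hsm) (Ideal.Quotient.mk M)
  have hN : N = F.length + n := by
    let A : Matrix (Fin F.length ⊕ Fin n) (Fin N) (R' ⧸ M) := Matrix.of fun i j ↦
      Ideal.Quotient.mk M (algebraMap R R' (π (pderiv j (Sum.elim F.get H i))))
    have := LinearEquiv.finrank_eq (LinearEquiv.ofBijective A.mulVecLin hbij)
    simpa using this
  let ε : Fin F.length ⊕ Fin n ≃ Fin N := finSumFinEquiv.trans (finCongr hN.symm)
  refine ⟨hN, ⟨⟨F.length, n, y, hy, fun i ↦ rename ε.symm (Sum.elim F.get H i),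
    π.comp (rename ε : MvPolynomial (Fin F.length ⊕ Fin n) k →ₐ[k] _).toRingHom,
    ?_, ?_, ?_, ?_, ?_⟩, rfl⟩⟩
  · exact hπ.comp (renameEquiv k ε).surjective
  · have h1 : RingHom.ker (π.comp (rename ε :
        MvPolynomial (Fin F.length ⊕ Fin n) k →ₐ[k] _).toRingHom) =
        (RingHom.ker π).comap (renameEquiv k ε) := rfl
    rw [h1, hker']
    refine (Ideal.map_symm (renameEquiv k ε).toRingEquiv).symm.trans ?_
    rw [Ideal.map_span, ← Set.range_comp]
    rfl
  · rw [← hπc]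
    ext t
    simp
  · intro i
    rw [← hH]
    simp [rename_rename]
  · have h1 := isWeaklyRegular_map_ringEquiv
      (renameEquiv k ε.symm).toRingEquiv hF'
    rw [List.map_ofFn] at h1
    exact h1

namespace NewtonChart

variable (ch : NewtonChart c f)

/-- The Jacobian determinant. -/
def δ : R := ch.π (jacobian ch.G)

lemma isUnit_δ_of_formallyEtale (hc : c.FormallySmooth) [Algebra R R'] (g : R)
    [IsLocalization.Away g R'] (hf : ((algebraMap R R').comp f).FormallyEtale) (ρ : R' →+* L) :
    ρ (algebraMap R R' ch.δ) ≠ 0 := by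
  have hsm : (((algebraMap R R').comp ch.π).comp C).FormallySmooth := by
    rw [comp_assoc, ch.π_C, ← comp_assoc]
    exact RingHom.FormallySmooth.comp hc (formallySmooth_of_formallyEtale hf)
  have hbij := bijective_jacobian_of_formallyEtale ch.hy (ch.G ∘ Sum.inl) (ch.G ∘ Sum.inr) ch.π ch.surj
    ch.ker_π g f ch.π_C.symm ch.π_G hf
    (exists_rightInverse_jacobian_localization _ ch.reg ch.π ch.surj ch.ker_π g hsm) ρ
  let A : Matrix ch.Idx ch.Idx L := Matrix.of fun i j ↦
      ρ (algebraMap R R' (ch.π (pderiv j (ch.G i))))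
  have hA : A.det = ρ (algebraMap R R' ch.δ) := by
    have h1 := det_jacobianMatrix ch.G (((ρ.comp (algebraMap R R')).comp ch.π).comp C)
      (fun j ↦ ((ρ.comp (algebraMap R R')).comp ch.π) (X j))
    rw [eval₂_eq_map] at h1
    refine Eq.trans ?_ h1
    congr 1
    ext i j
    exact (eval₂_eq_map ((ρ.comp (algebraMap R R')).comp ch.π) _).symm
  rw [← hA]
  refine det_ne_zero_of_bijective A ?_
  convert hbij.1 using 1
  ext v i
  rcases i with i | i <;> rfl

lemma formallyEtale_of_isUnit [Algebra R R'] [IsLocalization.Away ch.δ R'] :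
    ((algebraMap R R').comp f).FormallyEtale := by
  refine formallyEtale_of_isCoordinates ch.hy _ ?_
  have : IsLocalization.Away (ch.π (jacobian ch.G)) R' := inferInstanceAs (IsLocalization.Away ch.δ R')
  have := formallyEtale_eval₂Hom ch.G ch.π ch.surj ch.ker_π (R' := R') (ch.π (jacobian ch.G))
    (IsLocalization.Away.algebraMap_isUnit _) ⟨1, by rw [pow_one]⟩
  rw [comp_assoc, ch.π_C, ← comp_assoc] at this
  simp only [ch.π_G] at this
  exact this

end NewtonChart

lemma mulVec_injective_of_det_mem {S ι : Type*} [CommRing S] [Fintype ι] [DecidableEq ι]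
    (A : Matrix ι ι S) (h : A.det ∈ nonZeroDivisors S) : Function.Injective A.mulVecLin := by
  refine (injective_iff_map_eq_zero _).mpr fun v hv ↦ ?_
  have h1 := congr(A.adjugate.mulVec $hv)
  rw [Matrix.mulVecLin_apply, Matrix.mulVec_mulVec, Matrix.adjugate_mul, Matrix.smul_mulVec,
    Matrix.one_mulVec, Matrix.mulVec_zero] at h1
  ext j
  exact (mul_left_mem_nonZeroDivisors_eq_zero_iff h).mp congr($h1 j)

/-- The ideal of the different is generated by the Jacobian determinant. -/
lemma NewtonChart.resolutionIdeal_eq (ch : NewtonChart c f) {S Bq : Type u} [CommRing S]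
    [CommRing Bq] [Algebra Bq S] [Algebra R S] [Algebra B Bq] (M : Submonoid R)
    [IsLocalization M S] (N : Submonoid B) [IsLocalization N Bq]
    (hcomp : ∀ b, algebraMap Bq S (algebraMap B Bq b) = algebraMap R S (f b))
    (hδ : algebraMap R S ch.δ ∈ nonZeroDivisors S) :
    resolutionIdeal S (Ω[S⁄Bq]) = Ideal.span {algebraMap R S ch.δ} := by
  let σ := ch.Idx
  let τ : MvPolynomial σ k →+* S := (algebraMap R S).comp ch.π
  have hτinl : ∀ i, τ (ch.G (Sum.inl i)) = 0 := fun i ↦ by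
    have : ch.π (ch.G (Sum.inl i)) = 0 := by
      rw [← RingHom.mem_ker, ch.ker_π]; exact Ideal.subset_span ⟨i, rfl⟩
    rw [RingHom.comp_apply, this, map_zero]
  have hτinr : ∀ i, τ (ch.G (Sum.inr i)) = algebraMap R S (f (ch.y i)) := fun i ↦
    congr(algebraMap R S $(ch.π_G i))
  have hτC : ∀ t, τ (C t) = algebraMap R S (f (c t)) := fun t ↦
    congr(algebraMap R S $(congr($ch.π_C t)))
  have hev : ∀ p, eval₂ (τ.comp C) (fun j ↦ τ (X j)) p = τ p := eval₂_eq_map τ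
  let J : Matrix σ σ S := jacobianMatrix ch.G (τ.comp C) (fun j ↦ τ (X j))
  have hJ : ∀ i j, J i j = τ (pderiv j (ch.G i)) := fun i j ↦ hev _
  have hJdet : J.det = algebraMap R S ch.δ := by rw [det_jacobianMatrix, hev]; rfl
  let D := KaehlerDifferential.D Bq S
  have hDB : ∀ b, D (algebraMap R S (f b)) = 0 := fun b ↦ by rw [← hcomp]; exact D.map_algebraMap _
  have hDτ : ∀ p, D (τ p) = ∑ j, τ (pderiv j p) • D (τ (X j)) := fun p ↦ by
    have := derivation_eval₂ (D.restrictScalars ℤ) (τ.comp C)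
      (fun t ↦ by
        change D (τ (C t)) = 0
        rw [hτC, hDB]) (fun j ↦ τ (X j)) p
    simp only [hev] at this
    exact this
  let φ : (σ → S) →ₗ[S] Ω[S⁄Bq] := Fintype.linearCombination S fun j ↦ D (τ (X j))
  have hφ : ∀ v, φ v = ∑ j, v j • D (τ (X j)) := fun v ↦ rfl
  have hφs : Surjective φ := by
    rw [← LinearMap.range_eq_top, eq_top_iff, ← KaehlerDifferential.span_range_derivation,
      Submodule.span_le]
    rintro _ ⟨s, rfl⟩
    have h0 : ∀ a, D (algebraMap R S a) ∈ LinearMap.range φ := fun a ↦ by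
      obtain ⟨p, rfl⟩ := ch.surj a
      exact ⟨fun j ↦ τ (pderiv j p), (hDτ p).symm⟩
    obtain ⟨⟨a, t⟩, hat⟩ := IsLocalization.surj M s
    have h1 := congr(D $hat)
    rw [D.leibniz] at h1
    have hu := IsLocalization.map_units S t
    have h2 : algebraMap R S t • D s ∈ LinearMap.range φ := by
      have : algebraMap R S t • D s = D (algebraMap R S a) - s • D (algebraMap R S t) := by
        rw [← h1]; abel
      rw [this]
      exact sub_mem (h0 a) (Submodule.smul_mem _ _ (h0 t))
    obtain ⟨u, hu⟩ := hu
    rw [← hu] at h2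
    exact (Submodule.smul_mem_iff_of_isUnit _ u.isUnit).mp h2
  have hsum : ∀ i, ∑ j, J i j • D (τ (X j)) = 0 := fun i ↦ by
    simp only [hJ]
    rw [← hDτ]
    rcases i with i | i
    · rw [hτinl, map_zero]
    · rw [hτinr, hDB]
  have hle : LinearMap.range J.transpose.mulVecLin ≤ LinearMap.ker φ := by
    rintro _ ⟨v, rfl⟩
    rw [LinearMap.mem_ker, hφ]
    simp only [Matrix.mulVecLin_apply, Matrix.mulVec, dotProduct, Matrix.transpose_apply,
      Finset.sum_smul]
    rw [Finset.sum_comm]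
    refine Finset.sum_eq_zero fun i _ ↦ ?_
    simp only [mul_comm _ (v i), mul_smul]
    rw [← Finset.smul_sum, hsum, smul_zero]
  have hge : LinearMap.ker φ ≤ LinearMap.range J.transpose.mulVecLin := by
    let K := LinearMap.range J.transpose.mulVecLin
    let Q := (σ → S) ⧸ K
    let d : MvPolynomial σ k → Q := fun p ↦ K.mkQ fun j ↦ τ (pderiv j p)
    let χ₀ : MvPolynomial σ k →+* TrivSqZeroExt S Q :=
      { toFun := fun p ↦ inl (τ p) + inr (d p)
        map_one' := by
          have : d 1 = 0 := by
            simp only [d, pderiv_one, map_zero]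
            exact map_zero _
          rw [map_one, this]; simp
        map_zero' := by
          have : d 0 = 0 := by
            simp only [d, map_zero]
            exact map_zero _
          rw [map_zero, this]; simp
        map_add' := fun p q ↦ by
          have : d (p + q) = d p + d q := by
            simp only [d, map_add]
            exact map_add K.mkQ (fun j ↦ τ (pderiv j p)) (fun j ↦ τ (pderiv j q))
          rw [map_add, this]; ext <;> simp
        map_mul' := fun p q ↦ by
          have : d (p * q) = τ p • d q + τ q • d p := by
            simp only [d, ← map_smul, ← map_add]
            congr 1
            ext j
            simp [(pderiv j).leibniz]
          rw [map_mul, this]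
          ext
          · simp
          · simp }
    have hχ₀ : ∀ p, χ₀ p = inl (τ p) + inr (d p) := fun _ ↦ rfl
    have hd : ∀ i, d (ch.G i) = 0 := fun i ↦ by
      rw [← LinearMap.mem_ker, Submodule.ker_mkQ]
      refine ⟨Pi.single i 1, ?_⟩
      ext j
      simp [hJ]
    let χ₁ : R →+* TrivSqZeroExt S Q := RingHom.liftOfSurjective ch.π ch.surj ⟨χ₀, by
      rw [ch.ker_π, Ideal.span_le]
      rintro _ ⟨i, rfl⟩
      rw [SetLike.mem_coe, RingHom.mem_ker, Function.comp_apply, hχ₀, hτinl, hd]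
      simp⟩
    have hχ₁ : ∀ q, χ₁ (ch.π q) = χ₀ q := fun q ↦ RingHom.liftOfRightInverse_comp_apply _ _ _ _ q
    let χ : S →+* TrivSqZeroExt S Q := IsLocalization.lift (M := M) (g := χ₁) fun t ↦ by
      obtain ⟨t, ht⟩ := t
      obtain ⟨p, rfl⟩ := ch.surj t
      rw [hχ₁, TrivSqZeroExt.isUnit_iff_isUnit_fst, hχ₀]
      simp only [TrivSqZeroExt.fst_add, TrivSqZeroExt.fst_inl, TrivSqZeroExt.fst_inr, add_zero]
      exact IsLocalization.map_units S ⟨_, ht⟩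
    have hχ : ∀ p, χ (τ p) = inl (τ p) + inr (d p) := fun p ↦
      (IsLocalization.lift_eq _ _).trans (hχ₁ p)
    let ω : S →+* TrivSqZeroExt S Q := inlHom S Q
    have hfst : (fstHom S S Q : TrivSqZeroExt S Q →+* S).comp χ = RingHom.id S := by
      refine IsLocalization.ringHom_ext M (RingHom.ext fun a ↦ ?_)
      obtain ⟨p, rfl⟩ := ch.surj a
      exact congr(TrivSqZeroExt.fst $(hχ p)).trans (by simp [τ])
    have hfst' : ∀ s, (χ s).fst = s := fun s ↦ congr($hfst s)
    have hB : ω.comp ((algebraMap R S).comp f) = χ.comp ((algebraMap R S).comp f) := by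
      refine ch.hy.ringHom_ext _ _ (RingHom.ext fun t ↦ ?_) _ ker_fst_mul_self (fun b ↦ ?_)
        fun i ↦ ?_
      · change inl (algebraMap R S (f (c t))) = χ (algebraMap R S (f (c t)))
        rw [← hτC, hχ]
        have : d (C t) = 0 := by
          simp only [d, pderiv_C, map_zero]
          exact map_zero _
        rw [this]; simp
      · rw [RingHom.mem_ker, map_sub, sub_eq_zero]
        exact hfst' _
      · change inl (algebraMap R S (f (ch.y i))) = χ (algebraMap R S (f (ch.y i)))
        rw [← hτinr, hχ, hd]
        simp
    have hBq : ω.comp (algebraMap Bq S) = χ.comp (algebraMap Bq S) := by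
      refine IsLocalization.ringHom_ext N (RingHom.ext fun b ↦ ?_)
      have := congr($hB b)
      simp only [RingHom.comp_apply, hcomp] at this ⊢
      exact this
    let D₀ : S →ₗ[Bq] Q :=
      { toFun := fun s ↦ (χ s).snd
        map_add' := fun a b ↦ by rw [map_add]; rfl
        map_smul' := fun b s ↦ by
          have h1 : χ (algebraMap Bq S b) = inl (algebraMap Bq S b) :=
            congr($hBq.symm b)
          rw [Algebra.smul_def, map_mul, h1, TrivSqZeroExt.snd_mul]
          simp }
    let D' : Derivation Bq S Q := Derivation.mk' D₀ fun a b ↦ by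
      change (χ (a * b)).snd = a • (χ b).snd + b • (χ a).snd
      rw [map_mul, TrivSqZeroExt.snd_mul, hfst', hfst', op_smul_eq_smul]
    have hcompφ : D'.liftKaehlerDifferential ∘ₗ φ = K.mkQ := by
      refine LinearMap.pi_ext' fun j ↦ LinearMap.ext_ring ?_
      have h1 : φ (Pi.single j 1) = D (τ (X j)) := by
        rw [hφ, Finset.sum_eq_single j] <;> simp +contextual
      simp only [LinearMap.comp_apply, LinearMap.single_apply, h1]
      refine (Derivation.liftKaehlerDifferential_comp_D D' _).trans ?_
      change (χ (τ (X j))).snd = _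
      rw [hχ]
      have h2 : d (X j) = K.mkQ (Pi.single j 1) := by
        simp only [d]
        congr 1
        ext i
        rw [pderiv_X]
        by_cases h : i = j
        · subst h; simp
        · simp [h, Ne.symm h]
      rw [h2]
      simp
      rfl
    intro v hv
    have h1 : K.mkQ v = 0 := by
      rw [← hcompφ, LinearMap.comp_apply, LinearMap.mem_ker.mp hv, map_zero]
    rwa [← LinearMap.mem_ker, Submodule.ker_mkQ] at h1
  have hker : LinearMap.ker φ = LinearMap.range J.transpose.mulVecLin := le_antisymm hge hle
  refine le_antisymm (Ideal.span_le.mpr ?_) ((Ideal.span_singleton_le_iff_mem _).mpr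
    (Ideal.subset_span ?_))
  · rintro _ ⟨l, A, -, ⟨e⟩, rfl⟩
    have := det_mem_span_of_equiv J.transpose A φ (e.toLinearMap ∘ₗ Submodule.mkQ _) hφs
      (e.surjective.comp (Submodule.mkQ_surjective _)) hker (by
        rintro _ ⟨v, rfl⟩
        change e (Submodule.Quotient.mk (A.mulVecLin v)) = 0
        rw [(Submodule.Quotient.mk_eq_zero _).mpr (LinearMap.mem_range_self _ v), map_zero])
    rwa [Matrix.det_transpose, hJdet] at this
  · let ε : σ ≃ Fin (ch.m + ch.n) := finSumFinEquiv
    have hdet : (Matrix.reindex ε ε J.transpose).det = algebraMap R S ch.δ := by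
      rw [Matrix.det_reindex_self, Matrix.det_transpose, hJdet]
    refine ⟨ch.m + ch.n, Matrix.reindex ε ε J.transpose,
      mulVec_injective_of_det_mem _ (by rw [hdet]; exact hδ), ⟨?_⟩, hdet⟩
    let φ' : (Fin (ch.m + ch.n) → S) →ₗ[S] Ω[S⁄Bq] := φ ∘ₗ (LinearMap.funLeft S S ε)
    have hφ's : Surjective φ' :=
      hφs.comp (LinearMap.funLeft_surjective_of_injective _ _ _ ε.injective)
    have hk : LinearMap.range (Matrix.reindex ε ε J.transpose).mulVecLin = LinearMap.ker φ' := by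
      ext v
      rw [LinearMap.mem_ker, LinearMap.comp_apply, ← LinearMap.mem_ker, hker]
      simp only [LinearMap.mem_range, Matrix.mulVecLin_apply, Matrix.reindex_apply]
      constructor
      · rintro ⟨w, rfl⟩
        refine ⟨w ∘ ε, ?_⟩
        ext j
        rw [Matrix.submatrix_mulVec_equiv]
        simp [LinearMap.funLeft_apply]
      · rintro ⟨w, hw⟩
        refine ⟨w ∘ ε.symm, ?_⟩
        ext j
        rw [Matrix.submatrix_mulVec_equiv]
        have := congr($hw (ε.symm j))
        simpa [LinearMap.funLeft_apply, Function.comp_def] using this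
    exact (Submodule.quotEquivOfEq _ _ hk).trans (φ'.quotKerEquivOfSurjective hφ's)

end Charts

section NewtonAlgebra

open MvPolynomial

variable {k B R : Type u} [Field k] [CommRing B] [CommRing R] {c : k →+* B} {f : B →+* R}

/-- Two ring homomorphisms out of `R` satisfying the relation defining the Newton groupoid. -/
structure NewtonPair (c : k →+* B) (f : B →+* R) (δ : R) (r : ℕ) {S : Type u} [CommRing S]
    (α β : R →+* S) : Prop where
  comp_eq : α.comp (f.comp c) = β.comp (f.comp c)
  mem : α δ ∈ nonZeroDivisors S
  unit : ∃ u : S, IsUnit u ∧ β δ = α δ * u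
  dvd : ∀ g, α δ ^ (r - 1) ∣ β g - α g
  dvd' : ∀ b, α δ ^ r ∣ β (f b) - α (f b)

namespace NewtonPair

variable {δ : R} {r : ℕ} {S S' : Type u} [CommRing S] [CommRing S'] {α β γ : R →+* S}

lemma refl (h : α δ ∈ nonZeroDivisors S) : NewtonPair c f δ r α α where
  comp_eq := rfl
  mem := h
  unit := ⟨1, isUnit_one, (mul_one _).symm⟩
  dvd g := by simp
  dvd' b := by simp

lemma symm (h : NewtonPair c f δ r α β) : NewtonPair c f δ r β α := by
  obtain ⟨u, hu, e⟩ := h.unit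
  have h1 : ∀ n s, α δ ^ n ∣ s → β δ ^ n ∣ -s := fun n s hs ↦ by
    rw [e, mul_pow, (hu.pow n).mul_right_dvd, dvd_neg]; exact hs
  refine ⟨h.comp_eq.symm, ?_, ?_, fun g ↦ ?_, fun b ↦ ?_⟩
  · rw [e]; exact mul_mem h.mem hu.mem_nonZeroDivisors
  · obtain ⟨v, rfl⟩ := hu
    exact ⟨_, (v⁻¹).isUnit, by rw [e, mul_assoc, Units.mul_inv, mul_one]⟩
  · simpa using h1 _ _ (h.dvd g)
  · simpa using h1 _ _ (h.dvd' b)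

lemma trans (h : NewtonPair c f δ r α β) (h' : NewtonPair c f δ r β γ) :
    NewtonPair c f δ r α γ := by
  obtain ⟨u, hu, e⟩ := h.unit
  obtain ⟨u', hu', e'⟩ := h'.unit
  have h1 : ∀ n s, β δ ^ n ∣ s → α δ ^ n ∣ s := fun n s hs ↦ by
    rw [e, mul_pow, (hu.pow n).mul_right_dvd] at hs; exact hs
  refine ⟨h.comp_eq.trans h'.comp_eq, h.mem, ⟨_, hu.mul hu', by rw [e', e, mul_assoc]⟩,
    fun g ↦ ?_, fun b ↦ ?_⟩
  · simpa using dvd_add (h.dvd g) (h1 _ _ (h'.dvd g))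
  · simpa using dvd_add (h.dvd' b) (h1 _ _ (h'.dvd' b))

lemma map (h : NewtonPair c f δ r α β) (χ : S →+* S') (hχ : χ (α δ) ∈ nonZeroDivisors S') :
    NewtonPair c f δ r (χ.comp α) (χ.comp β) where
  comp_eq := by rw [comp_assoc, h.comp_eq, comp_assoc]
  mem := hχ
  unit := by
    obtain ⟨u, hu, e⟩ := h.unit
    exact ⟨χ u, hu.map χ, by simp only [RingHom.comp_apply, e, map_mul]⟩
  dvd g := by
    have := map_dvd χ (h.dvd g)
    rwa [map_pow, map_sub] at this
  dvd' b := by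
    have := map_dvd χ (h.dvd' b)
    rwa [map_pow, map_sub] at this

end NewtonPair

/-- `Q` with `ι₁`, `ι₂` is the tensor square of `R` over `k`. -/
structure IsSquareRing {Q : Type u} [CommRing Q] (c : k →+* R) (ι₁ ι₂ : R →+* Q) : Prop where
  comp_eq : ι₁.comp c = ι₂.comp c
  exists_desc : ∀ {S : Type u} [CommRing S] (α β : R →+* S), α.comp c = β.comp c →
    ∃ χ : Q →+* S, χ.comp ι₁ = α ∧ χ.comp ι₂ = β
  hom_ext : ∀ {S : Type u} [CommRing S] {χ χ' : Q →+* S}, χ.comp ι₁ = χ'.comp ι₁ →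
    χ.comp ι₂ = χ'.comp ι₂ → χ = χ'

namespace NewtonChart

variable (ch : NewtonChart c f) (r : ℕ)

section Points

variable {S S' : Type u} [CommRing S] [CommRing S'] (α : R →+* S)

/-- The constants at a point. -/
abbrev constants : k →+* S := (α.comp ch.π).comp C

/-- The coordinates of a point. -/
abbrev coords (j : ch.Idx) : S := α (ch.π (X j))

lemma eval₂_coords (p : MvPolynomial ch.Idx k) :
    eval₂ (ch.constants α) (ch.coords α) p = α (ch.π p) :=
  eval₂_eq_map (α.comp ch.π) p

lemma eval₂_coords_jacobian :
    eval₂ (ch.constants α) (ch.coords α) (jacobian ch.G) = α ch.δ := ch.eval₂_coords α _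

lemma π_inl (i : Fin ch.m) : ch.π (ch.G (Sum.inl i)) = 0 := by
  rw [← RingHom.mem_ker, ch.ker_π]; exact Ideal.subset_span ⟨i, rfl⟩

/-- The equations of the Newton groupoid at a point of the source. -/
def eqAt (ξ : ch.Idx → S) (η : Fin ch.n → S) : ch.Idx → S :=
  newtonEq ch.G r (ch.constants α) (ch.coords α) ξ η

/-- The ratio of the Jacobians at target and source. -/
def unitAt (ξ : ch.Idx → S) : S := newtonUnit ch.G r (ch.constants α) (ch.coords α) ξ

lemma map_eqAt (χ : S →+* S') (ξ : ch.Idx → S) (η : Fin ch.n → S) (j) :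
    χ (ch.eqAt r α ξ η j) = ch.eqAt r (χ.comp α) (χ ∘ ξ) (χ ∘ η) j :=
  map_newtonEq _ _ _ _ _ _ _ _

lemma map_unitAt (χ : S →+* S') (ξ : ch.Idx → S) :
    χ (ch.unitAt r α ξ) = ch.unitAt r (χ.comp α) (χ ∘ ξ) :=
  map_newtonUnit _ _ _ _ _ _

lemma ringHom_ext {β β' : R →+* S} (h : β.comp (f.comp c) = β'.comp (f.comp c))
    (h' : ∀ j, β (ch.π (X j)) = β' (ch.π (X j))) : β = β' := by
  have : β.comp ch.π = β'.comp ch.π := MvPolynomial.ringHom_ext (fun t ↦ by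
    have := congr($h t)
    rw [← ch.π_C] at this
    exact this) h'
  refine RingHom.ext fun a ↦ ?_
  obtain ⟨p, rfl⟩ := ch.surj a
  exact congr($this p)

variable {r} (hr : 2 ≤ r)
include hr

/-- The target of a point of the Newton groupoid. -/
lemma exists_target {ξ : ch.Idx → S} {η : Fin ch.n → S} (h : ch.eqAt r α ξ η = 0) :
    ∃ β : R →+* S, α.comp (f.comp c) = β.comp (f.comp c) ∧
      (∀ j, β (ch.π (X j)) = α (ch.π (X j)) + α ch.δ ^ (r - 1) * ξ j) ∧
      (∀ i, β (f (ch.y i)) = α (f (ch.y i)) + α ch.δ ^ r * η i) ∧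
      (∀ p, β (ch.π p) = eval₂ (ch.constants α) (ch.coords α + α ch.δ ^ (r - 1) • ξ) p) ∧
      β ch.δ = α ch.δ * ch.unitAt r α ξ := by
  have key := pow_mul_jacobianMatrix_mulVec_newtonEq ch.G r hr (ch.constants α) (ch.coords α) ξ η
  have h0 : newtonEq ch.G r (ch.constants α) (ch.coords α) ξ η = 0 := h
  simp only [h0, Matrix.mulVec_zero, Pi.zero_apply, mul_zero, ch.eval₂_coords] at key
  let θ : MvPolynomial ch.Idx k →+* S :=
    eval₂Hom (ch.constants α) (ch.coords α + α ch.δ ^ (r - 1) • ξ)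
  have hθ : ∀ i, θ (ch.G i) = α (ch.π (ch.G i)) + α ch.δ ^ r *
      (Sum.elim (fun _ ↦ 0) η : ch.Idx → S) i := fun i ↦ by
    have h1 := key i
    rw [eq_comm, sub_sub, sub_eq_zero] at h1
    exact h1
  let β : R →+* S := RingHom.liftOfSurjective ch.π ch.surj ⟨θ, by
    rw [ch.ker_π, Ideal.span_le]
    rintro _ ⟨i, rfl⟩
    rw [SetLike.mem_coe, RingHom.mem_ker, Function.comp_apply, hθ, ch.π_inl]
    simp⟩
  have hβ : ∀ p, β (ch.π p) = θ p := fun q ↦ RingHom.liftOfRightInverse_comp_apply _ _ _ _ q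
  refine ⟨β, ?_, fun j ↦ ?_, fun i ↦ ?_, hβ, ?_⟩
  · rw [← ch.π_C]
    refine RingHom.ext fun t ↦ ?_
    simp only [RingHom.comp_apply, hβ, θ]
    simp
  · rw [hβ]; simp [θ]
  · rw [← ch.π_G, hβ, hθ]; simp
  · refine (hβ _).trans ?_
    have := eval₂_jacobian_add ch.G r hr (ch.constants α) (ch.coords α) ξ
    rwa [eval₂_coords_jacobian] at this

/-- The coordinates of a Newton pair. -/
lemma exists_coordinates {β : R →+* S} (h : NewtonPair c f ch.δ r α β) :
    ∃ (ξ : ch.Idx → S) (η : Fin ch.n → S), ch.eqAt r α ξ η = 0 ∧ IsUnit (ch.unitAt r α ξ) ∧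
      (∀ j, β (ch.π (X j)) = α (ch.π (X j)) + α ch.δ ^ (r - 1) * ξ j) ∧
      (∀ i, β (f (ch.y i)) = α (f (ch.y i)) + α ch.δ ^ r * η i) ∧
      β ch.δ = α ch.δ * ch.unitAt r α ξ := by
  choose ξ hξ using fun j ↦ h.dvd (ch.π (X j))
  choose η hη using fun i ↦ h.dvd' (ch.y i)
  have hβ : ∀ p, eval₂ (ch.constants α) (ch.coords α + α ch.δ ^ (r - 1) • ξ) p = β (ch.π p) := by
    intro p
    rw [← RingHom.comp_apply, ← eval₂_eq_map (β.comp ch.π) p]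
    congr 1
    · have := h.comp_eq
      rw [← ch.π_C] at this
      exact this
    · ext j
      simp [← hξ]
  have hu := eval₂_jacobian_add ch.G r hr (ch.constants α) (ch.coords α) ξ
  rw [eval₂_coords_jacobian, hβ] at hu
  refine ⟨ξ, η, ?_, ?_, fun j ↦ ?_, fun i ↦ ?_, hu⟩
  · refine newtonEq_eq_zero ch.G r hr _ _ _ _ (by rw [eval₂_coords_jacobian]; exact h.mem)
      fun i ↦ ?_
    rw [eval₂_coords_jacobian, hβ, ch.eval₂_coords]
    rcases i with i | i
    · simp [ch.π_inl]
    · rw [ch.π_G, hη]; simp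
  · obtain ⟨u, hu', e⟩ := h.unit
    have : u = ch.unitAt r α ξ := (mul_cancel_left_mem_nonZeroDivisors h.mem).mp (e.symm.trans hu)
    rwa [← this]
  · rw [← hξ]; ring
  · rw [← hη]; ring

end Points

section Algebra

/-- The polynomial ring with the coordinates `ξ`, `η` over the ring of the source. -/
abbrev Poly : Type u := MvPolynomial (ch.Idx ⊕ Fin ch.n) R

/-- The equations as polynomials. -/
def polyEq : ch.Idx → ch.Poly := ch.eqAt r C (X ∘ Sum.inl) (X ∘ Sum.inr)

/-- The unit as a polynomial. -/
def polyUnit : ch.Poly := ch.unitAt r C (X ∘ Sum.inl)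

variable (e : ch.Poly)

/-- The relations of the Newton algebra. -/
def rel : ch.Idx ⊕ Unit → MvPolynomial ((ch.Idx ⊕ Fin ch.n) ⊕ Unit) R :=
  Sum.elim (fun j ↦ rename Sum.inl (ch.polyEq r j))
    fun _ ↦ rename Sum.inl (ch.polyUnit r * e) * X (Sum.inr ()) - 1

/-- The algebra with generators `ξ`, `η` and relations the equations of the Newton groupoid, in
which the unit and `e` are inverted. -/
abbrev NewtonAlgebra : Type u :=
  MvPolynomial ((ch.Idx ⊕ Fin ch.n) ⊕ Unit) R ⧸ Ideal.span (Set.range (ch.rel r e))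

/-- The quotient map. -/
def toNewton : ch.Poly →+* ch.NewtonAlgebra r e :=
  (Ideal.Quotient.mk _).comp (rename Sum.inl : ch.Poly →ₐ[R] _).toRingHom

lemma toNewton_polyEq (j) : ch.toNewton r e (ch.polyEq r j) = 0 :=
  eq_zero_iff_mem.mpr (Ideal.subset_span ⟨Sum.inl j, rfl⟩)

lemma toNewton_mul_mk :
    ch.toNewton r e (ch.polyUnit r * e) * Ideal.Quotient.mk _ (X (Sum.inr ())) = 1 := by
  rw [toNewton, RingHom.comp_apply, ← map_mul, ← map_one (Ideal.Quotient.mk _),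
    Ideal.Quotient.mk_eq_mk_iff_sub_mem]
  exact Ideal.subset_span ⟨Sum.inr (), rfl⟩

lemma isUnit_toNewton : IsUnit (ch.toNewton r e (ch.polyUnit r * e)) :=
  IsUnit.of_mul_eq_one _ (ch.toNewton_mul_mk r e)

variable {S : Type u} [CommRing S]

variable {r e} in
lemma newtonAlgebra_hom_ext {χ χ' : ch.NewtonAlgebra r e →+* S}
    (h : χ.comp (ch.toNewton r e) = χ'.comp (ch.toNewton r e)) : χ = χ' := by
  refine Ideal.Quotient.ringHom_ext (MvPolynomial.ringHom_ext (fun a ↦ ?_) ?_)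
  · have := congr($h (C a))
    simp only [toNewton, RingHom.comp_apply, AlgHom.toRingHom_eq_coe, RingHom.coe_coe,
      rename_C] at this
    exact this
  · rintro (i | i)
    · have := congr($h (X i))
      simp only [toNewton, RingHom.comp_apply, AlgHom.toRingHom_eq_coe, RingHom.coe_coe,
        rename_X] at this
      exact this
    · have h1 := congr(χ $(ch.toNewton_mul_mk r e))
      have h2 := congr(χ' $(ch.toNewton_mul_mk r e))
      have h3 : χ (ch.toNewton r e (ch.polyUnit r * e)) = χ' (ch.toNewton r e (ch.polyUnit r * e)) :=
        congr($h _)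
      rw [map_mul, map_one] at h1 h2
      exact ((ch.isUnit_toNewton r e).map χ).mul_left_cancel (h1.trans (by rw [h3]; exact h2.symm))

lemma exists_newtonAlgebra_hom (θ : ch.Poly →+* S) (h : ∀ j, θ (ch.polyEq r j) = 0)
    (hu : IsUnit (θ (ch.polyUnit r * e))) :
    ∃ χ : ch.NewtonAlgebra r e →+* S, χ.comp (ch.toNewton r e) = θ := by
  obtain ⟨v, hv⟩ := hu.exists_right_inv
  let ψ : MvPolynomial ((ch.Idx ⊕ Fin ch.n) ⊕ Unit) R →+* S :=
    eval₂Hom (θ.comp C) (Sum.elim (fun i ↦ θ (X i)) fun _ ↦ v)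
  have hψ : ∀ p, ψ (rename Sum.inl p) = θ p := fun p ↦ by
    have : ψ.comp (rename Sum.inl : ch.Poly →ₐ[R] _).toRingHom = θ :=
      MvPolynomial.ringHom_ext (by simp [ψ]) (by simp [ψ])
    exact congr($this p)
  refine ⟨Ideal.Quotient.lift _ ψ fun p hp ↦ ?_, RingHom.ext fun p ↦ hψ p⟩
  have : Ideal.span (Set.range (ch.rel r e)) ≤ RingHom.ker ψ := by
    rw [Ideal.span_le]
    rintro _ ⟨i | i, rfl⟩
    · exact (hψ _).trans (h i)
    · have : ψ (X (Sum.inr ())) = v := by simp [ψ]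
      rw [SetLike.mem_coe, RingHom.mem_ker]
      simp only [rel, Sum.elim_inr, map_sub, map_mul ψ, hψ, this, hv, map_one, sub_self]
  exact this hp

lemma C_mem_nonZeroDivisors {R σ : Type*} [CommRing R] {d : R} (h : d ∈ nonZeroDivisors R) :
    (C d : MvPolynomial σ R) ∈ nonZeroDivisors (MvPolynomial σ R) := by
  rw [mem_nonZeroDivisors_iff_right]
  intro p hp
  ext s
  have := congr(coeff s $hp)
  rw [mul_comm, coeff_C_mul, coeff_zero] at this
  rw [coeff_zero]
  exact (mul_left_mem_nonZeroDivisors_eq_zero_iff h).mp this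

lemma pderiv_rename_inl {R σ σ' : Type*} [CommRing R] [Fintype σ] (p : MvPolynomial σ R) (i : σ') :
    pderiv (Sum.inr i) (rename Sum.inl p : MvPolynomial (σ ⊕ σ') R) = 0 := by
  have h := derivation_eval₂ ((pderiv (R := R) (σ := σ ⊕ σ') (Sum.inr i)).restrictScalars ℤ) C
    (fun t ↦ pderiv_C) (fun j ↦ X (Sum.inl j)) p
  have h1 : eval₂ C (fun j ↦ X (Sum.inl j)) p = (rename Sum.inl p : MvPolynomial (σ ⊕ σ') R) := by
    rw [rename_eq_aeval, aeval_def]; rfl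
  rw [h1] at h
  refine h.trans (Finset.sum_eq_zero fun j _ ↦ ?_)
  change _ • pderiv (Sum.inr i) (X (Sum.inl j)) = 0
  rw [pderiv_X_of_ne (by simp), smul_zero]

lemma isStandardSmooth_newtonAlgebra (hr : 2 ≤ r) (hδ : ch.δ ∈ nonZeroDivisors R) :
    Algebra.IsStandardSmooth R (ch.NewtonAlgebra r e) := by
  classical
  let a : ch.Idx ⊕ Unit → (ch.Idx ⊕ Fin ch.n) ⊕ Unit :=
    Sum.elim (fun j ↦ Sum.inl (Sum.inl j)) fun _ ↦ Sum.inr ()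
  have ha : Function.Injective a := by rintro (i | i) (j | j) h <;> simp_all [a]
  let P := Algebra.PreSubmersivePresentation.naive (v := ch.rel r e) a ha
  have hE : ∀ j, rename Sum.inl (ch.polyEq r j) = ch.eqAt r
      (C : R →+* MvPolynomial ((ch.Idx ⊕ Fin ch.n) ⊕ Unit) R)
      (fun j ↦ X (Sum.inl (Sum.inl j))) (fun j ↦ X (Sum.inl (Sum.inr j))) j := fun j ↦ by
    have := ch.map_eqAt r C (rename Sum.inl : ch.Poly →ₐ[R] MvPolynomial
      ((ch.Idx ⊕ Fin ch.n) ⊕ Unit) R).toRingHom (X ∘ Sum.inl) (X ∘ Sum.inr) j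
    refine this.trans ?_
    congr 1
    · ext; simp
    · ext; simp
    · ext; simp
  have hU : rename Sum.inl (ch.polyUnit r) = ch.unitAt r
      (C : R →+* MvPolynomial ((ch.Idx ⊕ Fin ch.n) ⊕ Unit) R)
      (fun j ↦ X (Sum.inl (Sum.inl j))) := by
    have := ch.map_unitAt r C (rename Sum.inl : ch.Poly →ₐ[R] MvPolynomial
      ((ch.Idx ⊕ Fin ch.n) ⊕ Unit) R).toRingHom (X ∘ Sum.inl)
    refine this.trans ?_
    congr 1
    · ext; simp
    · ext; simp
  have hdet : (Matrix.of fun j l ↦ pderiv (Sum.inl (Sum.inl l))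
      (rename Sum.inl (ch.polyEq r j) : MvPolynomial
        ((ch.Idx ⊕ Fin ch.n) ⊕ Unit) R)).det = rename Sum.inl (ch.polyUnit r) := by
    rw [hU]
    simp only [hE]
    refine det_derivation_newtonEq ch.G r hr _ _ _ _ ?_
      (fun l ↦ (pderiv (R := R) (Sum.inl (Sum.inl l))).restrictScalars ℤ) ?_ ?_ ?_ ?_
    · rw [eval₂_coords_jacobian]; exact C_mem_nonZeroDivisors hδ
    · exact fun l t ↦ pderiv_C
    · exact fun l j ↦ pderiv_C
    · exact fun l i ↦ pderiv_X_of_ne (by simp)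
    · intro l j
      refine (pderiv_X _ _).trans ?_
      by_cases h : j = l
      · subst h; simp
      · simp [h]
  have hjac : P.jacobian = ch.toNewton r e (ch.polyUnit r) * ch.toNewton r e (ch.polyUnit r * e) := by
    rw [P.jacobian_eq_jacobiMatrix_det]
    have hM : P.jacobiMatrix = Matrix.fromBlocks
        (Matrix.of fun j l ↦ pderiv (Sum.inl (Sum.inl l)) (rename Sum.inl (ch.polyEq r j))).transpose
        (Matrix.of fun l _ ↦ pderiv (Sum.inl (Sum.inl l)) (ch.rel r e (Sum.inr ()))) 0
        (Matrix.of fun _ _ ↦ rename Sum.inl (ch.polyUnit r * e)) := by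
      ext1 i j
      rw [Algebra.PreSubmersivePresentation.jacobiMatrix_naive]
      rcases i with i | i <;> rcases j with j | j
      · rfl
      · rfl
      · exact pderiv_rename_inl _ _
      · simp only [rel, a, Sum.elim_inr, map_sub, (pderiv _).leibniz, pderiv_rename_inl, pderiv_one,
          pderiv_X_self, Matrix.fromBlocks_apply₂₂, Matrix.of_apply]
        simp
    rw [hM, Matrix.det_fromBlocks_zero₂₁, Matrix.det_transpose, hdet, Matrix.det_unique, map_mul]
    rfl
  let P' : Algebra.SubmersivePresentation R (ch.NewtonAlgebra r e)
      ((ch.Idx ⊕ Fin ch.n) ⊕ Unit) (ch.Idx ⊕ Unit) :=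
    { P with
      jacobian_isUnit := by
        change IsUnit P.jacobian
        rw [hjac]
        have h1 := ch.isUnit_toNewton r e
        refine IsUnit.mul ?_ h1
        rw [map_mul] at h1
        exact isUnit_of_mul_isUnit_left h1 }
  exact P'.isStandardSmooth

end Algebra

end NewtonChart

end NewtonAlgebra

section NewtonRing

open MvPolynomial

variable {k B R : Type u} [Field k] [CommRing B] [CommRing R] {c : k →+* B} {f : B →+* R}

lemma mem_nonZeroDivisors_of_flat {R S : Type u} [CommRing R] [CommRing S] (α : R →+* S)
    (h : α.Flat) {d : R} (hd : d ∈ nonZeroDivisors R) : α d ∈ nonZeroDivisors S := by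
  let := α.toAlgebra
  have : Module.Flat R S := h
  have h1 := Module.Flat.isSMulRegular_of_nonZeroDivisors (M := S) hd
  rw [mem_nonZeroDivisors_iff_right]
  intro s hs
  refine h1 (?_ : d • s = d • 0)
  rw [smul_zero, Algebra.smul_def, mul_comm]
  exact hs

/-- The universal ring with a Newton pair extending a homomorphism from `Q` which inverts `e`. -/
structure IsNewtonRing (c : k →+* B) (f : B →+* R) (δ : R) (r : ℕ) {Q A : Type u} [CommRing Q]
    [CommRing A] (ι₁ ι₂ : R →+* Q) (e : Q) (ρ : Q →+* A) : Prop where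
  pair : NewtonPair c f δ r (ρ.comp ι₁) (ρ.comp ι₂)
  unit : IsUnit (ρ e)
  exists_lift : ∀ {S : Type u} [CommRing S] (χ : Q →+* S),
    NewtonPair c f δ r (χ.comp ι₁) (χ.comp ι₂) → IsUnit (χ e) → ∃ ψ : A →+* S, ψ.comp ρ = χ
  hom_ext : ∀ {S : Type u} [CommRing S] {ψ ψ' : A →+* S}, ψ.comp ρ = ψ'.comp ρ →
    ψ (ρ (ι₁ δ)) ∈ nonZeroDivisors S → ψ = ψ'

lemma IsNewtonRing.exists_ringEquiv {δ : R} {r : ℕ} {Q A A' : Type u} [CommRing Q]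
    [CommRing A] [CommRing A'] {ι₁ ι₂ : R →+* Q} {e : Q} {ρ : Q →+* A} {ρ' : Q →+* A'}
    (h : IsNewtonRing c f δ r ι₁ ι₂ e ρ) (h' : IsNewtonRing c f δ r ι₁ ι₂ e ρ') :
    ∃ φ : A ≃+* A', φ.toRingHom.comp ρ = ρ' := by
  obtain ⟨ψ, hψ⟩ := h.exists_lift ρ' h'.pair h'.unit
  obtain ⟨ψ', hψ'⟩ := h'.exists_lift ρ h.pair h.unit
  refine ⟨RingEquiv.ofRingHom ψ ψ' ?_ ?_, hψ⟩
  · exact h'.hom_ext (by rw [comp_assoc, hψ', hψ, RingHom.id_comp])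
      (by
        have h1 : ∀ a, ψ (ρ a) = ρ' a := fun a ↦ congr($hψ a)
        have h2 : ∀ a, ψ' (ρ' a) = ρ a := fun a ↦ congr($hψ' a)
        rw [RingHom.comp_apply, h2, h1]; exact h'.pair.mem)
  · exact h.hom_ext (by rw [comp_assoc, hψ, hψ', RingHom.id_comp])
      (by
        have h1 : ∀ a, ψ (ρ a) = ρ' a := fun a ↦ congr($hψ a)
        have h2 : ∀ a, ψ' (ρ' a) = ρ a := fun a ↦ congr($hψ' a)
        rw [RingHom.comp_apply, h1, h2]; exact h.pair.mem)

namespace NewtonChart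

variable (ch : NewtonChart c f) (r : ℕ) (e₀ : ch.Poly)

/-- The coordinates of the target minus those of the source, divided by a power of `δ`. -/
def ξ (j : ch.Idx) : ch.NewtonAlgebra r e₀ := ch.toNewton r e₀ (X (Sum.inl j))

/-- The coordinates on the base of the target minus those of the source, divided by a power of
`δ`. -/
def η (i : Fin ch.n) : ch.NewtonAlgebra r e₀ := ch.toNewton r e₀ (X (Sum.inr i))

/-- The source. -/
abbrev source : R →+* ch.NewtonAlgebra r e₀ := algebraMap R (ch.NewtonAlgebra r e₀)

lemma toNewton_comp_C : (ch.toNewton r e₀).comp C = ch.source r e₀ := by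
  refine RingHom.ext fun a ↦ ?_
  simp only [toNewton, RingHom.comp_apply, AlgHom.toRingHom_eq_coe, RingHom.coe_coe, rename_C]
  rfl

lemma toNewton_polyUnit :
    ch.toNewton r e₀ (ch.polyUnit r) = ch.unitAt r (ch.source r e₀) (ch.ξ r e₀) := by
  rw [polyUnit, map_unitAt, toNewton_comp_C]; rfl

lemma eqAt_source : ch.eqAt r (ch.source r e₀) (ch.ξ r e₀) (ch.η r e₀) = 0 := by
  ext j
  have := ch.toNewton_polyEq r e₀ j
  rw [polyEq, map_eqAt, toNewton_comp_C] at this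
  exact this

lemma isUnit_unitAt_source : IsUnit (ch.unitAt r (ch.source r e₀) (ch.ξ r e₀)) := by
  have h1 := ch.isUnit_toNewton r e₀
  rw [map_mul] at h1
  rw [← toNewton_polyUnit]
  exact isUnit_of_mul_isUnit_left h1

variable {S : Type u} [CommRing S]

variable {r e₀} in
lemma newtonAlgebra_hom_ext' {χ χ' : ch.NewtonAlgebra r e₀ →+* S}
    (h : χ.comp (ch.source r e₀) = χ'.comp (ch.source r e₀))
    (hξ : ∀ j, χ (ch.ξ r e₀ j) = χ' (ch.ξ r e₀ j)) (hη : ∀ i, χ (ch.η r e₀ i) = χ' (ch.η r e₀ i)) :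
    χ = χ' := by
  refine newtonAlgebra_hom_ext ch (MvPolynomial.ringHom_ext (fun a ↦ ?_) ?_)
  · have := congr($h a)
    rw [← toNewton_comp_C] at this
    exact this
  · rintro (j | i)
    exacts [hξ j, hη i]

/-- The polynomial ring evaluated at a point. -/
abbrev evalPoly (α : R →+* S) (ξ : ch.Idx → S) (η : Fin ch.n → S) : ch.Poly →+* S :=
  eval₂Hom α (Sum.elim ξ η)

lemma evalPoly_polyEq (α : R →+* S) (ξ : ch.Idx → S) (η : Fin ch.n → S) (j) :
    ch.evalPoly α ξ η (ch.polyEq r j) = ch.eqAt r α ξ η j := by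
  rw [polyEq, map_eqAt]
  congr 1
  · ext; simp
  · ext; simp
  · ext; simp

lemma evalPoly_polyUnit (α : R →+* S) (ξ : ch.Idx → S) (η : Fin ch.n → S) :
    ch.evalPoly α ξ η (ch.polyUnit r) = ch.unitAt r α ξ := by
  rw [polyUnit, map_unitAt]
  congr 1
  · ext; simp
  · ext; simp

lemma exists_newtonAlgebra_hom' (α : R →+* S) (ξ : ch.Idx → S) (η : Fin ch.n → S)
    (h : ch.eqAt r α ξ η = 0) (hu : IsUnit (ch.unitAt r α ξ))
    (he : IsUnit (ch.evalPoly α ξ η e₀)) :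
    ∃ χ : ch.NewtonAlgebra r e₀ →+* S, χ.comp (ch.source r e₀) = α ∧
      (∀ j, χ (ch.ξ r e₀ j) = ξ j) ∧ ∀ i, χ (ch.η r e₀ i) = η i := by
  obtain ⟨χ, hχ⟩ := ch.exists_newtonAlgebra_hom r e₀ (ch.evalPoly α ξ η)
    (fun j ↦ by rw [evalPoly_polyEq, h]; rfl)
    (by rw [map_mul, evalPoly_polyUnit]; exact hu.mul he)
  have h1 : ∀ p, χ (ch.toNewton r e₀ p) = ch.evalPoly α ξ η p := fun p ↦ congr($hχ p)
  refine ⟨χ, ?_, fun j ↦ ?_, fun i ↦ ?_⟩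
  · rw [← toNewton_comp_C, ← comp_assoc, hχ]
    ext; simp
  · exact (h1 _).trans (by simp)
  · exact (h1 _).trans (by simp)

lemma sub_mem_span_coords {α β : R →+* S} (h : α.comp (f.comp c) = β.comp (f.comp c)) (g : R) :
    β g - α g ∈ Ideal.span (Set.range fun j ↦ β (ch.π (X j)) - α (ch.π (X j))) := by
  set J := Ideal.span (Set.range fun j ↦ β (ch.π (X j)) - α (ch.π (X j)))
  have : (Ideal.Quotient.mk J).comp β = (Ideal.Quotient.mk J).comp α := by
    refine ch.ringHom_ext (by rw [comp_assoc, comp_assoc, h]) fun j ↦ ?_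
    exact Ideal.Quotient.eq.mpr (Ideal.subset_span ⟨j, rfl⟩)
  exact Ideal.Quotient.eq.mp congr($this g)

section Universal

variable {r} (hr : 2 ≤ r) {Q : Type u} [CommRing Q] [IsNoetherianRing Q] {ι₁ ι₂ : R →+* Q}
  (hQ : IsSquareRing (f.comp c) ι₁ ι₂) (hδ : ch.δ ∈ nonZeroDivisors R)
include hr hQ hδ

lemma exists_isNewtonRing : ∃ (e : Q) (e₀ : ch.Poly) (ρ : Q →+* ch.NewtonAlgebra r e₀),
    e - 1 ∈ Ideal.span (Set.range fun b ↦ ι₂ (f b) - ι₁ (f b)) ∧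
    IsNewtonRing c f ch.δ r ι₁ ι₂ e ρ ∧ ρ.comp ι₁ = ch.source r e₀ ∧
    (∀ j, ρ (ι₂ (ch.π (X j))) = ρ (ι₁ (ch.π (X j))) + ρ (ι₁ ch.δ) ^ (r - 1) * ch.ξ r e₀ j) ∧
    (∀ i, ρ (ι₂ (f (ch.y i))) = ρ (ι₁ (f (ch.y i))) + ρ (ι₁ ch.δ) ^ r * ch.η r e₀ i) ∧
    ρ (ι₂ ch.δ) = ρ (ι₁ ch.δ) * ch.unitAt r (ch.source r e₀) (ch.ξ r e₀) ∧
    ∀ {S : Type u} [CommRing S] (α : R →+* S), α ch.δ = 0 →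
      ∀ (ξ : ch.Idx → S) (η : Fin ch.n → S), ch.eqAt r α ξ η = 0 →
      IsUnit (ch.unitAt r α ξ) → IsUnit (ch.evalPoly α ξ η e₀) := by
  obtain ⟨e, he, he'⟩ := ch.hy.exists_mul_mem_span (ι₁.comp f) (ι₂.comp f) hQ.comp_eq
  let I₀ : Ideal ch.Poly := Ideal.span (Set.range (ch.polyEq r))
  let q : ch.Poly →+* ch.Poly ⧸ I₀ := Ideal.Quotient.mk I₀
  let α₀ : R →+* ch.Poly ⧸ I₀ := q.comp C
  have h₀ : ch.eqAt r α₀ (q ∘ X ∘ Sum.inl) (q ∘ X ∘ Sum.inr) = 0 := by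
    ext j
    rw [← map_eqAt]
    exact eq_zero_iff_mem.mpr (Ideal.subset_span ⟨j, rfl⟩)
  obtain ⟨β₀, hβ₀, hβX, -, -, -⟩ := ch.exists_target α₀ hr h₀
  obtain ⟨χ₀, h1, h2⟩ := hQ.exists_desc α₀ β₀ hβ₀
  obtain ⟨e₀, he₀⟩ := Ideal.Quotient.mk_surjective (χ₀ e)
  -- evaluation of the lift of `e`
  have eval_e : ∀ {S : Type u} [CommRing S] (χ : Q →+* S) (ξ : ch.Idx → S)
      (η : Fin ch.n → S), ch.eqAt r (χ.comp ι₁) ξ η = 0 →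
      (∀ j, χ (ι₂ (ch.π (X j))) = χ (ι₁ (ch.π (X j))) + χ (ι₁ ch.δ) ^ (r - 1) * ξ j) →
      ch.evalPoly (χ.comp ι₁) ξ η e₀ = χ e := by
    intro S _ χ ξ η h hξ
    have hI : I₀ ≤ RingHom.ker (ch.evalPoly (χ.comp ι₁) ξ η) := by
      rw [Ideal.span_le]
      rintro _ ⟨j, rfl⟩
      rw [SetLike.mem_coe, RingHom.mem_ker, evalPoly_polyEq, h]; rfl
    let ψ : ch.Poly ⧸ I₀ →+* S := Ideal.Quotient.lift I₀ (ch.evalPoly (χ.comp ι₁) ξ η) hI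
    have hψ : ∀ p, ψ (q p) = ch.evalPoly (χ.comp ι₁) ξ η p := fun p ↦ rfl
    have hα : ψ.comp α₀ = χ.comp ι₁ := by ext a; exact (hψ _).trans (by simp)
    have : ψ.comp χ₀ = χ := by
      refine hQ.hom_ext (by rw [comp_assoc, h1, hα]) ?_
      rw [comp_assoc, h2]
      refine ch.ringHom_ext ?_ fun j ↦ ?_
      · rw [comp_assoc, ← hβ₀, ← comp_assoc, hα, comp_assoc, hQ.comp_eq]
        rfl
      · have ha : ∀ a, ψ (α₀ a) = χ (ι₁ a) := fun a ↦ congr($hα a)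
        rw [RingHom.comp_apply, hβX, RingHom.comp_apply χ, hξ, map_add, map_mul, map_pow, ha, ha]
        congr 2
        exact (hψ _).trans (by simp)
    rw [← congr($this e), RingHom.comp_apply, ← he₀]
    exact (hψ _).symm
  obtain ⟨β, hβ, hβX, hβy, -, hβδ⟩ := ch.exists_target (ch.source r e₀) hr (ch.eqAt_source r e₀)
  obtain ⟨ρ, hρ₁, hρ₂⟩ := hQ.exists_desc _ β hβ
  have hρ₁' : ∀ a, ch.source r e₀ a = ρ (ι₁ a) := fun a ↦ congr($hρ₁.symm a)
  have hρ₂' : ∀ a, β a = ρ (ι₂ a) := fun a ↦ congr($hρ₂.symm a)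
  simp only [hρ₂'] at hβX hβy hβδ
  simp only [hρ₁'] at hβX hβy hβδ
  have hev : IsUnit (ρ e) := by
    rw [← eval_e ρ (ch.ξ r e₀) (ch.η r e₀) (by rw [hρ₁]; exact ch.eqAt_source r e₀) hβX, hρ₁]
    have : ch.evalPoly (ch.source r e₀) (ch.ξ r e₀) (ch.η r e₀) = ch.toNewton r e₀ := by
      refine MvPolynomial.ringHom_ext (fun a ↦ ?_) ?_
      · refine Eq.trans ?_ congr($((ch.toNewton_comp_C r e₀).symm) a)
        simp
      · rintro (j | j) <;> simp [ξ, η]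
    rw [this]
    have h1 := ch.isUnit_toNewton r e₀
    rw [map_mul] at h1
    exact isUnit_of_mul_isUnit_right h1
  have hd : ρ (ι₁ ch.δ) ∈ nonZeroDivisors (ch.NewtonAlgebra r e₀) := by
    have := ch.isStandardSmooth_newtonAlgebra r e₀ hr hδ
    rw [← hρ₁']
    exact mem_nonZeroDivisors_of_flat _ (RingHom.flat_algebraMap_iff.mpr inferInstance) hδ
  have hcomp : (ρ.comp ι₁).comp (f.comp c) = (ρ.comp ι₂).comp (f.comp c) := by
    rw [comp_assoc, hQ.comp_eq, comp_assoc]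
  refine ⟨e, e₀, ρ, he, ⟨?_, hev, ?_, ?_⟩, hρ₁, hβX, hβy, hβδ, ?_⟩
  · refine ⟨hcomp, hd, ⟨_, ch.isUnit_unitAt_source r e₀, hβδ⟩, fun g ↦ ?_, fun b ↦ ?_⟩
    · rw [← Ideal.mem_span_singleton]
      refine Ideal.span_le.mpr ?_ (ch.sub_mem_span_coords hcomp g)
      rintro _ ⟨j, rfl⟩
      refine Ideal.mem_span_singleton.mpr ⟨ch.ξ r e₀ j, ?_⟩
      simp only [RingHom.comp_apply, hβX]; ring
    · have h3 := Ideal.mem_map_of_mem ρ (he' b)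
      rw [Ideal.map_span, map_mul] at h3
      rw [← hev.dvd_mul_left, ← Ideal.mem_span_singleton]
      simp only [RingHom.comp_apply] at h3 ⊢
      rw [← map_sub]
      refine Ideal.span_le.mpr ?_ h3
      rintro _ ⟨_, ⟨i, rfl⟩, rfl⟩
      refine Ideal.mem_span_singleton.mpr ⟨ch.η r e₀ i, ?_⟩
      simp only [map_sub, hβy]; ring
  · intro S _ χ hχ hχe
    obtain ⟨ξ, η, hE, hu, hX, hY, -⟩ := ch.exists_coordinates _ hr hχ
    obtain ⟨ψ, hψ, hψξ, hψη⟩ := ch.exists_newtonAlgebra_hom' r e₀ (χ.comp ι₁) ξ η hE hu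
      (by rw [eval_e χ ξ η hE hX]; exact hχe)
    refine ⟨ψ, hQ.hom_ext (by rw [comp_assoc, hρ₁, hψ]) ?_⟩
    refine ch.ringHom_ext ?_ fun j ↦ ?_
    · have := hχ.comp_eq
      have h5 : (ψ.comp β).comp (f.comp c) = (χ.comp ι₁).comp (f.comp c) := by
        rw [comp_assoc, ← hβ, ← comp_assoc, hψ]
      rw [← this, ← h5, ← hρ₂]
      rfl
    · have hψ' : ∀ a, ψ (ρ (ι₁ a)) = χ (ι₁ a) := fun a ↦ by rw [← hρ₁']; exact congr($hψ a)
      simp only [RingHom.comp_apply] at hX ⊢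
      rw [hβX, hX, map_add, map_mul, map_pow, hψ', hψ', hψξ]
  · intro S _ ψ ψ' h hS
    have h' : ∀ a, ψ (ρ a) = ψ' (ρ a) := fun a ↦ congr($h a)
    refine ch.newtonAlgebra_hom_ext' (by rw [← hρ₁, ← comp_assoc, h]; rfl) (fun j ↦ ?_)
      fun i ↦ ?_
    · have h1 := congr(ψ $(hβX j))
      have h2 := congr(ψ' $(hβX j))
      simp only [map_add, map_mul, map_pow, ← h'] at h1 h2
      exact (mul_cancel_left_mem_nonZeroDivisors (pow_mem hS (r - 1))).mp
        (add_left_cancel (h1.symm.trans h2))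
    · have h1 := congr(ψ $(hβy i))
      have h2 := congr(ψ' $(hβy i))
      simp only [map_add, map_mul, map_pow, ← h'] at h1 h2
      exact (mul_cancel_left_mem_nonZeroDivisors (pow_mem hS r)).mp
        (add_left_cancel (h1.symm.trans h2))
  · intro S _ α hα ξ η hE hu
    obtain ⟨β', hβ', hX', -, -, -⟩ := ch.exists_target α hr hE
    obtain ⟨χ, hχ₁, hχ₂⟩ := hQ.exists_desc α β' hβ'
    have hχ₁' : ∀ a, α a = χ (ι₁ a) := fun a ↦ congr($hχ₁.symm a)
    have hχ₂' : ∀ a, β' a = χ (ι₂ a) := fun a ↦ congr($hχ₂.symm a)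
    have hαβ : β' = α := ch.ringHom_ext hβ'.symm fun j ↦ by
      rw [hX', hα, zero_pow (by omega), zero_mul, add_zero]
    rw [← hχ₁, eval_e χ ξ η (by rw [hχ₁]; exact hE) (fun j ↦ by rw [← hχ₁', ← hχ₁', ← hχ₂', hX'])]
    have h3 := Ideal.mem_map_of_mem χ he
    have h4 : (Ideal.span (Set.range fun b ↦ ι₂ (f b) - ι₁ (f b))).map χ = ⊥ := by
      rw [Ideal.map_span, Ideal.span_eq_bot]
      rintro _ ⟨_, ⟨b, rfl⟩, rfl⟩
      rw [map_sub, ← hχ₁', ← hχ₂', hαβ, sub_self]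
    have h5 : χ e = 1 := by
      have h3' : χ (e - 1) ∈ (Ideal.span (Set.range fun b ↦ ι₂ (f b) - ι₁ (f b))).map χ := h3
      rw [h4, Ideal.mem_bot, map_sub, map_one, sub_eq_zero] at h3'
      exact h3'
    rw [h5]
    exact isUnit_one

end Universal

end NewtonChart

section Fractions

/-- The algebra of fractions has the universal property of the Newton ring. -/
lemma isNewtonRing_fractionSubring {δ : R} {r : ℕ} (hr : 2 ≤ r) {Q Q' L : Type u} [CommRing Q]
    [CommRing Q'] [CommRing L] {ι₁ ι₂ : R →+* Q} (hι : ι₁.comp (f.comp c) = ι₂.comp (f.comp c))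
    {e : Q} {q : Q →+* Q'} (hq : Inverts q e) {ρ : Q' →+* L}
    (hρ : Inverts ρ (q (ι₁ δ) * q (ι₂ δ))) {I₁ I₂ D₁ D₂ : Ideal Q'}
    (hI₁ : I₁ = Ideal.span (Set.range fun g ↦ q (ι₂ g) - q (ι₁ g)))
    (hI₂ : I₂ = Ideal.span (Set.range fun b ↦ q (ι₂ (f b)) - q (ι₁ (f b))))
    (hD₁ : D₁ = Ideal.span {q (ι₁ δ)}) (hD₂ : D₂ = Ideal.span {q (ι₂ δ)}) :
    IsNewtonRing c f δ r ι₁ ι₂ e ((ρ.codRestrict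
      (fractionSubring ρ ![I₁, I₂, I₁, I₂] ![D₁ ^ (r - 1), D₁ ^ r, D₂ ^ (r - 1), D₂ ^ r])
      fun a ↦ mem_fractionSubring _ _ _ a).comp q) := by
  subst hI₁ hI₂ hD₁ hD₂
  set I₁ := Ideal.span (Set.range fun g ↦ q (ι₂ g) - q (ι₁ g))
  set I₂ := Ideal.span (Set.range fun b ↦ q (ι₂ (f b)) - q (ι₁ (f b)))
  set d₁ := q (ι₁ δ)
  set d₂ := q (ι₂ δ)
  rw [Ideal.span_singleton_pow, Ideal.span_singleton_pow, Ideal.span_singleton_pow,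
    Ideal.span_singleton_pow]
  set A := fractionSubring ρ ![I₁, I₂, I₁, I₂]
    ![Ideal.span {d₁ ^ (r - 1)}, Ideal.span {d₁ ^ r}, Ideal.span {d₂ ^ (r - 1)},
      Ideal.span {d₂ ^ r}]
  let ρA : Q' →+* A := ρ.codRestrict A fun a ↦ mem_fractionSubring _ _ _ a
  have hu := hρ.2.2
  rw [map_mul] at hu
  have hu₁ : IsUnit (ρ d₁) := isUnit_of_mul_isUnit_left hu
  have hu₂ : IsUnit (ρ d₂) := isUnit_of_mul_isUnit_right hu
  have hN : ∀ d, IsUnit (ρ d) → ρA d ∈ nonZeroDivisors A := fun d hd ↦ by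
    rw [mem_nonZeroDivisors_iff_right]
    intro a ha
    have := congrArg Subtype.val ha
    exact Subtype.ext ((hd.mul_left_eq_zero).mp this)
  have frac : ∀ (i : Fin 4) (a d : Q'), a ∈ (![I₁, I₂, I₁, I₂] : Fin 4 → Ideal Q') i → IsUnit (ρ d) →
      (![Ideal.span {d₁ ^ (r - 1)}, Ideal.span {d₁ ^ r}, Ideal.span {d₂ ^ (r - 1)},
        Ideal.span {d₂ ^ r}] : Fin 4 → Ideal Q') i = Ideal.span {d} → ρA d ∣ ρA a := by
    intro i a d ha hd hi
    obtain ⟨v, hv⟩ := hd.exists_right_inv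
    refine ⟨⟨v * ρ a, Subring.subset_closure (Or.inr (Set.mem_iUnion.mpr ⟨i, ?_⟩))⟩, Subtype.ext ?_⟩
    · intro x hx
      rw [hi] at hx
      obtain ⟨y, rfl⟩ := Ideal.mem_span_singleton'.mp hx
      refine ⟨y * a, Ideal.mul_mem_left _ _ ha, ?_⟩
      rw [map_mul, map_mul]
      linear_combination ρ y * ρ a * hv
    · change ρ a = ρ d * (v * ρ a)
      linear_combination - ρ a * hv
  have hm₁ : ∀ g, q (ι₂ g) - q (ι₁ g) ∈ I₁ := fun g ↦ Ideal.subset_span ⟨g, rfl⟩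
  have hm₂ : ∀ b, q (ι₂ (f b)) - q (ι₁ (f b)) ∈ I₂ := fun b ↦ Ideal.subset_span ⟨b, rfl⟩
  have hpair : NewtonPair c f δ r ((ρA.comp q).comp ι₁) ((ρA.comp q).comp ι₂) := by
    refine ⟨?_, hN _ hu₁, ?_, fun g ↦ ?_, fun b ↦ ?_⟩
    · rw [comp_assoc, hι]; rfl

    · have h1 := (dvd_pow_self (ρA d₁) (by omega : r - 1 ≠ 0)).trans
        ((map_pow ρA _ _).symm.dvd.trans (frac 0 _ _ (hm₁ δ) (by
          rw [map_pow]; exact hu₁.pow _) rfl))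
      have h2 := (dvd_pow_self (ρA d₂) (by omega : r - 1 ≠ 0)).trans
        ((map_pow ρA _ _).symm.dvd.trans (frac 2 _ _ (hm₁ δ) (by
          rw [map_pow]; exact hu₂.pow _) rfl))
      rw [map_sub] at h1 h2
      obtain ⟨u, hu⟩ := (dvd_sub_self_right).mp h1
      obtain ⟨v, hv⟩ := (dvd_sub_self_left).mp h2
      refine ⟨u, IsUnit.of_mul_eq_one v ?_, hu⟩
      refine (mul_cancel_left_mem_nonZeroDivisors (hN _ hu₁)).mp ?_
      change ρA d₂ = ρA d₁ * u at hu
      change ρA d₁ = ρA d₂ * v at hv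
      rw [← mul_assoc, ← hu, ← hv, mul_one]
    · have := frac 0 _ _ (hm₁ g) (by rw [map_pow]; exact hu₁.pow _) rfl
      rwa [map_pow, map_sub] at this
    · have := frac 1 _ _ (hm₂ b) (by rw [map_pow]; exact hu₁.pow _) rfl
      rwa [map_pow, map_sub] at this
  refine ⟨hpair, hq.2.2.map ρA, ?_, ?_⟩
  · intro S _ χ hχ hχe
    have hqloc := hq.isLocalization
    let := q.toAlgebra
    let χ' : Q' →+* S := IsLocalization.Away.lift e hχe
    have hχ' : ∀ a, χ' (q a) = χ a := fun a ↦ IsLocalization.Away.lift_eq e hχe a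
    obtain ⟨u, hu, hu'⟩ := hχ.unit
    have hS₁ : χ' d₁ ∈ nonZeroDivisors S := by rw [hχ']; exact hχ.mem
    have hS₂ : χ' d₂ = χ' d₁ * u := by rw [hχ', hχ']; exact hu'
    let T := Localization.Away (χ' d₁)
    let t : S →+* T := algebraMap S T
    have ht : Function.Injective t := IsLocalization.injective T (Submonoid.powers_le.mpr hS₁)
    have hT₁ : IsUnit (t (χ' d₁)) := IsLocalization.Away.algebraMap_isUnit _
    have hT : IsUnit ((t.comp χ') (d₁ * d₂)) := by
      rw [RingHom.comp_apply, map_mul χ', hS₂, map_mul t, map_mul t]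
      exact hT₁.mul (hT₁.mul (hu.map t))
    have hρloc := hρ.isLocalization
    let := ρ.toAlgebra
    let τ : L →+* T := IsLocalization.Away.lift (d₁ * d₂) hT
    have hτ : ∀ a, τ (ρ a) = t (χ' a) := fun a ↦ IsLocalization.Away.lift_eq (d₁ * d₂) hT a
    have hI₁ : ∀ a ∈ I₁, χ' d₁ ^ (r - 1) ∣ χ' a := by
      intro a ha
      rw [← Ideal.mem_span_singleton]
      suffices I₁ ≤ (Ideal.span {χ' d₁ ^ (r - 1)}).comap χ' from this ha
      rw [Ideal.span_le]
      rintro _ ⟨g, rfl⟩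
      rw [SetLike.mem_coe, Ideal.mem_comap, Ideal.mem_span_singleton, map_sub, hχ', hχ', hχ']
      exact hχ.dvd g
    have hI₂ : ∀ a ∈ I₂, χ' d₁ ^ r ∣ χ' a := by
      intro a ha
      rw [← Ideal.mem_span_singleton]
      suffices I₂ ≤ (Ideal.span {χ' d₁ ^ r}).comap χ' from this ha
      rw [Ideal.span_le]
      rintro _ ⟨g, rfl⟩
      rw [SetLike.mem_coe, Ideal.mem_comap, Ideal.mem_span_singleton, map_sub, hχ', hχ', hχ']
      exact hχ.dvd' g
    have hfrac : ∀ (s : L) (d a : Q'), IsUnit (t (χ' d)) → ρ d * s = ρ a → χ' d ∣ χ' a →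
        τ s ∈ t.range := by
      rintro s d a hd hs ⟨x, hx⟩
      refine ⟨x, hd.mul_left_cancel ?_⟩
      have := congr(τ $hs)
      rw [map_mul, hτ, hτ, hx, map_mul] at this
      exact this.symm
    have hT₂ : IsUnit (t (χ' d₂)) := by rw [hS₂, map_mul]; exact hT₁.mul (hu.map t)
    have hdvd : ∀ (n : ℕ) x, χ' d₁ ^ n ∣ x → χ' d₂ ^ n ∣ x := fun n x hx ↦ by
      rw [hS₂, mul_pow, (hu.pow n).mul_right_dvd]; exact hx
    have hA : ∀ a ∈ A, τ a ∈ t.range := by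
      suffices A ≤ t.range.comap τ from this
      refine Subring.closure_le.mpr ?_
      rintro s (⟨a, rfl⟩ | hs)
      · exact ⟨χ' a, (hτ a).symm⟩
      · obtain ⟨i, hi⟩ := Set.mem_iUnion.mp hs
        fin_cases i
        · obtain ⟨a, ha, h⟩ := hi _ (Ideal.mem_span_singleton_self _)
          refine hfrac s _ a ?_ h (by rw [map_pow]; exact hI₁ a ha)
          rw [map_pow, map_pow]; exact hT₁.pow _
        · obtain ⟨a, ha, h⟩ := hi _ (Ideal.mem_span_singleton_self _)
          refine hfrac s _ a ?_ h (by rw [map_pow]; exact hI₂ a ha)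
          rw [map_pow, map_pow]; exact hT₁.pow _
        · obtain ⟨a, ha, h⟩ := hi _ (Ideal.mem_span_singleton_self _)
          refine hfrac s _ a ?_ h (by rw [map_pow]; exact hdvd _ _ (hI₁ a ha))
          rw [map_pow, map_pow]; exact hT₂.pow _
        · obtain ⟨a, ha, h⟩ := hi _ (Ideal.mem_span_singleton_self _)
          refine hfrac s _ a ?_ h (by rw [map_pow]; exact hdvd _ _ (hI₂ a ha))
          rw [map_pow, map_pow]; exact hT₂.pow _
    let tE : S ≃+* t.range := RingEquiv.ofBijective t.rangeRestrict
      ⟨fun x y h ↦ ht congr(($h).1), t.rangeRestrict_surjective⟩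
    refine ⟨tE.symm.toRingHom.comp (RingHom.restrict τ A t.range hA), RingHom.ext fun a ↦ ?_⟩
    change tE.symm _ = _
    rw [RingEquiv.symm_apply_eq]
    refine Subtype.ext ?_
    change τ (ρ (q a)) = t (χ a)
    exact (hτ _).trans (congrArg t (hχ' a))
  · intro S _ ψ ψ' h hS
    have h1 : ψ.comp ρA = ψ'.comp ρA := by
      have := hq.isLocalization
      let := q.toAlgebra
      refine IsLocalization.ringHom_ext (Submonoid.powers e) ?_
      exact h
    have h1' : ∀ a, ψ (ρA a) = ψ' (ρA a) := fun a ↦ congr($h1 a)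
    have hS' : ψ (ρA (d₁ * d₂)) ∈ nonZeroDivisors S := by
      obtain ⟨u, hu, h2⟩ := hpair.unit
      change ρA d₂ = ρA d₁ * u at h2
      rw [map_mul, map_mul, h2, map_mul]
      exact mul_mem hS (mul_mem hS (hu.map ψ).mem_nonZeroDivisors)
    refine RingHom.ext fun a ↦ ?_
    obtain ⟨n, b, hb⟩ := hρ.1 a.1
    have hb' : ρA b = ρA (d₁ * d₂) ^ n * a := Subtype.ext hb
    have h2 := congr(ψ $hb')
    have h3 := congr(ψ' $hb')
    rw [map_mul, map_pow] at h2 h3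
    rw [← h1', ← h1', h2] at h3
    exact (mul_cancel_left_mem_nonZeroDivisors (pow_mem hS' n)).mp h3

end Fractions

end NewtonRing

section Adjugate

open Matrix

variable {K σ : Type*} [Field K] [Fintype σ] [DecidableEq σ] {J : Matrix σ σ K}

lemma eq_zero_of_adjugate_ne_zero {p q : σ} (h : J.adjugate p q ≠ 0) {x : σ → K}
    (hx : J *ᵥ x = 0) (hp : x p = 0) : x = 0 := by
  rw [adjugate_apply] at h
  refine eq_zero_of_mulVec_eq_zero h ?_
  ext i
  by_cases hi : i = q
  · subst hi
    rw [mulVec, updateRow_self, single_one_dotProduct, hp]; rfl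
  · rw [mulVec, updateRow_ne hi]
    exact congrFun hx i

lemma exists_adjugate_eq_vecMulVec (hJ : J.det = 0) (h : J.adjugate ≠ 0) :
    ∃ (v w : σ → K) (p : σ), v p = 1 ∧ (∀ i j, J.adjugate i j = v i * w j) ∧
      ∀ x, J *ᵥ x = 0 → x = x p • v := by
  obtain ⟨p, q, hpq⟩ : ∃ p q, J.adjugate p q ≠ 0 := by
    by_contra! h'
    exact h (Matrix.ext h')
  let v : σ → K := fun i ↦ (J.adjugate p q)⁻¹ * J.adjugate i q
  have hcol : ∀ j, J *ᵥ (fun i ↦ J.adjugate i j) = 0 := fun j ↦ by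
    ext i
    have := congr($(J.mul_adjugate) i j)
    rw [hJ, zero_smul] at this
    exact this
  have hv : J *ᵥ v = 0 := by
    have : v = (J.adjugate p q)⁻¹ • fun i ↦ J.adjugate i q := rfl
    rw [this, mulVec_smul, hcol, smul_zero]
  have hvp : v p = 1 := inv_mul_cancel₀ hpq
  have key : ∀ x, J *ᵥ x = 0 → x = x p • v := fun x hx ↦ by
    rw [← sub_eq_zero]
    refine eq_zero_of_adjugate_ne_zero hpq ?_ ?_
    · rw [mulVec_sub, mulVec_smul, hx, hv, smul_zero, sub_zero]
    · simp [hvp]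
  refine ⟨v, fun j ↦ J.adjugate p j, p, hvp, fun i j ↦ ?_, key⟩
  have := congrFun (key _ (hcol j)) i
  rw [this, Pi.smul_apply, smul_eq_mul, mul_comm]

lemma exists_kernel_of_adjugate_eq_zero [Nonempty σ] (h : J.adjugate = 0) :
    ∃ (v x : σ → K) (p q : σ), J *ᵥ v = 0 ∧ J *ᵥ x = 0 ∧ v p ≠ 0 ∧ x p = 0 ∧ x q ≠ 0 := by
  have hJ : J.det = 0 := by
    have h1 := J.mul_adjugate
    rw [h, mul_zero] at h1
    obtain ⟨i⟩ := ‹Nonempty σ›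
    simpa using congr($h1.symm i i)
  obtain ⟨v, hv0, hv⟩ := exists_mulVec_eq_zero_iff.mpr hJ
  obtain ⟨p, hp⟩ := Function.ne_iff.mp hv0
  have h1 : ∀ q, ∃ x : σ → K, x ≠ 0 ∧ x p = 0 ∧ ∀ i ≠ q, (J *ᵥ x) i = 0 := fun q ↦ by
    have : (J.updateRow q (Pi.single p 1)).det = 0 := by rw [← adjugate_apply, h]; rfl
    obtain ⟨x, hx0, hx⟩ := exists_mulVec_eq_zero_iff.mpr this
    refine ⟨x, hx0, ?_, fun i hi ↦ ?_⟩
    · have := congrFun hx q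
      rwa [mulVec, updateRow_self, single_one_dotProduct] at this
    · have := congrFun hx i
      rwa [mulVec, updateRow_ne hi] at this
  choose x hx0 hxp hx using h1
  by_cases hq : ∃ q, (J *ᵥ x q) q = 0
  · obtain ⟨q, hq⟩ := hq
    obtain ⟨l, hl⟩ := Function.ne_iff.mp (hx0 q)
    refine ⟨v, x q, p, l, hv, ?_, hp, hxp q, hl⟩
    ext i
    by_cases hi : i = q
    · subst hi; exact hq
    · exact hx q i hi
  · push Not at hq
    exfalso
    obtain ⟨w, hw0, hw⟩ := exists_vecMul_eq_zero_iff.mpr hJ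
    obtain ⟨q, hwq⟩ := Function.ne_iff.mp hw0
    have h2 : w ⬝ᵥ (J *ᵥ x q) = 0 := by rw [dotProduct_mulVec, hw, zero_dotProduct]
    rw [dotProduct, Finset.sum_eq_single q (fun i _ hi ↦ by rw [hx q i hi, mul_zero])
      (by simp)] at h2
    exact (mul_ne_zero hwq (hq q)) h2

end Adjugate

section FiberEquations

open MvPolynomial Matrix

variable {k S : Type*} [CommRing k] [CommRing S] {σ : Type*} [Fintype σ]

lemma taylor_zero (c : k →+* S) (a ξ : σ → S) (p : MvPolynomial σ k) :
    taylor c a 0 ξ p = (lineRestriction c a ξ p).coeff 2 := by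
  rw [taylor, ← Polynomial.coeff_zero_eq_eval_zero, Polynomial.coeff_divX, Polynomial.coeff_divX]

lemma lineRestriction_smul (c : k →+* S) (a ξ : σ → S) (t : S) (p : MvPolynomial σ k) :
    lineRestriction c a (t • ξ) p =
      (lineRestriction c a ξ p).comp (Polynomial.C t * Polynomial.X) := by
  rw [lineRestriction, lineRestriction, ← Polynomial.coe_compRingHom_apply, ← coe_eval₂Hom,
    ← coe_eval₂Hom, ← RingHom.comp_apply, comp_eval₂Hom]
  congr 2
  · ext x : 1; simp
  · ext j : 1; simp; ring

lemma taylor_zero_smul (c : k →+* S) (a ξ : σ → S) (t : S) (p : MvPolynomial σ k) :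
    taylor c a 0 (t • ξ) p = t ^ 2 * taylor c a 0 ξ p := by
  rw [taylor_zero, taylor_zero, lineRestriction_smul, Polynomial.comp_C_mul_X_coeff, mul_comm]

variable {ι κ : Type*} [Fintype ι] [Fintype κ] [DecidableEq ι] [DecidableEq κ]
  (G : ι ⊕ κ → MvPolynomial (ι ⊕ κ) k) {r : ℕ} {c : k →+* S} {a : ι ⊕ κ → S}

lemma derivative_lineRestriction (ξ : ι ⊕ κ → S) (p : MvPolynomial (ι ⊕ κ) k) :
    Polynomial.derivative (lineRestriction c a ξ p) =
      ∑ j, lineRestriction c a ξ (pderiv j p) * Polynomial.C (ξ j) := by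
  have h := derivation_eval₂ ((Polynomial.derivative' (R := S)).restrictScalars ℤ)
    (Polynomial.C.comp c) (fun t ↦ Polynomial.derivative_C)
    (fun j ↦ Polynomial.C (a j) + Polynomial.X * Polynomial.C (ξ j)) p
  refine h.trans (Finset.sum_congr rfl fun j _ ↦ ?_)
  rw [smul_eq_mul]
  congr 1
  change Polynomial.derivative _ = _
  simp

/-- The derivative of the Jacobian determinant along a vector in the kernel of the Jacobian matrix. -/
lemma smul_sum_pderiv_jacobian {v : ι ⊕ κ → S} (hv : jacobianMatrix G c a *ᵥ v = 0) (l : ι ⊕ κ) :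
    (∑ j, eval₂ c a (pderiv j (jacobian G)) * v j) * v l =
      2 * ∑ i, (jacobianMatrix G c a).adjugate l i * taylor c a 0 v (G i) := by
  let M : Matrix (ι ⊕ κ) (ι ⊕ κ) (Polynomial S) :=
    jacobianMatrix G (Polynomial.C.comp c) fun j ↦ Polynomial.C (a j) + Polynomial.X * Polynomial.C (v j)
  have hM : ∀ i j, M i j = lineRestriction c a v (pderiv j (G i)) := fun i j ↦ rfl
  have hdet : M.det = lineRestriction c a v (jacobian G) := det_jacobianMatrix _ _ _
  have h1 : M *ᵥ (fun j ↦ Polynomial.C (v j)) =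
      fun i ↦ Polynomial.derivative (lineRestriction c a v (G i)) := by
    ext1 i
    rw [derivative_lineRestriction]; rfl
  have h2 := congr(M.adjugate *ᵥ $h1)
  rw [mulVec_mulVec, adjugate_mul, hdet, smul_mulVec, one_mulVec] at h2
  have h3 := congr(Polynomial.coeff ($h2 l) 1)
  have hadj : ∀ i, (M.adjugate l i).coeff 0 = (jacobianMatrix G c a).adjugate l i := fun i ↦ by
    have hMm : M.map (Polynomial.evalRingHom 0) = jacobianMatrix G c a := by
      ext i j
      rw [map_apply, hM, Polynomial.coe_evalRingHom, eval_lineRestriction, zero_smul, add_zero]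
      rfl
    rw [← hMm, ← RingHom.mapMatrix_apply, ← RingHom.map_adjugate, Polynomial.coeff_zero_eq_eval_zero]
    rfl
  rw [Pi.smul_apply, smul_eq_mul, Polynomial.coeff_mul_C, coeff_one_lineRestriction] at h3
  rw [h3, mulVec, dotProduct, Polynomial.finsetSum_coeff, Finset.mul_sum]
  refine Finset.sum_congr rfl fun i _ ↦ ?_
  have h4 : (Polynomial.derivative (lineRestriction c a v (G i))).coeff 0 = 0 := by
    rw [Polynomial.coeff_derivative, zero_add, coeff_one_lineRestriction]
    have : ∑ j, eval₂ c a (pderiv j (G i)) * v j = 0 := congrFun hv i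
    simp [this]
  rw [Polynomial.mul_coeff_one, h4, mul_zero, add_zero, hadj, taylor_zero,
    Polynomial.coeff_derivative]
  push_cast
  ring

variable (hδ : eval₂ c a (jacobian G) = 0)
include hδ

lemma newtonEq_of_adjugate (h : 3 ≤ r ∨ 2 ≤ r ∧ (jacobianMatrix G c a).adjugate = 0)
    (ξ : ι ⊕ κ → S) (η : κ → S) :
    newtonEq G r c a ξ η = ξ - (jacobianMatrix G c a).adjugate *ᵥ Sum.elim (fun _ ↦ 0) η := by
  rcases h with h | ⟨-, h⟩
  · rw [newtonEq, hδ, zero_pow (by omega : r - 2 ≠ 0), zero_smul, zero_sub, mulVec_neg, sub_eq_add_neg]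
  · rw [newtonEq, h, zero_mulVec, zero_mulVec, add_zero, sub_zero]

lemma newtonUnit_of_adjugate (h : 3 ≤ r ∨ 2 ≤ r ∧ (jacobianMatrix G c a).adjugate = 0)
    {ξ : ι ⊕ κ → S} {η : κ → S} (he : newtonEq G r c a ξ η = 0) : newtonUnit G r c a ξ = 1 := by
  rw [newtonEq_of_adjugate G hδ h] at he
  rcases h with h | ⟨hr, h⟩
  · rw [newtonUnit, hδ, zero_pow (by omega), zero_pow (by omega)]; ring
  · rw [h, zero_mulVec, sub_zero] at he
    rw [newtonUnit, hδ, zero_pow (by omega : 2 * r - 3 ≠ 0), he]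
    simp

lemma newtonEq_two {v w : ι ⊕ κ → S} (hvw : ∀ i j, (jacobianMatrix G c a).adjugate i j = v i * w j)
    (ξ : ι ⊕ κ → S) (η : κ → S) :
    newtonEq G 2 c a ξ η =
      ξ + (∑ i, w i * taylor c a 0 ξ (G i) - ∑ i, w (Sum.inr i) * η i) • v := by
  ext l
  rw [newtonEq, hδ]
  simp only [Nat.sub_self, pow_zero, one_smul, Nat.add_one_sub_one, pow_one, Pi.add_apply, mulVec,
    dotProduct, hvw, Pi.sub_apply, Pi.smul_apply, smul_eq_mul, mul_sub, Finset.sum_sub_distrib,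
    Fintype.sum_sum_type (fun i ↦ v l * w i * (Sum.elim (fun _ ↦ 0) η : ι ⊕ κ → S) i),
    Sum.elim_inl, Sum.elim_inr, mul_zero, Finset.sum_const_zero, zero_add, sub_mul, Finset.sum_mul]
  congr 1
  congr 1 <;> exact Finset.sum_congr rfl fun i _ ↦ by ring

lemma newtonEq_two_smul {v w : ι ⊕ κ → S} {p : ι ⊕ κ} (hvp : v p = 1)
    (hvw : ∀ i j, (jacobianMatrix G c a).adjugate i j = v i * w j)
    (t : S) (η : κ → S) : newtonEq G 2 c a (t • v) η = 0 ↔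
      t + (∑ i, w i * taylor c a 0 v (G i)) * t ^ 2 = ∑ i, w (Sum.inr i) * η i := by
  have : newtonEq G 2 c a (t • v) η =
      (t + (∑ i, w i * taylor c a 0 v (G i)) * t ^ 2 - ∑ i, w (Sum.inr i) * η i) • v := by
    rw [newtonEq_two G hδ hvw, add_sub_assoc, add_smul, Finset.sum_mul]
    congr 4
    funext i
    rw [taylor_zero_smul]; ring
  rw [this, ← sub_eq_zero (a := _ + _)]
  refine ⟨fun h ↦ ?_, fun h ↦ by rw [h, zero_smul]⟩
  simpa [hvp] using congrFun h p

lemma eq_smul_of_newtonEq_two {v w : ι ⊕ κ → S} {p : ι ⊕ κ} (hvp : v p = 1)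
    (hvw : ∀ i j, (jacobianMatrix G c a).adjugate i j = v i * w j)
    {ξ : ι ⊕ κ → S} {η : κ → S} (h : newtonEq G 2 c a ξ η = 0) : ξ = ξ p • v := by
  rw [newtonEq_two G hδ hvw] at h
  have h1 := congrFun h p
  rw [Pi.add_apply, Pi.smul_apply, hvp, smul_eq_mul, mul_one, Pi.zero_apply] at h1
  rw [← eq_neg_iff_add_eq_zero] at h h1
  rw [h1, neg_smul]
  exact h

lemma newtonUnit_two_smul {v w : ι ⊕ κ → S} {p : ι ⊕ κ} (hvp : v p = 1)
    (hv : jacobianMatrix G c a *ᵥ v = 0)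
    (hvw : ∀ i j, (jacobianMatrix G c a).adjugate i j = v i * w j) (t : S) :
    newtonUnit G 2 c a (t • v) = 1 + 2 * (∑ i, w i * taylor c a 0 v (G i)) * t := by
  have h := smul_sum_pderiv_jacobian G hv p
  rw [hvp, mul_one] at h
  have h1 : ∑ j, eval₂ c a (pderiv j (jacobian G)) * (t • v) j =
      t * ∑ j, eval₂ c a (pderiv j (jacobian G)) * v j := by
    rw [Finset.mul_sum]
    exact Finset.sum_congr rfl fun j _ ↦ by rw [Pi.smul_apply, smul_eq_mul]; ring
  simp only [hvw, hvp, one_mul] at h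
  rw [newtonUnit, hδ, h1, h]
  simp
  ring

end FiberEquations

section Multiplicity

open MvPolynomial Matrix

lemma three_le_length {O : Type u} [CommRing O] {I J : Ideal O} (h₁ : ⊥ < I) (h₂ : I < J)
    (h₃ : J < ⊤) : 3 ≤ Module.length O O := by
  let s : LTSeries (Submodule O O) :=
    { length := 3
      toFun := ![⊥, I, J, ⊤]
      step := fun i ↦ by fin_cases i <;> assumption }
  have := Order.LTSeries.length_le_krullDim s
  rw [← Module.coe_length] at this
  exact_mod_cast this

lemma two_le_length {O : Type u} [CommRing O] {I : Ideal O} (h₁ : ⊥ < I) (h₃ : I < ⊤) :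
    2 ≤ Module.length O O := by
  let s : LTSeries (Submodule O O) :=
    { length := 2
      toFun := ![⊥, I, ⊤]
      step := fun i ↦ by fin_cases i <;> assumption }
  have := Order.LTSeries.length_le_krullDim s
  rw [← Module.coe_length] at this
  exact_mod_cast this

lemma length_le_two {O : Type u} [CommRing O] [IsLocalRing O] {y : O}
    (h : maximalIdeal O = Ideal.span {y}) (hy : y * y = 0) :
    Module.length O O ≤ 2 := by
  set M := maximalIdeal O
  have h1 : Module.length O (O ⧸ M) = 1 := Module.length_eq_one_iff.mpr
    (isSimpleModule_iff_isCoatom.mpr (Ideal.isMaximal_def.mp inferInstance))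
  have h2 : Module.length O M ≤ Module.length O (O ⧸ M) := by
    let g : O →ₗ[O] M := LinearMap.toSpanSingleton O M
      ⟨y, by rw [h]; exact Ideal.mem_span_singleton_self y⟩
    have hg : M ≤ LinearMap.ker g := fun x hx ↦ by
      rw [h] at hx
      obtain ⟨z, rfl⟩ := Ideal.mem_span_singleton'.mp hx
      refine LinearMap.mem_ker.mpr (Subtype.ext ?_)
      change (z * y) * y = 0
      rw [mul_assoc, hy, mul_zero]
    refine Module.length_le_of_surjective (M.liftQ g hg) ?_
    rintro ⟨x, hx⟩
    have hx' := hx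
    rw [h] at hx'
    obtain ⟨z, rfl⟩ := Ideal.mem_span_singleton'.mp hx'
    exact ⟨Submodule.Quotient.mk z, Subtype.ext rfl⟩
  rw [Module.length_eq_add_of_exact M.subtype M.mkQ M.injective_subtype M.mkQ_surjective
    (LinearMap.exact_subtype_mkQ M), h1]
  rw [h1] at h2
  calc _ ≤ (1 : ℕ∞) + 1 := by gcongr
    _ = 2 := one_add_one_eq_two

variable {k B R K : Type u} [Field k] [CommRing B] [CommRing R] [Field K] {c : k →+* B}
  {f : B →+* R}

/-- `O` is the local ring of the fibre of `f` through the point `ρ`, at this point. -/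
structure IsFiberRing (f : B →+* R) (ρ : R →+* K) {O : Type u} [CommRing O] [IsLocalRing O]
    (θ : R →+* O) (κ : K →+* O) : Prop where
  comp_eq : θ.comp f = κ.comp (ρ.comp f)
  exists_lift : ∀ {S : Type u} [CommRing S] [IsLocalRing S] (θ' : R →+* S) (κ' : K →+* S),
    θ'.comp f = κ'.comp (ρ.comp f) →
    (∀ g, θ' g - κ' (ρ g) ∈ maximalIdeal S) →
    ∃ χ : O →+* S, χ.comp θ = θ' ∧ χ.comp κ = κ'
  hom_ext : ∀ {S : Type u} [CommRing S] {χ χ' : O →+* S}, χ.comp θ = χ'.comp θ →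
    χ.comp κ = χ'.comp κ → χ = χ'

variable (ch : NewtonChart c f) {ρ : R →+* K}

namespace NewtonChart

variable {S : Type u} [CommRing S]

lemma exists_thickening (κ : K →+* S) {s : S} (hs : s ^ 3 = 0)
    (ξ : ch.Idx → S)
    (h : ∀ i, eval₂ (ch.constants (κ.comp ρ)) (ch.coords (κ.comp ρ) + s • ξ) (ch.G i) =
      eval₂ (ch.constants (κ.comp ρ)) (ch.coords (κ.comp ρ)) (ch.G i)) :
    ∃ θ : R →+* S, θ.comp f = κ.comp (ρ.comp f) ∧ (∀ g, θ g - κ (ρ g) ∈ Ideal.span {s}) ∧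
      ∀ j, θ (ch.π (X j)) = κ (ρ (ch.π (X j))) + s * ξ j := by
  let τ : MvPolynomial ch.Idx k →+* S :=
    eval₂Hom (ch.constants (κ.comp ρ)) (ch.coords (κ.comp ρ) + s • ξ)
  have hτ : ∀ i, τ (ch.G i) = κ (ρ (ch.π (ch.G i))) := fun i ↦ (h i).trans (ch.eval₂_coords _ _)
  let θ : R →+* S := RingHom.liftOfSurjective ch.π ch.surj ⟨τ, by
    rw [ch.ker_π, Ideal.span_le]
    rintro _ ⟨i, rfl⟩
    rw [SetLike.mem_coe, RingHom.mem_ker, Function.comp_apply, hτ, ch.π_inl, map_zero, map_zero]⟩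
  have hθ : ∀ p, θ (ch.π p) = τ p := fun q ↦ RingHom.liftOfRightInverse_comp_apply _ _ _ _ q
  have hc : (κ.comp ρ).comp (f.comp c) = θ.comp (f.comp c) := by
    rw [← ch.π_C]
    refine RingHom.ext fun t ↦ ?_
    simp only [RingHom.comp_apply, hθ, τ]
    simp
  have hX : ∀ j, θ (ch.π (X j)) = κ (ρ (ch.π (X j))) + s * ξ j := fun j ↦ by rw [hθ]; simp [τ]; rfl
  have hmem : ∀ g, θ g - κ (ρ g) ∈ Ideal.span {s} := fun g ↦ by
    refine Ideal.span_le.mpr ?_ (ch.sub_mem_span_coords hc g)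
    rintro _ ⟨j, rfl⟩
    refine Ideal.mem_span_singleton.mpr ⟨ξ j, ?_⟩
    simp only [RingHom.comp_apply, hX]; ring
  have hy : ∀ i, κ (ρ (f (ch.y i))) = θ (f (ch.y i)) := fun i ↦ by rw [← ch.π_G, hθ, hτ]
  refine ⟨θ, ?_, hmem, hX⟩
  let q := Ideal.Quotient.mk (Ideal.span {s ^ 2})
  have h1 : q.comp (κ.comp (ρ.comp f)) = q.comp (θ.comp f) := by
    refine ch.hy.ringHom_ext _ _ ?_ ((Ideal.span {s}).map q) ?_ (fun b ↦ ?_) fun i ↦ ?_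
    · exact congr(q.comp $hc)
    · rw [← Ideal.map_mul, Ideal.span_singleton_mul_span_singleton, ← pow_two,
        Ideal.map_span, Set.image_singleton, Ideal.span_singleton_eq_bot]
      exact eq_zero_iff_mem.mpr (Ideal.mem_span_singleton_self _)
    · simp only [RingHom.comp_apply]
      rw [← map_sub]
      exact Ideal.mem_map_of_mem q (hmem _)
    · exact congr(q $(hy i))
  refine (ch.hy.ringHom_ext _ _ hc (Ideal.span {s ^ 2}) ?_ (fun b ↦ ?_) hy).symm
  · rw [Ideal.span_singleton_mul_span_singleton, Ideal.span_singleton_eq_bot]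
    linear_combination s * hs
  · exact Ideal.Quotient.eq.mp congr($h1.symm b)

/-- The Jacobian matrix at a point. -/
abbrev matrixAt (ρ : R →+* K) : Matrix ch.Idx ch.Idx K :=
  jacobianMatrix ch.G (ch.constants ρ) (ch.coords ρ)

lemma sum_pderiv_mul (κ : K →+* S) (v : ch.Idx → K) (i) :
    ∑ j, eval₂ (ch.constants (κ.comp ρ)) (ch.coords (κ.comp ρ)) (pderiv j (ch.G i)) * κ (v j) =
      κ ((ch.matrixAt ρ *ᵥ v) i) := by
  rw [mulVec, dotProduct, map_sum]
  refine Finset.sum_congr rfl fun j _ ↦ ?_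
  rw [map_mul]
  congr 1
  exact (map_eval₂ κ (ch.constants ρ) (ch.coords ρ) (pderiv j (ch.G i))).symm

lemma exists_thickening_two {s : S} (hs : s ^ 2 = 0) (κ : K →+* S) {v : ch.Idx → K}
    (hv : ch.matrixAt ρ *ᵥ v = 0) :
    ∃ θ : R →+* S, θ.comp f = κ.comp (ρ.comp f) ∧ (∀ g, θ g - κ (ρ g) ∈ Ideal.span {s}) ∧
      ∀ j, θ (ch.π (X j)) = κ (ρ (ch.π (X j))) + s * κ (v j) := by
  refine ch.exists_thickening κ (by rw [pow_succ, hs, zero_mul]) (κ ∘ v) fun i ↦ ?_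
  have h1 : ∑ j, eval₂ (ch.constants (κ.comp ρ)) (ch.coords (κ.comp ρ)) (pderiv j (ch.G i)) *
      (κ ∘ v) j = 0 := by
    rw [show ∑ j, eval₂ (ch.constants (κ.comp ρ)) (ch.coords (κ.comp ρ)) (pderiv j (ch.G i)) *
      (κ ∘ v) j = _ from ch.sum_pderiv_mul κ v i, hv, Pi.zero_apply, map_zero]
  rw [taylor_spec, h1, hs]
  ring

lemma taylor_sub_mem (κ : K →+* S) (s : S) (v : ch.Idx → K)
    (x : ch.Idx → S) (i) :
    taylor (ch.constants (κ.comp ρ)) (ch.coords (κ.comp ρ)) s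
      (fun j ↦ κ (v j) + s * x j) (ch.G i) -
        κ (taylor (ch.constants ρ) (ch.coords ρ) 0 v (ch.G i)) ∈ Ideal.span {s} := by
  rw [← Ideal.Quotient.eq, map_taylor, map_taylor, map_taylor]
  have hs0 : Ideal.Quotient.mk (Ideal.span {s}) s = 0 :=
    eq_zero_iff_mem.mpr (Ideal.mem_span_singleton_self s)
  congr 1
  · rw [hs0, map_zero, map_zero]
  · ext j; simp [hs0]

lemma exists_thickening_three {s : S} (hs : s ^ 3 = 0) (κ : K →+* S)
    {v x : ch.Idx → K} (hv : ch.matrixAt ρ *ᵥ v = 0)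
    (hx : ∀ i, (ch.matrixAt ρ *ᵥ x) i = - taylor (ch.constants ρ) (ch.coords ρ) 0 v (ch.G i)) :
    ∃ θ : R →+* S, θ.comp f = κ.comp (ρ.comp f) ∧ (∀ g, θ g - κ (ρ g) ∈ Ideal.span {s}) ∧
      ∀ j, θ (ch.π (X j)) = κ (ρ (ch.π (X j))) + s * (κ (v j) + s * κ (x j)) := by
  refine ch.exists_thickening κ hs (fun j ↦ κ (v j) + s * κ (x j)) fun i ↦ ?_
  have h1 : ∑ j, eval₂ (ch.constants (κ.comp ρ)) (ch.coords (κ.comp ρ)) (pderiv j (ch.G i)) *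
      (κ (v j) + s * κ (x j)) = - s * κ (taylor (ch.constants ρ) (ch.coords ρ) 0 v (ch.G i)) := by
    simp only [mul_add, Finset.sum_add_distrib, mul_left_comm _ s, ← Finset.mul_sum,
      ch.sum_pderiv_mul κ, hv, hx, Pi.zero_apply, map_zero, map_neg]
    ring
  have h2 := ch.taylor_sub_mem (ρ := ρ) κ s v (fun j ↦ κ (x j)) i
  obtain ⟨w, hw⟩ := Ideal.mem_span_singleton'.mp h2
  rw [taylor_spec, h1, sub_eq_iff_eq_add.mp hw.symm]
  linear_combination w * hs

end NewtonChart

/-- The truncated polynomial ring. -/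
abbrev Truncated (K : Type u) [Field K] (n : ℕ) : Type u :=
  PowerSeries K ⧸ Ideal.span {(PowerSeries.X : PowerSeries K) ^ n}

namespace Truncated

variable (K) (n : ℕ)

/-- The variable. -/
def t : Truncated K n := Ideal.Quotient.mk _ PowerSeries.X

/-- The constants. -/
def ofField : K →+* Truncated K n := (Ideal.Quotient.mk _).comp PowerSeries.C

lemma t_pow : t K n ^ n = 0 := by
  rw [t, ← map_pow]
  exact eq_zero_iff_mem.mpr (Ideal.mem_span_singleton_self _)

lemma ofField_mul_t_pow_ne_zero {a : K} (ha : a ≠ 0) {i : ℕ} (hi : i < n) :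
    ofField K n a * t K n ^ i ≠ 0 := by
  rw [t, ofField, RingHom.comp_apply, ← map_pow, ← map_mul, Ne, eq_zero_iff_mem,
    Ideal.mem_span_singleton, PowerSeries.X_pow_dvd_iff]
  intro h
  have := h i hi
  rw [PowerSeries.coeff_C_mul, PowerSeries.coeff_X_pow_self, mul_one] at this
  exact ha this

instance [NeZero n] : IsLocalRing (Truncated K n) := by
  have : Nontrivial (Truncated K n) := ⟨_, 0, by
    simpa using ofField_mul_t_pow_ne_zero K n one_ne_zero (Nat.pos_of_neZero n)⟩
  exact .of_surjective' _ Ideal.Quotient.mk_surjective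

lemma span_t_le [NeZero n] : Ideal.span {t K n} ≤ maximalIdeal (Truncated K n) := by
  rw [Ideal.span_le, Set.singleton_subset_iff, SetLike.mem_coe, IsLocalRing.mem_maximalIdeal,
    mem_nonunits_iff]
  intro h
  have := h.pow n
  rw [t_pow] at this
  exact not_isUnit_zero this

end Truncated

section

variable {σ : Type*} [Fintype σ] [DecidableEq σ] {J : Matrix σ σ K} {v w : σ → K} {p : σ}

lemma sum_mul_mulVec_eq_zero (hJ : J.det = 0) (hvp : v p = 1)
    (hvw : ∀ i j, J.adjugate i j = v i * w j) (y : σ → K) : ∑ i, w i * (J *ᵥ y) i = 0 := by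
  have h1 := congr($(J.adjugate_mul) *ᵥ y)
  rw [hJ, zero_smul, zero_mulVec, ← mulVec_mulVec] at h1
  have h2 := congrFun h1 p
  simp only [mulVec, dotProduct, hvw, hvp, one_mul] at h2
  exact h2

lemma isUnit_updateRow (hvp : v p = 1) (hvw : ∀ i j, J.adjugate i j = v i * w j) {q : σ}
    (hq : w q ≠ 0) : IsUnit (J.updateRow q (Pi.single p 1)) := by
  rw [isUnit_iff_isUnit_det, ← adjugate_apply, hvw, hvp, one_mul]
  exact isUnit_iff_ne_zero.mpr hq

end

namespace IsFiberRing

variable {ch} {O : Type u} [CommRing O] [IsLocalRing O] {θ : R →+* O} {κ : K →+* O}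
  (h : IsFiberRing f ρ θ κ)
include h

lemma sub_mem (g : R) : θ g - κ (ρ g) ∈ maximalIdeal O := by
  obtain ⟨χ, hχ, hχ'⟩ := h.exists_lift ρ (RingHom.id K) rfl (by simp)
  rw [IsLocalRing.mem_maximalIdeal, mem_nonunits_iff]
  intro hu
  have := hu.map χ
  rw [map_sub, ← RingHom.comp_apply, ← RingHom.comp_apply, hχ, hχ', RingHom.id_apply, sub_self]
    at this
  exact not_isUnit_zero this

lemma maximalIdeal_eq : maximalIdeal O =
    Ideal.span (Set.range fun j ↦ θ (ch.π (X j)) - κ (ρ (ch.π (X j)))) := by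
  refine le_antisymm (fun x hx ↦ ?_) (Ideal.span_le.mpr ?_)
  · set I := Ideal.span (Set.range fun j ↦ θ (ch.π (X j)) - κ (ρ (ch.π (X j))))
    have hI : ∀ g, θ g - κ (ρ g) ∈ I := ch.sub_mem_span_coords (α := κ.comp ρ) (β := θ) (by
      have := h.comp_eq
      rw [comp_assoc, ← comp_assoc c f ρ, ← comp_assoc, ← this]
      rfl)
    obtain ⟨χ, hχ, hχ'⟩ := h.exists_lift ρ (RingHom.id K) rfl (by simp)
    have h1 : Ideal.Quotient.mk I = ((Ideal.Quotient.mk I).comp κ).comp χ := by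
      refine h.hom_ext ?_ ?_
      · rw [comp_assoc, hχ]
        exact RingHom.ext fun g ↦ Ideal.Quotient.eq.mpr (hI g)
      · rw [comp_assoc, hχ']; rfl
    have h2 : χ x = 0 := by
      by_contra hne
      have : x - κ (χ x) ∈ RingHom.ker χ := by
        rw [RingHom.mem_ker, map_sub, ← RingHom.comp_apply χ κ, hχ', RingHom.id_apply, sub_self]
      have h3 : RingHom.ker χ ≤ maximalIdeal O :=
        IsLocalRing.le_maximalIdeal (RingHom.ker_ne_top χ)
      have h4 : κ (χ x) ∈ maximalIdeal O := by
        have := Submodule.sub_mem _ hx (h3 this)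
        rwa [sub_sub_cancel] at this
      exact h4 ((isUnit_iff_ne_zero.mpr hne).map κ)
    rw [← eq_zero_iff_mem, h1, RingHom.comp_apply, h2, map_zero]
  · rintro _ ⟨j, rfl⟩
    exact h.sub_mem _

lemma exists_map_two {v : ch.Idx → K} (hv : ch.matrixAt ρ *ᵥ v = 0) :
    ∃ χ : O →+* Truncated K 2, ∀ j, χ (θ (ch.π (X j)) - κ (ρ (ch.π (X j)))) =
      Truncated.ofField K 2 (v j) * Truncated.t K 2 := by
  obtain ⟨θ', h1, h2, h3⟩ := ch.exists_thickening_two (Truncated.t_pow K 2)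
    (Truncated.ofField K 2) hv
  obtain ⟨χ, hχ, hχ'⟩ := h.exists_lift θ' _ h1 fun g ↦ Truncated.span_t_le K 2 (h2 g)
  refine ⟨χ, fun j ↦ ?_⟩
  rw [map_sub, ← RingHom.comp_apply χ θ, ← RingHom.comp_apply χ κ, hχ, hχ', h3]
  ring

lemma two_le_length (hρ : ρ ch.δ = 0) : 2 ≤ Module.length O O := by
  have hJ : (ch.matrixAt ρ).det = 0 := by rw [det_jacobianMatrix, ch.eval₂_coords]; exact hρ
  obtain ⟨v, hv0, hv⟩ := exists_mulVec_eq_zero_iff.mpr hJ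
  obtain ⟨p, hp⟩ := Function.ne_iff.mp hv0
  obtain ⟨χ, hχ⟩ := h.exists_map_two hv
  refine Newton.two_le_length (I := maximalIdeal O) (bot_lt_iff_ne_bot.mpr fun h0 ↦ ?_)
    (lt_top_iff_ne_top.mpr Ideal.IsPrime.ne_top')
  have h1 := h.sub_mem (ch.π (X p))
  rw [h0, Ideal.mem_bot] at h1
  have h2 := hχ p
  rw [h1, map_zero] at h2
  exact Truncated.ofField_mul_t_pow_ne_zero K 2 hp one_lt_two (by rw [pow_one]; exact h2.symm)

lemma three_le_length_of_adjugate (hρ : ρ ch.δ = 0) (hadj : (ch.matrixAt ρ).adjugate = 0) :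
    3 ≤ Module.length O O := by
  have : Nonempty ch.Idx := by
    by_contra hn
    rw [not_nonempty_iff] at hn
    have hJ : (ch.matrixAt ρ).det = 0 := by rw [det_jacobianMatrix, ch.eval₂_coords]; exact hρ
    rw [det_isEmpty] at hJ
    exact one_ne_zero hJ
  obtain ⟨v, x, p, q, hv, hx, hvp, hxp, hxq⟩ := exists_kernel_of_adjugate_eq_zero hadj
  obtain ⟨χ, hχ⟩ := h.exists_map_two hv
  obtain ⟨χ', hχ'⟩ := h.exists_map_two hx
  refine three_le_length (I := Ideal.span {θ (ch.π (X p)) - κ (ρ (ch.π (X p)))})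
    (J := maximalIdeal O) (bot_lt_iff_ne_bot.mpr fun h0 ↦ ?_)
    (lt_of_le_of_ne ?_ fun h0 ↦ ?_) (lt_top_iff_ne_top.mpr Ideal.IsPrime.ne_top')
  · have h2 := hχ p
    rw [Ideal.span_singleton_eq_bot.mp h0, map_zero] at h2
    exact Truncated.ofField_mul_t_pow_ne_zero K 2 hvp one_lt_two (by rw [pow_one]; exact h2.symm)
  · rw [Ideal.span_le, Set.singleton_subset_iff]; exact h.sub_mem _
  · have h1 := h.sub_mem (ch.π (X q))
    rw [← h0] at h1
    obtain ⟨a, ha⟩ := Ideal.mem_span_singleton'.mp h1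
    have h2 := hχ' q
    rw [← ha, map_mul, hχ', hxp, map_zero, zero_mul, mul_zero] at h2
    exact Truncated.ofField_mul_t_pow_ne_zero K 2 hxq one_lt_two (by rw [pow_one]; exact h2.symm)

variable {v w : ch.Idx → K} {p : ch.Idx}

lemma three_le_length_of_sum (hρ : ρ ch.δ = 0) (hvp : v p = 1)
    (hvw : ∀ i j, (ch.matrixAt ρ).adjugate i j = v i * w j) (hw : w ≠ 0)
    (hv : ch.matrixAt ρ *ᵥ v = 0)
    (hc : ∑ i, w i * taylor (ch.constants ρ) (ch.coords ρ) 0 v (ch.G i) = 0) :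
    3 ≤ Module.length O O := by
  have hJ : (ch.matrixAt ρ).det = 0 := by rw [det_jacobianMatrix, ch.eval₂_coords]; exact hρ
  obtain ⟨q, hq⟩ := Function.ne_iff.mp hw
  set J := ch.matrixAt ρ
  have hJw : ∀ y, ∑ i, w i * (J *ᵥ y) i = 0 := sum_mul_mulVec_eq_zero hJ hvp hvw
  -- solve the linear equation for the second order term
  obtain ⟨x, hx⟩ : ∃ x, ∀ i, (J *ᵥ x) i = - taylor (ch.constants ρ) (ch.coords ρ) 0 v (ch.G i) := by
    have hM := isUnit_updateRow hvp hvw hq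
    obtain ⟨x, hx⟩ := mulVec_surjective_iff_isUnit.mpr hM
      fun i ↦ - taylor (ch.constants ρ) (ch.coords ρ) 0 v (ch.G i)
    have hx' : ∀ i ≠ q, (J *ᵥ x) i = - taylor (ch.constants ρ) (ch.coords ρ) 0 v (ch.G i) := by
      intro i hi
      have := congrFun hx i
      rwa [mulVec, updateRow_ne hi] at this
    refine ⟨x, fun i ↦ ?_⟩
    by_cases hi : i = q
    · subst hi
      have h1 := hJw x
      rw [Finset.sum_eq_add_sum_sdiff_singleton_of_mem (Finset.mem_univ i)] at h1 hc
      rw [Finset.sum_congr rfl (g := fun l ↦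
        - (w l * taylor (ch.constants ρ) (ch.coords ρ) 0 v (ch.G l)))
        (fun l hl ↦ by rw [hx' l (by simpa using hl), mul_neg]), Finset.sum_neg_distrib] at h1
      refine mul_left_cancel₀ hq ?_
      linear_combination h1 + hc
    · exact hx' i hi
  obtain ⟨θ', h1, h2, h3⟩ := ch.exists_thickening_three (Truncated.t_pow K 3)
    (Truncated.ofField K 3) hv hx
  obtain ⟨χ, hχ, hχ'⟩ := h.exists_lift θ' _ h1 fun g ↦ Truncated.span_t_le K 3 (h2 g)
  set y := θ (ch.π (X p)) - κ (ρ (ch.π (X p)))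
  set t := Truncated.t K 3
  obtain ⟨b, hb⟩ : ∃ b, χ y = t * (1 + t * b) := by
    refine ⟨Truncated.ofField K 3 (x p), ?_⟩
    rw [map_sub, ← RingHom.comp_apply χ θ, ← RingHom.comp_apply χ κ, hχ, hχ', h3, hvp, map_one]
    ring
  have ht : t ^ 3 = 0 := Truncated.t_pow K 3
  have ht2 : t ^ 2 ≠ 0 := by
    have := Truncated.ofField_mul_t_pow_ne_zero K 3 one_ne_zero (by norm_num : 2 < 3)
    rwa [map_one, one_mul] at this
  have hy : y ∈ maximalIdeal O := h.sub_mem _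
  refine three_le_length (I := Ideal.span {y ^ 2}) (J := maximalIdeal O)
    (bot_lt_iff_ne_bot.mpr fun h0 ↦ ?_) (lt_of_le_of_ne ?_ fun h0 ↦ ?_)
    (lt_top_iff_ne_top.mpr Ideal.IsPrime.ne_top')
  · have h4 := congr(χ $(Ideal.span_singleton_eq_bot.mp h0))
    rw [map_pow, hb, map_zero] at h4
    refine ht2 ?_
    linear_combination h4 - (2 * b + t * b ^ 2) * ht
  · rw [Ideal.span_le, Set.singleton_subset_iff]
    exact Ideal.pow_mem_of_mem _ hy 2 two_pos
  · rw [← h0] at hy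
    obtain ⟨a, ha⟩ := Ideal.mem_span_singleton'.mp hy
    have h4 := congr(χ $ha)
    rw [map_mul, map_pow, hb] at h4
    refine ht2 ?_
    linear_combination - t * h4 + (χ a * (1 + t * b) ^ 2 - b) * ht

lemma length_le_two_of_sum (hρ : ρ ch.δ = 0) (hvp : v p = 1)
    (hvw : ∀ i j, (ch.matrixAt ρ).adjugate i j = v i * w j)
    (hc : ∑ i, w i * taylor (ch.constants ρ) (ch.coords ρ) 0 v (ch.G i) ≠ 0) :
    Module.length O O ≤ 2 := by
  set M := maximalIdeal O
  set J := ch.matrixAt ρ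
  have hJ : J.det = 0 := by rw [det_jacobianMatrix, ch.eval₂_coords]; exact hρ
  let ζ : ch.Idx → O := fun j ↦ θ (ch.π (X j)) - κ (ρ (ch.π (X j)))
  have hM : M = Ideal.span (Set.range ζ) := h.maximalIdeal_eq
  have hζ : ∀ j, ζ j ∈ M := fun j ↦ h.sub_mem _
  -- the equations
  have hG : ∀ i, ∑ j, κ (J i j) * ζ j +
      taylor (ch.constants (κ.comp ρ)) (ch.coords (κ.comp ρ)) 1 ζ (ch.G i) = 0 := by
    intro i
    have h1 := taylor_spec (ch.constants (κ.comp ρ)) (ch.coords (κ.comp ρ)) 1 ζ (ch.G i)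
    have h2 : ch.coords (κ.comp ρ) + (1 : O) • ζ = ch.coords θ := by
      ext j
      rw [one_smul]
      exact add_sub_cancel _ _
    have h3 : ch.constants (κ.comp ρ) = ch.constants θ := by
      have h6 : (κ.comp ρ).comp (f.comp c) = θ.comp (f.comp c) := by
        rw [← comp_assoc, ← comp_assoc, h.comp_eq]; rfl
      rw [← ch.π_C] at h6
      exact h6
    rw [h2, ch.eval₂_coords (κ.comp ρ)] at h1
    rw [h3, ch.eval₂_coords θ, ← h3] at h1
    have h4 : θ (ch.π (ch.G i)) = (κ.comp ρ) (ch.π (ch.G i)) := by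
      rcases i with i | i
      · rw [ch.π_inl, map_zero, map_zero]
      · rw [ch.π_G]; exact congr($(h.comp_eq) _)
    rw [h4] at h1
    have h5 : ∑ j, κ (J i j) * ζ j = ∑ j, eval₂ (ch.constants (κ.comp ρ)) (ch.coords (κ.comp ρ))
        (pderiv j (ch.G i)) * ζ j := Finset.sum_congr rfl fun j _ ↦ by
      congr 1
      exact map_eval₂ _ _ _ _
    rw [h5]
    linear_combination - h1
  have htay : ∀ i, taylor (ch.constants (κ.comp ρ)) (ch.coords (κ.comp ρ)) 1 ζ (ch.G i) ∈ M * M := by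
    intro i
    have h1 := eval₂_sub_mem_sq (ch.constants (κ.comp ρ)) (ch.coords (κ.comp ρ)) (-ζ) M (fun j ↦ Submodule.neg_mem _ (hζ j))
      (ch.G i)
    have h2 := taylor_spec (ch.constants (κ.comp ρ)) (ch.coords (κ.comp ρ)) 1 ζ (ch.G i)
    rw [one_smul] at h2
    rw [sub_neg_eq_add, h2, pow_two] at h1
    simp only [Pi.neg_apply, mul_neg, Finset.sum_neg_distrib] at h1
    convert h1 using 1
    ring
  obtain ⟨q, hq⟩ : ∃ q, w q ≠ 0 := by
    by_contra! h0
    exact hc (Finset.sum_eq_zero fun i _ ↦ by rw [h0, zero_mul])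
  have hv : J *ᵥ v = 0 := by
    ext i
    have h1 := congr($(J.mul_adjugate) i q)
    rw [hJ, zero_smul, mul_apply] at h1
    simp only [hvw, ← mul_assoc, ← Finset.sum_mul] at h1
    exact (mul_eq_zero_iff_right hq).mp h1
  have hlin : ∀ j, ζ j - κ (v j) * ζ p ∈ M * M := by
    let A := J.updateRow q (Pi.single p 1)
    have hA : IsUnit A := isUnit_updateRow hvp hvw hq
    have h1 : ∀ i, ((A.map κ) *ᵥ fun j ↦ ζ j - κ (v j) * ζ p) i ∈ M * M := by
      intro i
      by_cases hi : i = q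
      · subst hi
        have : ((A.map κ) *ᵥ fun j ↦ ζ j - κ (v j) * ζ p) i = ζ p - κ (v p) * ζ p := by
          have h5 : (fun j ↦ A.map κ i j) = Pi.single p 1 := by
            ext j
            change κ (J.updateRow i (Pi.single p 1) i j) = _
            rw [updateRow_self]
            by_cases hj : j = p
            · subst hj; simp
            · simp [hj]
          rw [mulVec, h5, single_one_dotProduct]
        rw [this, hvp, map_one, one_mul, sub_self]
        exact zero_mem _
      · have h5 : ((A.map κ) *ᵥ fun j ↦ ζ j - κ (v j) * ζ p) i =
            ∑ j, κ (J i j) * ζ j - κ ((J *ᵥ v) i) * ζ p := by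
          simp only [mulVec, dotProduct, map_apply, A, updateRow_ne hi, map_sum, map_mul,
            Finset.sum_mul, mul_sub, Finset.sum_sub_distrib]
          congr 1
          exact Finset.sum_congr rfl fun j _ ↦ by ring
        rw [h5, hv, Pi.zero_apply, map_zero, zero_mul, sub_zero, eq_neg_of_add_eq_zero_left (hG i)]
        exact Submodule.neg_mem _ (htay i)
    intro j
    have h2 : (A⁻¹.map κ) *ᵥ ((A.map κ) *ᵥ fun j ↦ ζ j - κ (v j) * ζ p) =
        fun j ↦ ζ j - κ (v j) * ζ p := by
      rw [mulVec_mulVec, ← Matrix.map_mul, nonsing_inv_mul _ ((isUnit_iff_isUnit_det _).mp hA),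
        Matrix.map_one _ (map_zero κ) (map_one κ), one_mulVec]
    rw [← congrFun h2 j]
    rw [mulVec, dotProduct]
    exact Ideal.sum_mem _ fun i _ ↦ Ideal.mul_mem_left _ (A⁻¹.map κ j i) (h1 i)
  have hMy : M = Ideal.span {ζ p} := by
    refine le_antisymm ?_ (by rw [Ideal.span_le, Set.singleton_subset_iff]; exact hζ p)
    refine Submodule.le_of_le_smul_of_le_jacobson_bot (I := M) ?_
      (IsLocalRing.jacobson_eq_maximalIdeal ⊥ bot_ne_top).ge ?_
    · rw [hM]; exact ⟨(Set.finite_range ζ).toFinset, by simp⟩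
    · conv_lhs => rw [hM]
      rw [Ideal.span_le]
      rintro _ ⟨j, rfl⟩
      rw [← sub_add_cancel (ζ j) (κ (v j) * ζ p), add_comm]
      exact Submodule.add_mem_sup (Ideal.mul_mem_left _ _ (Ideal.mem_span_singleton_self _))
        (hlin j)
  refine Newton.length_le_two hMy ?_
  have hz : ∀ j, ∃ z, ζ j = ζ p * (κ (v j) + ζ p * z) := fun j ↦ by
    have h1 := hlin j
    rw [hMy, Ideal.span_singleton_mul_span_singleton] at h1
    obtain ⟨z, hz⟩ := Ideal.mem_span_singleton'.mp h1
    exact ⟨z, by linear_combination -hz⟩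
  choose z hz using hz
  have hsum : ∑ i, κ (w i) * taylor (ch.constants (κ.comp ρ)) (ch.coords (κ.comp ρ)) 1 ζ (ch.G i)
      = 0 := by
    have h1 : ∑ i, κ (w i) * (∑ j, κ (J i j) * ζ j) = 0 := by
      simp only [Finset.mul_sum]
      rw [Finset.sum_comm]
      refine Finset.sum_eq_zero fun j _ ↦ ?_
      have h5 := sum_mul_mulVec_eq_zero hJ hvp hvw (Pi.single j 1)
      simp only [mulVec_single_one, col_apply] at h5
      simp only [← mul_assoc, ← map_mul, ← Finset.sum_mul, ← map_sum, h5, map_zero, zero_mul]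
    have h2 : ∑ i, κ (w i) * (∑ j, κ (J i j) * ζ j +
      taylor (ch.constants (κ.comp ρ)) (ch.coords (κ.comp ρ)) 1 ζ (ch.G i)) = 0 :=
      Finset.sum_eq_zero fun i _ ↦ by rw [hG, mul_zero]
    simpa only [mul_add, Finset.sum_add_distrib, h1, zero_add] using h2
  have htay' : ∀ i, ∃ b, taylor (ch.constants (κ.comp ρ)) (ch.coords (κ.comp ρ)) 1 ζ (ch.G i) =
      ζ p ^ 2 * (κ (taylor (ch.constants ρ) (ch.coords ρ) 0 v (ch.G i)) + b * ζ p) := by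
    intro i
    obtain ⟨b, hb⟩ := Ideal.mem_span_singleton'.mp (ch.taylor_sub_mem (ρ := ρ) κ (ζ p) v z i)
    refine ⟨b, ?_⟩
    set ξ : ch.Idx → O := fun j ↦ κ (v j) + ζ p * z j
    have hξ : ζ = ζ p • ξ := funext hz
    have h1 := taylor_spec (ch.constants (κ.comp ρ)) (ch.coords (κ.comp ρ)) 1 (ζ p • ξ) (ch.G i)
    have h2 := taylor_spec (ch.constants (κ.comp ρ)) (ch.coords (κ.comp ρ)) (ζ p) ξ (ch.G i)
    rw [one_smul, h2] at h1
    simp only [Pi.smul_apply, smul_eq_mul, mul_left_comm _ (ζ p), ← Finset.mul_sum, one_mul,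
      one_pow] at h1
    rw [← hξ] at h1
    rw [hb]
    linear_combination - h1
  choose b hb using htay'
  simp only [hb] at hsum
  have h5 : ζ p * ζ p * (κ (∑ i, w i * taylor (ch.constants ρ) (ch.coords ρ) 0 v (ch.G i)) +
      ζ p * ∑ i, κ (w i) * b i) = 0 := by
    rw [← hsum, map_sum, Finset.mul_sum, ← Finset.sum_add_distrib, Finset.mul_sum]
    refine Finset.sum_congr rfl fun i _ ↦ ?_
    rw [map_mul]; ring
  refine (IsUnit.mul_left_eq_zero ?_).mp h5
  have h6 : ζ p * ∑ i, κ (w i) * b i ∈ M := Ideal.mul_mem_right _ _ (hζ p)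
  by_contra hnu
  have h7 : κ (∑ i, w i * taylor (ch.constants ρ) (ch.coords ρ) 0 v (ch.G i)) ∈ M := by
    have := Submodule.sub_mem _ ((IsLocalRing.mem_maximalIdeal _).mpr hnu) h6
    rwa [add_sub_cancel_right] at this
  exact h7 ((isUnit_iff_ne_zero.mpr hc).map κ)

end IsFiberRing

end Multiplicity

section FiberShape

open MvPolynomial Matrix

variable {k B R K : Type u} [Field k] [CommRing B] [CommRing R] [Field K] {c : k →+* B}
  {f : B →+* R} (ch : NewtonChart c f) (r : ℕ) (ρ : R →+* K)

namespace NewtonChart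

/-- The points of the fibre of the Newton groupoid at `ρ` are given by their coordinates `t`, `η`,
subject to the equation `t + c₀ t² = ∑ hᵢ ηᵢ` and with `1 + 2 c₀ t` invertible. -/
structure FiberShape (c₀ : K) (h : Fin ch.n → K) (l : ch.Idx → K) : Prop where
  eq : ∀ {S : Type u} [CommRing S] (κ : K →+* S) (ξ : ch.Idx → S) (η : Fin ch.n → S),
    ch.eqAt r (κ.comp ρ) ξ η = 0 →
    ∑ j, κ (l j) * ξ j + κ c₀ * (∑ j, κ (l j) * ξ j) ^ 2 = ∑ i, κ (h i) * η i
  unit : ∀ {S : Type u} [CommRing S] (κ : K →+* S) (ξ : ch.Idx → S) (η : Fin ch.n → S),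
    ch.eqAt r (κ.comp ρ) ξ η = 0 →
    ch.unitAt r (κ.comp ρ) ξ = 1 + 2 * κ c₀ * ∑ j, κ (l j) * ξ j
  inj : ∀ {S : Type u} [CommRing S] (κ : K →+* S) (ξ ξ' : ch.Idx → S)
    (η : Fin ch.n → S), ch.eqAt r (κ.comp ρ) ξ η = 0 → ch.eqAt r (κ.comp ρ) ξ' η = 0 →
    ∑ j, κ (l j) * ξ j = ∑ j, κ (l j) * ξ' j → ξ = ξ'
  surj : ∀ {S : Type u} [CommRing S] (κ : K →+* S) (t : S) (η : Fin ch.n → S),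
    t + κ c₀ * t ^ 2 = ∑ i, κ (h i) * η i →
    ∃ ξ : ch.Idx → S, ch.eqAt r (κ.comp ρ) ξ η = 0 ∧ ∑ j, κ (l j) * ξ j = t
  eq_two_or : r = 2 ∨ c₀ = 0 ∧ l = 0

variable {r ρ}

lemma jacobianMatrix_comp {S : Type u} [CommRing S] (κ : K →+* S) :
    jacobianMatrix ch.G (ch.constants (κ.comp ρ)) (ch.coords (κ.comp ρ)) = (ch.matrixAt ρ).map κ :=
  (map_jacobianMatrix ch.G κ (ch.constants ρ) (ch.coords ρ)).symm

lemma adjugate_jacobianMatrix_comp {S : Type u} [CommRing S] (κ : K →+* S) :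
    (jacobianMatrix ch.G (ch.constants (κ.comp ρ)) (ch.coords (κ.comp ρ))).adjugate =
      (ch.matrixAt ρ).adjugate.map κ := by
  rw [jacobianMatrix_comp, ← RingHom.mapMatrix_apply, ← RingHom.map_adjugate]; rfl

variable (hρ : ρ ch.δ = 0)
include hρ

lemma eval₂_jacobian_comp {S : Type u} [CommRing S] (κ : K →+* S) :
    eval₂ (ch.constants (κ.comp ρ)) (ch.coords (κ.comp ρ)) (jacobian ch.G) = 0 := by
  rw [eval₂_coords_jacobian, RingHom.comp_apply, hρ, map_zero]

lemma fiberShape_of_adjugate (h : 3 ≤ r ∨ 2 ≤ r ∧ (ch.matrixAt ρ).adjugate = 0) :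
    ch.FiberShape r ρ 0 0 0 := by
  have h' : ∀ {S : Type u} [CommRing S] (κ : K →+* S), 3 ≤ r ∨ 2 ≤ r ∧
      (jacobianMatrix ch.G (ch.constants (κ.comp ρ)) (ch.coords (κ.comp ρ))).adjugate = 0 := by
    intro S _ κ
    refine h.imp id (And.imp id fun h0 ↦ ?_)
    rw [adjugate_jacobianMatrix_comp, h0]
    ext; simp
  have heq : ∀ {S : Type u} [CommRing S] (κ : K →+* S) (ξ η), ch.eqAt r (κ.comp ρ) ξ η =
      ξ - (jacobianMatrix ch.G (ch.constants (κ.comp ρ)) (ch.coords (κ.comp ρ))).adjugate *ᵥ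
        Sum.elim (fun _ ↦ 0) η := fun κ ξ η ↦
    newtonEq_of_adjugate ch.G (ch.eval₂_jacobian_comp hρ κ) (h' κ) ξ η
  refine ⟨fun κ ξ η _ ↦ by simp, fun κ ξ η he ↦ ?_, fun κ ξ ξ' η he he' _ ↦ ?_, fun κ t η ht ↦ ?_,
    .inr ⟨rfl, rfl⟩⟩
  · rw [unitAt, newtonUnit_of_adjugate ch.G (ch.eval₂_jacobian_comp hρ κ) (h' κ) he]
    simp
  · rw [heq, sub_eq_zero] at he he'
    rw [he, he']
  · refine ⟨_, by rw [heq, sub_self], ?_⟩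
    simpa using ht.symm

variable {v w : ch.Idx → K} {p : ch.Idx} (hvp : v p = 1)
  (hvw : ∀ i j, (ch.matrixAt ρ).adjugate i j = v i * w j) (hv : ch.matrixAt ρ *ᵥ v = 0)
include hvp hvw hv

lemma fiberShape_two : ch.FiberShape 2 ρ
    (∑ i, w i * taylor (ch.constants ρ) (ch.coords ρ) 0 v (ch.G i)) (w ∘ Sum.inr)
    (Pi.single p 1) := by
  set c₀ := ∑ i, w i * taylor (ch.constants ρ) (ch.coords ρ) 0 v (ch.G i)
  have hsum : ∀ {S : Type u} [CommRing S] (κ : K →+* S) (ξ : ch.Idx → S),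
      ∑ j, κ ((Pi.single p 1 : ch.Idx → K) j) * ξ j = ξ p := by
    intro S _ κ ξ
    rw [Finset.sum_eq_single p (fun j _ hj ↦ by rw [Pi.single_eq_of_ne hj, map_zero, zero_mul])
      (by simp), Pi.single_eq_same, map_one, one_mul]
  have hvw' : ∀ {S : Type u} [CommRing S] (κ : K →+* S) (i j),
      (jacobianMatrix ch.G (ch.constants (κ.comp ρ)) (ch.coords (κ.comp ρ))).adjugate i j =
        (κ ∘ v) i * (κ ∘ w) j := by
    intro S _ κ i j
    rw [adjugate_jacobianMatrix_comp, map_apply, hvw, map_mul]; rfl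
  have hvp' : ∀ {S : Type u} [CommRing S] (κ : K →+* S), (κ ∘ v) p = 1 := fun κ ↦ by
    rw [Function.comp_apply, hvp, map_one]
  have hv' : ∀ {S : Type u} [CommRing S] (κ : K →+* S),
      jacobianMatrix ch.G (ch.constants (κ.comp ρ)) (ch.coords (κ.comp ρ)) *ᵥ (κ ∘ v) = 0 := by
    intro S _ κ
    rw [jacobianMatrix_comp]
    ext i
    rw [← RingHom.map_mulVec, hv]; simp
  have hc' : ∀ {S : Type u} [CommRing S] (κ : K →+* S), ∑ i, (κ ∘ w) i *
      taylor (ch.constants (κ.comp ρ)) (ch.coords (κ.comp ρ)) 0 (κ ∘ v) (ch.G i) = κ c₀ := by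
    intro S _ κ
    rw [map_sum]
    refine Finset.sum_congr rfl fun i _ ↦ ?_
    rw [map_mul, map_taylor, map_zero]; rfl
  have key : ∀ {S : Type u} [CommRing S] (κ : K →+* S) (ξ : ch.Idx → S) (η),
      ch.eqAt 2 (κ.comp ρ) ξ η = 0 → ξ = ξ p • (κ ∘ v) := fun κ ξ η he ↦
    eq_smul_of_newtonEq_two ch.G (ch.eval₂_jacobian_comp hρ κ) (hvp' κ) (hvw' κ) he
  refine ⟨fun κ ξ η he ↦ ?_, fun κ ξ η he ↦ ?_, fun κ ξ ξ' η he he' ht ↦ ?_, fun κ t η ht ↦ ?_,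
    .inl rfl⟩
  · rw [hsum]
    rw [key κ ξ η he, eqAt, newtonEq_two_smul ch.G (ch.eval₂_jacobian_comp hρ κ) (hvp' κ) (hvw' κ),
      hc'] at he
    exact he
  · rw [hsum]
    conv_lhs => rw [key κ ξ η he]
    rw [unitAt, newtonUnit_two_smul ch.G (ch.eval₂_jacobian_comp hρ κ) (hvp' κ) (hv' κ) (hvw' κ), hc']
  · rw [hsum, hsum] at ht
    rw [key κ ξ η he, key κ ξ' η he', ht]
  · refine ⟨t • (κ ∘ v), ?_, ?_⟩
    · rw [eqAt, newtonEq_two_smul ch.G (ch.eval₂_jacobian_comp hρ κ) (hvp' κ) (hvw' κ), hc']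
      exact ht
    · rw [hsum, Pi.smul_apply, hvp', smul_eq_mul, mul_one]

end NewtonChart

section Smoothness

variable {ι σ : Type*} [Fintype ι] [Fintype σ] [DecidableEq ι] [DecidableEq σ]

/-- The first rows of a square matrix of corank one are linearly independent if and only if the
relation between all rows involves one of the other rows. -/
lemma linearIndependent_inl_iff {J : Matrix (ι ⊕ σ) (ι ⊕ σ) K} (hJ : J.det = 0)
    {v w : ι ⊕ σ → K} {p : ι ⊕ σ} (hvp : v p = 1)
    (hvw : ∀ i j, J.adjugate i j = v i * w j) (hw : w ≠ 0) :
    LinearIndependent K (fun i ↦ J (Sum.inl i)) ↔ w ∘ Sum.inr ≠ 0 := by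
  have hrel : ∀ j, ∑ i, w i * J i j = 0 := fun j ↦ by
    have := sum_mul_mulVec_eq_zero hJ hvp hvw (Pi.single j 1)
    simpa only [mulVec_single_one, col_apply] using this
  constructor
  · intro hli h0
    refine hw ?_
    have h1 := Fintype.linearIndependent_iff.mp hli (w ∘ Sum.inl) (by
      ext j
      have := hrel j
      rw [Fintype.sum_sum_type, Finset.sum_eq_zero (s := (Finset.univ : Finset σ))
        (fun i _ ↦ by rw [show w (Sum.inr i) = 0 from congrFun h0 i, zero_mul]), add_zero] at this
      simpa using this)
    ext (i | i)
    exacts [h1 i, congrFun h0 i]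
  · intro h0
    rw [Fintype.linearIndependent_iff]
    intro g hg
    let x : ι ⊕ σ → K := Sum.elim g 0
    have hx : Jᵀ *ᵥ x = 0 := by
      ext j
      have := congrFun hg j
      rw [mulVec, dotProduct, Fintype.sum_sum_type]
      simp only [x, Sum.elim_inl, Sum.elim_inr, Pi.zero_apply, mul_zero, Finset.sum_const_zero,
        add_zero, transpose_apply]
      simpa [mul_comm] using this
    obtain ⟨i₀, hi₀⟩ := Function.ne_iff.mp h0
    have hadj : Jᵀ.adjugate (Sum.inr i₀) p ≠ 0 := by
      rw [← adjugate_transpose, transpose_apply, hvw, hvp, one_mul]; exact hi₀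
    have := eq_zero_of_adjugate_ne_zero hadj hx rfl
    exact fun i ↦ congrFun this (Sum.inl i)

end Smoothness

/-- The shape of the fibre of the Newton groupoid and its relation to the multiplicity. -/
lemma NewtonChart.exists_fiberShape (hr : 2 ≤ r) (hρ : ρ ch.δ = 0) {O : Type u} [CommRing O]
    [IsLocalRing O] {θ : R →+* O} {κ : K →+* O} (hO : IsFiberRing f ρ θ κ) :
    ∃ (c₀ : K) (h : Fin ch.n → K) (l : ch.Idx → K), ch.FiberShape r ρ c₀ h l ∧
      (c₀ = 0 ↔ 3 ≤ r ∨ 3 ≤ Module.length O O) ∧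
      (c₀ ≠ 0 → (LinearIndependent K (fun i ↦ ch.matrixAt ρ (Sum.inl i)) ↔ h ≠ 0)) := by
  by_cases h : 3 ≤ r ∨ 2 ≤ r ∧ (ch.matrixAt ρ).adjugate = 0
  · refine ⟨0, 0, 0, ch.fiberShape_of_adjugate hρ h, ⟨fun _ ↦ h.imp id fun h0 ↦ ?_, fun _ ↦ rfl⟩,
      fun h0 ↦ absurd rfl h0⟩
    exact hO.three_le_length_of_adjugate hρ h0.2
  · push Not at h
    obtain rfl : r = 2 := by omega
    have hadj := h.2 le_rfl
    have hJ : (ch.matrixAt ρ).det = 0 := by rw [det_jacobianMatrix, ch.eval₂_coords]; exact hρ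
    obtain ⟨v, w, p, hvp, hvw, -⟩ := exists_adjugate_eq_vecMulVec hJ hadj
    have hw : w ≠ 0 := by
      rintro rfl
      exact hadj (Matrix.ext fun i j ↦ by rw [hvw, Pi.zero_apply, mul_zero]; rfl)
    obtain ⟨q, hq⟩ := Function.ne_iff.mp hw
    have hv : ch.matrixAt ρ *ᵥ v = 0 := by
      ext i
      have h1 := congr($((ch.matrixAt ρ).mul_adjugate) i q)
      rw [hJ, zero_smul, mul_apply] at h1
      simp only [hvw, ← mul_assoc, ← Finset.sum_mul] at h1
      exact (mul_eq_zero_iff_right hq).mp h1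
    refine ⟨_, _, _, ch.fiberShape_two hρ hvp hvw hv, ⟨fun h0 ↦ .inr ?_, fun h0 ↦ ?_⟩, fun _ ↦ ?_⟩
    · exact hO.three_le_length_of_sum hρ hvp hvw hw hv h0
    · by_contra hc
      have h2 := hO.length_le_two_of_sum hρ hvp hvw hc
      rcases h0 with h0 | h0
      · omega
      · exact absurd (h0.trans h2) (by decide)
    · exact linearIndependent_inl_iff hJ hvp hvw hw

end FiberShape

section Idempotents

variable {T : Scheme.{u}}

lemma germ_eq_one_of_mem {e : Γ(T, ⊤)} (he : IsIdempotentElem e) {x : T} (hx : x ∈ T.basicOpen e) :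
    T.presheaf.germ ⊤ x trivial e = 1 := by
  have h := (T.mem_basicOpen_top e x).mp hx
  have h2 : T.presheaf.germ ⊤ x trivial e * T.presheaf.germ ⊤ x trivial e =
      T.presheaf.germ ⊤ x trivial e * 1 := by rw [← map_mul, he.eq, mul_one]
  exact h.mul_left_cancel h2

lemma germ_eq_zero_of_notMem {e : Γ(T, ⊤)} (he : IsIdempotentElem e) {x : T}
    (hx : x ∉ T.basicOpen e) : T.presheaf.germ ⊤ x trivial e = 0 := by
  have h := fun h ↦ hx ((T.mem_basicOpen_top e x).mpr h)
  have h2 : IsUnit (1 - T.presheaf.germ ⊤ x trivial e) := by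
    by_contra h3
    have := IsLocalRing.nonunits_add h3 h
    rw [sub_add_cancel] at this
    exact this isUnit_one
  refine h2.mul_right_eq_zero.mp ?_
  rw [sub_mul, one_mul, ← map_mul, he.eq, sub_self]

lemma isClopen_basicOpen {e : Γ(T, ⊤)} (he : IsIdempotentElem e) :
    IsClopen (T.basicOpen e : Set T) := by
  refine ⟨⟨?_⟩, (T.basicOpen e).isOpen⟩
  convert (T.basicOpen (1 - e)).isOpen using 1
  ext x
  rw [Set.mem_compl_iff, SetLike.mem_coe, SetLike.mem_coe, T.mem_basicOpen_top (1 - e)]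
  rw [map_sub, map_one]
  constructor
  · intro h
    rw [germ_eq_zero_of_notMem he h, sub_zero]; exact isUnit_one
  · intro h hx
    rw [germ_eq_one_of_mem he hx, sub_self] at h
    exact not_isUnit_zero h

open Classical in
/-- The locally constant function with values `0`, `1` given by an idempotent. -/
def idempotentFunction (e : Γ(T, ⊤)) (he : IsIdempotentElem e) : LocallyConstant T (ZMod 2) :=
  LocallyConstant.charFn _ (isClopen_basicOpen he)

lemma eq_of_forall_germ {e e' : Γ(T, ⊤)}
    (h : ∀ x, T.presheaf.germ ⊤ x trivial e = T.presheaf.germ ⊤ x trivial e') : e = e' :=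
  TopCat.Presheaf.section_ext T.sheaf ⊤ e e' fun x _ ↦ h x

lemma idempotentFunction_injective {e e' : Γ(T, ⊤)} (he : IsIdempotentElem e)
    (he' : IsIdempotentElem e') (h : idempotentFunction e he = idempotentFunction e' he') :
    e = e' := by
  have h1 : ∀ x, x ∈ T.basicOpen e ↔ x ∈ T.basicOpen e' := fun x ↦
    Set.ext_iff.mp (LocallyConstant.charFn_inj _ _ _ h) x
  refine eq_of_forall_germ fun x ↦ ?_
  by_cases hx : x ∈ T.basicOpen e
  · rw [germ_eq_one_of_mem he hx, germ_eq_one_of_mem he' ((h1 x).mp hx)]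
  · rw [germ_eq_zero_of_notMem he hx, germ_eq_zero_of_notMem he' (mt (h1 x).mpr hx)]

lemma exists_idempotentFunction (g : LocallyConstant T (ZMod 2)) :
    ∃ (e : Γ(T, ⊤)) (he : IsIdempotentElem e), idempotentFunction e he = g := by
  let V : ZMod 2 → T.Opens := fun i ↦ ⟨g ⁻¹' {i}, g.isLocallyConstant.isOpen_fiber i⟩
  let s : ∀ i, Γ(T, V i) := fun i ↦ if i = 0 then 0 else 1
  obtain ⟨e, he⟩ : ∃ e : Γ(T, ⊤), ∀ i, T.presheaf.map (homOfLE (le_top : V i ≤ ⊤)).op e = s i := by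
    obtain ⟨e, he, -⟩ := T.sheaf.existsUnique_gluing' V ⊤ (fun i ↦ homOfLE le_top)
      (fun x _ ↦ TopologicalSpace.Opens.mem_iSup.mpr ⟨g x, rfl⟩) s (by
      intro i j
      by_cases h : i = j
      · subst h; rfl
      · have h1 : V i ⊓ V j = ⊥ := by
          ext x
          simp only [V, TopologicalSpace.Opens.coe_inf, Set.mem_inter_iff,
            TopologicalSpace.Opens.coe_bot, Set.mem_empty_iff_false, iff_false]
          rintro ⟨h1, h2⟩
          exact h (h1.symm.trans h2)
        have : Subsingleton Γ(T, V i ⊓ V j) := by rw [h1]; infer_instance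
        exact @Subsingleton.elim _ this _ _)
    exact ⟨e, he⟩
  have hg : ∀ x, T.presheaf.germ ⊤ x trivial e = if g x = 0 then 0 else 1 := by
    intro x
    have hx : x ∈ V (g x) := rfl
    have h1 := congr(T.presheaf.germ (V (g x)) x hx $(he (g x)))
    have h2 := T.presheaf.germ_res_apply (homOfLE (le_top : V (g x) ≤ ⊤)) x hx e
    rw [← h2]
    refine h1.trans ?_
    by_cases h : g x = 0
    · rw [if_pos h]; simp only [s]; rw [if_pos h, map_zero]
    · rw [if_neg h]; simp only [s]; rw [if_neg h, map_one]
  have he' : IsIdempotentElem e := eq_of_forall_germ fun x ↦ by rw [map_mul, hg]; split_ifs <;> simp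
  refine ⟨e, he', LocallyConstant.ext fun x ↦ ?_⟩
  have h2 : ∀ a : ZMod 2, a ≠ 0 → a = 1 := by decide
  by_cases h : g x = 0
  · rw [h]
    refine (LocallyConstant.charFn_eq_zero _ _ _).mpr fun hx ↦ ?_
    have := germ_eq_one_of_mem he' hx
    rw [hg, if_pos h] at this
    exact zero_ne_one this
  · rw [h2 _ h]
    refine (LocallyConstant.charFn_eq_one _ _ _).mpr ?_
    rw [SetLike.mem_coe, T.mem_basicOpen_top, hg, if_neg h]
    exact isUnit_one

lemma idempotentFunction_add {e e' e'' : Γ(T, ⊤)} (he : IsIdempotentElem e)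
    (he' : IsIdempotentElem e') (he'' : IsIdempotentElem e'') (h : e'' = e + (1 - 2 * e) * e') :
    idempotentFunction e'' he'' = idempotentFunction e he + idempotentFunction e' he' := by
  classical
  ext x
  have key : ∀ {a : Γ(T, ⊤)} (ha : IsIdempotentElem a),
      idempotentFunction a ha x = if T.presheaf.germ ⊤ x trivial a = 0 then 0 else 1 := by
    intro a ha
    by_cases hx : x ∈ T.basicOpen a
    · rw [if_neg (by rw [germ_eq_one_of_mem ha hx]; exact one_ne_zero)]
      exact (LocallyConstant.charFn_eq_one _ _ _).mpr hx
    · rw [if_pos (germ_eq_zero_of_notMem ha hx)]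
      exact (LocallyConstant.charFn_eq_zero _ _ _).mpr hx
  have dich : ∀ {a : Γ(T, ⊤)}, IsIdempotentElem a →
      T.presheaf.germ ⊤ x trivial a = 0 ∨ T.presheaf.germ ⊤ x trivial a = 1 := by
    intro a ha
    by_cases hx : x ∈ T.basicOpen a
    · exact .inr (germ_eq_one_of_mem ha hx)
    · exact .inl (germ_eq_zero_of_notMem ha hx)
  rw [LocallyConstant.coe_add, Pi.add_apply, key, key, key, h]
  simp only [map_add, map_mul, map_sub, map_one, map_ofNat]
  rcases dich he with h1 | h1 <;> rcases dich he' with h2 | h2 <;> rw [h1, h2]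
  · simp
  · simp
  · simp
  · rw [if_pos (by ring), if_neg one_ne_zero]; rfl

lemma idempotentFunction_comap {T' : Scheme.{u}} (f : T' ⟶ T) {e : Γ(T, ⊤)} (he : IsIdempotentElem e)
    {e' : Γ(T', ⊤)} (he' : IsIdempotentElem e') (h : e' = f.appTop e) (x : T') :
    idempotentFunction e' he' x = idempotentFunction e he (f x) := by
  have h1 : x ∈ T'.basicOpen e' ↔ f x ∈ T.basicOpen e := by
    subst h
    have := f.preimage_basicOpen_top e
    rw [← this]; rfl
  by_cases hx : x ∈ T'.basicOpen e'
  · exact ((LocallyConstant.charFn_eq_one _ _ _).mpr hx).trans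
      ((LocallyConstant.charFn_eq_one _ _ _).mpr (h1.mp hx)).symm
  · exact ((LocallyConstant.charFn_eq_zero _ _ _).mpr hx).trans
      ((LocallyConstant.charFn_eq_zero _ _ _).mpr (mt h1.mpr hx)).symm

end Idempotents

section GroupFunctors

lemma nonempty_iso_of_bijective {C : Type*} [Category* C] {L F : C ⥤ GrpCat.{u}}
    (ψ : ∀ T, L.obj T →* F.obj T) (nat : ∀ {T T'} (g : T ⟶ T') a, ψ T' (L.map g a) = F.map g (ψ T a))
    (hψ : ∀ T, Bijective (ψ T)) : Nonempty (L ≅ F) :=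
  ⟨NatIso.ofComponents (fun T ↦ MulEquiv.toGrpIso (MulEquiv.ofBijective (ψ T) (hψ T)))
    fun g ↦ GrpCat.hom_ext <| MonoidHom.ext fun a ↦ nat g a⟩

lemma hasGroupFunctor_fiberGroup {X Γ Z : Scheme.{u}} {p₁ p₂ : Γ ⟶ X} (G : GroupoidOn p₁ p₂)
    (z : Z ⟶ X) (h : fst p₁ z ≫ p₂ = fst p₁ z ≫ p₁) {F : (Over Z)ᵒᵖ ⥤ GrpCat.{u}}
    (hF : Nonempty (G.loopsFunctor z ≅ F)) : HasGroupFunctor (G.fiberGroup z h) F :=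
  hF.map fun e ↦ yonedaGrpObjIsoOfRepresentableBy _ _ (G.fiberRepresentableBy z h) ≪≫ e

variable {S : Scheme.{u}} {K : Type u} [Field K]

/-- Coordinates `t`, `η` on a group functor, subject to the equation `t + c₀ t² = ∑ hᵢ ηᵢ`, in which
`(t, η) (t', η') = (t + u t', η + u² η')` for `u = 1 + 2 c₀ t`. -/
structure QuadraticCoordinates (L : (Over S)ᵒᵖ ⥤ GrpCat.{u})
    (κ : ∀ T : (Over S)ᵒᵖ, K →+* (globalFunctions S).obj T) (c₀ : K) {n : ℕ} (h : Fin n → K) where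
  t : ∀ T, L.obj T → (globalFunctions S).obj T
  η : ∀ T, L.obj T → Fin n → (globalFunctions S).obj T
  map_κ : ∀ {T T'} (g : T ⟶ T') (x : K), (globalFunctions S).map g (κ T x) = κ T' x
  map_t : ∀ {T T'} (g : T ⟶ T') (a), t T' (L.map g a) = (globalFunctions S).map g (t T a)
  map_η : ∀ {T T'} (g : T ⟶ T') (a i), η T' (L.map g a) i = (globalFunctions S).map g (η T a i)
  eq : ∀ T a, t T a + κ T c₀ * t T a ^ 2 = ∑ i, κ T (h i) * η T a i
  unit : ∀ T a, IsUnit (1 + 2 * κ T c₀ * t T a)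
  inj : ∀ T a b, t T a = t T b → η T a = η T b → a = b
  surj : ∀ T (x : (globalFunctions S).obj T) (y : Fin n → (globalFunctions S).obj T),
    x + κ T c₀ * x ^ 2 = ∑ i, κ T (h i) * y i → IsUnit (1 + 2 * κ T c₀ * x) →
    ∃ a, t T a = x ∧ η T a = y
  mul_t : ∀ T a b, t T (a * b) = t T a + (1 + 2 * κ T c₀ * t T a) * t T b
  mul_η : ∀ T a b i, η T (a * b) i = η T a i + (1 + 2 * κ T c₀ * t T a) ^ 2 * η T b i

namespace QuadraticCoordinates

variable {L : (Over S)ᵒᵖ ⥤ GrpCat.{u}} {κ : ∀ T : (Over S)ᵒᵖ, K →+* (globalFunctions S).obj T}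
  {c₀ : K} {n : ℕ} {h : Fin n → K} (Q : QuadraticCoordinates L κ c₀ h)
include Q

lemma nonempty_iso_gaPow_of_eq_zero (hc : c₀ = 0) : Nonempty (L ≅ GaPow S n) := by
  subst hc
  have ht : ∀ T a, Q.t T a = ∑ i, κ T (h i) * Q.η T a i := fun T a ↦ by
    have := Q.eq T a
    rwa [map_zero, zero_mul, add_zero] at this
  refine nonempty_iso_of_bijective (fun T ↦ MonoidHom.mk'
    (fun a ↦ (ofAdd (Q.η T a) : (GaPow S n).obj T)) fun a b ↦ ?_) (fun g a ↦ ?_)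
    fun T ↦ ⟨fun a b hab ↦ ?_, fun y ↦ ?_⟩
  · refine congrArg ofAdd (funext fun i ↦ ?_)
    rw [Q.mul_η, map_zero]
    change _ = Q.η T a i + Q.η T b i
    ring
  · exact congrArg ofAdd (funext fun i ↦ Q.map_η g a i)
  · have h1 : Q.η T a = Q.η T b := congrArg toAdd hab
    exact Q.inj T a b (by rw [ht, ht, h1]) h1
  · obtain ⟨a, -, ha⟩ := Q.surj T _ (toAdd y) (by
      rw [map_zero, zero_mul, add_zero]) (by rw [map_zero, mul_zero, zero_mul, add_zero]
                                             exact isUnit_one)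
    exact ⟨a, congrArg ofAdd ha⟩

lemma nonempty_iso_gaPow_of_two_eq_zero (h2 : (2 : K) = 0) {i₀ : Fin n} (hi : h i₀ ≠ 0) :
    Nonempty (L ≅ GaPow S n) := by
  have h2' : ∀ T, (2 : (globalFunctions S).obj T) = 0 := fun T ↦ by
    rw [← map_ofNat (κ T) 2, h2, map_zero]
  have hi' : ∀ T, κ T (h i₀) * κ T (h i₀)⁻¹ = 1 := fun T ↦ by
    rw [← map_mul, mul_inv_cancel₀ hi, map_one]
  have hsum : ∀ T (y : Fin n → (globalFunctions S).obj T), ∑ i, κ T (h i) * y i =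
      κ T (h i₀) * y i₀ + ∑ i ∈ Finset.univ \ {i₀}, κ T (h i) * y i := fun T y ↦
    Finset.sum_eq_add_sum_sdiff_singleton_of_mem (Finset.mem_univ _) _
  refine nonempty_iso_of_bijective (fun T ↦ MonoidHom.mk'
    (fun a ↦ (ofAdd (Function.update (Q.η T a) i₀ (Q.t T a)) : (GaPow S n).obj T))
    fun a b ↦ ?_) (fun {T T'} g a ↦ ?_) fun T ↦ ⟨fun a b hab ↦ ?_, fun y ↦ ?_⟩
  · refine congrArg ofAdd (funext fun i ↦ ?_)
    change _ = Function.update (Q.η T a) i₀ (Q.t T a) i + Function.update (Q.η T b) i₀ (Q.t T b) i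
    by_cases hi : i = i₀
    · subst hi
      simp only [Function.update_self, Q.mul_t, h2']
      ring
    · simp only [Function.update_of_ne hi, Q.mul_η, h2']
      ring
  · refine congrArg ofAdd (funext fun i ↦ ?_)
    change _ = (globalFunctions S).map g (Function.update (Q.η T a) i₀ (Q.t T a) i)
    by_cases hi : i = i₀
    · subst hi
      simp only [Function.update_self, Q.map_t]
    · simp only [Function.update_of_ne hi, Q.map_η]
  · have h1 : ∀ i, Function.update (Q.η T a) i₀ (Q.t T a) i =
      Function.update (Q.η T b) i₀ (Q.t T b) i := fun i ↦ congrFun (congrArg toAdd hab) i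
    have ht : Q.t T a = Q.t T b := by simpa using h1 i₀
    have hη : ∀ i ≠ i₀, Q.η T a i = Q.η T b i := fun i hi ↦ by
      simpa [Function.update_of_ne hi] using h1 i
    refine Q.inj T a b ht (funext fun i ↦ ?_)
    by_cases hi : i = i₀
    · subst hi
      have e1 := Q.eq T a
      have e2 := Q.eq T b
      rw [hsum] at e1 e2
      rw [Finset.sum_congr rfl fun l hl ↦ by rw [hη l (by simpa using hl)], ht] at e1
      have e3 : κ T (h i) * Q.η T a i = κ T (h i) * Q.η T b i := by linear_combination e2 - e1
      linear_combination κ T (h i)⁻¹ * e3 + (Q.η T b i - Q.η T a i) * hi' T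
    · exact hη i hi
  · let x := toAdd y i₀
    let z : Fin n → (globalFunctions S).obj T := toAdd y
    have hz : ∀ w, ∑ i ∈ Finset.univ \ {i₀}, κ T (h i) * Function.update z i₀ w i =
        ∑ i ∈ Finset.univ \ {i₀}, κ T (h i) * z i := fun w ↦ Finset.sum_congr rfl fun l hl ↦ by
      rw [Function.update_of_ne (by simpa using hl)]
    obtain ⟨a, hat, haη⟩ := Q.surj T x (Function.update z i₀ (κ T (h i₀)⁻¹ *
      (x + κ T c₀ * x ^ 2 - ∑ i ∈ Finset.univ \ {i₀}, κ T (h i) * z i))) (by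
        rw [hsum, Function.update_self, hz]
        linear_combination -(x + κ T c₀ * x ^ 2 -
          ∑ i ∈ Finset.univ \ {i₀}, κ T (h i) * z i) * hi' T) (by
        rw [h2', zero_mul, zero_mul, add_zero]; exact isUnit_one)
    refine ⟨a, congrArg ofAdd (funext fun i ↦ ?_)⟩
    rw [hat, haη]
    by_cases hi : i = i₀
    · subst hi; exact Function.update_self _ _ _
    · rw [Function.update_of_ne hi, Function.update_of_ne hi]; rfl

lemma nonempty_iso_gmGaPow (hc : c₀ ≠ 0) (h2 : (2 : K) ≠ 0) {i₀ : Fin n} (hi : h i₀ ≠ 0) :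
    Nonempty (L ≅ GmGaPow S (n - 1)) := by
  obtain _ | n := n
  · exact i₀.elim0
  rw [Nat.add_sub_cancel]
  have hi' : ∀ T, κ T (h i₀) * κ T (h i₀)⁻¹ = 1 := fun T ↦ by
    rw [← map_mul, mul_inv_cancel₀ hi, map_one]
  have hc' : ∀ T, 2 * κ T c₀ * κ T (2 * c₀)⁻¹ = 1 := fun T ↦ by
    rw [← map_ofNat (κ T) 2, ← map_mul, ← map_mul, mul_inv_cancel₀ (mul_ne_zero h2 hc), map_one]
  refine nonempty_iso_of_bijective (fun T ↦ MonoidHom.mk'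
    (fun a ↦ (⟨ofAdd (Q.η T a ∘ i₀.succAbove), (Q.unit T a).unit⟩ :
      (GmGaPow S n).obj T)) fun a b ↦ ?_) (fun {T T'} g a ↦ ?_) fun T ↦ ⟨fun a b hab ↦ ?_, fun y ↦ ?_⟩
  · refine SemidirectProduct.ext ?_ ?_
    · refine congrArg ofAdd (funext fun i ↦ ?_)
      change Q.η T (a * b) _ = Q.η T a (i₀.succAbove i) +
        ((Q.unit T a).unit ^ 2) • Q.η T b (i₀.succAbove i)
      rw [Q.mul_η, Units.smul_def, smul_eq_mul]
      rfl
    · refine Units.ext ?_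
      change 1 + 2 * κ T c₀ * Q.t T (a * b) =
        (1 + 2 * κ T c₀ * Q.t T a) * (1 + 2 * κ T c₀ * Q.t T b)
      rw [Q.mul_t]; ring
  · refine SemidirectProduct.ext ?_ ?_
    · exact congrArg ofAdd (funext fun i ↦ Q.map_η g a _)
    · refine Units.ext ?_
      change 1 + 2 * κ T' c₀ * Q.t T' (L.map g a) =
        ((globalFunctions S).map g).hom (1 + 2 * κ T c₀ * Q.t T a)
      rw [Q.map_t, ← Q.map_κ g, map_add, map_mul, map_mul, map_one, map_ofNat]
  · have h1 : ∀ i, Q.η T a (i₀.succAbove i) = Q.η T b (i₀.succAbove i) := fun i ↦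
      congrFun (congrArg (fun x ↦ toAdd (SemidirectProduct.left x)) hab) i
    have h3 : 1 + 2 * κ T c₀ * Q.t T a = 1 + 2 * κ T c₀ * Q.t T b :=
      congrArg (fun x ↦ Units.val (SemidirectProduct.right x)) hab
    have ht : Q.t T a = Q.t T b := by
      linear_combination κ T (2 * c₀)⁻¹ * h3 + (Q.t T b - Q.t T a) * hc' T
    refine Q.inj T a b ht (funext fun i ↦ ?_)
    obtain rfl | ⟨i, rfl⟩ := Fin.eq_self_or_eq_succAbove i₀ i
    · have e1 := Q.eq T a
      have e2 := Q.eq T b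
      rw [Fin.sum_univ_succAbove _ i] at e1 e2
      simp only [h1, ht] at e1
      have e3 : κ T (h i) * Q.η T a i = κ T (h i) * Q.η T b i := by linear_combination e2 - e1
      linear_combination κ T (h i)⁻¹ * e3 + (Q.η T b i - Q.η T a i) * hi' T
    · exact h1 i
  · obtain ⟨y, v⟩ := y
    let x := κ T (2 * c₀)⁻¹ * ((v : (globalFunctions S).obj T) - 1)
    let z : Fin n → (globalFunctions S).obj T := toAdd y
    have hx : 1 + 2 * κ T c₀ * x = v := by
      linear_combination ((v : (globalFunctions S).obj T) - 1) * hc' T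
    obtain ⟨a, hat, haη⟩ := Q.surj T x (i₀.insertNth (κ T (h i₀)⁻¹ *
      (x + κ T c₀ * x ^ 2 - ∑ i, κ T (h (i₀.succAbove i)) * z i)) z) (by
        rw [Fin.sum_univ_succAbove _ i₀]
        simp only [Fin.insertNth_apply_same, Fin.insertNth_apply_succAbove]
        linear_combination -(x + κ T c₀ * x ^ 2 -
          ∑ i, κ T (h (i₀.succAbove i)) * z i) * hi' T) (by rw [hx]; exact v.isUnit)
    refine ⟨a, SemidirectProduct.ext ?_ ?_⟩
    · refine congrArg ofAdd (funext fun i ↦ ?_)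
      rw [haη, Function.comp_apply, Fin.insertNth_apply_succAbove]; rfl
    · refine Units.ext ?_
      change 1 + 2 * κ T c₀ * Q.t T a = v
      rw [hat, hx]

lemma nonempty_iso_zmodTwoGaPow (hc : c₀ ≠ 0) (hh : h = 0) :
    Nonempty (L ≅ ZModTwoGaPow S n) := by
  subst hh
  have hc' : ∀ T, κ T c₀ * κ T c₀⁻¹ = 1 := fun T ↦ by rw [← map_mul, mul_inv_cancel₀ hc, map_one]
  have eq : ∀ T a, Q.t T a + κ T c₀ * Q.t T a ^ 2 = 0 := fun T a ↦ by rw [Q.eq]; simp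
  have hid : ∀ T a, IsIdempotentElem (-(κ T c₀ * Q.t T a)) := fun T a ↦ by
    rw [IsIdempotentElem]
    linear_combination κ T c₀ * eq T a
  have sq : ∀ T a, (1 + 2 * κ T c₀ * Q.t T a) ^ 2 = 1 := fun T a ↦ by
    linear_combination 4 * κ T c₀ * eq T a
  refine nonempty_iso_of_bijective (fun T ↦ MonoidHom.mk'
    (fun a ↦ ((ofAdd (idempotentFunction (T := T.unop.left) _ (hid T a)),
      ofAdd (Q.η T a)) : (ZModTwoGaPow S n).obj T)) fun a b ↦ ?_)
    (fun {T T'} g a ↦ ?_) fun T ↦ ⟨fun a b hab ↦ ?_, fun y ↦ ?_⟩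
  · refine Prod.ext ?_ ?_
    · refine congrArg ofAdd (idempotentFunction_add (hid T a) (hid T b) _ ?_)
      have : -(κ T c₀ * Q.t T (a * b)) = -(κ T c₀ * Q.t T a) +
          (1 - 2 * -(κ T c₀ * Q.t T a)) * -(κ T c₀ * Q.t T b) := by
        rw [Q.mul_t]
        ring
      exact this
    · refine congrArg ofAdd (funext fun i ↦ ?_)
      change _ = Q.η T a i + Q.η T b i
      rw [Q.mul_η, sq, one_mul]
  · refine Prod.ext ?_ ?_
    · refine congrArg ofAdd (LocallyConstant.ext fun x ↦ ?_)
      refine idempotentFunction_comap g.unop.left (hid T a) _ ?_ x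
      have : ((globalFunctions S).map g) (-(κ T c₀ * Q.t T a)) = -(κ T' c₀ * Q.t T' (L.map g a)) := by
        rw [Q.map_t, ← Q.map_κ g, map_neg, map_mul]
      exact this.symm
    · exact congrArg ofAdd (funext fun i ↦ Q.map_η g a i)
  · have h1 := idempotentFunction_injective (hid T a) (hid T b) (congrArg (fun x ↦ toAdd (Prod.fst x)) hab)
    have h2 : Q.η T a = Q.η T b := congrArg (fun x ↦ toAdd (Prod.snd x)) hab
    refine Q.inj T a b ?_ h2
    have h3 : -(κ T c₀ * Q.t T a) = -(κ T c₀ * Q.t T b) := h1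
    linear_combination - κ T c₀⁻¹ * h3 + (Q.t T b - Q.t T a) * hc' T
  · obtain ⟨g, y⟩ := y
    obtain ⟨e, he, hg⟩ := exists_idempotentFunction (toAdd g)
    let e' : (globalFunctions S).obj T := e
    have he' : e' * e' = e' := he
    let x : (globalFunctions S).obj T := -(κ T c₀⁻¹ * e')
    have hx : -(κ T c₀ * x) = e' := by linear_combination e' * hc' T
    have hx' : x + κ T c₀ * x ^ 2 = 0 := by
      linear_combination κ T c₀⁻¹ * e' ^ 2 * hc' T + κ T c₀⁻¹ * he'
    obtain ⟨a, hat, haη⟩ := Q.surj T x (toAdd y) (by rw [hx']; simp) (by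
      refine IsUnit.of_mul_eq_one (1 + 2 * κ T c₀ * x) ?_
      linear_combination 4 * κ T c₀ * hx')
    refine ⟨a, Prod.ext ?_ (congrArg ofAdd haη)⟩
    refine (congrArg ofAdd ?_).trans (congrArg ofAdd hg)
    congr 1
    rw [hat]
    exact hx

end QuadraticCoordinates

end GroupFunctors

section AffineTargets

variable {T Z : Scheme.{u}} {V : Z.Opens} (hV : IsAffineOpen V)
include hV

lemma toSpecΓ_map_appLE_fromSpec (g : T ⟶ Z) (h : ⊤ ≤ g ⁻¹ᵁ V) :
    T.toSpecΓ ≫ Spec.map (g.appLE V ⊤ h) ≫ hV.fromSpec = g := by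
  have : Epi (⊤ : T.Opens).ι := inferInstanceAs (Epi T.topIso.hom)
  rw [← cancel_epi (⊤ : T.Opens).ι, ← assoc, ← Scheme.Opens.toSpecΓ_top,
    Scheme.Opens.toSpecΓ_SpecMap_appLE_assoc, hV.toSpecΓ_fromSpec, Scheme.Hom.resLE_comp_ι]

lemma hom_ext_of_appLE {g g' : T ⟶ Z} (h : ⊤ ≤ g ⁻¹ᵁ V) (h' : ⊤ ≤ g' ⁻¹ᵁ V)
    (e : g.appLE V ⊤ h = g'.appLE V ⊤ h') : g = g' := by
  rw [← toSpecΓ_map_appLE_fromSpec hV g h, e, toSpecΓ_map_appLE_fromSpec hV g' h']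

lemma exists_hom_of_ringHom (χ : Γ(Z, V) ⟶ Γ(T, ⊤)) :
    ∃ (g : T ⟶ Z) (h : ⊤ ≤ g ⁻¹ᵁ V), g.appLE V ⊤ h = χ := by
  let g := T.toSpecΓ ≫ Spec.map χ ≫ hV.fromSpec
  have h : ⊤ ≤ g ⁻¹ᵁ V := fun x _ ↦ by
    change (T.toSpecΓ ≫ Spec.map χ ≫ hV.fromSpec) x ∈ V
    have : hV.fromSpec ((T.toSpecΓ ≫ Spec.map χ) x) ∈ Set.range hV.fromSpec := ⟨_, rfl⟩
    rw [hV.range_fromSpec] at this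
    exact this
  refine ⟨g, h, ?_⟩
  have h1 := toSpecΓ_map_appLE_fromSpec hV g h
  have h2 : T.toSpecΓ ≫ Spec.map (g.appLE V ⊤ h) = T.toSpecΓ ≫ Spec.map χ := by
    rw [← cancel_mono hV.fromSpec, assoc, assoc]
    exact h1
  have h3 := congr((Scheme.ΓSpecIso _).inv ≫ Scheme.Hom.appTop $h2)
  simpa using h3

omit hV in
lemma isIso_appLE_top {A Z : Scheme.{u}} (i : A ⟶ Z) [IsOpenImmersion i] {O : Z.Opens}
    (h : O = i.opensRange) (h' : ⊤ ≤ i ⁻¹ᵁ O) : IsIso (i.appLE O ⊤ h') := by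
  rw [← Scheme.Hom.image_top_eq_opensRange] at h
  subst h
  rw [← Scheme.Hom.appIso_hom']
  infer_instance

lemma exists_sectionsEquiv {A : CommRingCat.{u}} {G : Scheme.{u}} (i : Spec A ⟶ G)
    [IsOpenImmersion i] (p : G ⟶ Z) (χ : Γ(Z, V) ⟶ A) (hi : i ≫ p = Spec.map χ ≫ hV.fromSpec)
    (h : p ⁻¹ᵁ V = i.opensRange) :
    ∃ e : A ≃+* Γ(G, p ⁻¹ᵁ V), e.toRingHom.comp χ.hom = (p.app V).hom := by
  have h' : ⊤ ≤ i ⁻¹ᵁ p ⁻¹ᵁ V := by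
    rw [h]
    exact fun x _ ↦ ⟨x, rfl⟩
  have := isIso_appLE_top i h h'
  let E := (asIso (i.appLE _ ⊤ h') ≪≫ Scheme.ΓSpecIso _).symm
  refine ⟨E.commRingCatIsoToRingEquiv, ?_⟩
  suffices h : χ ≫ E.hom = p.app V from congr(($h).hom)
  have h4 : p.app V ≫ i.appLE _ ⊤ h' = χ ≫ (Scheme.ΓSpecIso _).inv := by
    refine (Scheme.Hom.comp_appLE i p V ⊤ h').symm.trans ?_
    obtain ⟨g, hg, e⟩ := exists_hom_of_ringHom hV (T := Spec A) (χ ≫ (Scheme.ΓSpecIso _).inv)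
    have h1 := toSpecΓ_map_appLE_fromSpec hV g hg
    rw [e, Spec.map_comp, ← SpecMap_ΓSpecIso_hom, assoc, ← Spec.map_comp_assoc,
      Iso.inv_hom_id, Spec.map_id, id_comp, ← hi] at h1
    subst h1
    exact e
  rw [← Iso.eq_comp_inv]
  change χ = p.app V ≫ i.appLE _ ⊤ h' ≫ (Scheme.ΓSpecIso _).hom
  rw [reassoc_of% h4, Iso.inv_hom_id, comp_id]

end AffineTargets

section RelativeSpec

variable {P : Scheme.{u}} [IsLocallyNoetherian P] (W : P.Opens) {ι : Type}
  (I K : ι → P.IdealSheafData)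

/-- The open cover of the relative spectrum by its parts over affine opens. -/
def fractionSpecCover : (fractionSpec W I K).OpenCover :=
  (Scheme.AffineZariskiSite.relativeGluingData (coequifibered_fractionFunctorMap W I K)).cover

/-- The part of the relative spectrum over an affine open. -/
def fractionSpecι (V : P.AffineZariskiSite) :
    Spec (.of (fractionSections W I K V)) ⟶ fractionSpec W I K :=
  (fractionSpecCover W I K).f V

instance (V : P.AffineZariskiSite) : IsOpenImmersion (fractionSpecι W I K V) :=
  (fractionSpecCover W I K).map_prop V

/-- The structure map on sections over an affine open. -/
def toFractionSections (V : P.AffineZariskiSite) :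
    Γ(P, V.toOpens) →+* fractionSections W I K V :=
  (restrictTo W V.toOpens).codRestrict _ fun a ↦ mem_fractionSubring _ _ _ a

lemma fractionSpecι_map (V : P.AffineZariskiSite) :
    fractionSpecι W I K V ≫ fractionSpecMap W I K =
      Spec.map (ofHom (toFractionSections W I K V)) ≫ V.2.fromSpec :=
  (Scheme.AffineZariskiSite.relativeGluingData
    (coequifibered_fractionFunctorMap W I K)).ι_toBase V |>.trans (assoc _ _ _)

lemma fractionSpecMap_preimage (V : P.AffineZariskiSite) :
    fractionSpecMap W I K ⁻¹ᵁ V.toOpens = (fractionSpecι W I K V).opensRange := by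
  simpa using! (Scheme.AffineZariskiSite.relativeGluingData
    (coequifibered_fractionFunctorMap W I K)).toBase_preimage_eq_opensRange_ι V

lemma isAffineOpen_fractionSpecMap_preimage (V : P.AffineZariskiSite) :
    IsAffineOpen (fractionSpecMap W I K ⁻¹ᵁ V.toOpens) := by
  rw [fractionSpecMap_preimage]
  exact isAffineOpen_opensRange _

/-- The functions on the preimage of an affine open are the sections over this open. -/
lemma exists_fractionSectionsEquiv (V : P.AffineZariskiSite) :
    ∃ e : fractionSections W I K V ≃+*
        Γ(fractionSpec W I K, fractionSpecMap W I K ⁻¹ᵁ V.toOpens),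
      e.toRingHom.comp (toFractionSections W I K V) =
        ((fractionSpecMap W I K).app V.toOpens).hom := by
  exact exists_sectionsEquiv V.2 (fractionSpecι W I K V) (fractionSpecMap W I K)
    (ofHom (toFractionSections W I K V)) (fractionSpecι_map W I K V)
    (fractionSpecMap_preimage W I K V)

end RelativeSpec

section LocalCharts

open MvPolynomial RingTheory.Sequence

section Etale

variable {X Y : Scheme.{u}} (φ : X ⟶ Y)

lemma etale_ι_comp_iff {V : Y.Opens} (hV : IsAffineOpen V) {D : X.Opens} (hD : IsAffineOpen D)
    (h : D ≤ φ ⁻¹ᵁ V) : Etale (D.ι ≫ φ) ↔ (φ.appLE V D h).hom.Etale := by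
  have e : Spec.map (φ.appLE V D h) ≫ hV.fromSpec = hD.isoSpec.inv ≫ D.ι ≫ φ := by
    rw [IsAffineOpen.SpecMap_appLE_fromSpec φ hV hD h, IsAffineOpen.fromSpec, assoc]
  rw [← HasRingHomProperty.Spec_iff (P := @Etale)]
  refine ⟨fun h' ↦ ?_, fun h' ↦ ?_⟩
  · have : Etale (Spec.map (φ.appLE V D h) ≫ hV.fromSpec) := by rw [e]; infer_instance
    exact Etale.of_comp _ hV.fromSpec
  · have : D.ι ≫ φ = hD.isoSpec.hom ≫ Spec.map (φ.appLE V D h) ≫ hV.fromSpec := by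
      rw [e, Iso.hom_inv_id_assoc]
    rw [this]
    have := Etale.etale_comp (Spec.map (φ.appLE V D h)) hV.fromSpec
    infer_instance

lemma etale_ι_comp_of_le {D D' : X.Opens} (h : D ≤ D') (h' : Etale (D'.ι ≫ φ)) :
    Etale (D.ι ≫ φ) := by
  rw [← X.homOfLE_ι h, assoc]
  infer_instance

lemma le_etaleLocus {D : X.Opens} (h : Etale (D.ι ≫ φ)) : D ≤ etaleLocus φ := le_sSup h

lemma exists_etale_of_mem_etaleLocus {x : X} (h : x ∈ etaleLocus φ) :
    ∃ D : X.Opens, x ∈ D ∧ Etale (D.ι ≫ φ) := by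
  obtain ⟨D, hD, hx⟩ := TopologicalSpace.Opens.mem_sSup.mp h
  exact ⟨D, hx, hD⟩

end Etale

variable {k : Type u} [Field k] {X Y : Scheme.{u}} (φ : X ⟶ Y) (s : Y ⟶ Spec (.of k))

omit [Field k] in
lemma le_preimage_top {Z : Scheme.{u}} (s : Y ⟶ Z) (V : Y.Opens) : V ≤ s ⁻¹ᵁ ⊤ := fun _ _ ↦ trivial

/-- The elements of `k` as functions on an open subscheme. -/
def scalars (V : Y.Opens) : k →+* Γ(Y, V) :=
  ((Scheme.ΓSpecIso (.of k)).inv ≫ s.appLE ⊤ V (le_preimage_top s V)).hom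

lemma appLE_comp_scalars {V : Y.Opens} {W : X.Opens} (h : W ≤ φ ⁻¹ᵁ V) :
    (φ.appLE V W h).hom.comp (scalars s V) = scalars (φ ≫ s) W := by
  rw [scalars, scalars, ← CommRingCat.hom_comp, assoc, Scheme.Hom.appLE_comp_appLE]

/-- A chart of `φ` at a point. -/
structure ChartAt (z : X) where
  /-- an affine neighbourhood of the point -/
  W : X.Opens
  isAffineOpen : IsAffineOpen W
  mem : z ∈ W
  /-- an affine neighbourhood of the image -/
  V : Y.Opens
  isAffineOpen' : IsAffineOpen V
  le : W ≤ φ ⁻¹ᵁ V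
  /-- coordinates -/
  chart : NewtonChart (scalars s V) (φ.appLE V W le).hom
  δ_mem : chart.δ ∈ nonZeroDivisors Γ(X, W)
  inf_eq : etaleLocus φ ⊓ W = X.basicOpen chart.δ
  exists_presentation : ∃ N m, HasLCIPresentation (scalars (φ ≫ s) W) N m ∧ N = m + chart.n

variable {φ s}

lemma exists_hasLCIPresentation (hX : IsLocallyCompleteIntersection (φ ≫ s)) (z : X) :
    ∃ W : X.Opens, z ∈ W ∧ IsAffineOpen W ∧ ∃ N m, HasLCIPresentation (scalars (φ ≫ s) W) N m := by
  obtain ⟨W, hz, N, F, hF, e, he⟩ := hX z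
  have : IsAffine W := .of_isIso e.hom
  refine ⟨W, hz, this, N, F.length, F, rfl, hF, ?_⟩
  let E : CommRingCat.of (MvPolynomial (Fin N) k ⧸ Ideal.ofList F) ≅ Γ(X, W) :=
    (Scheme.ΓSpecIso _).symm ≪≫ (Scheme.Γ.mapIso e.op) ≪≫ W.topIso
  refine ⟨E.commRingCatIsoToRingEquiv.toRingHom.comp (Ideal.Quotient.mk _), ?_, ?_, ?_⟩
  · exact E.commRingCatIsoToRingEquiv.surjective.comp Ideal.Quotient.mk_surjective
  · refine (RingHom.ker_equiv_comp _ E.commRingCatIsoToRingEquiv).trans ?_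
    exact Ideal.mk_ker
  · suffices h : ofHom (algebraMap k (MvPolynomial (Fin N) k ⧸ Ideal.ofList F)) ≫ E.hom =
        (Scheme.ΓSpecIso (.of k)).inv ≫ (φ ≫ s).appLE ⊤ W (le_preimage_top _ W) from congr(($h).hom)
    have h1 := congr(Scheme.Hom.appTop $he)
    change ofHom (algebraMap k (MvPolynomial (Fin N) k ⧸ Ideal.ofList F)) ≫
      (Scheme.ΓSpecIso _).inv ≫ e.hom.appTop ≫ W.topIso.hom = _
    rw [Scheme.ΓSpecIso_inv_naturality_assoc, ← assoc (Scheme.Hom.appTop _),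
      ← Scheme.Hom.comp_appTop, he, Scheme.Hom.comp_appTop, assoc]
    congr 1
    change (φ ≫ s).app ⊤ ≫ _ ≫ _ = (φ ≫ s).app ⊤ ≫ _
    congr 1
    exact (X.presheaf.map_comp _ _).symm

lemma exists_coordinates_nhds [Smooth s] (y : Y) :
    ∃ V : Y.Opens, y ∈ V ∧ IsAffineOpen V ∧ (scalars s V).FormallySmooth ∧
      ∃ (n : ℕ) (y : Fin n → Γ(Y, V)), IsCoordinates (scalars s V) y := by
  obtain ⟨U, hU, V, hV, hyV, e, h⟩ := Smooth.exists_isStandardSmooth s y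
  obtain rfl : U = ⊤ := by
    refine eq_top_iff.mpr fun x _ ↦ ?_
    rw [Subsingleton.elim x (s y)]
    exact e hyV
  have h' : (scalars s V).IsStandardSmooth := by
    rw [scalars, CommRingCat.hom_comp]
    exact h.comp (RingHom.IsStandardSmoothOfRelativeDimension.equiv
      (Scheme.ΓSpecIso (.of k)).symm.commRingCatIsoToRingEquiv).isStandardSmooth
  let := (scalars s V).toAlgebra
  have hst : Algebra.IsStandardSmooth k Γ(Y, V) := h'
  have : Nontrivial Γ(Y, V) := (Y.presheaf.germ V y hyV).hom.domain_nontrivial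
  obtain ⟨-, I, b, hb⟩ := Algebra.IsStandardSmooth.iff_exists_basis_kaehlerDifferential.mp hst
  have : Finite I := Module.Finite.finite_basis b
  let b' := b.reindex (Finite.equivFin I)
  choose y hy using fun i ↦ hb ⟨(Finite.equivFin I).symm i, rfl⟩
  refine ⟨V, hyV, hV, (inferInstance : Algebra.FormallySmooth k Γ(Y, V)), _, y, ?_⟩
  refine isCoordinates_of_basis y b' fun i ↦ ?_
  rw [hy, Module.Basis.reindex_apply]

variable [Smooth s] [LocallyOfFiniteType (φ ≫ s)]
  (hX : IsLocallyCompleteIntersection (φ ≫ s)) (hU : Dense (etaleLocus φ : Set X))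
include hX hU

lemma exists_chartAt (z : X) : Nonempty (ChartAt φ s z) := by
  obtain ⟨V, hzV, hV, hsm, n, y, hy⟩ := exists_coordinates_nhds (s := s) (φ z)
  obtain ⟨W₀, hzW₀, hW₀, N₀, m₀, h₀⟩ := exists_hasLCIPresentation hX z
  obtain ⟨g, hgV, hzW⟩ := hW₀.exists_basicOpen_le (V := φ ⁻¹ᵁ V) ⟨z, hzV⟩ hzW₀
  have hW := hW₀.basicOpen g
  obtain ⟨N, m, h⟩ : ∃ N m, HasLCIPresentation (scalars (φ ≫ s) (X.basicOpen g)) N m := by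
    have := hW₀.isLocalization_basicOpen g
    have : Nontrivial Γ(X, X.basicOpen g) := (X.presheaf.germ _ z hzW).hom.domain_nontrivial
    have h1 := h₀.localization (R' := Γ(X, X.basicOpen g)) g
    have h2 : (algebraMap Γ(X, W₀) Γ(X, X.basicOpen g)).comp (scalars (φ ≫ s) W₀) =
        scalars (φ ≫ s) (X.basicOpen g) := by
      refine (congrArg CommRingCat.Hom.hom ?_ : ((Scheme.ΓSpecIso (.of k)).inv ≫
        (φ ≫ s).appLE ⊤ W₀ (le_preimage_top _ _) ≫
        X.presheaf.map (homOfLE (X.basicOpen_le g)).op).hom = _)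
      rw [Scheme.Hom.appLE_map]
    rw [h2] at h1
    exact ⟨_, _, h1⟩
  generalize X.basicOpen g = W at *
  have key : ∀ x ∈ etaleLocus φ ⊓ W, ∃ g : Γ(X, W), x ∈ X.basicOpen g ∧
      ((algebraMap Γ(X, W) Γ(X, X.basicOpen g)).comp (φ.appLE V W hgV).hom).FormallyEtale := by
    intro x hx
    obtain ⟨D, hxD, hD⟩ := exists_etale_of_mem_etaleLocus φ hx.1
    obtain ⟨g, hg, hxg⟩ := hW.exists_basicOpen_le (V := D) ⟨x, hxD⟩ hx.2
    have h1 := (etale_ι_comp_iff φ hV (hW.basicOpen g) ((X.basicOpen_le g).trans hgV)).mp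
      (etale_ι_comp_of_le φ hg hD)
    rw [← Scheme.Hom.appLE_map _ hgV (homOfLE (X.basicOpen_le g)).op] at h1
    exact ⟨g, hxg, h1.formallyEtale⟩
  obtain ⟨x, hxU, hxW⟩ := hU.inter_open_nonempty W W.isOpen ⟨z, hzW⟩
  obtain ⟨g, hxg, hg⟩ := key x ⟨hxW, hxU⟩
  have hloc (g : Γ(X, W)) := hW.isLocalization_basicOpen g
  have hnon : Nontrivial Γ(X, X.basicOpen g) := (X.presheaf.germ _ x hxg).hom.domain_nontrivial
  rw [← appLE_comp_scalars φ s hgV] at h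
  obtain ⟨hN, ch, rfl⟩ := exists_newtonChart h hy hsm g hg
  have hY : IsLocallyNoetherian Y := LocallyOfFiniteType.isLocallyNoetherian s
  have hφ : LocallyOfFiniteType φ := locallyOfFiniteType_of_comp φ s
  have hφ' : LocallyOfFinitePresentation φ :=
    LocallyOfFinitePresentation.iff_locallyOfFiniteType.mpr hφ
  have hinf : etaleLocus φ ⊓ W = X.basicOpen ch.δ := by
    refine le_antisymm (fun x hx ↦ ?_) (le_inf (le_etaleLocus φ ?_) (X.basicOpen_le _))
    · obtain ⟨g, hxg, hg⟩ := key x hx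
      have h1 := ch.isUnit_δ_of_formallyEtale hsm g hg
        (X.presheaf.germ (X.basicOpen g) x hxg ≫ X.residue x).hom
      rw [X.mem_basicOpen _ x hx.2]
      refine (IsLocalRing.residue_ne_zero_iff_isUnit _).mp ?_
      rw [← X.presheaf.germ_res (homOfLE (X.basicOpen_le g)) x hxg]
      exact h1
    · refine (etale_ι_comp_iff φ hV (hW.basicOpen ch.δ) ((X.basicOpen_le _).trans hgV)).mpr ?_
      refine @Algebra.Etale.mk _ _ _ _ (RingHom.toAlgebra _) ?_ (HasRingHomProperty.appLE @LocallyOfFinitePresentation φ hφ' ⟨V, hV⟩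
        ⟨_, hW.basicOpen ch.δ⟩ _)
      change RingHom.FormallyEtale _
      rw [← Scheme.Hom.appLE_map _ hgV (homOfLE (X.basicOpen_le ch.δ)).op]
      exact ch.formallyEtale_of_isUnit (R' := Γ(X, X.basicOpen ch.δ))
  refine ⟨⟨W, hW, hzW, V, hV, hgV, ch, h.mem_nonZeroDivisors fun p hp hδ ↦ ?_, hinf, N, m, ?_, hN⟩⟩
  · obtain ⟨y, hy, hδy⟩ := (Ideal.iUnion_minimalPrimes (I := (⊥ : Ideal Γ(X, W)))).subset
      (Set.mem_biUnion hp hδ)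
    have h1 : (X.basicOpen y : Set X).Nonempty := by
      by_contra h1
      rw [Set.not_nonempty_iff_eq_empty] at h1
      have h2 : X.basicOpen y = ⊥ := TopologicalSpace.Opens.ext h1
      rw [← Scheme.isNilpotent_iff_basicOpen_eq_bot_of_isCompact hW.isCompact] at h2
      exact hy (mem_nilradical.mpr h2)
    obtain ⟨x, hxy, hxU⟩ := hU.inter_open_nonempty _ (X.basicOpen y).isOpen h1
    have h2 : x ∈ X.basicOpen ch.δ ⊓ X.basicOpen y := by
      rw [← hinf]
      exact ⟨⟨hxU, X.basicOpen_le _ hxy⟩, hxy⟩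
    have h3 : X.basicOpen (ch.δ * y) = ⊥ :=
      X.basicOpen_eq_bot_of_isNilpotent _ _ (mem_nilradical.mp hδy)
    rw [← Scheme.basicOpen_mul, h3] at h2
    exact h2
  · rw [← appLE_comp_scalars φ s hgV]; exact h

end LocalCharts

section Different

/-- Ideals of the stalks that are locally principal come from an ideal sheaf. -/
lemma ideal_ofIdeals_eq_span {X : Scheme.{u}} (I : ∀ x, Ideal (X.presheaf.stalk x))
    (hI : ∀ x, ∃ (W : X.Opens) (_ : IsAffineOpen W) (d : Γ(X, W)), x ∈ W ∧
      ∀ y (hy : y ∈ W), I y = Ideal.span {X.presheaf.germ W y hy d})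
    {W : X.Opens} (hW : IsAffineOpen W) (d : Γ(X, W))
    (hd : ∀ y (hy : y ∈ W), I y = Ideal.span {X.presheaf.germ W y hy d}) :
    (Scheme.IdealSheafData.ofIdeals fun W ↦
      ⨅ x : W.1, (I x.1).comap (X.presheaf.germ W.1 x.1 x.2).hom).ideal ⟨W, hW⟩ =
      Ideal.span {d} := by
  let J (W : X.Opens) : Ideal Γ(X, W) := ⨅ x : W, (I x.1).comap (X.presheaf.germ W x.1 x.2).hom
  have memJ {W : X.Opens} {a : Γ(X, W)} : a ∈ J W ↔ ∀ y (hy : y ∈ W), X.presheaf.germ W y hy a ∈ I y := by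
    simp only [J, Submodule.mem_iInf, Subtype.forall, Ideal.mem_comap]
  have span {W : X.Opens} (hW : IsAffineOpen W) {d : Γ(X, W)}
      (hd : ∀ y (hy : y ∈ W), I y = Ideal.span {X.presheaf.germ W y hy d}) :
      J W = Ideal.span {d} := by
    ext a
    rw [memJ, hW.mem_ideal_iff]
    refine forall₂_congr fun y hy ↦ ?_
    rw [hd, Ideal.map_span, Set.image_singleton]
  have res {W W' : X.Opens} (h : W' ≤ W) {d : Γ(X, W)}
      (hd : ∀ y (hy : y ∈ W), I y = Ideal.span {X.presheaf.germ W y hy d}) :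
      ∀ y (hy : y ∈ W'), I y = Ideal.span {X.presheaf.germ W' y hy (X.presheaf.map (homOfLE h).op d)} :=
    fun y hy ↦ by rw [TopCat.Presheaf.germ_res_apply X.presheaf (homOfLE h) y hy d, hd]
  have germ {W W' : X.Opens} (h : W' ≤ W) (a : Γ(X, W)) {y : X} (hy : y ∈ W') :
      X.presheaf.germ W' y hy (X.presheaf.map (homOfLE h).op a) = X.presheaf.germ W y (h hy) a :=
    TopCat.Presheaf.germ_res_apply X.presheaf (homOfLE h) y hy a
  let 𝓙 : X.IdealSheafData :=
    { ideal W := J W.1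
      map_ideal_basicOpen := by
        rintro ⟨U, hU⟩ g
        refine le_antisymm (Ideal.map_le_iff_le_comap.mpr fun a ha ↦ ?_) fun b hb ↦ ?_
        · refine memJ.mpr fun y hy ↦ ?_
          have h1 := memJ.mp ha y (X.basicOpen_le g hy)
          rw [← germ (X.basicOpen_le g) a hy] at h1
          exact h1
        · have := hU.isLocalization_basicOpen g
          obtain ⟨n, a, ha⟩ := IsLocalization.Away.surj g b
          change b * _ = X.presheaf.map (homOfLE (X.basicOpen_le g)).op a at ha
          have key : ∃ M, ∀ y ∈ (U : Set X), ∀ hy : y ∈ U, X.presheaf.germ U y hy (g ^ M * a) ∈ I y := by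
            refine hU.isCompact.induction_on (p := fun S ↦ ∃ M, ∀ y ∈ S, ∀ hy : y ∈ U,
              X.presheaf.germ U y hy (g ^ M * a) ∈ I y) ⟨0, fun _ h ↦ h.elim⟩
              (fun S T hST ⟨M, hM⟩ ↦ ⟨M, fun y hy ↦ hM y (hST hy)⟩) ?_ fun x hx ↦ ?_
            · rintro S T ⟨M, hM⟩ ⟨M', hM'⟩
              refine ⟨M + M', fun y hy hyU ↦ ?_⟩
              rcases hy with hy | hy
              · rw [pow_add, mul_comm (g ^ M), mul_assoc, map_mul]
                exact Ideal.mul_mem_left _ _ (hM y hy hyU)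
              · rw [pow_add, mul_assoc, map_mul]
                exact Ideal.mul_mem_left _ _ (hM' y hy hyU)
            · obtain ⟨V, hV, d, hxV, hd⟩ := hI x
              obtain ⟨f, hf, hxf⟩ := hV.exists_basicOpen_le (V := U) ⟨x, hx⟩ hxV
              have hA := hV.basicOpen f
              have hdA := res (X.basicOpen_le f) hd
              generalize X.presheaf.map (homOfLE (X.basicOpen_le f)).op d = d' at hdA
              generalize X.basicOpen f = A at *
              let ρ := X.presheaf.map (homOfLE hf).op
              let gA := ρ g
              have hAg : X.basicOpen gA ≤ X.basicOpen g := by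
                rw [Scheme.basicOpen_res]; exact inf_le_right
              have h1 : algebraMap _ Γ(X, X.basicOpen gA) (ρ a) ∈ (Ideal.span {d'}).map
                  (algebraMap Γ(X, A) Γ(X, X.basicOpen gA)) := by
                rw [Ideal.map_span, Set.image_singleton]
                change _ ∈ Ideal.span {X.presheaf.map (homOfLE (X.basicOpen_le gA)).op d'}
                rw [← span (hA.basicOpen gA) (res (X.basicOpen_le gA) hdA)]
                refine memJ.mpr fun y hy ↦ ?_
                change X.presheaf.germ _ y hy (X.presheaf.map (homOfLE (X.basicOpen_le gA)).op (ρ a)) ∈ _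
                rw [germ, germ, ← germ (X.basicOpen_le g) a (hAg hy), ← ha, map_mul]
                exact Ideal.mul_mem_right _ _ (memJ.mp hb y (hAg hy))
              have := hA.isLocalization_basicOpen gA
              obtain ⟨_, ⟨M, rfl⟩, h2⟩ := (IsLocalization.algebraMap_mem_map_algebraMap_iff
                (.powers gA) _ _ _).mp h1
              refine ⟨A, mem_nhdsWithin_of_mem_nhds (A.isOpen.mem_nhds hxf), M, fun y hy hyU ↦ ?_⟩
              rw [← span hA hdA] at h2
              have h3 := memJ.mp h2 y hy
              rw [← germ hf _ hy, map_mul, map_pow]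
              exact h3
          obtain ⟨M, hM⟩ := key
          refine (Ideal.mul_unit_mem_iff_mem (y := algebraMap _ _ (g ^ (n + M))) _ ?_).mp ?_
          · rw [map_pow]
            exact (IsLocalization.Away.algebraMap_isUnit g).pow _
          · rw [pow_add, map_mul, ← mul_assoc, map_pow, ha]
            change X.presheaf.map (homOfLE (X.basicOpen_le g)).op a *
              X.presheaf.map (homOfLE (X.basicOpen_le g)).op (g ^ M) ∈ _
            rw [← map_mul, mul_comm]
            exact Ideal.mem_map_of_mem _ (memJ.mpr fun y hy ↦ hM y hy hy) }
  refine le_antisymm ?_ ?_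
  · rw [← span hW hd]
    exact Scheme.IdealSheafData.ideal_ofIdeals_le _ _
  · rw [← span hW hd]
    exact (Scheme.IdealSheafData.le_ofIdeals_iff (I := 𝓙)).mpr (fun _ ↦ le_rfl) ⟨W, hW⟩

variable {k : Type u} [Field k] {X Y : Scheme.{u}} {φ : X ⟶ Y} {s : Y ⟶ Spec (.of k)} {z : X}

lemma ChartAt.differentStalk_eq (C : ChartAt φ s z) (x : X) (hx : x ∈ C.W) :
    differentStalk φ x = Ideal.span {X.presheaf.germ C.W x hx C.chart.δ} := by
  let : Algebra (Y.presheaf.stalk (φ x)) (X.presheaf.stalk x) := (φ.stalkMap x).hom.toAlgebra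
  let : Algebra Γ(X, C.W) (X.presheaf.stalk x) := (X.presheaf.germ C.W x hx).hom.toAlgebra
  let : Algebra Γ(Y, C.V) (Y.presheaf.stalk (φ x)) :=
    (Y.presheaf.germ C.V (φ x) (C.le hx)).hom.toAlgebra
  have h1 : IsLocalization.AtPrime (X.presheaf.stalk x) (C.isAffineOpen.primeIdealOf ⟨x, hx⟩).asIdeal :=
    C.isAffineOpen.isLocalization_stalk ⟨x, hx⟩
  have h2 : IsLocalization.AtPrime (Y.presheaf.stalk (φ x))
      (C.isAffineOpen'.primeIdealOf ⟨φ x, C.le hx⟩).asIdeal :=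
    C.isAffineOpen'.isLocalization_stalk ⟨φ x, C.le hx⟩
  refine C.chart.resolutionIdeal_eq (S := X.presheaf.stalk x) (Bq := Y.presheaf.stalk (φ x))
    (C.isAffineOpen.primeIdealOf ⟨x, hx⟩).asIdeal.primeCompl
    (C.isAffineOpen'.primeIdealOf ⟨φ x, C.le hx⟩).asIdeal.primeCompl (fun b ↦ ?_) ?_
  · have h3 := Scheme.Hom.germ_stalkMap_apply φ C.V x (C.le hx) b
    refine h3.trans ?_
    change _ = X.presheaf.germ C.W x hx (φ.appLE C.V C.W C.le b)
    exact (TopCat.Presheaf.germ_res_apply X.presheaf (homOfLE C.le) x hx _).symm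
  · exact mem_nonZeroDivisors_of_flat (algebraMap _ _) (RingHom.flat_algebraMap_iff.mpr
      (IsLocalization.flat _ (C.isAffineOpen.primeIdealOf ⟨x, hx⟩).asIdeal.primeCompl)) C.δ_mem

variable (ch : ∀ z, ChartAt φ s z)
include ch

lemma ideal_different (C : ChartAt φ s z) :
    (different φ).ideal ⟨C.W, C.isAffineOpen⟩ = Ideal.span {C.chart.δ} :=
  ideal_ofIdeals_eq_span _ (fun x ↦ ⟨(ch x).W, (ch x).isAffineOpen, _, (ch x).mem,
    fun y hy ↦ (ch x).differentStalk_eq y hy⟩) _ _ fun y hy ↦ C.differentStalk_eq y hy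

lemma mem_support_different_iff : z ∈ (different φ).support ↔ z ∉ etaleLocus φ := by
  rw [Scheme.IdealSheafData.mem_support_iff_of_mem (U := ⟨(ch z).W, (ch z).isAffineOpen⟩) (ch z).mem,
    ideal_different ch, Scheme.zeroLocus_span, Scheme.zeroLocus_singleton, ← (ch z).inf_eq]
  exact not_congr (and_iff_left (ch z).mem)

end Different

section Dimension

variable {k : Type u} [Field k] {X Y : Scheme.{u}} {φ : X ⟶ Y} {s : Y ⟶ Spec (.of k)} {z : X}

lemma ChartAt.topologicalKrullDim_eq (C : ChartAt φ s z) (g : Γ(X, C.W))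
    (hg : (X.basicOpen g : Set X).Nonempty) :
    topologicalKrullDim (X.basicOpen g : X.Opens) = C.chart.n := by
  obtain ⟨x, hx⟩ := hg
  obtain ⟨N, m, h, hN⟩ := C.exists_presentation
  have := C.isAffineOpen.isLocalization_basicOpen g
  have : Nontrivial Γ(X, X.basicOpen g) := (X.presheaf.germ _ x hx).hom.domain_nontrivial
  have h1 := (h.localization (R' := Γ(X, X.basicOpen g)) g).ringKrullDim
  have hA := C.isAffineOpen.basicOpen g
  have h2 : topologicalKrullDim (X.basicOpen g : X.Opens) = ringKrullDim Γ(X, X.basicOpen g) := by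
    rw [← PrimeSpectrum.topologicalKrullDim_eq_ringKrullDim]
    exact IsHomeomorph.topologicalKrullDim_eq _
      (Scheme.homeoOfIso hA.isoSpec).isHomeomorph
  rw [h2]
  rw [hN] at h1
  generalize ringKrullDim Γ(X, X.basicOpen g) = d at h1
  cases d with
  | bot =>
    rw [WithBot.bot_add] at h1
    exact absurd h1 (WithBot.bot_ne_coe (a := ((m + C.chart.n + 1 : ℕ) : ℕ∞)))
  | coe d =>
    cases d with
    | top => exact absurd h1 (by norm_cast; rw [top_add]; exact ENat.top_ne_natCast _)
    | coe d =>
      norm_cast at h1 ⊢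
      omega

lemma ChartAt.dimAt_eq (C : ChartAt φ s z) : dimAt X z = C.chart.n := by
  refine le_antisymm ?_ (le_iInf fun W ↦ ?_)
  · refine (iInf_le _ ⟨C.W, C.mem⟩).trans_eq ?_
    have h1 := C.topologicalKrullDim_eq 1
    rw [X.basicOpen_of_isUnit isUnit_one] at h1
    exact h1 ⟨z, C.mem⟩
  · obtain ⟨g, hg, hz⟩ := C.isAffineOpen.exists_basicOpen_le (V := W.1) ⟨z, W.2⟩ C.mem
    rw [← C.topologicalKrullDim_eq g ⟨z, hz⟩]
    exact (Topology.IsEmbedding.inclusion hg).toIsInducing.topologicalKrullDim_le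

end Dimension

section IdealSheaves

section

variable {X Y Z : Scheme.{u}} {U : Z.Opens} {V : Y.Opens} {W : X.Opens}

lemma app_comp_appLE (f : X ⟶ Y) (g : Y ⟶ Z) (e : W ≤ f ⁻¹ᵁ (g ⁻¹ᵁ U)) (e' : W ≤ (f ≫ g) ⁻¹ᵁ U) :
    g.app U ≫ f.appLE (g ⁻¹ᵁ U) W e = (f ≫ g).appLE U W e' := (Scheme.Hom.comp_appLE ..).symm

lemma appLE_trans (f : X ⟶ Y) (g : Y ⟶ Z) (e : V ≤ g ⁻¹ᵁ U) (e' : W ≤ f ⁻¹ᵁ V)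
    (e'' : W ≤ (f ≫ g) ⁻¹ᵁ U) : g.appLE U V e ≫ f.appLE V W e' = (f ≫ g).appLE U W e'' :=
  Scheme.Hom.appLE_comp_appLE ..

lemma appLE_congr_hom {f g : X ⟶ Z} (h : f = g) (e : W ≤ f ⁻¹ᵁ U) (e' : W ≤ g ⁻¹ᵁ U) :
    f.appLE U W e = g.appLE U W e' := by subst h; rfl

end

lemma exists_spec_hom {Z : Scheme.{u}} {V : Z.Opens} (hV : IsAffineOpen V) {A : Type u} [CommRing A]
    (q : Γ(Z, V) →+* A) : ∃ (g : Spec (.of A) ⟶ Z) (h : ⊤ ≤ g ⁻¹ᵁ V),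
      g.appLE V ⊤ h = ofHom q ≫ (Scheme.ΓSpecIso (.of A)).inv :=
  exists_hom_of_ringHom hV _

lemma ΓSpecIso_inv_injective (A : CommRingCat.{u}) : Function.Injective (Scheme.ΓSpecIso A).inv :=
  (Scheme.ΓSpecIso A).symm.commRingCatIsoToRingEquiv.injective

lemma ker_ideal_eq {Z P : Scheme.{u}} (f : Z ⟶ P) [QuasiCompact f] {N : P.Opens} (hN : IsAffineOpen N)
    (J : Ideal Γ(P, N)) (h₁ : ∀ a ∈ J, f.app N a = 0)
    (h₂ : ∃ (T : Scheme.{u}) (g : T ⟶ Z) (h : ⊤ ≤ (g ≫ f) ⁻¹ᵁ N),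
      ∀ a, (g ≫ f).appLE N ⊤ h a = 0 → a ∈ J) : f.ker.ideal ⟨N, hN⟩ = J := by
  obtain ⟨T, g, h, h₂⟩ := h₂
  rw [Scheme.Hom.ker_apply]
  refine le_antisymm (fun a ha ↦ h₂ a ?_) h₁
  have h3 : (g ≫ f).appLE N ⊤ h a = g.appLE (f ⁻¹ᵁ N) ⊤ h (f.app N a) :=
    congr($(Scheme.Hom.comp_appLE g f N ⊤ h) a)
  rw [h3, show f.app N a = 0 from ha, map_zero]

lemma ideal_comap {Z P : Scheme.{u}} (I : Z.IdealSheafData) (f : P ⟶ Z) {W : Z.Opens}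
    (hW : IsAffineOpen W) {N : P.Opens} (hN : IsAffineOpen N) (h : N ≤ f ⁻¹ᵁ W) :
    (I.comap f).ideal ⟨N, hN⟩ = (I.ideal ⟨W, hW⟩).map (f.appLE W N h).hom := by
  refine ker_ideal_eq _ hN _ (fun a ha ↦ ?_) ?_
  · refine (Ideal.map_le_iff_le_comap (K := RingHom.ker _)).mpr (fun i hi ↦ ?_) ha
    have h1 : I.subschemeι.app W i = 0 := by
      rw [← I.ker_subschemeι, Scheme.Hom.ker_apply] at hi
      exact hi
    have h0 : fst f I.subschemeι ⁻¹ᵁ N ≤ (fst f I.subschemeι ≫ f) ⁻¹ᵁ W :=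
      (fst f I.subschemeι).preimage_mono h
    have h0' : fst f I.subschemeι ⁻¹ᵁ N ≤ (snd f I.subschemeι ≫ I.subschemeι) ⁻¹ᵁ W := by
      rw [← pullback.condition]; exact h0
    have h2 : f.appLE W N h ≫ (fst f I.subschemeι).app N =
        I.subschemeι.app W ≫ (snd f I.subschemeι).appLE _
          (fst f I.subschemeι ⁻¹ᵁ N) h0' := by
      rw [Scheme.Hom.app_eq_appLE]
      exact (appLE_trans _ _ _ _ h0).trans ((appLE_congr_hom pullback.condition h0 h0').trans
        (app_comp_appLE _ _ _ _).symm)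
    have h3 := congr($h2 i)
    simp only [CommRingCat.comp_apply, h1, map_zero] at h3
    exact h3
  · set J := (I.ideal ⟨W, hW⟩).map (f.appLE W N h).hom
    obtain ⟨g, hg, e⟩ := exists_spec_hom hN (Ideal.Quotient.mk J)
    have hker : ∀ i, I.subschemeι.app W i = 0 → (f.appLE W N h).hom i ∈ J := fun i hi ↦ by
      refine Ideal.mem_map_of_mem _ ?_
      rw [← I.ker_subschemeι, Scheme.Hom.ker_apply]
      exact hi
    let θ : Γ(I.subscheme, I.subschemeι ⁻¹ᵁ W) →+* Γ(P, N) ⧸ J :=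
      (I.subschemeι.app W).hom.liftOfSurjective (I.subschemeι.app_surjective W hW)
        ⟨(Ideal.Quotient.mk J).comp (f.appLE W N h).hom, fun i hi ↦
          eq_zero_iff_mem.mpr (hker i hi)⟩
    have hθ : ∀ i, θ (I.subschemeι.app W i) = Ideal.Quotient.mk J (f.appLE W N h i) := fun i ↦
      RingHom.liftOfRightInverse_comp_apply (I.subschemeι.app W).hom _
        (Function.rightInverse_surjInv (I.subschemeι.app_surjective W hW)) _ i
    obtain ⟨g', hg', e'⟩ := exists_spec_hom (hW.preimage I.subschemeι) θ
    have key : g ≫ f = g' ≫ I.subschemeι := by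
      refine hom_ext_of_appLE hW (hg.trans (g.preimage_mono h)) hg' ?_
      refine (appLE_trans _ _ h hg _).symm.trans (.trans ?_ (app_comp_appLE _ _ hg' _))
      rw [e, e']
      ext i
      exact congrArg (Scheme.ΓSpecIso (.of (Γ(P, N) ⧸ J))).inv
        (hθ i).symm
    refine ⟨_, pullback.lift g g' key, ?_, fun a ha ↦ ?_⟩
    · rw [pullback.lift_fst]; exact hg
    · simp only [pullback.lift_fst, e] at ha
      exact eq_zero_iff_mem.mp (ΓSpecIso_inv_injective _ (ha.trans (map_zero _).symm))

end IdealSheaves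

section Square

variable {k : Type u} [Field k] {X Y : Scheme.{u}} (φ : X ⟶ Y) (s : Y ⟶ Spec (.of k))

/-- The open subscheme `W × W` of `X × X`. -/
def sqOpen (W : X.Opens) : (square φ s).Opens :=
  fst (φ ≫ s) (φ ≫ s) ⁻¹ᵁ W ⊓ snd (φ ≫ s) (φ ≫ s) ⁻¹ᵁ W

lemma sqOpen_le_fst (W : X.Opens) : sqOpen φ s W ≤ fst (φ ≫ s) (φ ≫ s) ⁻¹ᵁ W := inf_le_left

lemma sqOpen_le_snd (W : X.Opens) : sqOpen φ s W ≤ snd (φ ≫ s) (φ ≫ s) ⁻¹ᵁ W := inf_le_right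

lemma le_preimage_sqOpen {T : Scheme.{u}} {W : X.Opens} (g : T ⟶ square φ s) {O : T.Opens}
    (h₁ : O ≤ (g ≫ fst (φ ≫ s) (φ ≫ s)) ⁻¹ᵁ W)
    (h₂ : O ≤ (g ≫ snd (φ ≫ s) (φ ≫ s)) ⁻¹ᵁ W) : O ≤ g ⁻¹ᵁ sqOpen φ s W :=
  fun _ h ↦ ⟨h₁ h, h₂ h⟩

omit [Field k] in
lemma hom_ext_spec {k : CommRingCat.{u}} {T : Scheme.{u}} {g g' : T ⟶ Spec k}
    (h : (Scheme.ΓSpecIso k).inv ≫ g.appLE ⊤ ⊤ (le_preimage_top g ⊤) =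
      (Scheme.ΓSpecIso k).inv ≫ g'.appLE ⊤ ⊤ (le_preimage_top g' ⊤)) : g = g' := by
  rw [cancel_epi] at h
  exact hom_ext_of_appLE (isAffineOpen_top (Spec k)) _ _ h

variable {W : X.Opens} (hW : IsAffineOpen W)
include hW

lemma isAffineOpen_sqOpen : IsAffineOpen (sqOpen φ s W) := by
  have : IsAffine (W : Scheme.{u}) := hW
  let p : pullback (W.ι ≫ φ ≫ s) (W.ι ≫ φ ≫ s) ⟶ square φ s :=
    pullback.map _ _ _ _ W.ι W.ι (𝟙 _) (comp_id _) (comp_id _)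
  have : sqOpen φ s W = p.opensRange := by
    ext x
    change _ ↔ x ∈ Set.range p
    rw [Scheme.Pullback.range_map, W.range_ι]
    rfl
  rw [this]
  exact isAffineOpen_opensRange p

lemma isSquareRing_sqOpen : IsSquareRing (scalars (φ ≫ s) W)
    ((fst (φ ≫ s) (φ ≫ s)).appLE W (sqOpen φ s W) (sqOpen_le_fst φ s W)).hom
    ((snd (φ ≫ s) (φ ≫ s)).appLE W (sqOpen φ s W) (sqOpen_le_snd φ s W)).hom where
  comp_eq := by
    rw [appLE_comp_scalars (fst (φ ≫ s) (φ ≫ s)) (φ ≫ s),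
      appLE_comp_scalars (snd (φ ≫ s) (φ ≫ s)) (φ ≫ s)]
    exact congrArg (fun f ↦ scalars f _) pullback.condition
  exists_desc {S} _ α β h := by
    obtain ⟨a, ha, ea⟩ := exists_spec_hom hW α
    obtain ⟨b, hb, eb⟩ := exists_spec_hom hW β
    have hab : a ≫ φ ≫ s = b ≫ φ ≫ s := by
      have h1 (a : Spec (.of S) ⟶ X) (ha : ⊤ ≤ a ⁻¹ᵁ W) (α : Γ(X, W) →+* S)
          (ea : a.appLE W ⊤ ha = ofHom α ≫ (Scheme.ΓSpecIso (.of S)).inv) :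
          scalars (a ≫ φ ≫ s) ⊤ = (Scheme.ΓSpecIso (.of S)).inv.hom.comp (α.comp (scalars (φ ≫ s) W)) := by
        rw [← appLE_comp_scalars a (φ ≫ s) ha, ea]
        rfl
      have h2 := (h1 a ha α ea).trans (((congrArg _ h)).trans (h1 b hb β eb).symm)
      exact hom_ext_spec (CommRingCat.hom_ext h2)
    have h1 : ⊤ ≤ pullback.lift a b hab ⁻¹ᵁ sqOpen φ s W :=
      le_preimage_sqOpen φ s _ (by rw [pullback.lift_fst]; exact ha) (by rw [pullback.lift_snd]; exact hb)
    refine ⟨((pullback.lift a b hab).appLE _ ⊤ h1 ≫ (Scheme.ΓSpecIso (.of S)).hom).hom, ?_, ?_⟩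
    · change ((fst (φ ≫ s) (φ ≫ s)).appLE W (sqOpen φ s W) (sqOpen_le_fst φ s W) ≫
        (pullback.lift a b hab).appLE _ ⊤ h1 ≫ (Scheme.ΓSpecIso (.of S)).hom).hom = _
      rw [Scheme.Hom.appLE_comp_appLE_assoc]
      simp only [pullback.lift_fst, ea]
      rw [assoc, Iso.inv_hom_id]
      rfl
    · change ((snd (φ ≫ s) (φ ≫ s)).appLE W (sqOpen φ s W) (sqOpen_le_snd φ s W) ≫
        (pullback.lift a b hab).appLE _ ⊤ h1 ≫ (Scheme.ΓSpecIso (.of S)).hom).hom = _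
      rw [Scheme.Hom.appLE_comp_appLE_assoc]
      simp only [pullback.lift_snd, eb]
      rw [assoc, Iso.inv_hom_id]
      rfl
  hom_ext {S} _ χ χ' h₁ h₂ := by
    obtain ⟨g, hg, e⟩ := exists_spec_hom (isAffineOpen_sqOpen φ s hW) χ
    obtain ⟨g', hg', e'⟩ := exists_spec_hom (isAffineOpen_sqOpen φ s hW) χ'
    have key : g = g' := by
      refine pullback.hom_ext ?_ ?_
      · refine hom_ext_of_appLE hW (hg.trans (g.preimage_mono (sqOpen_le_fst φ s W)))
          (hg'.trans (g'.preimage_mono (sqOpen_le_fst φ s W))) ?_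
        rw [← Scheme.Hom.appLE_comp_appLE _ _ W (sqOpen φ s W) ⊤ (sqOpen_le_fst φ s W) hg,
          ← Scheme.Hom.appLE_comp_appLE _ _ W (sqOpen φ s W) ⊤ (sqOpen_le_fst φ s W) hg', e, e']
        exact congr(ofHom $h₁ ≫ (Scheme.ΓSpecIso (.of S)).inv)
      · refine hom_ext_of_appLE hW (hg.trans (g.preimage_mono (sqOpen_le_snd φ s W)))
          (hg'.trans (g'.preimage_mono (sqOpen_le_snd φ s W))) ?_
        rw [← Scheme.Hom.appLE_comp_appLE _ _ W (sqOpen φ s W) ⊤ (sqOpen_le_snd φ s W) hg,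
          ← Scheme.Hom.appLE_comp_appLE _ _ W (sqOpen φ s W) ⊤ (sqOpen_le_snd φ s W) hg', e, e']
        exact congr(ofHom $h₂ ≫ (Scheme.ΓSpecIso (.of S)).inv)
    subst key
    rw [e] at e'
    rw [cancel_mono] at e'
    exact congr(($e').hom)

end Square

section Boxes

variable {k : Type u} [Field k] {X Y : Scheme.{u}} (φ : X ⟶ Y) (s : Y ⟶ Spec (.of k))

lemma idealDiagonal_ideal [IsSeparated (φ ≫ s)] {W : X.Opens} (hW : IsAffineOpen W) :
    (idealDiagonal φ s).ideal ⟨sqOpen φ s W, isAffineOpen_sqOpen φ s hW⟩ =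
      Ideal.span (Set.range fun g ↦
        ((snd (φ ≫ s) (φ ≫ s)).appLE W (sqOpen φ s W) (sqOpen_le_snd φ s W)).hom g -
        ((fst (φ ≫ s) (φ ≫ s)).appLE W (sqOpen φ s W) (sqOpen_le_fst φ s W)).hom g) := by
  set J := Ideal.span (Set.range fun g ↦
        ((snd (φ ≫ s) (φ ≫ s)).appLE W (sqOpen φ s W) (sqOpen_le_snd φ s W)).hom g -
        ((fst (φ ≫ s) (φ ≫ s)).appLE W (sqOpen φ s W) (sqOpen_le_fst φ s W)).hom g)
  refine ker_ideal_eq _ _ _ (fun a ha ↦ ?_) ?_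
  · refine (Ideal.span_le (I := RingHom.ker ((pullback.diagonal (φ ≫ s)).app _).hom)).mpr ?_ ha
    rintro _ ⟨g, rfl⟩
    rw [SetLike.mem_coe, RingHom.mem_ker, map_sub, sub_eq_zero]
    suffices h : (snd (φ ≫ s) (φ ≫ s)).appLE W (sqOpen φ s W) (sqOpen_le_snd φ s W) ≫
        (pullback.diagonal (φ ≫ s)).app _ = (fst (φ ≫ s) (φ ≫ s)).appLE W (sqOpen φ s W)
          (sqOpen_le_fst φ s W) ≫ (pullback.diagonal (φ ≫ s)).app _ from congr($h g)
    rw [Scheme.Hom.app_eq_appLE]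
    refine (appLE_trans _ _ _ _ ?_).trans ((appLE_congr_hom (by simp) ?_ ?_).trans
      (appLE_trans _ _ _ _ ?_).symm)
    · exact (pullback.diagonal (φ ≫ s)).preimage_mono (sqOpen_le_snd φ s W)
    · exact (pullback.diagonal (φ ≫ s)).preimage_mono (sqOpen_le_snd φ s W)
    · exact (pullback.diagonal (φ ≫ s)).preimage_mono (sqOpen_le_fst φ s W)
    · exact (pullback.diagonal (φ ≫ s)).preimage_mono (sqOpen_le_fst φ s W)
  · obtain ⟨g, hg, e⟩ := exists_spec_hom (isAffineOpen_sqOpen φ s hW) (Ideal.Quotient.mk J)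
    have key : (g ≫ fst (φ ≫ s) (φ ≫ s)) ≫ pullback.diagonal (φ ≫ s) = g := by
      refine pullback.hom_ext (by simp) ?_
      rw [assoc, pullback.diagonal_snd, comp_id]
      refine hom_ext_of_appLE hW (hg.trans (g.preimage_mono (sqOpen_le_fst φ s W)))
        (hg.trans (g.preimage_mono (sqOpen_le_snd φ s W))) ?_
      refine (appLE_trans _ _ (sqOpen_le_fst φ s W) hg _).symm.trans (.trans ?_
        (appLE_trans _ _ (sqOpen_le_snd φ s W) hg _))
      rw [e]
      ext x
      refine (congrArg (Scheme.ΓSpecIso _).inv (Ideal.Quotient.eq (I := J).mpr ?_)).symm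
      exact Ideal.subset_span ⟨x, rfl⟩
    refine ⟨_, g ≫ fst (φ ≫ s) (φ ≫ s), by rw [key]; exact hg, fun a ha ↦ ?_⟩
    simp only [key, e] at ha
    exact eq_zero_iff_mem.mp (ΓSpecIso_inv_injective _ (ha.trans (map_zero _).symm))

lemma idealFiberProduct_ideal [IsSeparated s] {W : X.Opens} (hW : IsAffineOpen W) {V : Y.Opens}
    (hV : IsAffineOpen V) (hWV : W ≤ φ ⁻¹ᵁ V) :
    (idealFiberProduct φ s).ideal ⟨sqOpen φ s W, isAffineOpen_sqOpen φ s hW⟩ =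
      Ideal.span (Set.range fun b ↦
        ((snd (φ ≫ s) (φ ≫ s)).appLE W (sqOpen φ s W) (sqOpen_le_snd φ s W)).hom
          ((φ.appLE V W hWV).hom b) -
        ((fst (φ ≫ s) (φ ≫ s)).appLE W (sqOpen φ s W) (sqOpen_le_fst φ s W)).hom
          ((φ.appLE V W hWV).hom b)) := by
  set J := Ideal.span (Set.range fun b ↦
        ((snd (φ ≫ s) (φ ≫ s)).appLE W (sqOpen φ s W) (sqOpen_le_snd φ s W)).hom
          ((φ.appLE V W hWV).hom b) -
        ((fst (φ ≫ s) (φ ≫ s)).appLE W (sqOpen φ s W) (sqOpen_le_fst φ s W)).hom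
          ((φ.appLE V W hWV).hom b))
  let ψ : pullback φ φ ⟶ square φ s := pullback.lift (fst φ φ) (snd φ φ)
    (by rw [pullback.condition_assoc])
  have hψ₁ : ψ ≫ fst _ _ = fst φ φ := pullback.lift_fst _ _ _
  have hψ₂ : ψ ≫ snd _ _ = snd φ φ := pullback.lift_snd _ _ _
  have : QuasiCompact ψ := by
    have : ψ = pullback.mapDesc φ φ s := by
      refine pullback.hom_ext ?_ ?_
      · rw [hψ₁, pullback.mapDesc, pullback.lift_fst, comp_id]
      · rw [hψ₂, pullback.mapDesc, pullback.lift_snd, comp_id]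
    rw [this]; infer_instance
  refine ker_ideal_eq ψ _ _ (fun a ha ↦ ?_) ?_
  · refine (Ideal.span_le (I := RingHom.ker (ψ.app _).hom)).mpr ?_ ha
    rintro _ ⟨b, rfl⟩
    rw [SetLike.mem_coe, RingHom.mem_ker, map_sub, sub_eq_zero]
    have h1 : ψ ⁻¹ᵁ sqOpen φ s W ≤ snd φ φ ⁻¹ᵁ W := by
      rw [← hψ₂]; exact ψ.preimage_mono (sqOpen_le_snd φ s W)
    have h2 : ψ ⁻¹ᵁ sqOpen φ s W ≤ fst φ φ ⁻¹ᵁ W := by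
      rw [← hψ₁]; exact ψ.preimage_mono (sqOpen_le_fst φ s W)
    suffices h : φ.appLE V W hWV ≫ (snd (φ ≫ s) (φ ≫ s)).appLE W (sqOpen φ s W)
          (sqOpen_le_snd φ s W) ≫ ψ.app _ =
        φ.appLE V W hWV ≫ (fst (φ ≫ s) (φ ≫ s)).appLE W (sqOpen φ s W)
          (sqOpen_le_fst φ s W) ≫ ψ.app _ from congr($h b)
    rw [Scheme.Hom.app_eq_appLE,
      (appLE_trans ψ _ (sqOpen_le_snd φ s W) le_rfl (by rw [hψ₂]; exact h1)).trans
        (appLE_congr_hom hψ₂ _ h1),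
      (appLE_trans ψ _ (sqOpen_le_fst φ s W) le_rfl (by rw [hψ₁]; exact h2)).trans
        (appLE_congr_hom hψ₁ _ h2)]
    have h3 : ψ ⁻¹ᵁ sqOpen φ s W ≤ (snd φ φ ≫ φ) ⁻¹ᵁ V :=
      h1.trans ((snd φ φ).preimage_mono hWV)
    have h4 : ψ ⁻¹ᵁ sqOpen φ s W ≤ (fst φ φ ≫ φ) ⁻¹ᵁ V :=
      h2.trans ((fst φ φ).preimage_mono hWV)
    exact (appLE_trans _ _ _ _ h3).trans ((appLE_congr_hom pullback.condition.symm h3 h4).trans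
      (appLE_trans _ _ _ _ h4).symm)
  · obtain ⟨g, hg, e⟩ := exists_spec_hom (isAffineOpen_sqOpen φ s hW) (Ideal.Quotient.mk J)
    have hg₁ : ⊤ ≤ (g ≫ fst (φ ≫ s) (φ ≫ s)) ⁻¹ᵁ W := hg.trans (g.preimage_mono (sqOpen_le_fst φ s W))
    have hg₂ : ⊤ ≤ (g ≫ snd (φ ≫ s) (φ ≫ s)) ⁻¹ᵁ W := hg.trans (g.preimage_mono (sqOpen_le_snd φ s W))
    have key : (g ≫ fst (φ ≫ s) (φ ≫ s)) ≫ φ = (g ≫ snd (φ ≫ s) (φ ≫ s)) ≫ φ := by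
      refine hom_ext_of_appLE hV (hg₁.trans ((g ≫ fst _ _).preimage_mono hWV))
        (hg₂.trans ((g ≫ snd _ _).preimage_mono hWV)) ?_
      refine (appLE_trans _ _ hWV hg₁ _).symm.trans (.trans ?_
        (appLE_trans _ _ hWV hg₂ _))
      rw [← appLE_trans _ _ (sqOpen_le_fst φ s W) hg hg₁,
        ← appLE_trans _ _ (sqOpen_le_snd φ s W) hg hg₂, e]
      ext x
      refine (congrArg (Scheme.ΓSpecIso _).inv (Ideal.Quotient.eq (I := J).mpr ?_)).symm
      exact Ideal.subset_span ⟨x, rfl⟩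
    have key' : pullback.lift _ _ key ≫ ψ = g := by
      refine pullback.hom_ext ?_ ?_
      · rw [assoc, hψ₁, pullback.lift_fst]
      · rw [assoc, hψ₂, pullback.lift_snd]
    refine ⟨_, pullback.lift _ _ key, by rw [key']; exact hg, fun a ha ↦ ?_⟩
    rw [appLE_congr_hom key' _ hg, e] at ha
    exact eq_zero_iff_mem.mp (ΓSpecIso_inv_injective _ (ha.trans (map_zero _).symm))

variable {φ s} {z : X} (C : ChartAt φ s z)

namespace ChartAt

abbrev f : Γ(Y, C.V) →+* Γ(X, C.W) := (φ.appLE C.V C.W C.le).hom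

/-- The first projection on functions. -/
abbrev ι₁ : Γ(X, C.W) →+* Γ(square φ s, sqOpen φ s C.W) :=
  ((fst (φ ≫ s) (φ ≫ s)).appLE C.W (sqOpen φ s C.W) (sqOpen_le_fst φ s C.W)).hom

/-- The second projection on functions. -/
abbrev ι₂ : Γ(X, C.W) →+* Γ(square φ s, sqOpen φ s C.W) :=
  ((snd (φ ≫ s) (φ ≫ s)).appLE C.W (sqOpen φ s C.W) (sqOpen_le_snd φ s C.W)).hom

lemma isSquareRing : IsSquareRing (C.f.comp (scalars s C.V)) C.ι₁ C.ι₂ := by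
  rw [appLE_comp_scalars φ s C.le]
  exact isSquareRing_sqOpen φ s C.isAffineOpen

end ChartAt

lemma isNewtonRing_fractionSubring' {B R : Type u} [CommRing B] [CommRing R] {c : k →+* B} {f : B →+* R}
    {δ : R} {r : ℕ} (hr : 2 ≤ r) {Q Q' L A : Type u} [CommRing Q]
    [CommRing Q'] [CommRing L] [CommRing A] {ι₁ ι₂ : R →+* Q} (hι : ι₁.comp (f.comp c) = ι₂.comp (f.comp c))
    {e : Q} {q : Q →+* Q'} (hq : Inverts q e) {ρ : Q' →+* L}
    (hρ : Inverts ρ (q (ι₁ δ) * q (ι₂ δ))) {I₁ I₂ D₁ D₂ : Ideal Q'}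
    (hI₁ : I₁ = Ideal.span (Set.range fun g ↦ q (ι₂ g) - q (ι₁ g)))
    (hI₂ : I₂ = Ideal.span (Set.range fun b ↦ q (ι₂ (f b)) - q (ι₁ (f b))))
    (hD₁ : D₁ = Ideal.span {q (ι₁ δ)}) (hD₂ : D₂ = Ideal.span {q (ι₂ δ)})
    {I K : Fin 4 → Ideal Q'} (hI : I = ![I₁, I₂, I₁, I₂])
    (hK : K = ![D₁ ^ (r - 1), D₁ ^ r, D₂ ^ (r - 1), D₂ ^ r]) {θ : Q →+* A}
    (E : fractionSubring ρ I K ≃+* A)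
    (hE : E.toRingHom.comp ((ρ.codRestrict (fractionSubring ρ I K)
      fun a ↦ mem_fractionSubring _ _ _ a).comp q) = θ) :
    IsNewtonRing c f δ r ι₁ ι₂ e θ := by
  subst hI hK hE
  have h := isNewtonRing_fractionSubring (c := c) hr hι hq hρ hI₁ hI₂ hD₁ hD₂
  refine ⟨h.pair.map E.toRingHom ?_, h.unit.map E.toRingHom, fun χ hχ hu ↦ ?_, fun {S} _ ψ ψ' hψ hn ↦ ?_⟩
  · exact mem_nonZeroDivisors_of_flat E.toRingHom (.of_bijective E.bijective) h.pair.mem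
  · obtain ⟨ψ, hψ⟩ := h.exists_lift χ hχ hu
    refine ⟨ψ.comp E.symm.toRingHom, ?_⟩
    rw [← hψ]
    ext x
    exact congrArg ψ (E.symm_apply_apply _)
  · have h1 := h.hom_ext (ψ := ψ.comp E.toRingHom) (ψ' := ψ'.comp E.toRingHom) hψ hn
    ext x
    obtain ⟨y, rfl⟩ := E.surjective x
    exact congr($h1 y)

end Boxes

section Boxes

open MvPolynomial

variable {k : Type u} [Field k] {X Y : Scheme.{u}} {φ : X ⟶ Y} {s : Y ⟶ Spec (.of k)}
  [LocallyOfFiniteType (φ ≫ s)] {z : X} (C : ChartAt φ s z) (r : ℕ)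

namespace ChartAt

variable {C} in
/-- The part of the Newton groupoid over the locus in `W × W` where `e` is invertible. -/
abbrev box (e : Γ(square φ s, sqOpen φ s C.W)) : (newtonScheme φ s r).Opens :=
  newtonMap φ s r ⁻¹ᵁ (square φ s).basicOpen e

variable {C} (e : Γ(square φ s, sqOpen φ s C.W))

lemma box_le : box r e ≤ newtonMap φ s r ⁻¹ᵁ sqOpen φ s C.W :=
  (newtonMap φ s r).preimage_mono ((square φ s).basicOpen_le e)

lemma box_le_source : box r e ≤ newtonSource φ s r ⁻¹ᵁ C.W :=
  (box_le r e).trans ((newtonMap φ s r).preimage_mono (sqOpen_le_fst φ s C.W))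

lemma box_le_target : box r e ≤ newtonTarget φ s r ⁻¹ᵁ C.W :=
  (box_le r e).trans ((newtonMap φ s r).preimage_mono (sqOpen_le_snd φ s C.W))

/-- Functions of the source. -/
abbrev sourceMap : Γ(X, C.W) →+* Γ(newtonScheme φ s r, box r e) :=
  ((newtonSource φ s r).appLE C.W (box r e) (box_le_source r e)).hom

/-- Functions of the target. -/
abbrev targetMap : Γ(X, C.W) →+* Γ(newtonScheme φ s r, box r e) :=
  ((newtonTarget φ s r).appLE C.W (box r e) (box_le_target r e)).hom

/-- Functions on the square. -/
abbrev squareMap : Γ(square φ s, sqOpen φ s C.W) →+* Γ(newtonScheme φ s r, box r e) :=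
  ((newtonMap φ s r).appLE (sqOpen φ s C.W) (box r e) (box_le r e)).hom

lemma squareMap_comp_ι₁ : (squareMap r e).comp C.ι₁ = sourceMap r e :=
  congrArg CommRingCat.Hom.hom (appLE_trans _ _ _ _ _)

lemma squareMap_comp_ι₂ : (squareMap r e).comp C.ι₂ = targetMap r e :=
  congrArg CommRingCat.Hom.hom (appLE_trans _ _ _ _ _)

end ChartAt

open ChartAt

/-- An explicit description of the Newton groupoid near the identity of `z`. -/
structure NewtonBox where
  e : Γ(square φ s, sqOpen φ s C.W)
  mem : e - 1 ∈ Ideal.span (Set.range fun b ↦ C.ι₂ (C.f b) - C.ι₁ (C.f b))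
  isAffineOpen : IsAffineOpen (box r e)
  isNewtonRing : IsNewtonRing (scalars s C.V) C.f C.chart.δ r C.ι₁ C.ι₂ e (squareMap r e)
  e₀ : C.chart.Poly
  E : C.chart.NewtonAlgebra r e₀ ≃+* Γ(newtonScheme φ s r, box r e)
  E_source : ∀ x, E (C.chart.source r e₀ x) = sourceMap r e x
  target_X : ∀ j, targetMap r e (C.chart.π (MvPolynomial.X j)) =
    sourceMap r e (C.chart.π (MvPolynomial.X j)) + sourceMap r e C.chart.δ ^ (r - 1) * E (C.chart.ξ r e₀ j)
  target_y : ∀ i, targetMap r e (C.f (C.chart.y i)) =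
    sourceMap r e (C.f (C.chart.y i)) + sourceMap r e C.chart.δ ^ r * E (C.chart.η r e₀ i)
  target_δ : targetMap r e C.chart.δ = sourceMap r e C.chart.δ *
    E (C.chart.unitAt r (C.chart.source r e₀) (C.chart.ξ r e₀))
  isUnit_evalPoly : ∀ {S : Type u} [CommRing S] (α : Γ(X, C.W) →+* S), α C.chart.δ = 0 →
    ∀ (ξ : C.chart.Idx → S) (η : Fin C.chart.n → S), C.chart.eqAt r α ξ η = 0 →
      IsUnit (C.chart.unitAt r α ξ) → IsUnit (C.chart.evalPoly α ξ η e₀)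

variable [IsSeparated s] [IsSeparated (φ ≫ s)] (ch : ∀ z, ChartAt φ s z)

include ch in
lemma squareOpen_inf_sqOpen :
    sqOpen φ s C.W ⊓ squareOpen φ s = (square φ s).basicOpen (C.ι₁ C.chart.δ * C.ι₂ C.chart.δ) := by
  have h1 : (square φ s).basicOpen (C.ι₁ C.chart.δ) =
      sqOpen φ s C.W ⊓ fst (φ ≫ s) (φ ≫ s) ⁻¹ᵁ X.basicOpen C.chart.δ :=
    Scheme.basicOpen_appLE _ _ _ _ _
  have h2 : (square φ s).basicOpen (C.ι₂ C.chart.δ) =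
      sqOpen φ s C.W ⊓ snd (φ ≫ s) (φ ≫ s) ⁻¹ᵁ X.basicOpen C.chart.δ :=
    Scheme.basicOpen_appLE _ _ _ _ _
  rw [Scheme.basicOpen_mul, h1, h2, ← C.inf_eq]
  ext x
  constructor
  · rintro ⟨⟨h1, h2⟩, h3, h4⟩; exact ⟨⟨⟨h1, h2⟩, h3, h1⟩, ⟨h1, h2⟩, h4, h2⟩
  · rintro ⟨⟨⟨h1, h2⟩, h3, _⟩, _, h4, _⟩; exact ⟨⟨h1, h2⟩, h3, h4⟩

include ch in
lemma exists_newtonBox (hr : 2 ≤ r) : Nonempty (NewtonBox C r) := by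
  have hWW := isAffineOpen_sqOpen φ s C.isAffineOpen
  have : IsNoetherianRing Γ(square φ s, sqOpen φ s C.W) :=
    IsLocallyNoetherian.component_noetherian ⟨_, hWW⟩
  obtain ⟨e, e₀, ρ, he, hρ, h1, h2, h3, h4, h5⟩ :=
    C.chart.exists_isNewtonRing hr C.isSquareRing C.δ_mem
  let q := (square φ s).presheaf.map (homOfLE ((square φ s).basicOpen_le e)).op
  let V : (square φ s).AffineZariskiSite := ⟨(square φ s).basicOpen e, hWW.basicOpen e⟩
  have hq : Inverts q.hom e := inverts_of_eq_basicOpen hWW.isCompact hWW.isQuasiSeparated e _ rfl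
  have hL : Inverts (restrictTo (squareOpen φ s) V.toOpens)
      (q.hom (C.ι₁ C.chart.δ) * q.hom (C.ι₂ C.chart.δ)) := by
    refine inverts_of_eq_basicOpen V.2.isCompact V.2.isQuasiSeparated _ _ ?_
    rw [← map_mul]
    refine .trans ?_ (Scheme.basicOpen_res _ _ _).symm
    rw [← squareOpen_inf_sqOpen C ch]
    ext x
    exact ⟨fun h ↦ ⟨h.1, (square φ s).basicOpen_le e h.1, h.2⟩, fun h ↦ ⟨h.1, h.2.2⟩⟩
  obtain ⟨E, hE⟩ := exists_fractionSectionsEquiv (squareOpen φ s)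
    ![idealDiagonal φ s, idealFiberProduct φ s, idealDiagonal φ s, idealFiberProduct φ s]
    ![idealD φ s ^ (r - 1), idealD φ s ^ r, idealDTilde φ s ^ (r - 1), idealDTilde φ s ^ r] V
  have hN : IsNewtonRing (scalars s C.V) C.f C.chart.δ r C.ι₁ C.ι₂ e (squareMap r e) := by
    have hVle := (square φ s).basicOpen_le e
    refine isNewtonRing_fractionSubring' hr C.isSquareRing.comp_eq hq hL
      (I₁ := (idealDiagonal φ s).ideal ⟨V.1, V.2⟩) (I₂ := (idealFiberProduct φ s).ideal ⟨V.1, V.2⟩)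
      (D₁ := (idealD φ s).ideal ⟨V.1, V.2⟩) (D₂ := (idealDTilde φ s).ideal ⟨V.1, V.2⟩) ?_ ?_ ?_ ?_
      (funext fun i ↦ ?_) (funext fun i ↦ ?_) E ?_
    · refine ((idealDiagonal φ s).map_ideal_basicOpen ⟨_, hWW⟩ e).symm.trans ?_
      rw [idealDiagonal_ideal φ s C.isAffineOpen, Ideal.map_span, ← Set.range_comp]
      congr! 3 with g
      exact map_sub q.hom _ _
    · refine ((idealFiberProduct φ s).map_ideal_basicOpen ⟨_, hWW⟩ e).symm.trans ?_
      rw [idealFiberProduct_ideal φ s C.isAffineOpen C.isAffineOpen' C.le, Ideal.map_span,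
        ← Set.range_comp]
      congr! 3 with g
      exact map_sub q.hom _ _
    · refine (ideal_comap _ _ C.isAffineOpen V.2 (hVle.trans (sqOpen_le_fst φ s C.W))).trans ?_
      rw [ideal_different ch, Ideal.map_span, Set.image_singleton]
      congr 2
      exact congr($((Scheme.Hom.appLE_map _ (sqOpen_le_fst φ s C.W) (homOfLE hVle).op).symm) _)
    · refine (ideal_comap _ _ C.isAffineOpen V.2 (hVle.trans (sqOpen_le_snd φ s C.W))).trans ?_
      rw [ideal_different ch, Ideal.map_span, Set.image_singleton]
      congr 2
      exact congr($((Scheme.Hom.appLE_map _ (sqOpen_le_snd φ s C.W) (homOfLE hVle).op).symm) _)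
    · fin_cases i <;> rfl
    · fin_cases i <;> rfl
    · refine (comp_assoc _ _ _).symm.trans ((congrArg (·.comp q.hom) hE).trans ?_)
      have h : q ≫ (newtonMap φ s r).app _ = (newtonMap φ s r).appLE _ _ (box_le r e) := by
        rw [Scheme.Hom.app_eq_appLE]
        exact Scheme.Hom.map_appLE (newtonMap φ s r) le_rfl (homOfLE hVle).op
      exact congr(($h).hom)
  obtain ⟨F, hF⟩ := hρ.exists_ringEquiv hN
  have hF' (x) : F (ρ x) = squareMap r e x := congr($hF x)
  have hs (x) : squareMap r e (C.ι₁ x) = sourceMap r e x := congr($(squareMap_comp_ι₁ r e) x)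
  have ht (x) : squareMap r e (C.ι₂ x) = targetMap r e x := congr($(squareMap_comp_ι₂ r e) x)
  have hsF (x) : F (C.chart.source r e₀ x) = sourceMap r e x := by
    rw [← h1, RingHom.comp_apply, hF', hs]
  refine ⟨⟨e, he, isAffineOpen_fractionSpecMap_preimage _ _ _ V, hN, e₀, F, hsF, fun j ↦ ?_, fun i ↦ ?_,
    ?_, h5⟩⟩
  · rw [← ht, ← hF', h2, map_add, map_mul, map_pow, hF', hF', hs, hs]
  · rw [← ht, ← hF', h3, map_add, map_mul, map_pow, hF', hF', hs, hs]
  · rw [← ht, ← hF', h4, map_mul, hF', hs]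

end Boxes

section LocalHoms

variable {T Z P : Scheme.{u}} {O : T.Opens} {B : Z.Opens} (hB : IsAffineOpen B)
include hB

lemma toSpecΓ_map_appLE_fromSpec' (g : T ⟶ Z) (h : O ≤ g ⁻¹ᵁ B) :
    O.toSpecΓ ≫ Spec.map (g.appLE B O h) ≫ hB.fromSpec = O.ι ≫ g := by
  rw [Scheme.Opens.toSpecΓ_SpecMap_appLE_assoc, hB.toSpecΓ_fromSpec, Scheme.Hom.resLE_comp_ι]

lemma ι_comp_ext_of_appLE {g g' : T ⟶ Z} (h : O ≤ g ⁻¹ᵁ B) (h' : O ≤ g' ⁻¹ᵁ B)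
    (e : g.appLE B O h = g'.appLE B O h') : O.ι ≫ g = O.ι ≫ g' := by
  rw [← toSpecΓ_map_appLE_fromSpec' hB g h, e, toSpecΓ_map_appLE_fromSpec' hB g' h']

lemma exists_local_lift (p : Z ⟶ P) {N : P.Opens} (hN : IsAffineOpen N) (hBN : B ≤ p ⁻¹ᵁ N)
    (g : T ⟶ P) (h : O ≤ g ⁻¹ᵁ N) (χ : Γ(Z, B) ⟶ Γ(T, O)) (e : p.appLE N B hBN ≫ χ = g.appLE N O h) :
    ∃ g' : (O : Scheme.{u}) ⟶ Z, g' ≫ p = O.ι ≫ g := by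
  refine ⟨O.toSpecΓ ≫ Spec.map χ ≫ hB.fromSpec, ?_⟩
  rw [← toSpecΓ_map_appLE_fromSpec' hN g h, ← e, Spec.map_comp, assoc, assoc,
    assoc, IsAffineOpen.SpecMap_appLE_fromSpec p hN hB hBN]

end LocalHoms

section NewtonScheme

variable {k : Type u} [Field k] {X Y : Scheme.{u}} {φ : X ⟶ Y} {s : Y ⟶ Spec (.of k)}
  [LocallyOfFiniteType (φ ≫ s)] (r : ℕ)

lemma isIso_newtonMap_app (V : (square φ s).AffineZariskiSite) (hV : V.toOpens ≤ squareOpen φ s) :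
    IsIso ((newtonMap φ s r).app V.toOpens) := by
  obtain ⟨E, hE⟩ := exists_fractionSectionsEquiv (squareOpen φ s)
    ![idealDiagonal φ s, idealFiberProduct φ s, idealDiagonal φ s, idealFiberProduct φ s]
    ![idealD φ s ^ (r - 1), idealD φ s ^ r, idealDTilde φ s ^ (r - 1), idealDTilde φ s ^ r] V
  have h1 : IsIso ((square φ s).presheaf.map
      (homOfLE (inf_le_left : V.toOpens ⊓ squareOpen φ s ≤ V.toOpens)).op) := by
    have : IsIso (homOfLE (inf_le_left : V.toOpens ⊓ squareOpen φ s ≤ V.toOpens)) :=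
      ⟨homOfLE (le_inf le_rfl hV), rfl, rfl⟩
    infer_instance
  have h2 := (ConcreteCategory.isIso_iff_bijective _).mp h1
  refine (ConcreteCategory.isIso_iff_bijective _).mpr ?_
  change Bijective ((fractionSpecMap _ _ _).app V.toOpens).hom
  rw [← hE]
  refine E.bijective.comp ⟨fun a b h ↦ h2.1 (congrArg Subtype.val h), fun b ↦ ?_⟩
  obtain ⟨a, ha⟩ := h2.2 b.1
  exact ⟨a, Subtype.ext ha⟩

variable [IsSeparated s] [IsSeparated (φ ≫ s)] (ch : ∀ z, ChartAt φ s z)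
include ch

/-- Away from `U × U` the Newton groupoid lies over the diagonal. -/
lemma exists_newtonMap_eq_diagonal (hr : 2 ≤ r) (γ : newtonScheme φ s r)
    (hγ : newtonMap φ s r γ ∉ squareOpen φ s) :
    ∃ x ∉ etaleLocus φ, newtonMap φ s r γ = pullback.diagonal (φ ≫ s) x := by
  set w := newtonMap φ s r γ
  let C₁ := ch (fst (φ ≫ s) (φ ≫ s) w)
  let C₂ := ch (snd (φ ≫ s) (φ ≫ s) w)
  obtain ⟨N, hN, hwN, hle⟩ := (square φ s).isBasis_affineOpens.exists_subset_of_mem_open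
    (a := w) (u := (fst (φ ≫ s) (φ ≫ s) ⁻¹ᵁ C₁.W ⊓ snd (φ ≫ s) (φ ≫ s) ⁻¹ᵁ C₂.W :
      (square φ s).Opens)) ⟨C₁.mem, C₂.mem⟩ (TopologicalSpace.Opens.isOpen _)
  obtain ⟨N, hN : IsAffineOpen N, rfl⟩ := hN
  let I : Fin 4 → (square φ s).IdealSheafData :=
    ![idealDiagonal φ s, idealFiberProduct φ s, idealDiagonal φ s, idealFiberProduct φ s]
  let K : Fin 4 → (square φ s).IdealSheafData :=
    ![idealD φ s ^ (r - 1), idealD φ s ^ r, idealDTilde φ s ^ (r - 1), idealDTilde φ s ^ r]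
  obtain ⟨E, hE⟩ := exists_fractionSectionsEquiv (squareOpen φ s) I K ⟨N, hN⟩
  have key (i : Fin 4) (hI : I i = idealDiagonal φ s) (J) (hK : K i = J ^ (r - 1)) (d : Γ(square φ s, N))
      (hJ : J.ideal ⟨N, hN⟩ = Ideal.span {d}) (hd : N ⊓ squareOpen φ s ≤ (square φ s).basicOpen d)
      (hw : w ∉ (square φ s).basicOpen d) : w ∈ (idealDiagonal φ s).support := by
    have hu : IsUnit (restrictTo (squareOpen φ s) N d) := by
      refine (square φ s).toRingedSpace.isUnit_of_isUnit_germ _ _ fun x hx ↦ ?_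
      have h1 := ((square φ s).mem_basicOpen d x hx.1).mp (hd hx)
      rw [← TopCat.Presheaf.germ_res_apply (square φ s).presheaf (homOfLE inf_le_left) x hx] at h1
      exact h1
    rw [Scheme.IdealSheafData.mem_support_iff_of_mem (U := ⟨N, hN⟩) hwN, Scheme.mem_zeroLocus_iff]
    intro a ha hwa
    obtain ⟨v, hv⟩ := hu.exists_right_inv
    have hs : restrictTo (squareOpen φ s) N a * v ^ (r - 1) ∈
        fractionSections (squareOpen φ s) I K ⟨N, hN⟩ := by
      refine Subring.subset_closure (Or.inr (Set.mem_iUnion.mpr ⟨i, ?_⟩))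
      change _ ∈ fractions (restrictTo (squareOpen φ s) N) ((I i).ideal ⟨N, hN⟩) ((K i).ideal ⟨N, hN⟩)
      rw [hI, hK]
      intro x hx
      rw [Scheme.IdealSheafData.ideal_pow, Pi.pow_apply, hJ, Ideal.span_singleton_pow] at hx
      obtain ⟨y, rfl⟩ := Ideal.mem_span_singleton'.mp hx
      refine ⟨y * a, Ideal.mul_mem_left _ _ ha, ?_⟩
      rw [map_mul, map_mul, map_pow]
      linear_combination restrictTo (squareOpen φ s) N y * restrictTo (squareOpen φ s) N a *
        (by rw [← mul_pow, hv, one_pow] : restrictTo (squareOpen φ s) N d ^ (r - 1) * v ^ (r - 1) = 1)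
    have h1 : toFractionSections (squareOpen φ s) I K ⟨N, hN⟩ a =
        toFractionSections (squareOpen φ s) I K ⟨N, hN⟩ d ^ (r - 1) * ⟨_, hs⟩ := by
      refine Subtype.ext ?_
      change restrictTo (squareOpen φ s) N a = restrictTo (squareOpen φ s) N d ^ (r - 1) * _
      linear_combination -restrictTo (squareOpen φ s) N a *
        (by rw [← mul_pow, hv, one_pow] : restrictTo (squareOpen φ s) N d ^ (r - 1) * v ^ (r - 1) = 1)
    have hE' (x) : E (toFractionSections (squareOpen φ s) I K ⟨N, hN⟩ x) =
      (newtonMap φ s r).app N x := congr($hE x)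
    obtain ⟨t, h2⟩ : ∃ t : Γ(newtonScheme φ s r, newtonMap φ s r ⁻¹ᵁ N), (newtonMap φ s r).app N a =
        (newtonMap φ s r).app N d ^ (r - 1) * t := by
      refine ⟨E ⟨_, hs⟩, ?_⟩
      have h2 := congrArg E h1
      rw [map_mul, map_pow, hE', hE'] at h2
      exact h2
    have h3 : γ ∈ newtonMap φ s r ⁻¹ᵁ (square φ s).basicOpen a := hwa
    rw [Scheme.preimage_basicOpen, h2, Scheme.basicOpen_mul, Scheme.basicOpen_pow _ _ (by omega),
      ← Scheme.preimage_basicOpen] at h3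
    exact hw h3.1
  have hmem : w ∈ (idealDiagonal φ s).support := by
    have hN₁ : N ≤ fst (φ ≫ s) (φ ≫ s) ⁻¹ᵁ C₁.W := fun x hx ↦ (hle hx).1
    have hN₂ : N ≤ snd (φ ≫ s) (φ ≫ s) ⁻¹ᵁ C₂.W := fun x hx ↦ (hle hx).2
    have b₁ := Scheme.basicOpen_appLE (fst (φ ≫ s) (φ ≫ s)) N _ hN₁ C₁.chart.δ
    have b₂ := Scheme.basicOpen_appLE (snd (φ ≫ s) (φ ≫ s)) N _ hN₂ C₂.chart.δ
    rw [← C₁.inf_eq] at b₁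
    rw [← C₂.inf_eq] at b₂
    by_cases hx : fst (φ ≫ s) (φ ≫ s) w ∈ etaleLocus φ
    · refine key 2 rfl _ rfl ((snd (φ ≫ s) (φ ≫ s)).appLE _ _ hN₂ C₂.chart.δ)
        ((ideal_comap _ _ C₂.isAffineOpen hN hN₂).trans ?_) ?_ ?_
      · rw [ideal_different ch, Ideal.map_span, Set.image_singleton]
      · rw [b₂]; exact fun x hx ↦ ⟨hx.1, hx.2.2, hN₂ hx.1⟩
      · rw [b₂]; exact fun h ↦ hγ ⟨hx, h.2.1⟩
    · refine key 0 rfl _ rfl ((fst (φ ≫ s) (φ ≫ s)).appLE _ _ hN₁ C₁.chart.δ)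
        ((ideal_comap _ _ C₁.isAffineOpen hN hN₁).trans ?_) ?_ ?_
      · rw [ideal_different ch, Ideal.map_span, Set.image_singleton]
      · rw [b₁]; exact fun x hx ↦ ⟨hx.1, hx.2.1, hN₁ hx.1⟩
      · rw [b₁]; exact fun h ↦ hx h.2.1
  have hmem' : w ∈ Set.range (pullback.diagonal (φ ≫ s)) := by
    rw [← (pullback.diagonal (φ ≫ s)).isClosedEmbedding.isClosed_range.closure_eq,
      ← Scheme.Hom.support_ker]
    exact hmem
  obtain ⟨x, hx⟩ := hmem'
  have h (p : square φ s ⟶ X) (hp : pullback.diagonal (φ ≫ s) ≫ p = 𝟙 X) : p w = x := by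
    rw [← hx, ← Scheme.Hom.comp_apply, hp]; rfl
  refine ⟨x, fun hxU ↦ hγ ⟨?_, ?_⟩, hx.symm⟩
  · change fst (φ ≫ s) (φ ≫ s) w ∈ etaleLocus φ
    rw [h _ (pullback.diagonal_fst _)]; exact hxU
  · change snd (φ ≫ s) (φ ≫ s) w ∈ etaleLocus φ
    rw [h _ (pullback.diagonal_snd _)]; exact hxU

end NewtonScheme

section Relation

variable {k : Type u} [Field k] {X Y : Scheme.{u}} {φ : X ⟶ Y} {s : Y ⟶ Spec (.of k)}
  {r : ℕ} {T T' : Scheme.{u}} {a b c : T ⟶ X}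

/-- Over the affine open `O`, the points `a` and `b` take values in a chart and form
a Newton pair. -/
structure NewtonNear {z : X} (C : ChartAt φ s z) (r : ℕ) (a b : T ⟶ X) (O : T.Opens) : Prop where
  isAffineOpen : IsAffineOpen O
  le : O ≤ a ⁻¹ᵁ C.W
  le' : O ≤ b ⁻¹ᵁ C.W
  pair : NewtonPair (scalars s C.V) C.f C.chart.δ r (a.appLE C.W O le).hom (b.appLE C.W O le').hom

lemma NewtonNear.comp {z : X} {C : ChartAt φ s z} {O : T.Opens} (h : NewtonNear C r a b O)
    (g : T' ⟶ T) [Flat g] {O' : T'.Opens} (hO' : IsAffineOpen O') (hle : O' ≤ g ⁻¹ᵁ O) :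
    NewtonNear C r (g ≫ a) (g ≫ b) O' where
  isAffineOpen := hO'
  le := hle.trans (g.preimage_mono h.le)
  le' := hle.trans (g.preimage_mono h.le')
  pair := by
    have h1 := h.pair.map (g.appLE O O' hle).hom
      (mem_nonZeroDivisors_of_flat _ (g.flat_appLE h.isAffineOpen hO' hle) h.pair.mem)
    rwa [← CommRingCat.hom_comp, ← CommRingCat.hom_comp,
      appLE_trans g a h.le hle (hle.trans (g.preimage_mono h.le)),
      appLE_trans g b h.le' hle (hle.trans (g.preimage_mono h.le'))] at h1

lemma NewtonNear.mono {z : X} {C : ChartAt φ s z} {O O' : T.Opens} (h : NewtonNear C r a b O)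
    (hO' : IsAffineOpen O') (hle : O' ≤ O) : NewtonNear C r a b O' := by
  have := h.comp (𝟙 T) hO' hle
  rwa [id_comp, id_comp] at this

variable (ch : ∀ z, ChartAt φ s z) (r)

/-- The pairs of points of `X` which are morphisms of the Newton groupoid. -/
def NewtonRel (a b : T ⟶ X) : Prop :=
  a ≫ φ ≫ s = b ≫ φ ≫ s ∧ ∀ t, (a t ∈ etaleLocus φ ∧ b t ∈ etaleLocus φ) ∨
    ∃ z O, t ∈ O ∧ a t = z ∧ b t = z ∧ NewtonNear (ch z) r a b O

variable {ch r}

namespace NewtonRel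

lemma comp (h : NewtonRel r ch a b) (g : T' ⟶ T) [Flat g] : NewtonRel r ch (g ≫ a) (g ≫ b) := by
  refine ⟨by rw [assoc, h.1, assoc], fun t ↦ ?_⟩
  obtain h1 | ⟨z, O, htO, rfl, hb, hn⟩ := h.2 (g t)
  · exact Or.inl h1
  · obtain ⟨_, ⟨O', hO', rfl⟩, htO', hle⟩ := T'.isBasis_affineOpens.exists_subset_of_mem_open
      (a := t) (u := (g ⁻¹ᵁ O : T'.Opens)) htO (TopologicalSpace.Opens.isOpen _)
    exact Or.inr ⟨_, O', htO', rfl, hb, hn.comp g hO' hle⟩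

lemma symm (h : NewtonRel r ch a b) : NewtonRel r ch b a := by
  refine ⟨h.1.symm, fun t ↦ ?_⟩
  obtain h1 | ⟨z, O, htO, ha, hb, hn⟩ := h.2 t
  · exact Or.inl h1.symm
  · exact Or.inr ⟨z, O, htO, hb, ha, ⟨hn.isAffineOpen, hn.le', hn.le, hn.pair.symm⟩⟩

lemma trans (h : NewtonRel r ch a b) (h' : NewtonRel r ch b c) : NewtonRel r ch a c := by
  refine ⟨h.1.trans h'.1, fun t ↦ ?_⟩
  obtain h1 | ⟨z, O, htO, ha, hb, hn⟩ := h.2 t <;>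
  obtain h2 | ⟨z', O', htO', hb', hc, hn'⟩ := h'.2 t
  · exact Or.inl ⟨h1.1, h2.2⟩
  · refine Or.inl ⟨h1.1, ?_⟩
    rw [hc, ← hb']; exact h1.2
  · refine Or.inl ⟨?_, h2.2⟩
    rw [ha, ← hb]; exact h2.1
  · obtain rfl : z = z' := hb.symm.trans hb'
    obtain ⟨_, ⟨O'', hO'', rfl⟩, htO'', hle⟩ := T.isBasis_affineOpens.exists_subset_of_mem_open
      (a := t) (u := (O ⊓ O' : T.Opens)) ⟨htO, htO'⟩ (TopologicalSpace.Opens.isOpen _)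
    have k1 := hn.mono hO'' (hle.trans Set.inter_subset_left)
    have k2 := hn'.mono hO'' (hle.trans Set.inter_subset_right)
    exact Or.inr ⟨z, O'', htO'', ha, hc, ⟨hO'', k1.le, k2.le', k1.pair.trans k2.pair⟩⟩

lemma refl : NewtonRel r ch (𝟙 X) (𝟙 X) := by
  refine ⟨rfl, fun t ↦ Or.inr ⟨t, (ch t).W, (ch t).mem, rfl, rfl, ⟨(ch t).isAffineOpen, le_rfl, le_rfl,
    .refl ?_⟩⟩⟩
  refine mem_nonZeroDivisors_of_flat _ ?_ (ch t).δ_mem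
  exact Scheme.Hom.flat_appLE (𝟙 X) (ch t).isAffineOpen (ch t).isAffineOpen _

end NewtonRel

variable [LocallyOfFiniteType (φ ≫ s)] [IsSeparated s] [IsSeparated (φ ≫ s)]

lemma NewtonBox.newtonNear {z : X} {C : ChartAt φ s z} (β : NewtonBox C r) :
    NewtonNear C r (newtonSource φ s r) (newtonTarget φ s r) (ChartAt.box r β.e) where
  isAffineOpen := β.isAffineOpen
  le := ChartAt.box_le_source r β.e
  le' := ChartAt.box_le_target r β.e
  pair := by
    have := β.isNewtonRing.pair
    rwa [ChartAt.squareMap_comp_ι₁, ChartAt.squareMap_comp_ι₂] at this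

lemma NewtonBox.diagonal_mem {z : X} {C : ChartAt φ s z} (β : NewtonBox C r) {x : X} (hx : x ∈ C.W) :
    pullback.diagonal (φ ≫ s) x ∈ (square φ s).basicOpen β.e := by
  have h0 : C.W ≤ pullback.diagonal (φ ≫ s) ⁻¹ᵁ sqOpen φ s C.W :=
    le_preimage_sqOpen φ s _ (by rw [pullback.diagonal_fst]; rfl) (by rw [pullback.diagonal_snd]; rfl)
  let μ := (pullback.diagonal (φ ≫ s)).appLE _ _ h0
  have hμ : μ.hom.comp C.ι₁ = μ.hom.comp C.ι₂ := by
    have h1 : C.W ≤ (pullback.diagonal (φ ≫ s) ≫ fst (φ ≫ s) (φ ≫ s)) ⁻¹ᵁ C.W := by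
      rw [pullback.diagonal_fst]; rfl
    have h2 : C.W ≤ (pullback.diagonal (φ ≫ s) ≫ snd (φ ≫ s) (φ ≫ s)) ⁻¹ᵁ C.W := by
      rw [pullback.diagonal_snd]; rfl
    exact congrArg CommRingCat.Hom.hom ((appLE_trans _ _ (sqOpen_le_fst φ s C.W) h0 h1).trans
      ((appLE_congr_hom (by rw [pullback.diagonal_fst, pullback.diagonal_snd]) _ h2).trans
      (appLE_trans _ _ (sqOpen_le_snd φ s C.W) h0 h2).symm))
  have h1 : μ β.e = 1 := by
    rw [← sub_eq_zero, ← map_one μ.hom, ← map_sub]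
    refine (Ideal.span_le (I := RingHom.ker μ.hom)).mpr ?_ β.mem
    rintro _ ⟨b, rfl⟩
    rw [SetLike.mem_coe, RingHom.mem_ker, map_sub, sub_eq_zero]
    exact congr($hμ (C.f b)).symm
  have h2 := Scheme.basicOpen_appLE (pullback.diagonal (φ ≫ s)) C.W _ h0 β.e
  change X.basicOpen (μ β.e) = _ at h2
  rw [h1, X.basicOpen_of_isUnit isUnit_one] at h2
  exact (h2.le hx).2

lemma newtonRel_source_target (hr : 2 ≤ r) (β : ∀ z, NewtonBox (ch z) r) :
    NewtonRel r ch (newtonSource φ s r) (newtonTarget φ s r) := by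
  refine ⟨by rw [newtonSource, newtonTarget, assoc, pullback.condition, assoc],
    fun γ ↦ ?_⟩
  by_cases h : newtonMap φ s r γ ∈ squareOpen φ s
  · exact Or.inl h
  · obtain ⟨x, -, hx⟩ := exists_newtonMap_eq_diagonal r ch hr γ h
    refine Or.inr ⟨x, _, ?_, ?_, ?_, (β x).newtonNear⟩
    · change newtonMap φ s r γ ∈ (square φ s).basicOpen (β x).e
      rw [hx]
      exact (β x).diagonal_mem (ch x).mem
    · rw [newtonSource, Scheme.Hom.comp_apply, hx, ← Scheme.Hom.comp_apply, pullback.diagonal_fst]; rfl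
    · rw [newtonTarget, Scheme.Hom.comp_apply, hx, ← Scheme.Hom.comp_apply, pullback.diagonal_snd]; rfl

/-- Near each point, a related pair lifts uniquely to the Newton groupoid. -/
lemma NewtonRel.exists_nhds (h : NewtonRel r ch a b) (hr : 2 ≤ r) (β : ∀ z, NewtonBox (ch z) r)
    (g : T ⟶ square φ s) (h₁ : g ≫ fst _ _ = a) (h₂ : g ≫ snd _ _ = b) (t : T) :
    ∃ O : T.Opens, t ∈ O ∧ (∃ g' : (O : Scheme.{u}) ⟶ newtonScheme φ s r, g' ≫ newtonMap φ s r = O.ι ≫ g) ∧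
      ∀ g₁ g₂ : T ⟶ newtonScheme φ s r, g₁ ≫ newtonMap φ s r = g → g₂ ≫ newtonMap φ s r = g →
        O.ι ≫ g₁ = O.ι ≫ g₂ := by
  subst h₁ h₂
  by_cases ht : g t ∈ squareOpen φ s
  · obtain ⟨_, ⟨N, hN, rfl⟩, htN, hle⟩ := (square φ s).isBasis_affineOpens.exists_subset_of_mem_open
      ht (squareOpen φ s).isOpen
    have := isIso_newtonMap_app r ⟨N, hN⟩ hle
    have hB : IsAffineOpen (newtonMap φ s r ⁻¹ᵁ N) :=
      isAffineOpen_fractionSpecMap_preimage _ _ _ ⟨N, hN⟩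
    refine ⟨g ⁻¹ᵁ N, htN, ?_, fun g₁ g₂ e₁ e₂ ↦ ?_⟩
    · refine exists_local_lift hB (newtonMap φ s r) hN le_rfl g le_rfl
        (inv ((newtonMap φ s r).app N) ≫ g.app N) ?_
      rw [← Scheme.Hom.app_eq_appLE, ← Scheme.Hom.app_eq_appLE, IsIso.hom_inv_id_assoc]
    · have k₁ : g ⁻¹ᵁ N ≤ g₁ ⁻¹ᵁ newtonMap φ s r ⁻¹ᵁ N := by rw [← e₁]; rfl
      have k₂ : g ⁻¹ᵁ N ≤ g₂ ⁻¹ᵁ newtonMap φ s r ⁻¹ᵁ N := by rw [← e₂]; rfl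
      refine ι_comp_ext_of_appLE hB k₁ k₂ ?_
      rw [← cancel_epi ((newtonMap φ s r).app N)]
      refine (app_comp_appLE _ _ k₁ (by rw [e₁])).trans (.trans ?_ (app_comp_appLE _ _ k₂ (by rw [e₂])).symm)
      exact appLE_congr_hom (e₁.trans e₂.symm) _ _
  · obtain h1 | ⟨z, O, htO, ha, hb, hn⟩ := h.2 t
    · exact absurd h1 ht
    have hz : z ∉ etaleLocus φ := fun hz ↦ ht ⟨by rw [← ha] at hz; exact hz, by rw [← hb] at hz; exact hz⟩
    have hWW := isAffineOpen_sqOpen φ s (ch z).isAffineOpen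
    have hle : O ≤ g ⁻¹ᵁ sqOpen φ s (ch z).W := le_preimage_sqOpen φ s g hn.le hn.le'
    let χ := g.appLE _ O hle
    have hχ₁ : χ.hom.comp (ch z).ι₁ = ((g ≫ fst _ _).appLE _ O hn.le).hom :=
      congrArg CommRingCat.Hom.hom (appLE_trans _ _ _ _ _)
    have hχ₂ : χ.hom.comp (ch z).ι₂ = ((g ≫ snd _ _).appLE _ O hn.le').hom :=
      congrArg CommRingCat.Hom.hom (appLE_trans _ _ _ _ _)
    have hte : t ∈ T.basicOpen (χ (β z).e) := by
      let α := ((g ≫ fst _ _).appLE (ch z).W O hn.le).hom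
      have h1 : χ (β z).e - 1 ∈ Ideal.span {α (ch z).chart.δ ^ r} := by
        rw [← map_one χ.hom, ← map_sub]
        refine (Ideal.span_le (I := (Ideal.span {α (ch z).chart.δ ^ r}).comap χ.hom)).mpr ?_ (β z).mem
        rintro _ ⟨b, rfl⟩
        rw [SetLike.mem_coe, Ideal.mem_comap, map_sub, Ideal.mem_span_singleton]
        have := hn.pair.dvd' b
        rw [← hχ₁, ← hχ₂] at this
        rw [show α = χ.hom.comp (ch z).ι₁ from hχ₁.symm]
        exact this
      obtain ⟨w, hw⟩ := Ideal.mem_span_singleton'.mp h1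
      have h2 : t ∉ T.basicOpen (α (ch z).chart.δ) := by
        rw [Scheme.basicOpen_appLE, ← (ch z).inf_eq]
        exact fun h ↦ hz (by rw [← ha]; exact h.2.1)
      rw [T.mem_basicOpen _ t htO] at h2 ⊢
      have h3 : T.presheaf.germ O t htO (χ (β z).e) +
          T.presheaf.germ O t htO (-(w * α (ch z).chart.δ ^ r)) = 1 := by
        rw [← map_add, hw, ← map_one (T.presheaf.germ O t htO).hom]
        congr 1; ring
      refine (IsLocalRing.isUnit_or_isUnit_of_add_one h3).resolve_right fun h4 ↦ h2 ?_
      rw [map_neg, IsUnit.neg_iff, map_mul, map_pow] at h4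
      exact (isUnit_pow_iff (by omega)).mp (isUnit_of_mul_isUnit_right h4)
    have hO' := hn.isAffineOpen.basicOpen (χ (β z).e)
    have hle' : T.basicOpen (χ (β z).e) ≤ g ⁻¹ᵁ (square φ s).basicOpen (β z).e := by
      rw [Scheme.basicOpen_appLE]; exact inf_le_right
    have hn' := hn.mono hO' (T.basicOpen_le _)
    generalize T.basicOpen (χ (β z).e) = O' at *
    have hle₀ : O' ≤ g ⁻¹ᵁ sqOpen φ s (ch z).W := le_preimage_sqOpen φ s g hn'.le hn'.le'
    let χ := g.appLE _ O' hle₀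
    have hχ₁ : χ.hom.comp (ch z).ι₁ = ((g ≫ fst _ _).appLE _ O' hn'.le).hom :=
      congrArg CommRingCat.Hom.hom (appLE_trans _ _ _ _ _)
    have hχ₂ : χ.hom.comp (ch z).ι₂ = ((g ≫ snd _ _).appLE _ O' hn'.le').hom :=
      congrArg CommRingCat.Hom.hom (appLE_trans _ _ _ _ _)
    have hu : IsUnit (χ (β z).e) := by
      have h1 : (square φ s).presheaf.map (homOfLE ((square φ s).basicOpen_le (β z).e)).op ≫
          g.appLE _ O' hle' = χ := Scheme.Hom.map_appLE ..
      rw [← h1]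
      exact ((square φ s).toRingedSpace.isUnit_res_basicOpen (β z).e).map (g.appLE _ O' hle').hom
    refine ⟨O', hte, ?_, fun g₁ g₂ e₁ e₂ ↦ ?_⟩
    · obtain ⟨ψ, hψ⟩ := (β z).isNewtonRing.exists_lift χ.hom (by rw [hχ₁, hχ₂]; exact hn'.pair) hu
      exact exists_local_lift (β z).isAffineOpen (newtonMap φ s r) hWW (ChartAt.box_le r (β z).e) g hle₀
        (ofHom ψ) (CommRingCat.hom_ext hψ)
    · have k₁ : O' ≤ g₁ ⁻¹ᵁ ChartAt.box r (β z).e := by rw [← e₁] at hle'; exact hle'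
      have k₂ : O' ≤ g₂ ⁻¹ᵁ ChartAt.box r (β z).e := by rw [← e₂] at hle'; exact hle'
      refine ι_comp_ext_of_appLE (β z).isAffineOpen k₁ k₂ (CommRingCat.hom_ext ?_)
      have l₁ : (g₁.appLE _ O' k₁).hom.comp (ChartAt.squareMap r (β z).e) = χ.hom :=
        congrArg CommRingCat.Hom.hom ((appLE_trans _ _ _ _ (by rw [e₁]; exact hle₀)).trans
          (appLE_congr_hom e₁ _ _))
      have l₂ : (g₂.appLE _ O' k₂).hom.comp (ChartAt.squareMap r (β z).e) = χ.hom :=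
        congrArg CommRingCat.Hom.hom ((appLE_trans _ _ _ _ (by rw [e₂]; exact hle₀)).trans
          (appLE_congr_hom e₂ _ _))
      refine (β z).isNewtonRing.hom_ext (l₁.trans l₂.symm) ?_
      have l₃ : (g₁.appLE _ O' k₁).hom (ChartAt.squareMap r (β z).e ((ch z).ι₁ (ch z).chart.δ)) =
        ((g ≫ fst _ _).appLE _ O' hn'.le).hom (ch z).chart.δ := by rw [← hχ₁, ← l₁]; rfl
      rw [l₃]
      exact hn'.pair.mem

end Relation

section Smoothness

lemma smooth_ι_comp {X Y : Scheme.{u}} (φ : X ⟶ Y) {V : Y.Opens} (hV : IsAffineOpen V) {D : X.Opens}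
    (hD : IsAffineOpen D) (h : D ≤ φ ⁻¹ᵁ V) (hs : (φ.appLE V D h).hom.Smooth) : Smooth (D.ι ≫ φ) := by
  have : D.ι ≫ φ = hD.isoSpec.hom ≫ Spec.map (φ.appLE V D h) ≫ hV.fromSpec := by
    rw [IsAffineOpen.SpecMap_appLE_fromSpec φ hV hD h, IsAffineOpen.fromSpec, assoc,
      Iso.hom_inv_id_assoc]
  rw [this]
  have := (HasRingHomProperty.Spec_iff (P := @Smooth)).mpr hs
  infer_instance

variable {k : Type u} [Field k] {X Y : Scheme.{u}} {φ : X ⟶ Y} {s : Y ⟶ Spec (.of k)}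
  {r : ℕ} [LocallyOfFiniteType (φ ≫ s)]

instance : IsAffineHom (newtonMap φ s r) :=
  ⟨fun V hV ↦ isAffineOpen_fractionSpecMap_preimage _ _ _ ⟨V, hV⟩⟩

/-- The projection from `X × D` to `X` is smooth if `D` is smooth. -/
lemma smooth_fst_of_le {D : X.Opens} (hD : Smooth (D.ι ≫ φ ≫ s)) {N : (square φ s).Opens}
    (hN : N ≤ snd (φ ≫ s) (φ ≫ s) ⁻¹ᵁ D) :
    Smooth (N.ι ≫ fst (φ ≫ s) (φ ≫ s)) := by
  let j : pullback (φ ≫ s) (D.ι ≫ φ ≫ s) ⟶ square φ s :=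
    pullback.map _ _ _ _ (𝟙 X) D.ι (𝟙 _) (by simp) (by simp)
  have hj : Set.range N.ι ⊆ Set.range j := by
    rw [N.range_ι, Scheme.Pullback.range_map, D.range_ι]
    exact fun x hx ↦ ⟨⟨_, rfl⟩, hN hx⟩
  have hl := IsOpenImmersion.lift_fac j N.ι hj
  have : IsOpenImmersion (IsOpenImmersion.lift j N.ι hj) := by
    have : IsOpenImmersion (IsOpenImmersion.lift j N.ι hj ≫ j) := by rw [hl]; infer_instance
    exact IsOpenImmersion.of_comp _ j
  have hf : j ≫ fst (φ ≫ s) (φ ≫ s) = fst _ _ :=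
    (pullback.lift_fst _ _ _).trans (comp_id _)
  rw [← hl, assoc, hf]
  infer_instance

variable [Smooth s] [IsSeparated s] [IsSeparated (φ ≫ s)] {ch : ∀ z, ChartAt φ s z}

lemma smooth_newtonSource (hr : 2 ≤ r) (β : ∀ z, NewtonBox (ch z) r) : Smooth (newtonSource φ s r) := by
  have key : ∀ γ : newtonScheme φ s r, ∃ D : (newtonScheme φ s r).Opens, γ ∈ D ∧
      Smooth (D.ι ≫ newtonSource φ s r) := by
    intro γ
    by_cases h : newtonMap φ s r γ ∈ squareOpen φ s
    · obtain ⟨D, hxD, hD⟩ := exists_etale_of_mem_etaleLocus φ h.2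
      have hD' : Smooth (D.ι ≫ φ ≫ s) := by rw [← assoc]; infer_instance
      obtain ⟨_, ⟨N, hN, rfl⟩, hwN, hle⟩ := (square φ s).isBasis_affineOpens.exists_subset_of_mem_open
        (a := newtonMap φ s r γ) (u := (squareOpen φ s ⊓ snd (φ ≫ s) (φ ≫ s) ⁻¹ᵁ D :
          (square φ s).Opens)) ⟨h, hxD⟩ (TopologicalSpace.Opens.isOpen _)
      have h1 : IsIso (newtonMap φ s r ∣_ N) :=
        (isIso_morphismRestrict_iff_isIso_app _ hN).mpr
          (isIso_newtonMap_app r ⟨N, hN⟩ (hle.trans Set.inter_subset_left))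
      refine ⟨newtonMap φ s r ⁻¹ᵁ N, hwN, ?_⟩
      have h2 := smooth_fst_of_le hD' (hle.trans Set.inter_subset_right : N ≤ _)
      rw [newtonSource, ← morphismRestrict_ι_assoc]
      infer_instance
    · obtain ⟨x, -, hx⟩ := exists_newtonMap_eq_diagonal r ch hr γ h
      refine ⟨ChartAt.box r (β x).e, ?_, smooth_ι_comp _ (ch x).isAffineOpen (β x).isAffineOpen
        (ChartAt.box_le_source r _) ?_⟩
      · change newtonMap φ s r γ ∈ (square φ s).basicOpen (β x).e
        rw [hx]
        exact (β x).diagonal_mem (ch x).mem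
      · have h1 : ChartAt.sourceMap r (β x).e =
            (β x).E.toRingHom.comp ((ch x).chart.source r (β x).e₀) :=
          RingHom.ext fun a ↦ ((β x).E_source a).symm
        change (ChartAt.sourceMap r (β x).e).Smooth
        rw [h1]
        have h2 := (ch x).chart.isStandardSmooth_newtonAlgebra r (β x).e₀ hr (ch x).δ_mem
        have h3 : ((ch x).chart.source r (β x).e₀).Smooth := by
          rw [RingHom.smooth_algebraMap]
          infer_instance
        exact h3.comp (RingHom.Smooth.of_bijective (β x).E.bijective)
  choose D hD h using key
  have : IsZariskiLocalAtSource @Smooth := HasRingHomProperty.instIsZariskiLocalAtSource (P := @Smooth)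
  refine IsZariskiLocalAtSource.of_openCover (P := @Smooth)
    (Scheme.openCoverOfIsOpenCover _ D ?_) h
  exact eq_top_iff.mpr fun γ _ ↦ TopologicalSpace.Opens.mem_iSup.mpr ⟨γ, hD γ⟩

end Smoothness

section Lifting

lemma exists_glued_lift {T Z P : Scheme.{u}} (p : Z ⟶ P) (g : T ⟶ P) (O : T → T.Opens)
    (hO : ∀ t, t ∈ O t) (f : ∀ t, (O t : Scheme.{u}) ⟶ Z) (hf : ∀ t, f t ≫ p = (O t).ι ≫ g)
    (h : ∀ {T' : Scheme.{u}} (i : T' ⟶ T) [IsOpenImmersion i] (g₁ g₂ : T' ⟶ Z),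
      g₁ ≫ p = i ≫ g → g₂ ≫ p = i ≫ g → g₁ = g₂) : ∃ G : T ⟶ Z, G ≫ p = g := by
  let 𝒰 : T.OpenCover := Scheme.openCoverOfIsOpenCover T O
    (eq_top_iff.mpr fun t _ ↦ TopologicalSpace.Opens.mem_iSup.mpr ⟨t, hO t⟩)
  have hc (x y : T) : fst (O x).ι (O y).ι ≫ f x = snd (O x).ι (O y).ι ≫ f y :=
    h (fst (O x).ι (O y).ι ≫ (O x).ι) _ _ (by rw [assoc, hf, assoc])
      (by rw [assoc, hf, pullback.condition, assoc])
  refine ⟨𝒰.glueMorphisms f hc, 𝒰.hom_ext _ _ fun x ↦ ?_⟩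
  exact (assoc _ _ _).symm.trans
    ((congrArg (· ≫ p) (𝒰.ι_glueMorphisms f hc x)).trans (hf x))

variable {k : Type u} [Field k] {X Y : Scheme.{u}} {φ : X ⟶ Y} {s : Y ⟶ Spec (.of k)}
  {r : ℕ} [LocallyOfFiniteType (φ ≫ s)] [IsSeparated s] [IsSeparated (φ ≫ s)]
  {ch : ∀ z, ChartAt φ s z} (hr : 2 ≤ r) (β : ∀ z, NewtonBox (ch z) r) {T : Scheme.{u}} {a b : T ⟶ X}

include hr β

lemma NewtonRel.unique (h : NewtonRel r ch a b) {g₁ g₂ : T ⟶ newtonScheme φ s r}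
    (h₁ : g₁ ≫ newtonSource φ s r = a) (h₁' : g₁ ≫ newtonTarget φ s r = b)
    (h₂ : g₂ ≫ newtonSource φ s r = a) (h₂' : g₂ ≫ newtonTarget φ s r = b) : g₁ = g₂ := by
  have e : g₁ ≫ newtonMap φ s r = g₂ ≫ newtonMap φ s r := by
    refine pullback.hom_ext ?_ ?_
    · rw [assoc, assoc]; exact h₁.trans h₂.symm
    · rw [assoc, assoc]; exact h₁'.trans h₂'.symm
  refine Scheme.hom_ext_of_forall _ _ fun t ↦ ?_
  obtain ⟨O, htO, -, h3⟩ := h.exists_nhds hr β (g₂ ≫ newtonMap φ s r)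
    ((assoc _ _ _).trans h₂) ((assoc _ _ _).trans h₂') t
  exact ⟨O, htO, h3 g₁ g₂ e rfl⟩

lemma NewtonRel.exists_lift (h : NewtonRel r ch a b) : ∃ g : T ⟶ newtonScheme φ s r,
    g ≫ newtonSource φ s r = a ∧ g ≫ newtonTarget φ s r = b := by
  let g := pullback.lift a b h.1
  have hg₁ : g ≫ fst _ _ = a := pullback.lift_fst _ _ _
  have hg₂ : g ≫ snd _ _ = b := pullback.lift_snd _ _ _
  choose O htO hO hO' using h.exists_nhds hr β g hg₁ hg₂
  choose f hf using hO
  obtain ⟨G, hG⟩ := exists_glued_lift (newtonMap φ s r) g O htO f hf fun i _ g₁ g₂ e₁ e₂ ↦ by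
    have e (g' : _ ⟶ newtonScheme φ s r) (e' : g' ≫ newtonMap φ s r = i ≫ g) (p : square φ s ⟶ X) :
        g' ≫ newtonMap φ s r ≫ p = i ≫ g ≫ p := by
      rw [reassoc_of% e']
    refine (h.comp i).unique hr β ?_ ?_ ?_ ?_
    · rw [newtonSource, e _ e₁, hg₁]
    · rw [newtonTarget, e _ e₁, hg₂]
    · rw [newtonSource, e _ e₂, hg₁]
    · rw [newtonTarget, e _ e₂, hg₂]
  refine ⟨G, ?_, ?_⟩
  · rw [newtonSource, reassoc_of% hG, hg₁]
  · rw [newtonTarget, reassoc_of% hG, hg₂]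

end Lifting

section FlatRelation

variable {X Γ : Scheme.{u}}

/-- An equivalence relation on points of `X`, stable under flat base change, whose pairs lift
uniquely along `(p₁, p₂) : Γ → X × X`. -/
structure IsFlatRelation (p₁ p₂ : Γ ⟶ X) (R : ∀ {T : Scheme.{u}}, (T ⟶ X) → (T ⟶ X) → Prop) :
    Prop where
  comp : ∀ {T T' : Scheme.{u}} {a b : T ⟶ X} (_ : R a b) (g : T' ⟶ T) [Flat g], R (g ≫ a) (g ≫ b)
  refl : R (𝟙 X) (𝟙 X)
  symm : ∀ {T : Scheme.{u}} {a b : T ⟶ X}, R a b → R b a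
  trans : ∀ {T : Scheme.{u}} {a b c : T ⟶ X}, R a b → R b c → R a c
  rel : R p₁ p₂
  exists_lift : ∀ {T : Scheme.{u}} {a b : T ⟶ X}, R a b → ∃ g : T ⟶ Γ, g ≫ p₁ = a ∧ g ≫ p₂ = b
  unique : ∀ {T : Scheme.{u}} {a b : T ⟶ X}, R a b → ∀ {g₁ g₂ : T ⟶ Γ}, g₁ ≫ p₁ = a → g₁ ≫ p₂ = b →
    g₂ ≫ p₁ = a → g₂ ≫ p₂ = b → g₁ = g₂

namespace IsFlatRelation

variable {p₁ p₂ : Γ ⟶ X} {R : ∀ {T : Scheme.{u}}, (T ⟶ X) → (T ⟶ X) → Prop}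
  (H : IsFlatRelation p₁ p₂ R)

include H

lemma ext {T : Scheme.{u}} {g₁ g₂ : T ⟶ Γ} (h : R (g₁ ≫ p₁) (g₁ ≫ p₂)) (h₁ : g₂ ≫ p₁ = g₁ ≫ p₁)
    (h₂ : g₂ ≫ p₂ = g₁ ≫ p₂) : g₁ = g₂ :=
  H.unique h rfl rfl h₁ h₂

lemma exists_inv : ∃ i : Γ ⟶ Γ, i ≫ p₁ = p₂ ∧ i ≫ p₂ = p₁ ∧ i ≫ i = 𝟙 Γ := by
  obtain ⟨i, h₁, h₂⟩ := H.exists_lift (H.symm H.rel)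
  refine ⟨i, h₁, h₂, (H.ext (g₁ := 𝟙 Γ) ?_ ?_ ?_).symm⟩
  · rw [id_comp, id_comp]; exact H.rel
  · rw [assoc, h₁, h₂, id_comp]
  · rw [assoc, h₂, h₁, id_comp]

variable [Flat p₁]

lemma flat_target : Flat p₂ := by
  obtain ⟨i, h₁, -, h₃⟩ := H.exists_inv
  have : IsIso i := ⟨i, h₃, h₃⟩
  rw [← h₁]
  infer_instance

lemma rel_pullback : R (fst p₂ p₁ ≫ p₁) (snd p₂ p₁ ≫ p₂) := by
  have := H.flat_target
  have h1 := H.comp H.rel (snd p₂ p₁)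
  rw [← pullback.condition] at h1
  exact H.trans (H.comp H.rel (fst p₂ p₁)) h1

theorem exists_groupoidOn : ∃ G : GroupoidOn p₁ p₂, ∀ G' : GroupoidOn p₁ p₂, G' = G := by
  have := H.flat_target
  obtain ⟨i, i₁, i₂, -⟩ := H.exists_inv
  obtain ⟨e, e₁, e₂⟩ := H.exists_lift H.refl
  obtain ⟨c, c₁, c₂⟩ := H.exists_lift H.rel_pullback
  have hc (T : Scheme.{u}) (a b : T ⟶ Γ) (h : a ≫ p₂ = b ≫ p₁) :
      (pullback.lift a b h ≫ c) ≫ p₁ = a ≫ p₁ ∧ (pullback.lift a b h ≫ c) ≫ p₂ = b ≫ p₂ := by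
    rw [assoc, assoc, c₁, c₂, pullback.lift_fst_assoc, pullback.lift_snd_assoc]
    exact ⟨rfl, rfl⟩
  have lift_comp (T T' : Scheme.{u}) (f : T' ⟶ T) (a b : T ⟶ Γ) (h : a ≫ p₂ = b ≫ p₁)
      (h' : (f ≫ a) ≫ p₂ = (f ≫ b) ≫ p₁) :
      pullback.lift (f ≫ a) (f ≫ b) h' = f ≫ pullback.lift a b h :=
    pullback.hom_ext (by rw [assoc, pullback.lift_fst, pullback.lift_fst])
      (by rw [assoc, pullback.lift_snd, pullback.lift_snd])
  let G : GroupoidOn p₁ p₂ :=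
    { comp := c
      unit := e
      inv := i
      comp_p₁ := c₁
      comp_p₂ := c₂
      unit_p₁ := e₁
      unit_p₂ := e₂
      inv_p₁ := i₁
      inv_p₂ := i₂
      assoc := by
        intro T a b d hab hbd
        let q : pullback (snd p₂ p₁ ≫ p₂) p₁ ⟶ _ := fst _ _
        let A := q ≫ fst p₂ p₁
        let B := q ≫ snd p₂ p₁
        let D : pullback (snd p₂ p₁ ≫ p₂) p₁ ⟶ Γ := snd _ _
        have hAB : A ≫ p₂ = B ≫ p₁ := by simp only [A, B, assoc, pullback.condition]
        have hBD : B ≫ p₂ = D ≫ p₁ := by simp only [B, D, q, assoc, pullback.condition]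
        have hABD : (pullback.lift A B hAB ≫ c) ≫ p₂ = D ≫ p₁ := by rw [(hc _ A B hAB).2, hBD]
        have hABD' : A ≫ p₂ = (pullback.lift B D hBD ≫ c) ≫ p₁ := by rw [(hc _ B D hBD).1, hAB]
        have key : pullback.lift (pullback.lift A B hAB ≫ c) D hABD ≫ c =
            pullback.lift A (pullback.lift B D hBD ≫ c) hABD' ≫ c := by
          refine H.ext ?_ ?_ ?_
          · rw [(hc _ _ D hABD).1, (hc _ _ D hABD).2, (hc _ A B hAB).1]
            have h1 := H.comp H.rel_pullback q
            have h2 := H.comp H.rel D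
            rw [← assoc, ← assoc] at h1
            change R (A ≫ p₁) (B ≫ p₂) at h1
            rw [hBD] at h1
            exact H.trans h1 h2
          · rw [(hc _ _ D hABD).1, (hc _ A _ hABD').1, (hc _ A B hAB).1]
          · rw [(hc _ _ D hABD).2, (hc _ A _ hABD').2, (hc _ B D hBD).2]
        let t : T ⟶ pullback (snd p₂ p₁ ≫ p₂) p₁ :=
          pullback.lift (pullback.lift a b hab) d (by rw [pullback.lift_snd_assoc, hbd])
        have ta : t ≫ A = a := by simp only [t, A, q, pullback.lift_fst_assoc, pullback.lift_fst]
        have tb : t ≫ B = b := by simp only [t, B, q, pullback.lift_fst_assoc, pullback.lift_snd]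
        have td : t ≫ D = d := pullback.lift_snd _ _ _
        clear_value t A B D
        subst ta tb td
        have k1 : pullback.lift (pullback.lift (t ≫ A) (t ≫ B) hab ≫ c) (t ≫ D) (by
            rw [(hc _ _ _ hab).2, hbd]) =
            t ≫ pullback.lift (pullback.lift A B hAB ≫ c) D hABD := by
          rw [← lift_comp _ _ t _ _ hABD (by rw [assoc, hABD, assoc])]
          congr 1
          rw [lift_comp _ _ t A B hAB, assoc]
        have k2 : pullback.lift (t ≫ A) (pullback.lift (t ≫ B) (t ≫ D) hbd ≫ c) (by
            rw [(hc _ _ _ hbd).1, hab]) =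
            t ≫ pullback.lift A (pullback.lift B D hBD ≫ c) hABD' := by
          rw [← lift_comp _ _ t _ _ hABD'
            (((assoc _ _ _).trans (congrArg (t ≫ ·) hABD')).trans (assoc _ _ _).symm)]
          congr 1
          rw [lift_comp _ _ t B D hBD, assoc]
        rw [k1, k2, assoc, key, assoc]
      unit_comp := by
        intro T a
        have h0 : (p₁ ≫ e) ≫ p₂ = 𝟙 Γ ≫ p₁ := by
          rw [assoc, e₂, comp_id, id_comp]
        have h1 : 𝟙 Γ = pullback.lift (p₁ ≫ e) (𝟙 Γ) h0 ≫ c := by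
          refine H.ext ?_ ?_ ?_
          · rw [id_comp, id_comp]; exact H.rel
          · rw [(hc _ _ _ h0).1, assoc, e₁, comp_id, id_comp]
          · rw [(hc _ _ _ h0).2]
        have h2 := lift_comp _ _ a _ _ h0 (by rw [assoc, h0, ← assoc])
        simp only [comp_id] at h2
        rw [h2, assoc, ← h1, comp_id]
      comp_unit := by
        intro T a
        have h0 : 𝟙 Γ ≫ p₂ = (p₂ ≫ e) ≫ p₁ := by
          rw [assoc, e₁, comp_id, id_comp]
        have h1 : 𝟙 Γ = pullback.lift (𝟙 Γ) (p₂ ≫ e) h0 ≫ c := by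
          refine H.ext ?_ ?_ ?_
          · rw [id_comp, id_comp]; exact H.rel
          · rw [(hc _ _ _ h0).1]
          · rw [(hc _ _ _ h0).2, assoc, e₂, comp_id, id_comp]
        have h2 := lift_comp _ _ a _ _ h0 (by rw [assoc, h0, ← assoc])
        simp only [comp_id] at h2
        rw [h2, assoc, ← h1, comp_id]
      inv_comp := by
        intro T a
        have h0 : i ≫ p₂ = 𝟙 Γ ≫ p₁ := by rw [i₂, id_comp]
        have h1 : p₂ ≫ e = pullback.lift i (𝟙 Γ) h0 ≫ c := by
          refine H.ext ?_ ?_ ?_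
          · rw [assoc, assoc, e₁, e₂]; exact H.comp H.refl p₂
          · rw [(hc _ _ _ h0).1, assoc, i₁, e₁, comp_id]
          · rw [(hc _ _ _ h0).2, assoc, e₂, comp_id, id_comp]
        have h2 := lift_comp _ _ a _ _ h0 (by rw [assoc, h0, ← assoc])
        simp only [comp_id] at h2
        rw [h2, assoc, ← h1]
      comp_inv := by
        intro T a
        have h0 : 𝟙 Γ ≫ p₂ = i ≫ p₁ := by rw [i₁, id_comp]
        have h1 : p₁ ≫ e = pullback.lift (𝟙 Γ) i h0 ≫ c := by
          refine H.ext ?_ ?_ ?_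
          · rw [assoc, assoc, e₁, e₂]; exact H.comp H.refl p₁
          · rw [(hc _ _ _ h0).1, assoc, e₁, comp_id, id_comp]
          · rw [(hc _ _ _ h0).2, assoc, e₂, comp_id, i₂]
        have h2 := lift_comp _ _ a _ _ h0 (by rw [assoc, h0, ← assoc])
        simp only [comp_id] at h2
        rw [h2, assoc, ← h1] }
  refine ⟨G, fun G' ↦ GroupoidOn.ext ?_ ?_ ?_⟩
  · exact H.unique H.rel_pullback G'.comp_p₁ G'.comp_p₂ c₁ c₂
  · exact H.unique H.refl G'.unit_p₁ G'.unit_p₂ e₁ e₂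
  · exact H.unique (H.symm H.rel) G'.inv_p₁ G'.inv_p₂ i₁ i₂

end IsFlatRelation

end FlatRelation

section NewtonRelation

variable {k : Type u} [Field k] {X Y : Scheme.{u}} {φ : X ⟶ Y} {s : Y ⟶ Spec (.of k)}
  {r : ℕ} [LocallyOfFiniteType (φ ≫ s)] [IsSeparated s] [IsSeparated (φ ≫ s)]
  {ch : ∀ z, ChartAt φ s z}

lemma isFlatRelation_newtonRel (hr : 2 ≤ r) (β : ∀ z, NewtonBox (ch z) r) :
    IsFlatRelation (newtonSource φ s r) (newtonTarget φ s r) (NewtonRel r ch) where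
  comp h g _ := h.comp g
  refl := .refl
  symm h := h.symm
  trans h h' := h.trans h'
  rel := newtonRel_source_target hr β
  exists_lift h := h.exists_lift hr β
  unique h _ _ h₁ h₁' h₂ h₂' := h.unique hr β h₁ h₁' h₂ h₂'

end NewtonRelation

section Boxes

variable {k : Type u} [Field k] {X Y : Scheme.{u}} {φ : X ⟶ Y} {s : Y ⟶ Spec (.of k)}
  [LocallyOfFiniteType (φ ≫ s)] {z : X} {C : ChartAt φ s z} {r : ℕ}

open ChartAt

namespace NewtonBox

variable (β : NewtonBox C r) {S S' : Type u} [CommRing S] [CommRing S']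
  (χ : Γ(newtonScheme φ s r, box r β.e) →+* S)

/-- The first coordinates of a point of the box. -/
def ξ (j : C.chart.Idx) : S := χ (β.E (C.chart.ξ r β.e₀ j))

/-- The second coordinates of a point of the box. -/
def η (i : Fin C.chart.n) : S := χ (β.E (C.chart.η r β.e₀ i))

lemma comp_E_source : (χ.comp β.E.toRingHom).comp (C.chart.source r β.e₀) =
    χ.comp (sourceMap r β.e) :=
  RingHom.ext fun x ↦ congrArg χ (β.E_source x)

lemma eqAt_eq_zero : C.chart.eqAt r (χ.comp (sourceMap r β.e)) (β.ξ χ) (β.η χ) = 0 := by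
  have h := C.chart.map_eqAt (r := r) (C.chart.source r β.e₀) (χ.comp β.E.toRingHom)
    (C.chart.ξ r β.e₀) (C.chart.η r β.e₀)
  rw [C.chart.eqAt_source, comp_E_source] at h
  ext j
  refine (h j).symm.trans ?_
  exact map_zero (χ.comp β.E.toRingHom)

lemma map_unitAt : χ (β.E (C.chart.unitAt r (C.chart.source r β.e₀) (C.chart.ξ r β.e₀))) =
    C.chart.unitAt r (χ.comp (sourceMap r β.e)) (β.ξ χ) := by
  have h := C.chart.map_unitAt (r := r) (C.chart.source r β.e₀) (χ.comp β.E.toRingHom) (C.chart.ξ r β.e₀)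
  rw [comp_E_source] at h
  exact h

lemma isUnit_unitAt : IsUnit (C.chart.unitAt r (χ.comp (sourceMap r β.e)) (β.ξ χ)) := by
  rw [← map_unitAt]
  exact ((C.chart.isUnit_unitAt_source r β.e₀).map β.E).map χ

variable {χ} in
lemma hom_ext {χ' : Γ(newtonScheme φ s r, box r β.e) →+* S}
    (h : χ.comp (sourceMap r β.e) = χ'.comp (sourceMap r β.e)) (hξ : β.ξ χ = β.ξ χ')
    (hη : β.η χ = β.η χ') : χ = χ' := by
  have h1 : χ.comp β.E.toRingHom = χ'.comp β.E.toRingHom :=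
    C.chart.newtonAlgebra_hom_ext' (by rw [comp_E_source, comp_E_source, h]) (fun j ↦ congrFun hξ j)
      fun i ↦ congrFun hη i
  refine RingHom.ext fun a ↦ ?_
  obtain ⟨a, rfl⟩ := β.E.surjective a
  exact congr($h1 a)

lemma exists_hom (α : Γ(X, C.W) →+* S) (hα : α C.chart.δ = 0) (ξ : C.chart.Idx → S)
    (η : Fin C.chart.n → S) (h : C.chart.eqAt r α ξ η = 0) (hu : IsUnit (C.chart.unitAt r α ξ)) :
    ∃ χ : Γ(newtonScheme φ s r, box r β.e) →+* S, χ.comp (sourceMap r β.e) = α ∧ β.ξ χ = ξ ∧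
      β.η χ = η := by
  obtain ⟨χ, h₁, h₂, h₃⟩ := C.chart.exists_newtonAlgebra_hom' r β.e₀ α ξ η h hu
    (β.isUnit_evalPoly α hα ξ η h hu)
  refine ⟨χ.comp β.E.symm.toRingHom, ?_, funext fun j ↦ ?_, funext fun i ↦ ?_⟩
  · rw [← comp_E_source, ← h₁]
    refine RingHom.ext fun x ↦ ?_
    exact congrArg χ (β.E.symm_apply_apply _)
  · exact (congrArg χ (β.E.symm_apply_apply _)).trans (h₂ j)
  · exact (congrArg χ (β.E.symm_apply_apply _)).trans (h₃ i)

lemma target_eq_source (hr : 2 ≤ r) (h : χ (sourceMap r β.e C.chart.δ) = 0) :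
    χ.comp (targetMap r β.e) = χ.comp (sourceMap r β.e) := by
  refine C.chart.ringHom_ext ?_ fun j ↦ ?_
  · have := β.isNewtonRing.pair.comp_eq
    rw [squareMap_comp_ι₁, squareMap_comp_ι₂] at this
    rw [comp_assoc, comp_assoc]
    exact congrArg χ.comp this.symm
  · rw [RingHom.comp_apply, β.target_X, map_add, map_mul, map_pow, h, zero_pow (by omega), zero_mul,
      add_zero]
    rfl

variable {β} {χ₁ χ₂ χ₃ : Γ(newtonScheme φ s r, box r β.e) →+* S}
  (h : χ₁.comp (targetMap r β.e) = χ₂.comp (sourceMap r β.e))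
  (h₁ : χ₃.comp (sourceMap r β.e) = χ₁.comp (sourceMap r β.e))
  (h₂ : χ₃.comp (targetMap r β.e) = χ₂.comp (targetMap r β.e))
  (hδ : χ₁ (sourceMap r β.e C.chart.δ) ∈ nonZeroDivisors S)
include h h₁ h₂ hδ

lemma ξ_of_comp (j) : β.ξ χ₃ j = β.ξ χ₁ j +
    C.chart.unitAt r (χ₁.comp (sourceMap r β.e)) (β.ξ χ₁) ^ (r - 1) * β.ξ χ₂ j := by
  have h' (a) : χ₁ (targetMap r β.e a) = χ₂ (sourceMap r β.e a) := congr($h a)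
  have h₁' (a) : χ₃ (sourceMap r β.e a) = χ₁ (sourceMap r β.e a) := congr($h₁ a)
  have h₂' (a) : χ₃ (targetMap r β.e a) = χ₂ (targetMap r β.e a) := congr($h₂ a)
  have e₁ := congrArg χ₁ (β.target_X j)
  have e₂ := congrArg χ₂ (β.target_X j)
  have e₃ := congrArg χ₃ (β.target_X j)
  have eδ := congrArg χ₁ β.target_δ
  simp only [map_add, map_mul, map_pow, h₁', h₂', ← h', map_unitAt] at e₁ e₂ e₃ eδ
  rw [eδ] at e₂
  refine sub_eq_zero.mp ((mem_nonZeroDivisors_iff_right.mp (pow_mem hδ (r - 1))) _ ?_)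
  simp only [ξ]
  linear_combination e₂ - e₃ + e₁

lemma η_of_comp (i) : β.η χ₃ i = β.η χ₁ i +
    C.chart.unitAt r (χ₁.comp (sourceMap r β.e)) (β.ξ χ₁) ^ r * β.η χ₂ i := by
  have h' (a) : χ₁ (targetMap r β.e a) = χ₂ (sourceMap r β.e a) := congr($h a)
  have h₁' (a) : χ₃ (sourceMap r β.e a) = χ₁ (sourceMap r β.e a) := congr($h₁ a)
  have h₂' (a) : χ₃ (targetMap r β.e a) = χ₂ (targetMap r β.e a) := congr($h₂ a)
  have e₁ := congrArg χ₁ (β.target_y i)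
  have e₂ := congrArg χ₂ (β.target_y i)
  have e₃ := congrArg χ₃ (β.target_y i)
  have eδ := congrArg χ₁ β.target_δ
  simp only [map_add, map_mul, map_pow, h₁', h₂', ← h', map_unitAt] at e₁ e₂ e₃ eδ
  rw [eδ] at e₂
  refine sub_eq_zero.mp ((mem_nonZeroDivisors_iff_right.mp (pow_mem hδ r)) _ ?_)
  simp only [η]
  linear_combination e₂ - e₃ + e₁

end NewtonBox

section CompositionLaw

lemma appLE_mem_nonZeroDivisors {P : Scheme.{u}} (f : P ⟶ X) [Flat f] {W : X.Opens}
    (hW : IsAffineOpen W) {d : Γ(X, W)} (hd : d ∈ nonZeroDivisors Γ(X, W)) {O : P.Opens}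
    (h : O ≤ f ⁻¹ᵁ W) : (f.appLE W O h).hom d ∈ nonZeroDivisors Γ(P, O) := by
  rw [mem_nonZeroDivisors_iff_right]
  intro x hx
  refine TopCat.Presheaf.section_ext P.sheaf O x 0 fun p hp ↦ ?_
  obtain ⟨_, ⟨O', hO', rfl⟩, hpO', hle⟩ := P.isBasis_affineOpens.exists_subset_of_mem_open
    (a := p) (u := O) hp O.isOpen
  replace hle : O' ≤ O := hle
  let q := P.presheaf.map (homOfLE hle).op
  have h1 := mem_nonZeroDivisors_of_flat _ (f.flat_appLE hW hO' (hle.trans h)) hd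
  have h2 : q.hom x = 0 := by
    refine mem_nonZeroDivisors_iff_right.mp h1 _ ?_
    have := congrArg q.hom hx
    rw [map_mul, map_zero] at this
    rw [← this]
    congr 1
    exact congr($((Scheme.Hom.appLE_map f h (homOfLE hle).op).symm) d)
  have h3 := P.presheaf.germ_res_apply (homOfLE hle) p hpO' x
  change P.presheaf.germ O' p hpO' (q.hom x) = _ at h3
  rw [h2, map_zero] at h3
  change P.presheaf.germ O p hp x = P.presheaf.germ O p hp 0
  rw [← h3, map_zero]

variable (G : GroupoidOn (newtonSource φ s r) (newtonTarget φ s r)) [Flat (newtonSource φ s r)]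
  (β : NewtonBox C r)

/-- The composition of the Newton groupoid in coordinates. -/
lemma exists_forall_comp {T : Scheme.{u}} (a b : T ⟶ newtonScheme φ s r)
    (hab : a ≫ newtonTarget φ s r = b ≫ newtonSource φ s r) (ha : ⊤ ≤ a ⁻¹ᵁ box r β.e)
    (hb : ⊤ ≤ b ⁻¹ᵁ box r β.e) (hc : ⊤ ≤ (pullback.lift a b hab ≫ G.comp) ⁻¹ᵁ box r β.e)
    (u : Γ(T, ⊤)) (hu : u = C.chart.unitAt r
      ((a.appLE _ ⊤ ha).hom.comp (sourceMap r β.e)) (β.ξ (a.appLE _ ⊤ ha).hom)) :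
    (∀ j, β.ξ ((pullback.lift a b hab ≫ G.comp).appLE _ ⊤ hc).hom j =
      β.ξ (a.appLE _ ⊤ ha).hom j + u ^ (r - 1) * β.ξ (b.appLE _ ⊤ hb).hom j) ∧
    ∀ i, β.η ((pullback.lift a b hab ≫ G.comp).appLE _ ⊤ hc).hom i =
      β.η (a.appLE _ ⊤ ha).hom i + u ^ r * β.η (b.appLE _ ⊤ hb).hom i := by
  subst hu
  let P := pullback (newtonTarget φ s r) (newtonSource φ s r)
  let q₁ : P ⟶ newtonScheme φ s r := fst _ _
  let q₂ : P ⟶ newtonScheme φ s r := snd _ _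
  let O : P.Opens := q₁ ⁻¹ᵁ box r β.e ⊓ q₂ ⁻¹ᵁ box r β.e ⊓ G.comp ⁻¹ᵁ box r β.e
  have hO₁ : O ≤ q₁ ⁻¹ᵁ box r β.e := fun x hx ↦ hx.1.1
  have hO₂ : O ≤ q₂ ⁻¹ᵁ box r β.e := fun x hx ↦ hx.1.2
  have hO₃ : O ≤ G.comp ⁻¹ᵁ box r β.e := fun x hx ↦ hx.2
  have key {f₁ f₂ : P ⟶ newtonScheme φ s r} {p₁ p₂ : newtonScheme φ s r ⟶ X} (e : f₁ ≫ p₁ = f₂ ≫ p₂)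
      (l₁ : O ≤ f₁ ⁻¹ᵁ box r β.e) (l₂ : O ≤ f₂ ⁻¹ᵁ box r β.e) (m₁ : box r β.e ≤ p₁ ⁻¹ᵁ C.W)
      (m₂ : box r β.e ≤ p₂ ⁻¹ᵁ C.W) :
      (f₁.appLE _ O l₁).hom.comp (p₁.appLE _ _ m₁).hom =
        (f₂.appLE _ O l₂).hom.comp (p₂.appLE _ _ m₂).hom := by
    have n₁ : O ≤ (f₁ ≫ p₁) ⁻¹ᵁ C.W := l₁.trans (f₁.preimage_mono m₁)
    have n₂ : O ≤ (f₂ ≫ p₂) ⁻¹ᵁ C.W := l₂.trans (f₂.preimage_mono m₂)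
    exact congrArg CommRingCat.Hom.hom ((appLE_trans f₁ p₁ m₁ l₁ n₁).trans
      ((appLE_congr_hom e n₁ n₂).trans (appLE_trans f₂ p₂ m₂ l₂ n₂).symm))
  have k := key (pullback.condition (f := newtonTarget φ s r) (g := newtonSource φ s r)) hO₁ hO₂
    (box_le_target r β.e) (box_le_source r β.e)
  have k₁ := key G.comp_p₁ hO₃ hO₁ (box_le_source r β.e) (box_le_source r β.e)
  have k₂ := key G.comp_p₂ hO₃ hO₂ (box_le_target r β.e) (box_le_target r β.e)
  have hδ : (q₁.appLE _ O hO₁).hom (sourceMap r β.e C.chart.δ) ∈ nonZeroDivisors Γ(P, O) := by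
    have hf : Flat q₁ := inferInstanceAs (Flat (fst _ _))
    have h0 : O ≤ (q₁ ≫ newtonSource φ s r) ⁻¹ᵁ C.W :=
      hO₁.trans (q₁.preimage_mono (box_le_source r β.e))
    have h1 := appLE_mem_nonZeroDivisors (q₁ ≫ newtonSource φ s r) C.isAffineOpen C.δ_mem h0
    have h2 := appLE_trans q₁ (newtonSource φ s r) (box_le_source r β.e) hO₁ h0
    rw [← h2] at h1
    exact h1
  have e₁ := NewtonBox.ξ_of_comp k k₁ k₂ hδ
  have e₂ := NewtonBox.η_of_comp k k₁ k₂ hδ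
  let t : T ⟶ P := pullback.lift a b hab
  have ta : t ≫ q₁ = a := pullback.lift_fst _ _ _
  have tb : t ≫ q₂ = b := pullback.lift_snd _ _ _
  have tO : ⊤ ≤ t ⁻¹ᵁ O := fun x _ ↦ ⟨⟨by
    have : x ∈ (t ≫ q₁) ⁻¹ᵁ box r β.e := by rw [ta]; exact ha trivial
    exact this, by
    have : x ∈ (t ≫ q₂) ⁻¹ᵁ box r β.e := by rw [tb]; exact hb trivial
    exact this⟩, hc trivial⟩
  let τ := (t.appLE O ⊤ tO).hom
  have m₁ : τ.comp (q₁.appLE _ O hO₁).hom = (a.appLE _ ⊤ ha).hom := congrArg CommRingCat.Hom.hom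
    ((appLE_trans t q₁ hO₁ tO (by rw [ta]; exact ha)).trans (appLE_congr_hom ta _ _))
  have m₂ : τ.comp (q₂.appLE _ O hO₂).hom = (b.appLE _ ⊤ hb).hom := congrArg CommRingCat.Hom.hom
    ((appLE_trans t q₂ hO₂ tO (by rw [tb]; exact hb)).trans (appLE_congr_hom tb _ _))
  have m₃ : τ.comp (G.comp.appLE _ O hO₃).hom = ((t ≫ G.comp).appLE _ ⊤ hc).hom :=
    congrArg CommRingCat.Hom.hom (appLE_trans t G.comp hO₃ tO hc)
  have mu : τ (C.chart.unitAt r ((q₁.appLE _ O hO₁).hom.comp (sourceMap r β.e))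
      (β.ξ (q₁.appLE _ O hO₁).hom)) = C.chart.unitAt r
      ((a.appLE _ ⊤ ha).hom.comp (sourceMap r β.e)) (β.ξ (a.appLE _ ⊤ ha).hom) := by
    rw [← β.map_unitAt, ← β.map_unitAt, ← m₁]; rfl
  refine ⟨fun j ↦ ?_, fun i ↦ ?_⟩
  · have := congrArg τ (e₁ j)
    rw [map_add, map_mul, map_pow, mu] at this
    rw [← m₁, ← m₂]
    rw [← m₁] at this
    exact (congr($m₃.symm _)).trans this
  · have := congrArg τ (e₂ i)
    rw [map_add, map_mul, map_pow, mu] at this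
    rw [← m₁, ← m₂]
    rw [← m₁] at this
    exact (congr($m₃.symm _)).trans this

end CompositionLaw

end Boxes

section FiberCoordinates

open ChartAt

section ResidueField

variable {k : Type u} [Field k] {X Y : Scheme.{u}} {φ : X ⟶ Y} {s : Y ⟶ Spec (.of k)} {z : X}
  (C : ChartAt φ s z) {T : Scheme.{u}} (q : T ⟶ Spec (X.residueField z))

/-- The elements of the residue field as functions on a scheme over it. -/
def residueScalars : X.residueField z →+* Γ(T, ⊤) := ((Scheme.ΓSpecIso _).inv ≫ q.appTop).hom

lemma map_residueScalars {T' : Scheme.{u}} (g : T' ⟶ T) {q' : T' ⟶ Spec (X.residueField z)}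
    (h : g ≫ q = q') (x) : g.appTop.hom (residueScalars q x) = residueScalars q' x := by
  subst h
  rw [residueScalars, residueScalars, Scheme.Hom.comp_appTop]
  rfl

lemma top_le_fromSpecResidueField : ⊤ ≤ X.fromSpecResidueField z ⁻¹ᵁ C.W := fun x _ ↦ by
  change X.fromSpecResidueField z x ∈ C.W
  rw [Scheme.fromSpecResidueField_apply]
  exact C.mem

/-- The value of a function at `z`. -/
def ChartAt.residueMap : Γ(X, C.W) →+* X.residueField z :=
  ((X.fromSpecResidueField z).appLE C.W ⊤ (top_le_fromSpecResidueField C) ≫ (Scheme.ΓSpecIso _).hom).hom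

lemma residueScalars_comp_residueMap (h : ⊤ ≤ (q ≫ X.fromSpecResidueField z) ⁻¹ᵁ C.W) :
    (residueScalars q).comp C.residueMap = ((q ≫ X.fromSpecResidueField z).appLE C.W ⊤ h).hom := by
  rw [residueScalars, ChartAt.residueMap, ← CommRingCat.hom_comp, assoc,
    Iso.hom_inv_id_assoc, Scheme.Hom.appTop, Scheme.Hom.app_eq_appLE]
  exact congrArg CommRingCat.Hom.hom (appLE_trans _ _ _ _ _)

variable {C}

lemma residueMap_δ (hz : z ∉ etaleLocus φ) : C.residueMap C.chart.δ = 0 := by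
  by_contra h
  have h1 : IsUnit ((X.fromSpecResidueField z).appLE C.W ⊤ (top_le_fromSpecResidueField C) C.chart.δ) := by
    have := (Ne.isUnit h).map (Scheme.ΓSpecIso (X.residueField z)).inv.hom
    rw [ChartAt.residueMap, ← RingHom.comp_apply, ← CommRingCat.hom_comp, assoc,
      Iso.hom_inv_id, comp_id] at this
    exact this
  have h2 := (Spec (X.residueField z)).basicOpen_of_isUnit h1
  rw [Scheme.basicOpen_appLE, ← C.inf_eq] at h2
  let x : Spec (X.residueField z) := IsLocalRing.closedPoint (X.residueField z)
  have h3 := h2.ge (x := x) trivial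
  have h4 : X.fromSpecResidueField z x ∈ etaleLocus φ := h3.2.1
  rw [Scheme.fromSpecResidueField_apply] at h4
  exact hz h4

end ResidueField

section Fiber

variable {k : Type u} [Field k] {X Y : Scheme.{u}} {φ : X ⟶ Y} {s : Y ⟶ Spec (.of k)}
  [LocallyOfFiniteType (φ ≫ s)] [IsSeparated s] [IsSeparated (φ ≫ s)] {r : ℕ}
  (ch : ∀ z, ChartAt φ s z) {z : X} (hz : z ∉ etaleLocus φ) (hr : 2 ≤ r) (β : NewtonBox (ch z) r)
  {T : Scheme.{u}} {q : T ⟶ Spec (X.residueField z)}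

include hz hr ch

lemma top_le_box {g : T ⟶ newtonScheme φ s r}
    (hg : g ≫ newtonSource φ s r = q ≫ X.fromSpecResidueField z) : ⊤ ≤ g ⁻¹ᵁ box r β.e := fun t _ ↦ by
  have h0 : newtonSource φ s r (g t) = z := by
    rw [← Scheme.Hom.comp_apply, hg, Scheme.Hom.comp_apply, Scheme.fromSpecResidueField_apply]
  rw [newtonSource, Scheme.Hom.comp_apply] at h0
  obtain ⟨x, -, hx⟩ := exists_newtonMap_eq_diagonal r ch hr (g t) fun h ↦ hz (by
    have := h.1
    rw [← h0]; exact this)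
  have hxz : x = z := by rw [← h0, hx, ← Scheme.Hom.comp_apply, pullback.diagonal_fst]; rfl
  subst hxz
  change newtonMap φ s r (g t) ∈ (square φ s).basicOpen β.e
  rw [hx]
  exact β.diagonal_mem (ch x).mem

/-- The functions on the box at a point of the fibre. -/
def boxMap {g : T ⟶ newtonScheme φ s r} (hg : g ≫ newtonSource φ s r = q ≫ X.fromSpecResidueField z) :
    Γ(newtonScheme φ s r, box r β.e) →+* Γ(T, ⊤) :=
  (g.appLE _ ⊤ (top_le_box ch hz hr β hg)).hom

lemma boxMap_comp_sourceMap {g : T ⟶ newtonScheme φ s r}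
    (hg : g ≫ newtonSource φ s r = q ≫ X.fromSpecResidueField z) :
    (boxMap ch hz hr β hg).comp (sourceMap r β.e) = (residueScalars q).comp (ch z).residueMap := by
  have h0 : ⊤ ≤ (g ≫ newtonSource φ s r) ⁻¹ᵁ (ch z).W :=
    (top_le_box ch hz hr β hg).trans (g.preimage_mono (box_le_source r β.e))
  have h1 : ⊤ ≤ (q ≫ X.fromSpecResidueField z) ⁻¹ᵁ (ch z).W := by rw [← hg]; exact h0
  rw [residueScalars_comp_residueMap (ch z) q h1]
  exact congrArg CommRingCat.Hom.hom ((appLE_trans g _ _ _ h0).trans (appLE_congr_hom hg _ _))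

include β in
lemma comp_target_eq {g : T ⟶ newtonScheme φ s r}
    (hg : g ≫ newtonSource φ s r = q ≫ X.fromSpecResidueField z) :
    g ≫ newtonTarget φ s r = g ≫ newtonSource φ s r := by
  have h0 : ⊤ ≤ (g ≫ newtonSource φ s r) ⁻¹ᵁ (ch z).W :=
    (top_le_box ch hz hr β hg).trans (g.preimage_mono (box_le_source r β.e))
  have h1 : ⊤ ≤ (g ≫ newtonTarget φ s r) ⁻¹ᵁ (ch z).W :=
    (top_le_box ch hz hr β hg).trans (g.preimage_mono (box_le_target r β.e))
  refine hom_ext_of_appLE (ch z).isAffineOpen h1 h0 ?_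
  have h2 := β.target_eq_source (boxMap ch hz hr β hg) hr (by
    rw [← RingHom.comp_apply, boxMap_comp_sourceMap, RingHom.comp_apply, residueMap_δ hz, map_zero])
  exact (appLE_trans g _ _ _ h1).symm.trans ((CommRingCat.hom_ext h2).trans (appLE_trans g _ _ _ h0))

variable {ch hz hr β} in
lemma hom_ext_of_boxMap {g g' : T ⟶ newtonScheme φ s r}
    {hg : g ≫ newtonSource φ s r = q ≫ X.fromSpecResidueField z}
    {hg' : g' ≫ newtonSource φ s r = q ≫ X.fromSpecResidueField z}
    (h₁ : β.ξ (boxMap ch hz hr β hg) = β.ξ (boxMap ch hz hr β hg'))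
    (h₂ : β.η (boxMap ch hz hr β hg) = β.η (boxMap ch hz hr β hg')) : g = g' := by
  refine hom_ext_of_appLE β.isAffineOpen (top_le_box ch hz hr β hg) (top_le_box ch hz hr β hg')
    (CommRingCat.hom_ext ?_)
  exact β.hom_ext ((boxMap_comp_sourceMap ch hz hr β hg).trans
    (boxMap_comp_sourceMap ch hz hr β hg').symm) h₁ h₂

variable (q) in
lemma exists_fiberPoint (ξ : (ch z).chart.Idx → Γ(T, ⊤))
    (η : Fin (ch z).chart.n → Γ(T, ⊤))
    (h : (ch z).chart.eqAt r ((residueScalars q).comp (ch z).residueMap) ξ η = 0)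
    (hu : IsUnit ((ch z).chart.unitAt r ((residueScalars q).comp (ch z).residueMap) ξ)) :
    ∃ (g : T ⟶ newtonScheme φ s r) (hg : g ≫ newtonSource φ s r = q ≫ X.fromSpecResidueField z),
      β.ξ (boxMap ch hz hr β hg) = ξ ∧ β.η (boxMap ch hz hr β hg) = η := by
  obtain ⟨χ, h₁, h₂, h₃⟩ := β.exists_hom ((residueScalars q).comp (ch z).residueMap) (by
    rw [RingHom.comp_apply, residueMap_δ hz, map_zero]) ξ η h hu
  obtain ⟨g, hle, hg⟩ := exists_hom_of_ringHom β.isAffineOpen (ofHom χ)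
  have hq : ⊤ ≤ (q ≫ X.fromSpecResidueField z) ⁻¹ᵁ (ch z).W := fun x _ ↦
    top_le_fromSpecResidueField (ch z) (x := q x) trivial
  have h0 : ⊤ ≤ (g ≫ newtonSource φ s r) ⁻¹ᵁ (ch z).W :=
    hle.trans (g.preimage_mono (box_le_source r β.e))
  have hs : g ≫ newtonSource φ s r = q ≫ X.fromSpecResidueField z := by
    refine hom_ext_of_appLE (ch z).isAffineOpen h0 hq ((appLE_trans g _ (box_le_source r β.e) hle h0).symm.trans ?_)
    rw [hg]
    exact CommRingCat.hom_ext (h₁.trans (residueScalars_comp_residueMap (ch z) q hq))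
  have hχ : boxMap ch hz hr β hs = χ := congrArg CommRingCat.Hom.hom hg
  exact ⟨g, hs, by rw [hχ, h₂], by rw [hχ, h₃]⟩

variable (G : GroupoidOn (newtonSource φ s r) (newtonTarget φ s r)) [Flat (newtonSource φ s r)]

lemma boxMap_mul {T : Over (Spec (X.residueField z))} (a b : G.Loops (X.fromSpecResidueField z) T)
    {u : Γ(T.left, ⊤)} (hu : u = (ch z).chart.unitAt r ((residueScalars T.hom).comp (ch z).residueMap)
      (β.ξ (boxMap ch hz hr β a.2.1))) :
    (∀ j, β.ξ (boxMap ch hz hr β (a * b).2.1) j = β.ξ (boxMap ch hz hr β a.2.1) j +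
      u ^ (r - 1) * β.ξ (boxMap ch hz hr β b.2.1) j) ∧
    ∀ i, β.η (boxMap ch hz hr β (a * b).2.1) i = β.η (boxMap ch hz hr β a.2.1) i +
      u ^ r * β.η (boxMap ch hz hr β b.2.1) i := by
  rw [← boxMap_comp_sourceMap ch hz hr β a.2.1] at hu
  exact exists_forall_comp G β a.1 b.1 (a.2.2.trans b.2.1.symm) (top_le_box ch hz hr β a.2.1)
    (top_le_box ch hz hr β b.2.1) (top_le_box ch hz hr β (a * b).2.1) u hu

omit ch hz hr in
lemma nonempty_quadraticCoordinates {ch : ∀ z, ChartAt φ s z} (hz : z ∉ etaleLocus φ) (hr : 2 ≤ r)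
    (β : NewtonBox (ch z) r) {c₀ : X.residueField z} {h : Fin (ch z).chart.n → X.residueField z}
    {l : (ch z).chart.Idx → X.residueField z}
    (H : (ch z).chart.FiberShape r (ch z).residueMap c₀ h l) :
    Nonempty (QuadraticCoordinates (G.loopsFunctor (X.fromSpecResidueField z))
      (fun T ↦ residueScalars T.unop.hom) c₀ h) := by
  let χ (T : Over (Spec (X.residueField z))) (a : G.Loops (X.fromSpecResidueField z) T) :=
    boxMap ch hz hr β a.2.1
  have heq (T : Over (Spec (X.residueField z))) (a) : (ch z).chart.eqAt r ((residueScalars T.hom).comp (ch z).residueMap)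
      (β.ξ (χ T a)) (β.η (χ T a)) = 0 := by
    rw [← boxMap_comp_sourceMap ch hz hr β a.2.1]
    exact β.eqAt_eq_zero (χ T a)
  let t (T : Over (Spec (X.residueField z))) (a) : Γ(T.left, ⊤) := ∑ j, residueScalars T.hom (l j) * β.ξ (χ T a) j
  have hu (T : Over (Spec (X.residueField z))) (a) : (ch z).chart.unitAt r ((residueScalars T.hom).comp (ch z).residueMap) (β.ξ (χ T a)) =
      1 + 2 * residueScalars T.hom c₀ * t T a := by
    exact H.unit _ _ _ (heq T a)
  have nat {T T' : Over (Spec (X.residueField z))} (f : T' ⟶ T)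
      (a : G.Loops (X.fromSpecResidueField z) T) :
      χ T' ((G.loopsFunctor (X.fromSpecResidueField z)).map f.op a) = f.left.appTop.hom.comp (χ T a) := by
    refine congrArg CommRingCat.Hom.hom ((appLE_trans f.left a.1
      (top_le_box ch hz hr β a.2.1) (V := ⊤) le_top _).symm.trans ?_)
    rw [Scheme.Hom.appTop, Scheme.Hom.app_eq_appLE]
    rfl
  have unit (T : Over (Spec (X.residueField z))) (a) :
      IsUnit (1 + 2 * residueScalars T.hom c₀ * t T a) := by
    have := β.isUnit_unitAt (χ T a)
    rwa [boxMap_comp_sourceMap ch hz hr β a.2.1, hu] at this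
  have mul_t (T : Over (Spec (X.residueField z))) (a b : G.Loops (X.fromSpecResidueField z) T) :
      t T (a * b) = t T a + (1 + 2 * residueScalars T.hom c₀ * t T a) * t T b := by
    have h1 := (boxMap_mul ch hz hr β G a b (hu T a).symm).1
    obtain rfl | ⟨-, h0⟩ := H.eq_two_or
    · simp only [t] at h1 ⊢
      rw [Finset.mul_sum, ← Finset.sum_add_distrib]
      refine Finset.sum_congr rfl fun j _ ↦ ?_
      rw [mul_left_comm, ← mul_add]
      congr 1
      exact (h1 j).trans (by rw [Nat.add_one_sub_one, pow_one])
    · have h0 (c) : t T c = 0 := Finset.sum_eq_zero fun j _ ↦ by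
        rw [h0, Pi.zero_apply, map_zero, zero_mul]
      rw [h0, h0, h0, mul_zero, add_zero]
  have mul_η (T : Over (Spec (X.residueField z))) (a b : G.Loops (X.fromSpecResidueField z) T) (i) :
      β.η (χ T (a * b)) i =
        β.η (χ T a) i + (1 + 2 * residueScalars T.hom c₀ * t T a) ^ 2 * β.η (χ T b) i := by
    have h1 := (boxMap_mul ch hz hr β G a b (hu T a).symm).2 i
    obtain rfl | ⟨h0, -⟩ := H.eq_two_or
    · exact h1
    · simp only [h0, map_zero, mul_zero, zero_mul, add_zero, one_pow] at h1 ⊢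
      exact h1
  exact ⟨{
    t T a := t T.unop a
    η T a := β.η (χ T.unop a)
    map_κ g x := map_residueScalars _ g.unop.left (Over.w g.unop) x
    map_t {T T'} g a := by
      change t T'.unop _ = g.unop.left.appTop.hom (t T.unop a)
      rw [map_sum]
      refine Finset.sum_congr rfl fun j _ ↦ ?_
      rw [map_mul, map_residueScalars _ g.unop.left (Over.w g.unop)]
      congr 1
      exact congr($(nat g.unop a) _)
    map_η g a i := congr($(nat g.unop a) _)
    eq T a := H.eq _ _ _ (heq T.unop a)
    unit T a := unit T.unop a
    inj T a b h₁ h₂ := by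
      have h₃ := heq T.unop b
      change β.η (χ T.unop a) = β.η (χ T.unop b) at h₂
      rw [← h₂] at h₃
      exact Subtype.ext (hom_ext_of_boxMap (H.inj _ _ _ _ (heq T.unop a) h₃ h₁) h₂)
    surj T x y e hx := by
      obtain ⟨ξ, h₁, h₂⟩ := H.surj (residueScalars T.unop.hom) x y e
      obtain ⟨g, hg, h₃, h₄⟩ := exists_fiberPoint ch hz hr β T.unop.hom ξ y h₁ (by
        rw [H.unit _ _ _ h₁, h₂]; exact hx)
      refine ⟨⟨g, hg, (comp_target_eq ch hz hr β hg).trans hg⟩, ?_, h₄⟩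
      rw [← h₂]
      exact Finset.sum_congr rfl fun j _ ↦ congrArg _ (congrFun h₃ j)
    mul_t T a b := mul_t T.unop a b
    mul_η T a b i := mul_η T.unop a b i }⟩

end Fiber

end FiberCoordinates

section Evaluation

variable {X Z : Scheme.{u}} {W : X.Opens}

/-- Pullback of functions along a morphism from an affine scheme. -/
def evalMap {A : CommRingCat.{u}} (g : Spec A ⟶ X) (h : ⊤ ≤ g ⁻¹ᵁ W) : Γ(X, W) →+* A :=
  (g.appLE W ⊤ h ≫ (Scheme.ΓSpecIso A).hom).hom

lemma evalMap_map {A B : CommRingCat.{u}} (χ : A ⟶ B) {g : Spec A ⟶ X} (h : ⊤ ≤ g ⁻¹ᵁ W)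
    {g' : Spec B ⟶ X} (h' : ⊤ ≤ g' ⁻¹ᵁ W) (e : Spec.map χ ≫ g = g') :
    χ.hom.comp (evalMap g h) = evalMap g' h' := by
  subst e
  have e : g.appLE W ⊤ h ≫ (Spec.map χ).appTop = (Spec.map χ ≫ g).appLE W ⊤ h' := by
    rw [Scheme.Hom.appTop, Scheme.Hom.app_eq_appLE]
    exact appLE_trans _ _ _ _ _
  rw [evalMap, evalMap, ← CommRingCat.hom_comp, assoc, ← Scheme.ΓSpecIso_naturality,
    ← assoc, e]

lemma evalMap_comp {A : CommRingCat.{u}} {g : Spec A ⟶ X} (h : ⊤ ≤ g ⁻¹ᵁ W) {f : X ⟶ Z} {V : Z.Opens}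
    (hf : W ≤ f ⁻¹ᵁ V) {g' : Spec A ⟶ Z} (h' : ⊤ ≤ g' ⁻¹ᵁ V) (e : g ≫ f = g') :
    (evalMap g h).comp (f.appLE V W hf).hom = evalMap g' h' := by
  subst e
  rw [evalMap, evalMap, ← CommRingCat.hom_comp, ← assoc]
  exact congrArg (fun f ↦ (f ≫ (Scheme.ΓSpecIso A).hom).hom) (appLE_trans _ _ _ _ _)

lemma hom_ext_of_evalMap (hW : IsAffineOpen W) {A : CommRingCat.{u}} {g g' : Spec A ⟶ X}
    (h : ⊤ ≤ g ⁻¹ᵁ W) (h' : ⊤ ≤ g' ⁻¹ᵁ W) (e : evalMap g h = evalMap g' h') : g = g' := by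
  refine hom_ext_of_appLE hW h h' ?_
  rw [← cancel_mono (Scheme.ΓSpecIso A).hom]
  exact CommRingCat.hom_ext e

lemma exists_evalMap_eq (hW : IsAffineOpen W) {A : Type u} [CommRing A] (χ : Γ(X, W) →+* A) :
    ∃ (g : Spec (.of A) ⟶ X) (h : ⊤ ≤ g ⁻¹ᵁ W), evalMap g h = χ := by
  obtain ⟨g, h, e⟩ := exists_spec_hom hW χ
  refine ⟨g, h, ?_⟩
  rw [evalMap, e, assoc, Iso.inv_hom_id, comp_id]
  rfl

lemma exists_map_comp_fromSpecStalk {S : Type u} [CommRing S] [IsLocalRing S] (g : Spec (.of S) ⟶ X)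
    {x : X} (hx : g (IsLocalRing.closedPoint S) = x) :
    ∃ χ : X.presheaf.stalk x ⟶ .of S, Spec.map χ ≫ X.fromSpecStalk x = g := by
  subst hx
  exact ⟨_, Scheme.Spec_stalkClosedPointTo_fromSpecStalk g⟩

lemma top_le_of_fromSpecStalk {x : Z} (p : Z ⟶ X) (h : p x ∈ W) :
    ⊤ ≤ (Z.fromSpecStalk x ≫ p) ⁻¹ᵁ W := fun y _ ↦ by
  have h1 : Z.fromSpecStalk x y ∈ Set.range (Z.fromSpecStalk x) := ⟨y, rfl⟩
  rw [Scheme.range_fromSpecStalk] at h1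
  exact h1.mem_open (p ⁻¹ᵁ W).isOpen h

end Evaluation

section FiberRing

variable {k : Type u} [Field k] {X Y : Scheme.{u}} {φ : X ⟶ Y} {s : Y ⟶ Spec (.of k)} {z : X}

/-- The multiplicity of the fibre is the length of a fibre ring. -/
lemma ChartAt.exists_isFiberRing (C : ChartAt φ s z) :
    ∃ (O : Type u) (_ : CommRing O) (_ : IsLocalRing O) (θ : Γ(X, C.W) →+* O)
      (κ : X.residueField z →+* O), IsFiberRing C.f C.residueMap θ κ ∧
      fiberMultiplicity φ z = Module.length O O := by
  let b₀ := X.fromSpecResidueField z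
  let F := pullback φ (b₀ ≫ φ)
  let σ : Spec (X.residueField z) ⟶ F := pullback.lift b₀ (𝟙 _) (id_comp _).symm
  let x : F := σ (IsLocalRing.closedPoint (X.residueField z))
  let π := F.fromSpecStalk x
  have hσ₁ : σ ≫ fst φ (b₀ ≫ φ) = b₀ := pullback.lift_fst _ _ _
  have hσ₂ : σ ≫ snd φ (b₀ ≫ φ) = 𝟙 _ := pullback.lift_snd _ _ _
  have hx : fst φ (b₀ ≫ φ) x ∈ C.W := by
    have h1 : fst φ (b₀ ≫ φ) x = z := 
      (Scheme.Hom.comp_apply _ _ _).symm.trans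
        (congr($hσ₁ _).trans (Scheme.fromSpecResidueField_apply _ _))
    rw [h1]; exact C.mem
  have ha : ⊤ ≤ (π ≫ fst φ (b₀ ≫ φ)) ⁻¹ᵁ C.W := top_le_of_fromSpecStalk _ hx
  have hb₀ : ⊤ ≤ b₀ ⁻¹ᵁ C.W := top_le_fromSpecResidueField C
  have hbV : ⊤ ≤ (b₀ ≫ φ) ⁻¹ᵁ C.V := hb₀.trans (b₀.preimage_mono C.le)
  let κ : X.residueField z ⟶ F.presheaf.stalk x := Spec.preimage (π ≫ snd φ (b₀ ≫ φ))
  have hκ : Spec.map κ = π ≫ snd φ (b₀ ≫ φ) := Spec.map_preimage _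
  have hρ : C.residueMap.comp C.f = evalMap (b₀ ≫ φ) hbV := evalMap_comp hb₀ C.le hbV rfl
  refine ⟨F.presheaf.stalk x, inferInstance, inferInstance, evalMap _ ha, κ.hom, ⟨?_, ?_, ?_⟩, rfl⟩
  · have haV : ⊤ ≤ ((π ≫ fst φ (b₀ ≫ φ)) ≫ φ) ⁻¹ᵁ C.V :=
      ha.trans ((π ≫ fst φ (b₀ ≫ φ)).preimage_mono C.le)
    rw [hρ, evalMap_map κ hbV haV]
    · exact evalMap_comp ha C.le haV rfl
    · rw [hκ, assoc, ← pullback.condition, assoc]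
  · intro S _ _ θ' κ' e hm
    obtain ⟨a, ha', rfl⟩ := exists_evalMap_eq C.isAffineOpen θ'
    have haV : ⊤ ≤ (a ≫ φ) ⁻¹ᵁ C.V := ha'.trans (a.preimage_mono C.le)
    have hbV' : ⊤ ≤ (Spec.map (ofHom κ') ≫ b₀ ≫ φ) ⁻¹ᵁ C.V := fun x _ ↦
      hbV (x := Spec.map (ofHom κ') x) trivial
    have hg : a ≫ φ = Spec.map (ofHom κ') ≫ b₀ ≫ φ := by
      refine hom_ext_of_evalMap C.isAffineOpen' haV hbV' ?_
      rw [← evalMap_comp ha' C.le haV rfl, ← evalMap_map (ofHom κ') hbV hbV' rfl, ← hρ]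
      exact e
    let g : Spec (.of S) ⟶ F := pullback.lift a (Spec.map (ofHom κ')) hg
    have hg₁ : g ≫ fst φ (b₀ ≫ φ) = a := pullback.lift_fst _ _ _
    have hg₂ : g ≫ snd φ (b₀ ≫ φ) = Spec.map (ofHom κ') := pullback.lift_snd _ _ _
    let p : CommRingCat.of S ⟶ .of (IsLocalRing.ResidueField S) := ofHom (IsLocalRing.residue S)
    have hp : Spec.map p ≫ g = Spec.map (ofHom κ' ≫ p) ≫ σ := by
      refine pullback.hom_ext ?_ ?_
      · rw [assoc, hg₁, assoc, hσ₁]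
        have h1 : ⊤ ≤ (Spec.map p ≫ a) ⁻¹ᵁ C.W := fun x _ ↦ ha' (x := Spec.map p x) trivial
        have h2 : ⊤ ≤ (Spec.map (ofHom κ' ≫ p) ≫ b₀) ⁻¹ᵁ C.W := fun x _ ↦
          hb₀ (x := Spec.map (ofHom κ' ≫ p) x) trivial
        refine hom_ext_of_evalMap C.isAffineOpen h1 h2 ?_
        rw [← evalMap_map p ha' h1 rfl, ← evalMap_map (ofHom κ' ≫ p) hb₀ h2 rfl]
        refine RingHom.ext fun c ↦ ?_
        have := hm c
        rw [← IsLocalRing.residue_eq_zero_iff, map_sub, sub_eq_zero] at this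
        exact this
      · rw [assoc, hg₂, assoc, hσ₂]
        exact (Spec.map_comp _ _).symm.trans (comp_id _).symm
    have hgx : g (IsLocalRing.closedPoint S) = x := by
      let y : Spec (.of (IsLocalRing.ResidueField S)) := IsLocalRing.closedPoint _
      have h1 := congr($hp y)
      rw [Scheme.Hom.comp_apply, Scheme.Hom.comp_apply] at h1
      have h2 : Spec.map p y = IsLocalRing.closedPoint S := IsLocalRing.comap_closedPoint (IsLocalRing.residue S)
      have h3 : Spec.map (ofHom κ' ≫ p) y = IsLocalRing.closedPoint (X.residueField z) :=
        Subsingleton.elim (α := PrimeSpectrum (X.residueField z)) _ _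
      rw [h2, h3] at h1
      exact h1
    obtain ⟨χ, hχ⟩ := exists_map_comp_fromSpecStalk g hgx
    refine ⟨χ.hom, evalMap_map χ ha ha' ?_, ?_⟩
    · rw [← hg₁, ← hχ, assoc]
    · refine congrArg CommRingCat.Hom.hom (?_ : κ ≫ χ = ofHom κ')
      refine Spec.map_injective ?_
      rw [Spec.map_comp, hκ, ← hg₂, ← hχ, assoc]
  · intro S _ χ χ' h₁ h₂
    suffices h : ofHom χ = ofHom χ' from congrArg CommRingCat.Hom.hom h
    refine Spec.map_injective ?_
    rw [← cancel_mono π]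
    have hl (χ : F.presheaf.stalk x →+* S) :
        ⊤ ≤ (Spec.map (ofHom χ) ≫ π ≫ fst φ (b₀ ≫ φ)) ⁻¹ᵁ C.W := fun y _ ↦
      ha (x := Spec.map (ofHom χ) y) trivial
    refine pullback.hom_ext ?_ ?_
    · rw [assoc, assoc]
      refine hom_ext_of_evalMap C.isAffineOpen (hl χ) (hl χ') ?_
      rw [← evalMap_map (ofHom χ) ha (hl χ) rfl,
        ← evalMap_map (ofHom χ') ha (hl χ') rfl]
      exact h₁
    · rw [assoc, assoc, ← hκ, ← Spec.map_comp, ← Spec.map_comp]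
      exact congrArg (fun f ↦ Spec.map (ofHom f)) h₂

end FiberRing

section Jacobian

open MvPolynomial Matrix

lemma exists_linearIndependent_sumElim_single {K ι σ : Type*} [Field K] [Fintype ι] [Fintype σ]
    [DecidableEq ι] [DecidableEq σ] {v : ι → ι ⊕ σ → K} (hv : LinearIndependent K v) :
    ∃ s : σ → ι ⊕ σ, LinearIndependent K (Sum.elim v fun i ↦ Pi.single (s i) 1) := by
  let M := Submodule.span K (Set.range v)
  let w : ι → M := fun i ↦ ⟨v i, Submodule.subset_span ⟨i, rfl⟩⟩
  have hw : LinearIndependent K w := .of_comp M.subtype hv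
  let q : ι ⊕ σ → (ι ⊕ σ → K) ⧸ M := fun j ↦ M.mkQ (Pi.single j 1)
  have hq : Submodule.span K (Set.range q) = ⊤ := by
    have h1 : Set.range q = M.mkQ '' Set.range (Pi.basisFun K (ι ⊕ σ)) := by
      rw [← Set.range_comp]
      congr 1
      ext j : 1
      simp [q]
    rw [h1, ← Submodule.map_span, Module.Basis.span_eq, Submodule.map_top, Submodule.range_mkQ]
  obtain ⟨f, hf, -, hli⟩ := Submodule.exists_fun_fin_finrank_span_eq K (Set.range q)
  have hcard : Module.finrank K (Submodule.span K (Set.range q)) = Fintype.card σ := by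
    rw [hq, finrank_top, Submodule.finrank_quotient, finrank_span_eq_card hv]
    simp
  choose s hs using hf
  let ε : σ ≃ Fin (Module.finrank K (Submodule.span K (Set.range q))) :=
    (Fintype.equivFin σ).trans (finCongr hcard.symm)
  refine ⟨s ∘ ε, hw.sumElim_of_quotient (M' := M) _ ?_⟩
  have h1 := hli.comp ε ε.injective
  rw [← (funext hs : q ∘ s = f)] at h1
  exact h1

variable {k B R R' K : Type u} [Field k] [CommRing B] [CommRing R] [CommRing R'] [Field K]
  {c : k →+* B} {f : B →+* R} (ch : NewtonChart c f)

namespace NewtonChart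

lemma linearIndependent_of_formallySmooth [Algebra R R'] (g : R) [IsLocalization.Away g R']
    (hs : ((algebraMap R R').comp (f.comp c)).FormallySmooth) (ρ : R' →+* K) :
    LinearIndependent K (fun i ↦ ch.matrixAt (ρ.comp (algebraMap R R')) (Sum.inl i)) := by
  rw [← ch.π_C, ← comp_assoc] at hs
  obtain ⟨b, hb⟩ := exists_rightInverse_jacobian_localization _ ch.reg ch.π ch.surj ch.ker_π g hs
  rw [Fintype.linearIndependent_iff]
  intro a ha l
  have hb' (i l) : ∑ j, ch.matrixAt (ρ.comp (algebraMap R R')) (Sum.inl i) j * ρ (b j l) =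
      if i = l then 1 else 0 := by
    have := congrArg ρ (hb i l)
    rw [map_sum, apply_ite ρ, map_one, map_zero] at this
    rw [← this]
    refine Finset.sum_congr rfl fun j _ ↦ ?_
    rw [map_mul]
    congr 1
    exact ch.eval₂_coords (ρ.comp (algebraMap R R')) _
  calc a l = ∑ i, a i * if i = l then 1 else 0 := by simp
    _ = ∑ i, a i * ∑ j, ch.matrixAt (ρ.comp (algebraMap R R')) (Sum.inl i) j * ρ (b j l) := by
      simp only [hb']
    _ = ∑ j, (∑ i, a i • ch.matrixAt (ρ.comp (algebraMap R R')) (Sum.inl i)) j * ρ (b j l) := by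
      simp only [Finset.mul_sum, Finset.sum_apply, Finset.sum_mul, Pi.smul_apply, smul_eq_mul, mul_assoc]
      exact Finset.sum_comm
    _ = 0 := by simp only [ha, Pi.zero_apply, zero_mul, Finset.sum_const_zero]

lemma exists_formallySmooth {ρ : R →+* K}
    (h : LinearIndependent K (fun i ↦ ch.matrixAt ρ (Sum.inl i))) : ∃ g : R, ρ g ≠ 0 ∧
      ∀ {R' : Type u} [CommRing R'] [Algebra R R'] [IsLocalization.Away g R'],
        ((algebraMap R R').comp (f.comp c)).FormallySmooth := by
  obtain ⟨s, hs⟩ := exists_linearIndependent_sumElim_single h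
  let G : ch.Idx → MvPolynomial ch.Idx k :=
    Sum.elim (ch.G ∘ Sum.inl) fun i ↦ X (s i)
  refine ⟨ch.π (jacobian G), ?_, ?_⟩
  · have h1 : jacobianMatrix G (ch.constants ρ) (ch.coords ρ) =
        Sum.elim (fun i ↦ ch.matrixAt ρ (Sum.inl i)) fun i ↦ Pi.single (s i) 1 := by
      ext i j
      rcases i with i | i
      · rfl
      · change eval₂ _ _ (pderiv j (X (s i))) = (Pi.single (s i) 1 : _ → K) j
        rw [pderiv_X, Pi.single_apply, Pi.single_apply]
        split_ifs with h1 h2 h2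
        · exact eval₂_one _ _
        · exact absurd h1.symm h2
        · exact absurd h2.symm h1
        · exact eval₂_zero _ _
    rw [← ch.eval₂_coords, ← det_jacobianMatrix, h1]
    have h2 := (linearIndependent_rows_iff_isUnit (A := of (Sum.elim (fun i ↦ ch.matrixAt ρ (Sum.inl i))
      fun i ↦ Pi.single (s i) 1))).mp hs
    exact ((isUnit_iff_isUnit_det _).mp h2).ne_zero
  · intro R' _ _ _
    have h1 := formallyEtale_eval₂Hom G ch.π ch.surj (by exact ch.ker_π) (R' := R') (ch.π (jacobian G))
      (IsLocalization.Away.algebraMap_isUnit _) ⟨1, by rw [pow_one]⟩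
    have h2 : (C : k →+* MvPolynomial (Fin ch.n) k).FormallySmooth :=
      RingHom.formallySmooth_algebraMap.mpr inferInstance
    have h3 := h2.comp (formallySmooth_of_formallyEtale h1)
    rw [← ch.π_C, ← comp_assoc]
    convert h3 using 1
    ext t
    simp

end NewtonChart

end Jacobian

section SmoothPoints

variable {k : Type u} [Field k] {X Y : Scheme.{u}} {φ : X ⟶ Y} {s : Y ⟶ Spec (.of k)} {z : X}

lemma formallySmooth_scalars_iff (p : X ⟶ Spec (.of k)) (D : X.Opens) :
    (scalars p D).FormallySmooth ↔ (p.appLE ⊤ D (le_preimage_top p D)).hom.FormallySmooth :=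
  (RingHom.FormallySmooth.respectsIso.cancel_left_isIso (Scheme.ΓSpecIso (.of k)).inv
    (p.appLE ⊤ D (le_preimage_top p D)))

lemma formallySmooth_of_smooth (p : X ⟶ Spec (.of k)) {D : X.Opens} (hD : IsAffineOpen D)
    (h : Smooth (D.ι ≫ p)) : (scalars p D).FormallySmooth := by
  rw [formallySmooth_scalars_iff]
  have : IsAffine D := hD
  have h1 := (h.smooth_appLE (isAffineOpen_top _) (isAffineOpen_top (D : Scheme.{u}))
    (le_preimage_top _ _)).formallySmooth
  have h2 : ⊤ ≤ D.ι ⁻¹ᵁ D := fun x _ ↦ x.2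
  have := isIso_appLE_top D.ι (D.opensRange_ι).symm h2
  rw [← appLE_trans D.ι p (le_preimage_top p D) h2 (le_preimage_top _ _)] at h1
  exact (RingHom.FormallySmooth.respectsIso.cancel_right_isIso _ _).mp h1

lemma smooth_of_formallySmooth (p : X ⟶ Spec (.of k)) [LocallyOfFiniteType p] {D : X.Opens}
    (hD : IsAffineOpen D) (h : (scalars p D).FormallySmooth) : Smooth (D.ι ≫ p) := by
  refine smooth_ι_comp p (isAffineOpen_top _) hD (le_preimage_top p D) (RingHom.smooth_def.mpr
    ⟨(formallySmooth_scalars_iff p D).mp h, ?_⟩)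
  have : IsNoetherianRing Γ(Spec (CommRingCat.of k), ⊤) :=
    IsLocallyNoetherian.component_noetherian ⟨⊤, isAffineOpen_top _⟩
  exact RingHom.FinitePresentation.of_finiteType.mp (p.finiteType_appLE (isAffineOpen_top _) hD _)

lemma ChartAt.smoothAt_iff (C : ChartAt φ s z) [LocallyOfFiniteType (φ ≫ s)] :
    SmoothAt (φ ≫ s) z ↔ LinearIndependent (X.residueField z)
      (fun i ↦ C.chart.matrixAt C.residueMap (Sum.inl i)) := by
  have hsc (g : Γ(X, C.W)) : (algebraMap Γ(X, C.W) Γ(X, X.basicOpen g)).comp (C.f.comp (scalars s C.V)) =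
      scalars (φ ≫ s) (X.basicOpen g) := by
    rw [ChartAt.f, appLE_comp_scalars]
    refine (congrArg CommRingCat.Hom.hom ?_ : ((Scheme.ΓSpecIso (.of k)).inv ≫
      (φ ≫ s).appLE ⊤ C.W (le_preimage_top _ _) ≫
      X.presheaf.map (homOfLE (X.basicOpen_le g)).op).hom = _)
    rw [Scheme.Hom.appLE_map]
  constructor
  · rintro ⟨D, hzD, hD⟩
    obtain ⟨g, hgD, hzg⟩ := C.isAffineOpen.exists_basicOpen_le (V := D) ⟨z, hzD⟩ C.mem
    have := C.isAffineOpen.isLocalization_basicOpen g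
    have h1 : Smooth ((X.basicOpen g).ι ≫ φ ≫ s) := by
      rw [← X.homOfLE_ι hgD, assoc]
      infer_instance
    have h2 := formallySmooth_of_smooth (φ ≫ s) (C.isAffineOpen.basicOpen g) h1
    have h3 : ⊤ ≤ X.fromSpecResidueField z ⁻¹ᵁ X.basicOpen g := fun x _ ↦ by
      change X.fromSpecResidueField z x ∈ X.basicOpen g
      rw [Scheme.fromSpecResidueField_apply]; exact hzg
    have h4 := C.chart.linearIndependent_of_formallySmooth (R' := Γ(X, X.basicOpen g)) g
      (by exact (hsc g).symm ▸ h2) (evalMap (X.fromSpecResidueField z) h3)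
    have h5 : (evalMap (X.fromSpecResidueField z) h3).comp (algebraMap Γ(X, C.W) Γ(X, X.basicOpen g)) =
        C.residueMap := by
      refine (congrArg CommRingCat.Hom.hom ?_ : (X.presheaf.map (homOfLE (X.basicOpen_le g)).op ≫
        (X.fromSpecResidueField z).appLE _ ⊤ h3 ≫ (Scheme.ΓSpecIso _).hom).hom = _)
      rw [Scheme.Hom.map_appLE_assoc]
    rwa [h5] at h4
  · intro h
    obtain ⟨g, hg, hs⟩ := C.chart.exists_formallySmooth h
    have := C.isAffineOpen.isLocalization_basicOpen g
    have h1 := hs (R' := Γ(X, X.basicOpen g))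
    refine ⟨X.basicOpen g, ?_, smooth_of_formallySmooth (φ ≫ s) (C.isAffineOpen.basicOpen g)
      (by exact hsc g ▸ h1)⟩
    have h2 : IsUnit ((X.fromSpecResidueField z).appLE C.W ⊤ (top_le_fromSpecResidueField C) g) := by
      have := (Ne.isUnit hg).map (Scheme.ΓSpecIso (X.residueField z)).inv.hom
      rw [ChartAt.residueMap, ← RingHom.comp_apply, ← CommRingCat.hom_comp, assoc,
        Iso.hom_inv_id, comp_id] at this
      exact this
    have h3 := (Spec (X.residueField z)).basicOpen_of_isUnit h2
    rw [Scheme.basicOpen_appLE] at h3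
    let x : Spec (X.residueField z) := IsLocalRing.closedPoint (X.residueField z)
    have h4 : X.fromSpecResidueField z x ∈ X.basicOpen g := (h3.ge (x := x) trivial).2
    rwa [Scheme.fromSpecResidueField_apply] at h4

end SmoothPoints

lemma two_eq_zero_iff_ringChar {k K : Type*} [Field k] [Field K] (f : k →+* K) :
    (2 : K) = 0 ↔ ringChar k = 2 := by
  rw [← map_ofNat f 2, map_eq_zero]
  have h := ringChar.spec k 2
  rw [Nat.cast_ofNat] at h
  rw [h, Nat.dvd_prime Nat.prime_two]
  exact or_iff_right (CharP.ringChar_ne_one)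

section FiberGroup

variable {k : Type u} [Field k] {X Y : Scheme.{u}} {φ : X ⟶ Y} {s : Y ⟶ Spec (.of k)}
  [IsSeparated s] [Smooth s] [IsSeparated (φ ≫ s)] [LocallyOfFiniteType (φ ≫ s)] {r : ℕ} {z : X}

lemma fiberGroup_classification (G : GroupoidOn (newtonSource φ s r) (newtonTarget φ s r))
    [Flat (newtonSource φ s r)] {ch : ∀ z, ChartAt φ s z} (hz : z ∉ etaleLocus φ) (hr : 2 ≤ r)
    (β : NewtonBox (ch z) r)
    (h : fst (newtonSource φ s r) (X.fromSpecResidueField z) ≫ newtonTarget φ s r =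
      fst (newtonSource φ s r) (X.fromSpecResidueField z) ≫ newtonSource φ s r) :
    2 ≤ fiberMultiplicity φ z ∧ ((3 ≤ r ∨ 3 ≤ fiberMultiplicity φ z) →
        HasGroupFunctor (G.fiberGroup (X.fromSpecResidueField z) h) (GaPow _ (ch z).chart.n)) ∧
      (fiberMultiplicity φ z = 2 → r = 2 → SmoothAt (φ ≫ s) z → ringChar k ≠ 2 →
        HasGroupFunctor (G.fiberGroup (X.fromSpecResidueField z) h) (GmGaPow _ ((ch z).chart.n - 1))) ∧
      (fiberMultiplicity φ z = 2 → r = 2 → SmoothAt (φ ≫ s) z → ringChar k = 2 →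
        HasGroupFunctor (G.fiberGroup (X.fromSpecResidueField z) h) (GaPow _ (ch z).chart.n)) ∧
      (fiberMultiplicity φ z = 2 → r = 2 → ¬ SmoothAt (φ ≫ s) z →
        HasGroupFunctor (G.fiberGroup (X.fromSpecResidueField z) h)
          (ZModTwoGaPow _ (ch z).chart.n)) := by
  have hρ := residueMap_δ (C := ch z) hz
  obtain ⟨O, _, _, θ, κ, hO, hm⟩ := (ch z).exists_isFiberRing
  obtain ⟨c₀, a, l, hF, hc, ha⟩ := NewtonChart.exists_fiberShape (ch z).chart r _ hr hρ hO
  obtain ⟨Q⟩ := nonempty_quadraticCoordinates G hz hr β hF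
  have h2 := two_eq_zero_iff_ringChar ((ch z).residueMap.comp (scalars (φ ≫ s) (ch z).W))
  rw [← (ch z).smoothAt_iff] at ha
  rw [← hm] at hc
  have hne (hm : fiberMultiplicity φ z = 2) (hr : r = 2) : c₀ ≠ 0 := fun h0 ↦ by
    have := hc.mp h0
    rw [hm, hr] at this
    revert this
    decide
  refine ⟨hm ▸ hO.two_le_length hρ, fun H ↦ ?_, fun hm hr hs hk ↦ ?_,
    fun hm hr hs hk ↦ ?_, fun hm hr hs ↦ ?_⟩ <;> apply hasGroupFunctor_fiberGroup
  · exact Q.nonempty_iso_gaPow_of_eq_zero (hc.mpr H)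
  · obtain ⟨i, hi⟩ := Function.ne_iff.mp ((ha (hne hm hr)).mp hs)
    exact Q.nonempty_iso_gmGaPow (hne hm hr) (h2.not.mpr hk) hi
  · obtain ⟨i, hi⟩ := Function.ne_iff.mp ((ha (hne hm hr)).mp hs)
    exact Q.nonempty_iso_gaPow_of_two_eq_zero (h2.mpr hk) hi
  · exact Q.nonempty_iso_zmodTwoGaPow (hne hm hr) (not_not.mp ((ha (hne hm hr)).not.mp hs))

end FiberGroup

end Newton

end

theorem mainTheorem4 {k : Type u} [Field k] {X Y : Scheme.{u}} (φ : X ⟶ Y) (s : Y ⟶ Spec (.of k))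
    [IsSeparated s] [Smooth s] [IsSeparated (φ ≫ s)] [LocallyOfFiniteType (φ ≫ s)]
    (hX : Newton.IsLocallyCompleteIntersection (φ ≫ s))
    (hU : Dense (Newton.etaleLocus φ : Set X)) (r : ℕ) (hr : 2 ≤ r) :
    ∃ G : Newton.GroupoidOn (Newton.newtonSource φ s r) (Newton.newtonTarget φ s r),
      (∀ G' : Newton.GroupoidOn (Newton.newtonSource φ s r) (Newton.newtonTarget φ s r), G' = G) ∧
      G.IsSmooth ∧
      ∀ z ∈ (Newton.different φ).support,
        ∃ h : pullback.fst (Newton.newtonSource φ s r) (X.fromSpecResidueField z) ≫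
              Newton.newtonTarget φ s r =
            pullback.fst (Newton.newtonSource φ s r) (X.fromSpecResidueField z) ≫
              Newton.newtonSource φ s r,
        ∃ n : ℕ, Newton.dimAt X z = n ∧ 2 ≤ Newton.fiberMultiplicity φ z ∧
          ((3 ≤ r ∨ 3 ≤ Newton.fiberMultiplicity φ z) →
            Newton.HasGroupFunctor (G.fiberGroup (X.fromSpecResidueField z) h)
              (Newton.GaPow _ n)) ∧
          (Newton.fiberMultiplicity φ z = 2 → r = 2 → Newton.SmoothAt (φ ≫ s) z →
            ringChar k ≠ 2 →
            Newton.HasGroupFunctor (G.fiberGroup (X.fromSpecResidueField z) h)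
              (Newton.GmGaPow _ (n - 1))) ∧
          (Newton.fiberMultiplicity φ z = 2 → r = 2 → Newton.SmoothAt (φ ≫ s) z →
            ringChar k = 2 →
            Newton.HasGroupFunctor (G.fiberGroup (X.fromSpecResidueField z) h)
              (Newton.GaPow _ n)) ∧
          (Newton.fiberMultiplicity φ z = 2 → r = 2 → ¬ Newton.SmoothAt (φ ≫ s) z →
            Newton.HasGroupFunctor (G.fiberGroup (X.fromSpecResidueField z) h)
              (Newton.ZModTwoGaPow _ n)) := by
  let ch (z : X) : Newton.ChartAt φ s z := (Newton.exists_chartAt hX hU z).some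
  let β (z : X) : Newton.NewtonBox (ch z) r := (Newton.exists_newtonBox (ch z) r ch hr).some
  have hsm : Smooth (Newton.newtonSource φ s r) := Newton.smooth_newtonSource hr β
  obtain ⟨G, hG⟩ := (Newton.isFlatRelation_newtonRel hr β).exists_groupoidOn
  refine ⟨G, hG, hsm, fun z hz ↦ ?_⟩
  have hz' := (Newton.mem_support_different_iff ch).mp hz
  have h := Newton.comp_target_eq ch hz' hr (β z) pullback.condition
  exact ⟨h, (ch z).chart.n, (ch z).dimAt_eq,
    Newton.fiberGroup_classification (ch := ch) G hz' hr (β z) h⟩
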